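/- Let $k$ be a field of characteristic $0$, $V$ a finite-dimensional $k$-vector space, $R\subseteq V\otimes V$ a subspace, and $A=T(V)/(R)$ with its grading and its augmentation ideal $\bar A=\bigoplus_{n\ge1}A_n$. Its Koszul dual coalgebra is $C=A^{¡}=\bigoplus_n A^{¡}_n\subseteq T(V)$, where $A^{¡}_n=\bigcap_{i+j+2=n}V^{\otimes i}\otimes R\otimes V^{\otimes j}\subseteq V^{\otimes n}$ (so $A^{¡}_0=k$, $A^{¡}_1=V$), with the deconcatenation coproduct $\Delta(v_1\cdots v_n)=\sum_{i=0}^n v_1\cdots v_i\otimes v_{i+1}\cdots v_n$, written $\Delta c=\sum c'\otimes c''$. Let $\varepsilon:C\to A^{¡}_0=k$ be the counit, $\bar C=\ker\varepsilon$ and $\kappa:C\to A^{¡}_1=V\subseteq A$ the projection. Assume that: * $A$ is Koszul: the complex $\cdots\to A\otimes A^{¡}_2\to A\otimes A^{¡}_1\to A\to k\to0$ with differential $a\otimes v_1\cdots v_m\mapsto av_1\otimes v_2\cdots v_m$ is exact; * $A$ is AS-regular of dimension $n$ with Nakayama automorphism $\sigma$, in the following (twisted Calabi-Yau) form: $A$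 has a bounded resolution by finitely generated projective modules over $A^e=A\otimes A^{op}$, and $\sigma$ is an automorphism of the graded algebra $A$ such that $\mathrm{Ext}^i_{A^e}(A,A\otimes A)$ is $0$ for $i\ne n$ and is isomorphic to $A_\sigma$ for $i=n$. Here $A_\sigma$ is $A$ with the bimodule structure $a\cdot x\cdot c=a\,x\,\sigma(c)$, the group $\mathrm{Ext}_{A^e}$ is taken with respect to the outer bimodule structure of $A\otimes A$, and it is a bimodule by the inner one, $a\cdot(x\otimes y)\cdot c=xc\otimes ay$; * $\sigma$ is semisimple, that is, diagonalizable. We also write $\sigma$ for the induced action $v_1\cdots v_n\mapsto\sigma(v_1)\cdots\sigma(v_n)$ on $C$. *Complexes.* (1) $\mathrm{HH}_\bullet(A;A_\sigma)$ is the homology of $\mathrm{CH}_n=A\otimes\bar A^{\otimes n}$ with $$b(a_0,\dots,a_n)=(a_0\sigma(a_1),a_2,\dots,a_n)+\sum_{i=1}^{n-1}(-1)^i(a_0,\dots,a_ia_{i+1},\dots,a_n)+(-1)^n(a_na_0,a_1,\dots,a_{n-1})$$ (and $b=0$ on $\mathrm{CH}_0$). Put $T(a_0,\dots,a_n)=(\sigma(a_0),\dots,\sigma(a_n))$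 and $$B(a_0,\dots,a_n)=\sum_{i=1}^{n+1}(-1)^{ni}(1,a_i,\dots,a_n,\bar a_0,\sigma(a_1),\dots,\sigma(a_{i-1})),$$ where $\bar a_0$ is the component of $a_0$ in $\bar A$. (2) The twisted Koszul complex $K_\bullet(A_\sigma)$ is $K_m=A\otimes A^{¡}_m$ with $$b(a\otimes v_1\cdots v_m)=a\sigma(v_1)\otimes v_2\cdots v_m+(-1)^m v_ma\otimes v_1\cdots v_{m-1}.$$ (3) $\mathrm{HH}_\bullet(A^{¡};{}_\sigma A^{¡})$ is the homology of $\bigoplus_{n}\bar C^{\otimes n}\otimes C$, whose element $(a_1,\dots,a_n,m)=\omega\otimes m$, $\omega=a_1\cdots a_n$, has degree $|\omega|+|m|$, where $|\omega|=\sum_i(|a_i|-1)$, with $$b(\omega\otimes m)=d\omega\otimes m+\sum(-1)^{|\omega|+|m'|}\,\omega\,\sigma(m')\otimes m''-\sum(-1)^{|m''|(|\omega|+|m'|+1)}\,m''\,\omega\otimes m',$$ $$d(a_1\cdots a_n)=\sum_i\sum(-1)^{|a_1|+\cdots+|a_{i-1}|+(i-1)+|a_i'|}\,a_1\cdots a_{i-1}\,a_i'\,a_i''\,a_{i+1}\cdots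 a_n .$$ In these formulas a new letter in $C$ is replaced by its component in $\bar C$. Put $T(a_1,\dots,a_n,m)=(\sigma(a_1),\dots,\sigma(a_n),\sigma(m))$ and $$B(a_1,\dots,a_n,m)=(-1)^{|\omega|}\varepsilon(m)\sum_{i=1}^n(-1)^{|a_1\cdots a_i|\,|a_{i+1}\cdots a_n|}\,(a_{i+1},\dots,a_n,\sigma(a_1),\dots,\sigma(a_{i-1}),a_i).$$ *Connes operators.* In (1) and in (3), the chains fixed by $T$ (the part for the eigenvalue $1$) form a subcomplex; its homology maps onto the whole homology, and there is a unique operator $\beta$, respectively $\beta'$, of degree $1$ on the homology that sends the class of each $T$-fixed cycle $z$ to the class of the cycle $Bz$. This is the Connes operator. **Theorem.** The Connes operators $\beta$ on $\mathrm{HH}_\bullet(A;A_\sigma)$ and $\beta'$ on $\mathrm{HH}_\bullet(A^{¡};{}_\sigma A^{¡})$ exist as just described, and in every degree there are isomorphisms $$\mathrm{HH}_\bullet(A;A_\sigma)\xleftarrow[\ \Phi\ ]{\cong}\mathrm H_\bullet(K_\bullet(A_\sigma))\xleftarrow[\ \Psi\ ]{\cong}\mathrm{HH}_\bullet(A^{¡};{}_\sigma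 A^{¡}),$$ induced by the maps $a\otimes v_1\cdots v_m\mapsto(a,v_1,\dots,v_m)$ and $(a_1,\dots,a_n,m)\mapsto\kappa(a_1)\cdots\kappa(a_n)\otimes m$ respectively. They commute with the Connes operators: $\Phi\Psi\beta'=\beta\,\Phi\Psi$. -/

import Mathlib

open scoped TensorProduct

namespace KoszulHH
noncomputable section
universe u v w

section Free
variable (k : Type u) [Field k] (W : Type v) [AddCommGroup W] [Module k W]

/-- `W^{⊗ n}`, as a subspace of the tensor algebra `T(W)`. -/
def wordsOfLength (n : ℕ) : Submodule k (TensorAlgebra k W) :=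
  LinearMap.range (TensorAlgebra.ι k (M := W)) ^ n

variable {k W}

/-- The algebra map `T(f) : T(W) → T(W')` of a linear map `f`. -/
def tmap {W' : Type w} [AddCommGroup W'] [Module k W'] (f : W →ₗ[k] W') :
    TensorAlgebra k W →ₐ[k] TensorAlgebra k W' :=
  TensorAlgebra.lift k (TensorAlgebra.ι k ∘ₗ f)

/-- Auxiliary operator: a letter `a` acts by `(x, z) ↦ (a x, 1 ⊗ a x + (a ⊗ 1) z)`. -/
def deconcStep : W →ₗ[k] Module.End k
    (TensorAlgebra k W × (TensorAlgebra k W ⊗[k] TensorAlgebra k W)) where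
  toFun a :=
    (LinearMap.mulLeft k (TensorAlgebra.ι k a) ∘ₗ LinearMap.fst k _ _).prod
      (TensorProduct.mk k _ _ 1 ∘ₗ LinearMap.mulLeft k (TensorAlgebra.ι k a) ∘ₗ
          LinearMap.fst k _ _ +
        LinearMap.rTensor _ (LinearMap.mulLeft k (TensorAlgebra.ι k a)) ∘ₗ LinearMap.snd k _ _)
  map_add' a b := by
    ext <;> simp [add_mul, TensorProduct.tmul_add, TensorProduct.add_tmul]
  map_smul' c a := by
    ext <;> simp [TensorProduct.smul_tmul']

/-- The deconcatenation coproduct of the cofree coalgebra `T^c(W)`: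
`a₁ ⋯ aₙ ↦ ∑_{i = 0}^{n} a₁ ⋯ aᵢ ⊗ aᵢ₊₁ ⋯ aₙ`. -/
def deconc : TensorAlgebra k W →ₗ[k] TensorAlgebra k W ⊗[k] TensorAlgebra k W :=
  LinearMap.snd k _ _ ∘ₗ LinearMap.applyₗ ((1, 1 ⊗ₜ 1) :
      TensorAlgebra k W × (TensorAlgebra k W ⊗[k] TensorAlgebra k W)) ∘ₗ
    (TensorAlgebra.lift k (deconcStep (k := k) (W := W))).toLinearMap

lemma deconcStep_fst (x : TensorAlgebra k W)
    (p : TensorAlgebra k W × (TensorAlgebra k W ⊗[k] TensorAlgebra k W)) :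
    (TensorAlgebra.lift k (deconcStep (k := k) (W := W)) x p).1 = x * p.1 := by
  induction x using TensorAlgebra.induction generalizing p with
  | algebraMap r => simp [Algebra.smul_def]
  | ι a => simp [deconcStep]
  | mul a b ha hb => simp [ha, hb, mul_assoc]
  | add a b ha hb => simp [ha, hb, add_mul]

@[simp] lemma deconc_one : deconc (1 : TensorAlgebra k W) = 1 ⊗ₜ 1 := by
  simp [deconc]

lemma deconc_ι_mul (a : W) (x : TensorAlgebra k W) :
    deconc (TensorAlgebra.ι k a * x) = 1 ⊗ₜ (TensorAlgebra.ι k a * x) +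
      LinearMap.rTensor _ (LinearMap.mulLeft k (TensorAlgebra.ι k a)) (deconc x) := by
  have h := deconcStep_fst x (1, (1 : TensorAlgebra k W) ⊗ₜ[k] (1 : TensorAlgebra k W))
  simp only [deconc, LinearMap.comp_apply, AlgHom.toLinearMap_apply, map_mul,
    LinearMap.applyₗ_apply_apply, Module.End.mul_apply, TensorAlgebra.lift_ι_apply]
  simp only [mul_one] at h
  generalize TensorAlgebra.lift k (deconcStep (k := k) (W := W)) x
    (1, (1 : TensorAlgebra k W) ⊗ₜ[k] (1 : TensorAlgebra k W)) = p at h ⊢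
  simp [deconcStep, h]

theorem deconc_word (l : List W) :
    deconc ((l.map (TensorAlgebra.ι k)).prod) =
      ∑ i ∈ Finset.range (l.length + 1),
        ((l.take i).map (TensorAlgebra.ι k)).prod ⊗ₜ[k]
          ((l.drop i).map (TensorAlgebra.ι k)).prod := by
  induction l with
  | nil => simp
  | cons a l ih =>
    rw [List.map_cons, List.prod_cons, deconc_ι_mul, ih, List.length_cons,
      Finset.sum_range_succ' _ (l.length + 1), map_sum]
    simp only [List.take_succ_cons, List.drop_succ_cons, List.map_cons, List.prod_cons,
      LinearMap.rTensor_tmul, LinearMap.mulLeft_apply, List.take_zero, List.drop_zero,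
      List.map_nil, List.prod_nil]
    rw [add_comm]

lemma words_induction {P : TensorAlgebra k W → Prop} (h1 : P 1)
    (hsmul : ∀ (r : k) x, P x → P (r • x)) (hι : ∀ a x, P x → P (TensorAlgebra.ι k a * x))
    (hadd : ∀ x y, P x → P y → P (x + y)) (x : TensorAlgebra k W) : P x := by
  have key : ∀ x y : TensorAlgebra k W, P y → P (x * y) := by
    intro x
    induction x using TensorAlgebra.induction with
    | algebraMap r => intro y hy; rw [← Algebra.smul_def]; exact hsmul r y hy
    | ι a => exact fun y hy => hι a y hy
    | mul a b ha hb => intro y hy; rw [mul_assoc]; exact ha _ (hb _ hy)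
    | add a b ha hb => intro y hy; rw [add_mul]; exact hadd _ _ (ha _ hy) (hb _ hy)
  simpa using key x 1 h1

lemma deconc_counit_left (x : TensorAlgebra k W) :
    LinearMap.rTensor _ TensorAlgebra.algebraMapInv.toLinearMap (deconc x) =
      (1 : k) ⊗ₜ[k] x := by
  induction x using words_induction with
  | h1 => simp
  | hsmul r x hx => simp [hx]
  | hadd x y hx hy => simp [hx, hy, TensorProduct.tmul_add]
  | hι a x hx =>
    have : TensorAlgebra.algebraMapInv.toLinearMap ∘ₗ
        LinearMap.mulLeft k (TensorAlgebra.ι k a : TensorAlgebra k W) = 0 := by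
      ext; simp [TensorAlgebra.algebraMapInv]
    rw [deconc_ι_mul, map_add, ← LinearMap.comp_apply (LinearMap.rTensor _ _),
      ← LinearMap.rTensor_comp, this]
    simp

lemma deconc_counit_right (x : TensorAlgebra k W) :
    LinearMap.lTensor _ TensorAlgebra.algebraMapInv.toLinearMap (deconc x) =
      x ⊗ₜ[k] (1 : k) := by
  induction x using words_induction with
  | h1 => simp
  | hsmul r x hx => simp [hx, TensorProduct.smul_tmul']
  | hadd x y hx hy => simp [hx, hy, TensorProduct.add_tmul]
  | hι a x hx =>
    rw [deconc_ι_mul, map_add, ← LinearMap.comp_apply (LinearMap.lTensor _ _),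
      LinearMap.lTensor_comp_rTensor, ← LinearMap.rTensor_comp_lTensor, LinearMap.comp_apply, hx]
    simp [TensorAlgebra.algebraMapInv]

lemma deconc_coassoc (x : TensorAlgebra k W) :
    TensorProduct.assoc k _ _ _ (LinearMap.rTensor _ deconc (deconc x)) =
      LinearMap.lTensor _ deconc (deconc x) := by
  induction x using words_induction with
  | h1 => simp
  | hsmul r x hx => simp [hx]
  | hadd x y hx hy => simp [hx, hy]
  | hι a x hx =>
    have e1 : (deconc : TensorAlgebra k W →ₗ[k] _) ∘ₗ
        LinearMap.mulLeft k (TensorAlgebra.ι k a : TensorAlgebra k W) =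
        TensorProduct.mk k _ _ 1 ∘ₗ LinearMap.mulLeft k (TensorAlgebra.ι k a) +
          LinearMap.rTensor _ (LinearMap.mulLeft k (TensorAlgebra.ι k a)) ∘ₗ deconc := by
      ext y; simp [deconc_ι_mul]
    have e2 : ∀ z : TensorAlgebra k W ⊗[k] TensorAlgebra k W,
        TensorProduct.assoc k _ _ _ (LinearMap.rTensor (TensorAlgebra k W)
          (TensorProduct.mk k (TensorAlgebra k W) (TensorAlgebra k W) 1) z) = 1 ⊗ₜ z := by
      intro z
      induction z using TensorProduct.induction_on with
      | zero => simp
      | tmul a b => simp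
      | add a b ha hb => simp [ha, hb, TensorProduct.tmul_add]
    have e3 : ∀ z : (TensorAlgebra k W ⊗[k] TensorAlgebra k W) ⊗[k] TensorAlgebra k W,
        TensorProduct.assoc k _ _ _ (LinearMap.rTensor (TensorAlgebra k W)
          (LinearMap.rTensor (TensorAlgebra k W)
            (LinearMap.mulLeft k (TensorAlgebra.ι k a : TensorAlgebra k W))) z) =
          LinearMap.rTensor _ (LinearMap.mulLeft k (TensorAlgebra.ι k a))
            (TensorProduct.assoc k _ _ _ z) := by
      intro z
      induction z using TensorProduct.induction_on with
      | zero => simp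
      | add a b ha hb => simp [ha, hb]
      | tmul y c =>
        induction y using TensorProduct.induction_on with
        | zero => simp
        | tmul a b => simp
        | add a b ha hb => simp only [TensorProduct.add_tmul, map_add, ha, hb]
    rw [deconc_ι_mul, map_add, map_add, map_add]
    rw [← LinearMap.comp_apply (LinearMap.rTensor _ deconc), ← LinearMap.rTensor_comp, e1,
      ← LinearMap.comp_apply (LinearMap.lTensor _ deconc), LinearMap.lTensor_comp_rTensor,
      ← LinearMap.rTensor_comp_lTensor, LinearMap.comp_apply (LinearMap.rTensor _ _), ← hx]
    rw [LinearMap.rTensor_add, LinearMap.add_apply, map_add, LinearMap.rTensor_comp,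
      LinearMap.rTensor_comp, LinearMap.comp_apply, LinearMap.comp_apply, e2, e3]
    simp [deconc_ι_mul, TensorProduct.tmul_add, add_assoc]
end Free

section Inter
variable {k : Type u} [Field k] {E : Type v} [AddCommGroup E] [Module k E]
  {F : Type w} [AddCommGroup F] [Module k F]

lemma mem_range_rTensor (U : Submodule k E) (z : E ⊗[k] F) :
    z ∈ LinearMap.range (LinearMap.rTensor F U.subtype) ↔
      ∀ φ : F →ₗ[k] k, TensorProduct.rid k E (LinearMap.lTensor E φ z) ∈ U := by
  constructor
  · rintro ⟨y, rfl⟩ φ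
    induction y using TensorProduct.induction_on with
    | zero => simp
    | tmul a b => simpa using U.smul_mem _ a.2
    | add a b ha hb => simpa using U.add_mem ha hb
  · intro h
    let b := Module.Free.chooseBasis k F
    have hz := (TensorProduct.equivFinsuppOfBasisRight (M := E) b).symm_apply_apply z
    rw [← hz, TensorProduct.equivFinsuppOfBasisRight_symm_apply]
    refine Submodule.sum_mem _ fun i hi => ?_
    clear hi
    have : (TensorProduct.equivFinsuppOfBasisRight (M := E) b) z i =
        TensorProduct.rid k E (LinearMap.lTensor E (b.coord i) z) := by
      clear hz h
      induction z using TensorProduct.induction_on with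
      | zero => simp
      | tmul a c => simp
      | add a c ha hb => simp [ha, hb]
    rw [this]
    exact ⟨⟨_, h (b.coord i)⟩ ⊗ₜ b i, by simp⟩

lemma mem_range_lTensor (U : Submodule k F) (z : E ⊗[k] F) :
    z ∈ LinearMap.range (LinearMap.lTensor E U.subtype) ↔
      ∀ φ : E →ₗ[k] k, TensorProduct.lid k F (LinearMap.rTensor F φ z) ∈ U := by
  constructor
  · rintro ⟨y, rfl⟩ φ
    induction y using TensorProduct.induction_on with
    | zero => simp
    | tmul a b => simpa using U.smul_mem _ b.2
    | add a b ha hb => simpa using U.add_mem ha hb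
  · intro h
    let b := Module.Free.chooseBasis k E
    have hz := (TensorProduct.equivFinsuppOfBasisLeft (N := F) b).symm_apply_apply z
    rw [← hz, TensorProduct.equivFinsuppOfBasisLeft_symm_apply]
    refine Submodule.sum_mem _ fun i hi => ?_
    clear hi
    have : (TensorProduct.equivFinsuppOfBasisLeft (N := F) b) z i =
        TensorProduct.lid k F (LinearMap.rTensor F (b.coord i) z) := by
      clear hz h
      induction z using TensorProduct.induction_on with
      | zero => simp
      | tmul a c => simp
      | add a c ha hb => simp [ha, hb]
    rw [this]
    exact ⟨b i ⊗ₜ ⟨_, h (b.coord i)⟩, by simp⟩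

lemma mem_range_map (U : Submodule k E) (U' : Submodule k F) (z : E ⊗[k] F)
    (h1 : z ∈ LinearMap.range (LinearMap.rTensor F U.subtype))
    (h2 : z ∈ LinearMap.range (LinearMap.lTensor E U'.subtype)) :
    z ∈ LinearMap.range (TensorProduct.map U.subtype U'.subtype) := by
  obtain ⟨f, hf⟩ := U.subtype.exists_leftInverse_of_injective (by simp)
  obtain ⟨g, hg⟩ := U'.subtype.exists_leftInverse_of_injective (by simp)
  obtain ⟨y1, hy1⟩ := h1
  obtain ⟨y2, hy2⟩ := h2
  refine ⟨TensorProduct.map f g z, ?_⟩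
  have e1 : LinearMap.rTensor F (U.subtype ∘ₗ f) z = z := by
    rw [← hy1, ← LinearMap.comp_apply, ← LinearMap.rTensor_comp, LinearMap.comp_assoc, hf,
      LinearMap.comp_id]
  have e2 : LinearMap.lTensor E (U'.subtype ∘ₗ g) z = z := by
    rw [← hy2, ← LinearMap.comp_apply, ← LinearMap.lTensor_comp, LinearMap.comp_assoc, hg,
      LinearMap.comp_id]
  rw [← LinearMap.comp_apply, ← TensorProduct.map_comp]
  calc _ = LinearMap.rTensor F (U.subtype ∘ₗ f) (LinearMap.lTensor E (U'.subtype ∘ₗ g) z) := by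
        rw [← LinearMap.comp_apply, LinearMap.rTensor_comp_lTensor]
    _ = z := by rw [e2, e1]
end Inter

section Grading
variable {k : Type u} [Field k] {W : Type v} [AddCommGroup W] [Module k W]

instance wordsGradedAlgebra : GradedAlgebra (wordsOfLength k W) :=
  inferInstanceAs (GradedAlgebra (LinearMap.range (TensorAlgebra.ι k (M := W)) ^ ·))

lemma wordsOfLength_add (p q : ℕ) :
    wordsOfLength k W (p + q) = wordsOfLength k W p * wordsOfLength k W q := pow_add _ _ _

/-- The projection of `T(W)` onto `W^{⊗ n}`. -/
def wordsProj (n : ℕ) : TensorAlgebra k W →ₗ[k] TensorAlgebra k W :=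
  GradedAlgebra.proj (wordsOfLength k W) n

lemma wordsProj_same {n : ℕ} {x : TensorAlgebra k W} (hx : x ∈ wordsOfLength k W n) :
    wordsProj n x = x := by
  rw [wordsProj, GradedAlgebra.proj_apply, DirectSum.decompose_of_mem_same _ hx]

lemma wordsProj_ne {m n : ℕ} {x : TensorAlgebra k W} (hx : x ∈ wordsOfLength k W n)
    (h : n ≠ m) : wordsProj m x = 0 := by
  rw [wordsProj, GradedAlgebra.proj_apply, DirectSum.decompose_of_mem_ne _ hx h]

lemma ι_mem_words (a : W) : TensorAlgebra.ι k a ∈ wordsOfLength k W 1 := by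
  simp [wordsOfLength]

lemma ι_mul_mem_words (a : W) {n : ℕ} {x : TensorAlgebra k W} (hx : x ∈ wordsOfLength k W n) :
    TensorAlgebra.ι k a * x ∈ wordsOfLength k W (n + 1) := by
  rw [wordsOfLength, pow_succ']
  exact Submodule.mul_mem_mul (LinearMap.mem_range_self _ _) hx

lemma wordsProj_ι_mul (a : W) (n : ℕ) (x : TensorAlgebra k W) :
    wordsProj (n + 1) (TensorAlgebra.ι k a * x) = TensorAlgebra.ι k a * wordsProj n x := by
  rw [wordsProj, wordsProj, GradedAlgebra.proj_apply, GradedAlgebra.proj_apply, add_comm,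
    DirectSum.coe_decompose_mul_add_of_left_mem _ (ι_mem_words a)]

lemma wordsProj_zero_ι_mul (a : W) (x : TensorAlgebra k W) :
    wordsProj 0 (TensorAlgebra.ι k a * x) = 0 := by
  rw [wordsProj, GradedAlgebra.proj_apply]
  exact DirectSum.coe_decompose_mul_of_left_mem_of_not_le _ (ι_mem_words a) (by simp)

lemma words_ind {P : ℕ → TensorAlgebra k W → Prop} (h1 : P 0 1)
    (hsmul : ∀ n (r : k) x, P n x → P n (r • x))
    (hadd : ∀ n x y, P n x → P n y → P n (x + y))
    (hι : ∀ n a x, x ∈ wordsOfLength k W n → P n x → P (n + 1) (TensorAlgebra.ι k a * x))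
    {n : ℕ} {x : TensorAlgebra k W} (hx : x ∈ wordsOfLength k W n) : P n x := by
  induction n generalizing x with
  | zero =>
    rw [wordsOfLength, pow_zero, Submodule.mem_one] at hx
    obtain ⟨r, rfl⟩ := hx
    rw [Algebra.algebraMap_eq_smul_one]
    exact hsmul _ _ _ h1
  | succ n ih =>
    rw [wordsOfLength, pow_succ'] at hx
    refine Submodule.mul_induction_on hx ?_ (fun x y => hadd _ x y)
    rintro _ ⟨a, rfl⟩ y hy
    exact hι _ _ _ hy (ih hy)

lemma lTensor_deconc_of_lt {n m : ℕ} {x : TensorAlgebra k W} (hx : x ∈ wordsOfLength k W n)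
    (h : n < m) : LinearMap.lTensor _ (wordsProj m) (deconc x) = 0 := by
  refine words_ind (P := fun n x => ∀ m, n < m →
    LinearMap.lTensor (TensorAlgebra k W) (wordsProj m) (deconc x) = 0)
    ?_ ?_ ?_ ?_ hx m h
  · intro m hm
    simp [wordsProj_ne (k := k) (W := W) (n := 0) (m := m) (x := 1)
      (by simp [wordsOfLength, Submodule.mem_one]) (by omega)]
  · intro n r x hx m hm; simp [hx m hm]
  · intro n x y hx hy m hm; simp [hx m hm, hy m hm]
  · intro n a x hx ih m hm
    rw [deconc_ι_mul, map_add, ← LinearMap.comp_apply (LinearMap.lTensor _ _),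
      LinearMap.lTensor_comp_rTensor, ← LinearMap.rTensor_comp_lTensor, LinearMap.comp_apply,
      ih m (by omega)]
    simp [wordsProj_ne (ι_mul_mem_words a hx) (show n + 1 ≠ m by omega)]

lemma lTensor_deconc_self {q : ℕ} {x : TensorAlgebra k W} (hx : x ∈ wordsOfLength k W q) :
    LinearMap.lTensor _ (wordsProj q) (deconc x) = 1 ⊗ₜ x := by
  refine words_ind (P := fun q x =>
    LinearMap.lTensor (TensorAlgebra k W) (wordsProj q) (deconc x) = 1 ⊗ₜ x)
    ?_ ?_ ?_ ?_ hx
  · simp [wordsProj_same (k := k) (W := W) (n := 0) (x := 1)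
      (by simp [wordsOfLength, Submodule.mem_one])]
  · intro n r x hx; simp [hx]
  · intro n x y hx hy; simp [hx, hy, TensorProduct.tmul_add]
  · intro n a x hx _
    rw [deconc_ι_mul, map_add, ← LinearMap.comp_apply (LinearMap.lTensor _ _),
      LinearMap.lTensor_comp_rTensor, ← LinearMap.rTensor_comp_lTensor, LinearMap.comp_apply,
      lTensor_deconc_of_lt hx (Nat.lt_succ_self n)]
    simp [wordsProj_same (ι_mul_mem_words a hx)]

lemma lTensor_deconc_mul {p q : ℕ} {x y : TensorAlgebra k W} (hx : x ∈ wordsOfLength k W p)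
    (hy : y ∈ wordsOfLength k W q) :
    LinearMap.lTensor _ (wordsProj q) (deconc (x * y)) = x ⊗ₜ y := by
  refine words_ind (P := fun p x =>
    LinearMap.lTensor (TensorAlgebra k W) (wordsProj q) (deconc (x * y)) = x ⊗ₜ y)
    ?_ ?_ ?_ ?_ hx
  · simpa using lTensor_deconc_self hy
  · intro n r x hx; simp [hx, TensorProduct.smul_tmul']
  · intro n x z hx hz; simp [add_mul, hx, hz, TensorProduct.add_tmul]
  · intro n a x hx ih
    have hxy : x * y ∈ wordsOfLength k W (n + q) := by
      rw [wordsOfLength_add]; exact Submodule.mul_mem_mul hx hy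
    rw [mul_assoc, deconc_ι_mul, map_add, ← LinearMap.comp_apply (LinearMap.lTensor _ _),
      LinearMap.lTensor_comp_rTensor, ← LinearMap.rTensor_comp_lTensor, LinearMap.comp_apply, ih]
    simp [wordsProj_ne (ι_mul_mem_words a hxy) (show n + q + 1 ≠ q by omega)]

lemma exists_sum_lTensor (z : TensorAlgebra k W ⊗[k] TensorAlgebra k W) :
    z ∈ Submodule.span k (Set.range fun q : ℕ => LinearMap.lTensor _ (wordsProj q) z) := by
  have : ∃ s : Finset ℕ, ∀ t, s ⊆ t →
      z = ∑ q ∈ t, LinearMap.lTensor (TensorAlgebra k W) (wordsProj q) z := by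
    induction z using TensorProduct.induction_on with
    | zero => exact ⟨∅, by simp⟩
    | tmul a b =>
      classical
      refine ⟨(DirectSum.decompose (wordsOfLength k W) b).support, fun t ht => ?_⟩
      simp only [LinearMap.lTensor_tmul, ← TensorProduct.tmul_sum]
      congr 1
      conv_lhs => rw [← DirectSum.sum_support_decompose (wordsOfLength k W) b]
      refine Finset.sum_subset ht fun i _ hi => ?_
      simpa using hi
    | add a b ha hb =>
      classical
      obtain ⟨s, hs⟩ := ha
      obtain ⟨t, ht⟩ := hb
      refine ⟨s ∪ t, fun r hr => ?_⟩
      simp only [map_add, Finset.sum_add_distrib]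
      rw [← hs r (Finset.union_subset_left hr), ← ht r (Finset.union_subset_right hr)]
  obtain ⟨s, hs⟩ := this
  have h := Submodule.sum_mem (Submodule.span k (Set.range fun q : ℕ =>
    LinearMap.lTensor (TensorAlgebra k W) (wordsProj q) z)) (t := s)
    (f := fun q => LinearMap.lTensor (TensorAlgebra k W) (wordsProj q) z)
    fun q _ => Submodule.subset_span (Set.mem_range_self q)
  rwa [← hs s subset_rfl] at h

lemma lTensor_deconc_mem_left {p q : ℕ} {U : Submodule k (TensorAlgebra k W)}
    (hU : U ≤ wordsOfLength k W p) {x : TensorAlgebra k W} (hx : x ∈ U * wordsOfLength k W q) :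
    LinearMap.lTensor _ (wordsProj q) (deconc x) ∈
      LinearMap.range (LinearMap.rTensor (TensorAlgebra k W) U.subtype) := by
  refine Submodule.mul_induction_on hx ?_ ?_
  · intro a ha b hb
    rw [lTensor_deconc_mul (hU ha) hb]
    exact ⟨(⟨a, ha⟩ : U) ⊗ₜ[k] b, by simp⟩
  · intro a b ha hb
    rw [map_add, map_add]
    exact Submodule.add_mem _ ha hb

lemma lTensor_deconc_mem_right {p q : ℕ} {U : Submodule k (TensorAlgebra k W)}
    (hU : U ≤ wordsOfLength k W q) {x : TensorAlgebra k W} (hx : x ∈ wordsOfLength k W p * U) :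
    LinearMap.lTensor _ (wordsProj q) (deconc x) ∈
      LinearMap.range (LinearMap.lTensor (TensorAlgebra k W) U.subtype) := by
  refine Submodule.mul_induction_on hx ?_ ?_
  · intro a ha b hb
    rw [lTensor_deconc_mul ha (hU hb)]
    exact ⟨a ⊗ₜ[k] (⟨b, hb⟩ : U), by simp⟩
  · intro a b ha hb
    rw [map_add, map_add]
    exact Submodule.add_mem _ ha hb
end Grading

section Quadratic
variable {k : Type u} [Field k] {V : Type v} [AddCommGroup V] [Module k V]

/-- The space of relations `R ⊆ V ⊗ V`, as a subspace of `V^{⊗ 2} ⊆ T(V)`. -/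
def relations (R : Submodule k (V ⊗[k] V)) : Submodule k (TensorAlgebra k V) :=
  R.map (LinearMap.mul' k (TensorAlgebra k V) ∘ₗ
    TensorProduct.map (TensorAlgebra.ι k) (TensorAlgebra.ι k))

/-- The degree `n` part `⋂_{i + j + 2 = n} V^{⊗ i} ⊗ R ⊗ V^{⊗ j} ⊆ V^{⊗ n}` of the Koszul dual
coalgebra (so it is `k` for `n = 0` and `V` for `n = 1`). -/
def dualPiece (R : Submodule k (V ⊗[k] V)) (n : ℕ) : Submodule k (TensorAlgebra k V) :=
  wordsOfLength k V n ⊓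
    ⨅ (i : ℕ) (j : ℕ) (_ : i + j + 2 = n), wordsOfLength k V i * relations R * wordsOfLength k V j

/-- The Koszul dual coalgebra `A^¡ = ⨁ₙ A^¡ₙ`, as a subspace of `T(V)`. -/
def koszulDualSub (R : Submodule k (V ⊗[k] V)) : Submodule k (TensorAlgebra k V) :=
  ⨆ n, dualPiece R n

variable {R : Submodule k (V ⊗[k] V)}

lemma dualPiece_le (n : ℕ) : dualPiece R n ≤ koszulDualSub R := le_iSup (dualPiece R) n

lemma relations_le : relations R ≤ wordsOfLength k V 2 := by
  rintro _ ⟨r, -, rfl⟩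
  induction r using TensorProduct.induction_on with
  | zero => simp
  | add a b ha hb => rw [map_add]; exact Submodule.add_mem _ ha hb
  | tmul a b =>
    rw [wordsOfLength, pow_two]
    exact Submodule.mul_mem_mul (LinearMap.mem_range_self _ _) (LinearMap.mem_range_self _ _)

lemma cut_le {i j n : ℕ} (h : i + j + 2 = n) :
    wordsOfLength k V i * relations R * wordsOfLength k V j ≤ wordsOfLength k V n := by
  have : n = i + 2 + j := by omega
  rw [this, wordsOfLength_add, wordsOfLength_add]
  exact mul_le_mul' (mul_le_mul' le_rfl relations_le) le_rfl

lemma mem_dualPiece {n : ℕ} {x : TensorAlgebra k V} : x ∈ dualPiece R n ↔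
    x ∈ wordsOfLength k V n ∧ ∀ i j, i + j + 2 = n →
      x ∈ wordsOfLength k V i * relations R * wordsOfLength k V j := by
  simp [dualPiece, Submodule.mem_iInf]

lemma deconc_mem_piece {p q : ℕ} {x : TensorAlgebra k V} (hx : x ∈ dualPiece R (p + q)) :
    LinearMap.lTensor _ (wordsProj q) (deconc x) ∈
      LinearMap.range (TensorProduct.map (dualPiece R p).subtype (dualPiece R q).subtype) := by
  rw [mem_dualPiece] at hx
  obtain ⟨hx1, hx2⟩ := hx
  apply mem_range_map
  · rw [mem_range_rTensor]
    intro φ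
    rw [mem_dualPiece]
    constructor
    · refine (mem_range_rTensor _ _).1 (lTensor_deconc_mem_left (p := p) le_rfl ?_) φ
      rwa [← wordsOfLength_add]
    · intro i j hij
      refine (mem_range_rTensor _ _).1 (lTensor_deconc_mem_left (cut_le hij) ?_) φ
      rw [mul_assoc, ← wordsOfLength_add]
      exact hx2 i (j + q) (by omega)
  · rw [mem_range_lTensor]
    intro φ
    rw [mem_dualPiece]
    constructor
    · refine (mem_range_lTensor _ _).1 (lTensor_deconc_mem_right (p := p) le_rfl ?_) φ
      rwa [← wordsOfLength_add]
    · intro i j hij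
      refine (mem_range_lTensor _ _).1 (lTensor_deconc_mem_right (p := p) (cut_le hij) ?_) φ
      rw [← mul_assoc, ← mul_assoc, ← wordsOfLength_add]
      exact hx2 (p + i) j (by omega)

lemma deconc_mem {x : TensorAlgebra k V} (hx : x ∈ koszulDualSub R) :
    deconc x ∈ LinearMap.range
      (TensorProduct.map (koszulDualSub R).subtype (koszulDualSub R).subtype) := by
  refine Submodule.iSup_induction _ (motive := fun x => deconc x ∈ LinearMap.range
      (TensorProduct.map (koszulDualSub R).subtype (koszulDualSub R).subtype)) hx ?_ (by simp) ?_
  · intro n x hx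
    refine (Submodule.span_le.2 ?_) (exists_sum_lTensor (deconc x))
    rintro _ ⟨q, rfl⟩
    by_cases hq : q ≤ n
    · obtain ⟨p, rfl⟩ := Nat.exists_eq_add_of_le' hq
      obtain ⟨y, hy⟩ := deconc_mem_piece hx
      refine ⟨TensorProduct.map (Submodule.inclusion (dualPiece_le p))
        (Submodule.inclusion (dualPiece_le q)) y, ?_⟩
      rw [← LinearMap.comp_apply, ← TensorProduct.map_comp]
      exact hy
    · simp [lTensor_deconc_of_lt (mem_dualPiece.1 hx).1 (not_le.1 hq)]
  · intro x y hx hy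
    rw [map_add]
    exact Submodule.add_mem _ hx hy

variable (R) in
/-- The Koszul dual coalgebra `A^¡`, as a vector space. -/
def KoszulDual : Type max u v := koszulDualSub R

instance : AddCommGroup (KoszulDual R) := inferInstanceAs (AddCommGroup (koszulDualSub R))
instance : Module k (KoszulDual R) := inferInstanceAs (Module k (koszulDualSub R))

variable (R) in
/-- The inclusion of `A^¡` into `T(V)`. -/
def incl : KoszulDual R →ₗ[k] TensorAlgebra k V := (koszulDualSub R).subtype

lemma incl_mem (x : KoszulDual R) : incl R x ∈ koszulDualSub R := Subtype.property x

lemma incl_injective : Function.Injective (incl R) := Subtype.val_injective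

/-- A linear map to `T(V)` with image in `A^¡`, as a map to `A^¡`. -/
def toDual {E : Type w} [AddCommGroup E] [Module k E] (f : E →ₗ[k] TensorAlgebra k V)
    (hf : ∀ x, f x ∈ koszulDualSub R) : E →ₗ[k] KoszulDual R := f.codRestrict _ hf

lemma incl_toDual {E : Type w} [AddCommGroup E] [Module k E] (f : E →ₗ[k] TensorAlgebra k V)
    (hf : ∀ x, f x ∈ koszulDualSub R) (x : E) : incl R (toDual f hf x) = f x := rfl

variable (R) in
/-- The coproduct of `A^¡`: the restriction of the deconcatenation coproduct of `T^c(V)`. -/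
def dualComul : KoszulDual R →ₗ[k] KoszulDual R ⊗[k] KoszulDual R :=
  (LinearEquiv.ofInjective
      (TensorProduct.map (incl R) (incl R))
      (TensorProduct.map_injective_of_flat_flat _ _ incl_injective incl_injective)).symm.toLinearMap ∘ₗ
    (deconc ∘ₗ incl R).codRestrict _ (fun x => deconc_mem (incl_mem x))

lemma map_subtype_dualComul (x : KoszulDual R) :
    TensorProduct.map (incl R) (incl R) (dualComul R x) =
      deconc (incl R x) := by
  have := LinearEquiv.apply_symm_apply (LinearEquiv.ofInjective
      (TensorProduct.map (incl R) (incl R))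
      (TensorProduct.map_injective_of_flat_flat _ _ incl_injective incl_injective))
      ((deconc ∘ₗ incl R).codRestrict _ (fun x => deconc_mem (incl_mem x)) x)
  exact congrArg Subtype.val this

/-- `A^¡` is a coalgebra, with counit the projection onto `A^¡₀ = k`. -/
instance koszulDualCoalgebra : Coalgebra k (KoszulDual R) where
  comul := dualComul R
  counit := TensorAlgebra.algebraMapInv.toLinearMap ∘ₗ incl R
  coassoc := by
    ext x
    have hinj : Function.Injective (TensorProduct.map (incl R)
        (TensorProduct.map (incl R) (incl R))) :=
      TensorProduct.map_injective_of_flat_flat _ _ incl_injective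
        (TensorProduct.map_injective_of_flat_flat _ _ incl_injective incl_injective)
    apply hinj
    have e1 : ∀ z : KoszulDual R ⊗[k] KoszulDual R,
        TensorProduct.map (incl R)
          (TensorProduct.map (incl R) (incl R))
          (TensorProduct.assoc k _ _ _ (LinearMap.rTensor _ (dualComul R) z)) =
        TensorProduct.assoc k _ _ _ (LinearMap.rTensor _ deconc
          (TensorProduct.map (incl R) (incl R) z)) := by
      intro z
      induction z using TensorProduct.induction_on with
      | zero => simp
      | add a b ha hb => simp only [map_add, ha, hb]
      | tmul a b =>
        rw [LinearMap.rTensor_tmul, TensorProduct.map_tmul, LinearMap.rTensor_tmul,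
          ← map_subtype_dualComul]
        generalize dualComul R a = y
        induction y using TensorProduct.induction_on with
        | zero => simp
        | tmul a b => simp
        | add a b ha hb => simp only [map_add, TensorProduct.add_tmul, ha, hb]
    have e2 : ∀ z : KoszulDual R ⊗[k] KoszulDual R,
        TensorProduct.map (incl R)
          (TensorProduct.map (incl R) (incl R))
          (LinearMap.lTensor _ (dualComul R) z) =
        LinearMap.lTensor _ deconc
          (TensorProduct.map (incl R) (incl R) z) := by
      intro z
      induction z using TensorProduct.induction_on with
      | zero => simp
      | add a b ha hb => simp only [map_add, ha, hb]
      | tmul a b =>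
        rw [LinearMap.lTensor_tmul, TensorProduct.map_tmul, TensorProduct.map_tmul,
          LinearMap.lTensor_tmul,
          ← map_subtype_dualComul]
    simp only [LinearMap.comp_apply, LinearEquiv.coe_coe]
    rw [e1, e2, map_subtype_dualComul, deconc_coassoc]
  rTensor_counit_comp_comul := by
    ext x
    have hinj : Function.Injective (LinearMap.lTensor k (incl R)) :=
      Module.Flat.lTensor_preserves_injective_linearMap _ incl_injective
    apply hinj
    rw [LinearMap.comp_apply, ← LinearMap.comp_apply (LinearMap.lTensor _ _),
      LinearMap.lTensor_comp_rTensor, TensorProduct.mk_apply, LinearMap.lTensor_tmul,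
      ← deconc_counit_left, ← map_subtype_dualComul,
      ← LinearMap.comp_apply (LinearMap.rTensor _ _), LinearMap.rTensor_comp_map]
  lTensor_counit_comp_comul := by
    ext x
    have hinj : Function.Injective (LinearMap.rTensor k (incl R)) :=
      Module.Flat.rTensor_preserves_injective_linearMap _ incl_injective
    apply hinj
    rw [LinearMap.comp_apply, ← LinearMap.comp_apply (LinearMap.rTensor _ _),
      LinearMap.rTensor_comp_lTensor, LinearMap.flip_apply, TensorProduct.mk_apply,
      LinearMap.rTensor_tmul, ← deconc_counit_right, ← map_subtype_dualComul,
      ← LinearMap.comp_apply (LinearMap.lTensor _ _), LinearMap.lTensor_comp_map]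

lemma one_mem_dualPiece : (1 : TensorAlgebra k V) ∈ dualPiece R 0 := by
  rw [mem_dualPiece]
  exact ⟨by simp [wordsOfLength, Submodule.mem_one], fun i j h => by omega⟩

lemma tmap_mem_words (f : V →ₗ[k] V) {n : ℕ} {x : TensorAlgebra k V}
    (hx : x ∈ wordsOfLength k V n) : tmap f x ∈ wordsOfLength k V n := by
  refine words_ind (P := fun n x => tmap f x ∈ wordsOfLength k V n) ?_ ?_ ?_ ?_ hx
  · simp [wordsOfLength, Submodule.mem_one]
  · intro n r x hx; rw [map_smul]; exact Submodule.smul_mem _ _ hx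
  · intro n x y hx hy; rw [map_add]; exact Submodule.add_mem _ hx hy
  · intro n a x _ hx
    rw [map_mul, show tmap f (TensorAlgebra.ι k a) = TensorAlgebra.ι k (f a) by simp [tmap]]
    exact ι_mul_mem_words _ hx

lemma tmap_relations (f : V →ₗ[k] V) (r : V ⊗[k] V) :
    tmap f ((LinearMap.mul' k (TensorAlgebra k V) ∘ₗ
      TensorProduct.map (TensorAlgebra.ι k) (TensorAlgebra.ι k)) r) =
    (LinearMap.mul' k (TensorAlgebra k V) ∘ₗ
      TensorProduct.map (TensorAlgebra.ι k) (TensorAlgebra.ι k)) (TensorProduct.map f f r) := by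
  induction r using TensorProduct.induction_on with
  | zero => simp
  | tmul a b => simp [tmap]
  | add a b ha hb => simp only [map_add, ha, hb]

lemma tmap_mem_dual (f : V →ₗ[k] V) (hf : R.map (TensorProduct.map f f) ≤ R) :
    ∀ x ∈ koszulDualSub R, tmap f x ∈ koszulDualSub R := by
  intro x hx
  refine Submodule.iSup_induction _ (motive := fun x => tmap f x ∈ koszulDualSub R) hx ?_
    (by simp) ?_
  · intro n x hx
    refine dualPiece_le n ?_
    rw [mem_dualPiece] at hx ⊢
    refine ⟨tmap_mem_words f hx.1, fun i j hij => ?_⟩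
    refine Submodule.mul_induction_on (hx.2 i j hij) ?_ ?_
    · intro y hy c hc
      rw [map_mul]
      refine Submodule.mul_mem_mul ?_ (tmap_mem_words f hc)
      refine Submodule.mul_induction_on hy ?_ ?_
      · rintro a ha _ ⟨r, hr, rfl⟩
        rw [map_mul, tmap_relations]
        exact Submodule.mul_mem_mul (tmap_mem_words f ha)
          (Submodule.mem_map_of_mem (hf (Submodule.mem_map_of_mem hr)))
      · intro a b ha hb; rw [map_add]; exact Submodule.add_mem _ ha hb
    · intro a b ha hb; rw [map_add]; exact Submodule.add_mem _ ha hb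
  · intro x y hx hy
    rw [map_add]; exact Submodule.add_mem _ hx hy

/-- The endomorphism `v₁ ⋯ vₙ ↦ f(v₁) ⋯ f(vₙ)` of `A^¡` induced by an endomorphism `f` of `V`
with `(f ⊗ f)(R) ⊆ R`. -/
def dualMap (f : V →ₗ[k] V) (hf : R.map (TensorProduct.map f f) ≤ R) :
    KoszulDual R →ₗ[k] KoszulDual R :=
  toDual ((tmap f).toLinearMap ∘ₗ incl R) (fun x => tmap_mem_dual f hf _ (incl_mem x))

/-- The defining relations of `T(V) / (R)`. -/
inductive QuadRel (R : Submodule k (V ⊗[k] V)) : TensorAlgebra k V → TensorAlgebra k V → Prop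
  | of {r : TensorAlgebra k V} (hr : r ∈ relations R) : QuadRel R r 0

/-- The quadratic algebra `A = T(V) / (R)`. -/
def QuadAlg (R : Submodule k (V ⊗[k] V)) : Type max u v := RingQuot (QuadRel R)

instance : Ring (QuadAlg R) := inferInstanceAs (Ring (RingQuot (QuadRel R)))
instance : Algebra k (QuadAlg R) := inferInstanceAs (Algebra k (RingQuot (QuadRel R)))

variable (R) in
/-- The quotient map `T(V) → A`. -/
def QuadAlg.mk : TensorAlgebra k V →ₐ[k] QuadAlg R := RingQuot.mkAlgHom k (QuadRel R)

variable (R) in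
/-- The map `V → A`, with image `A₁`. -/
def QuadAlg.ι : V →ₗ[k] QuadAlg R := (QuadAlg.mk R).toLinearMap ∘ₗ TensorAlgebra.ι k

/-- The algebra map out of `T(V) / (R)` given by a linear map on `V` which kills `R`. -/
def QuadAlg.lift {B : Type w} [Ring B] [Algebra k B] (f : V →ₗ[k] B)
    (hf : ∀ r ∈ relations R, TensorAlgebra.lift k f r = 0) : QuadAlg R →ₐ[k] B :=
  RingQuot.liftAlgHom k ⟨TensorAlgebra.lift k f, by rintro _ _ ⟨hr⟩; simp [hf _ hr]⟩

lemma QuadAlg.lift_mk {B : Type w} [Ring B] [Algebra k B] (f : V →ₗ[k] B)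
    (hf : ∀ r ∈ relations R, TensorAlgebra.lift k f r = 0) (x : TensorAlgebra k V) :
    QuadAlg.lift f hf (QuadAlg.mk R x) = TensorAlgebra.lift k f x :=
  RingQuot.liftAlgHom_mkAlgHom_apply ..

lemma QuadAlg.mk_relations {r : TensorAlgebra k V} (hr : r ∈ relations R) :
    QuadAlg.mk R r = 0 := by
  have := RingQuot.mkAlgHom_rel k (QuadRel.of hr)
  rw [map_zero] at this
  exact this

lemma lift_relations {B : Type w} [Ring B] [Algebra k B] (f : V →ₗ[k] B) (r : V ⊗[k] V) :
    TensorAlgebra.lift k f ((LinearMap.mul' k (TensorAlgebra k V) ∘ₗ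
      TensorProduct.map (TensorAlgebra.ι k) (TensorAlgebra.ι k)) r) =
    LinearMap.mul' k B (TensorProduct.map f f r) := by
  induction r using TensorProduct.induction_on with
  | zero => simp
  | tmul a b => simp
  | add a b ha hb => simp only [map_add, ha, hb]

variable (R) in
/-- The augmentation `A → k`, with kernel `⨁_{n ≥ 1} Aₙ`. -/
def QuadAlg.aug : QuadAlg R →ₐ[k] k :=
  QuadAlg.lift 0 (by
    rintro _ ⟨r, -, rfl⟩
    rw [lift_relations]
    simp)

variable (R) in
/-- The degree `n` part `Aₙ` of `A`. -/
def QuadAlg.deg (n : ℕ) : Submodule k (QuadAlg R) := LinearMap.range (QuadAlg.ι R) ^ n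

variable (R) in
/-- Auxiliary action of `V` on `k ⊕ V ⊕ (V ⊗ V) / R`, by `v · (c, w, z) = (0, c v, [v ⊗ w])`. -/
def truncAction : V →ₗ[k] Module.End k (k × V × ((V ⊗[k] V) ⧸ R)) where
  toFun a := LinearMap.prod 0 (LinearMap.prod
    (LinearMap.toSpanSingleton k V a ∘ₗ LinearMap.fst k _ _)
    (R.mkQ ∘ₗ TensorProduct.mk k V V a ∘ₗ LinearMap.fst k _ _ ∘ₗ LinearMap.snd k _ _))
  map_add' a b := LinearMap.ext fun c => by simp
  map_smul' r a := LinearMap.ext fun c =>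
    Prod.ext (by simp) (Prod.ext (smul_comm c.1 r a)
      (congrArg R.mkQ (TensorProduct.smul_tmul' r a c.2.1).symm))

lemma trunc_mul (r : V ⊗[k] V) (c : k × V × ((V ⊗[k] V) ⧸ R)) :
    LinearMap.mul' k _ (TensorProduct.map (truncAction R) (truncAction R) r) c =
      (0, 0, c.1 • R.mkQ r) := by
  induction r using TensorProduct.induction_on with
  | zero => simp [Prod.ext_iff]
  | tmul a b => simp [truncAction]
  | add a b ha hb => simp only [map_add, LinearMap.add_apply, ha, hb]; simp

/-- The action of `A` on its truncation `A / A_{≥ 3} = k ⊕ V ⊕ (V ⊗ V) / R`. -/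
def truncRep : QuadAlg R →ₐ[k] Module.End k (k × V × ((V ⊗[k] V) ⧸ R)) :=
  QuadAlg.lift (truncAction R) (by
    rintro _ ⟨r, hr, rfl⟩
    rw [lift_relations]
    ext1
    · ext1; simp [trunc_mul, (Submodule.Quotient.mk_eq_zero R).2 hr]
    · refine LinearMap.ext fun c => ?_
      simp [trunc_mul])

variable (R) in
/-- The projection `A → A₁ = V`. -/
def QuadAlg.toGen : QuadAlg R →ₗ[k] V :=
  LinearMap.fst k _ _ ∘ₗ LinearMap.snd k _ _ ∘ₗ
    LinearMap.applyₗ ((1, 0, 0) : k × V × ((V ⊗[k] V) ⧸ R)) ∘ₗ truncRep.toLinearMap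

lemma QuadAlg.toGen_ι (a : V) : QuadAlg.toGen R (QuadAlg.ι R a) = a := by
  simp [QuadAlg.toGen, QuadAlg.ι, truncRep, QuadAlg.lift_mk, truncAction]

/-- An algebra automorphism preserving the grading. -/
def IsGradedAut (σ : QuadAlg R ≃ₐ[k] QuadAlg R) : Prop :=
  ∀ n, ∀ a ∈ QuadAlg.deg R n, σ a ∈ QuadAlg.deg R n

/-- The restriction of a graded automorphism `σ` to `A₁ = V`. -/
def onGen (σ : QuadAlg R ≃ₐ[k] QuadAlg R) : V →ₗ[k] V :=
  QuadAlg.toGen R ∘ₗ σ.toLinearMap ∘ₗ QuadAlg.ι R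

lemma ι_onGen {σ : QuadAlg R ≃ₐ[k] QuadAlg R} (hσ : IsGradedAut σ) (a : V) :
    QuadAlg.ι R (onGen σ a) = σ (QuadAlg.ι R a) := by
  have := hσ 1 (QuadAlg.ι R a) (by simp [QuadAlg.deg])
  rw [QuadAlg.deg, pow_one] at this
  obtain ⟨b, hb⟩ := this
  simp [onGen, ← hb, QuadAlg.toGen_ι]

lemma onGen_relations {σ : QuadAlg R ≃ₐ[k] QuadAlg R} (hσ : IsGradedAut σ) :
    R.map (TensorProduct.map (onGen σ) (onGen σ)) ≤ R := by
  rintro _ ⟨r, hr, rfl⟩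
  have h1 : ∀ r : V ⊗[k] V, QuadAlg.mk R ((LinearMap.mul' k (TensorAlgebra k V) ∘ₗ
      TensorProduct.map (TensorAlgebra.ι k) (TensorAlgebra.ι k))
        (TensorProduct.map (onGen σ) (onGen σ) r)) =
      σ (QuadAlg.mk R ((LinearMap.mul' k (TensorAlgebra k V) ∘ₗ
      TensorProduct.map (TensorAlgebra.ι k) (TensorAlgebra.ι k)) r)) := by
    intro r
    induction r using TensorProduct.induction_on with
    | zero => simp
    | add a b ha hb => simp only [map_add, ha, hb]
    | tmul a b =>
      have ha := ι_onGen hσ a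
      have hb := ι_onGen hσ b
      simp only [QuadAlg.ι, LinearMap.comp_apply, AlgHom.toLinearMap_apply] at ha hb
      simp [ha, hb]
  have h2 := h1 r
  rw [QuadAlg.mk_relations (Submodule.mem_map_of_mem hr), map_zero] at h2
  have h3 := congrArg (fun y => truncRep y ((1, 0, 0) : k × V × ((V ⊗[k] V) ⧸ R))) h2
  simp only [truncRep, QuadAlg.lift_mk, lift_relations, trunc_mul] at h3
  simpa using h3

/-- The action of a graded automorphism `σ` of `A` on the Koszul dual coalgebra. -/
def dualAut (σ : QuadAlg R ≃ₐ[k] QuadAlg R) (hσ : IsGradedAut σ) :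
    KoszulDual R →ₗ[k] KoszulDual R :=
  dualMap (onGen σ) (onGen_relations hσ)
end Quadratic

section Homology
variable {k : Type u} [Field k] {X : Type v} [AddCommGroup X] [Module k X]
  {Y : Type w} [AddCommGroup Y] [Module k Y]

/-- The cycles of degree `n` of a complex `(⨁ₙ G n, d)` in a vector space `X`. -/
def cycles (d : X →ₗ[k] X) (G : ℕ → Submodule k X) (n : ℕ) : Submodule k X :=
  G n ⊓ LinearMap.ker d

/-- The homology in degree `n` of the complex `⋯ → G (n + 1) → G n → G (n - 1) → ⋯`, with
differentials the restrictions of `d`: cycles in `G n` modulo the image of `G (n + 1)`. -/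
abbrev Homology (d : X →ₗ[k] X) (G : ℕ → Submodule k X) (n : ℕ) : Type v :=
  cycles d G n ⧸ ((G (n + 1)).map d).submoduleOf (cycles d G n)

/-- The homology class of a cycle. -/
def homologyClass {d : X →ₗ[k] X} {G : ℕ → Submodule k X} {n : ℕ} :
    cycles d G n →ₗ[k] Homology d G n :=
  (((G (n + 1)).map d).submoduleOf (cycles d G n)).mkQ

/-- `Φ` is induced by `f`: it maps the class of each cycle `z` to the class of the cycle `f z`. -/
def IsInducedBy {d : X →ₗ[k] X} {G : ℕ → Submodule k X} {d' : Y →ₗ[k] Y}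
    {G' : ℕ → Submodule k Y} (f : X →ₗ[k] Y)
    (Φ : ∀ n, Homology d G n ≃ₗ[k] Homology d' G' n) : Prop :=
  ∀ (n : ℕ) (z : X) (hz : z ∈ cycles d G n), ∃ hfz : f z ∈ cycles d' G' n,
    Φ n (homologyClass ⟨z, hz⟩) = homologyClass ⟨f z, hfz⟩

/-- `β` is the Connes operator on the homology of `(⨁ₙ G n, d)`, where the operator `B` of
degree `1` is to be restricted to the subcomplex of the chains fixed by `T`. This says that the
homology of this subcomplex maps onto the whole homology (so that `β` is determined by `B`), and
that `β` maps the class of a cycle `z` of this subcomplex to the class of the cycle `B z`. -/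
def IsConnesOperator (d : X →ₗ[k] X) (G : ℕ → Submodule k X) (T B : X →ₗ[k] X)
    (β : ∀ n, Homology d G n →ₗ[k] Homology d G (n + 1)) : Prop :=
  (∀ (n : ℕ) (c : Homology d G n), ∃ (z : X) (hz : z ∈ cycles d G n),
    T z = z ∧ homologyClass ⟨z, hz⟩ = c) ∧
  ∀ (n : ℕ) (z : X) (hz : z ∈ cycles d G n), T z = z →
    ∃ hBz : B z ∈ cycles d G (n + 1), β n (homologyClass ⟨z, hz⟩) = homologyClass ⟨B z, hBz⟩

/-- For involutions `f`, `g` that give the parity of elements of `X` and `Y`, the operator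
`x ⊗ y ↦ (-1)^{|x| |y|} x ⊗ y`. -/
def koszulSign (f : X →ₗ[k] X) (g : Y →ₗ[k] Y) : X ⊗[k] Y →ₗ[k] X ⊗[k] Y :=
  (2 : k)⁻¹ • (LinearMap.id + LinearMap.rTensor Y f + LinearMap.lTensor X g -
    TensorProduct.map f g)
end Homology

section Letters
variable (k : Type u) [Field k] (W : Type v) [AddCommGroup W] [Module k W]

/-- `x ↦ (-1)^n x` for `x ∈ W^{⊗ n}`. -/
def lengthParity : TensorAlgebra k W →ₗ[k] TensorAlgebra k W :=
  (tmap (-LinearMap.id)).toLinearMap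

/-- `a₁ ⋯ aₙ ↦ a₁ ⊗ a₂ ⋯ aₙ` for `n ≥ 1`, and `1 ↦ 0`. -/
def firstLetter : TensorAlgebra k W →ₗ[k] W ⊗[k] TensorAlgebra k W :=
  LinearMap.rTensor _ TensorAlgebra.ιInv ∘ₗ deconc

/-- `a₁ ⋯ aₙ ↦ a₁ ⋯ aₙ₋₁ ⊗ aₙ` for `n ≥ 1`, and `1 ↦ 0`. -/
def lastLetter : TensorAlgebra k W →ₗ[k] TensorAlgebra k W ⊗[k] W :=
  LinearMap.lTensor _ TensorAlgebra.ιInv ∘ₗ deconc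

/-- `a₁ ⋯ aₙ ↦ ∑_{i = 1}^{n} a₁ ⋯ aᵢ₋₁ ⊗ aᵢ ⊗ aᵢ₊₁ ⋯ aₙ`. -/
def markLetter :
    TensorAlgebra k W →ₗ[k] TensorAlgebra k W ⊗[k] (W ⊗[k] TensorAlgebra k W) :=
  LinearMap.lTensor _ (firstLetter k W) ∘ₗ deconc

/-- `a₁ ⋯ aₙ ↦ ∑_{i = 1}^{n - 1} a₁ ⋯ aᵢ₋₁ ⊗ aᵢ ⊗ aᵢ₊₁ ⊗ aᵢ₊₂ ⋯ aₙ`. -/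
def markTwoLetters : TensorAlgebra k W →ₗ[k]
    TensorAlgebra k W ⊗[k] (W ⊗[k] (W ⊗[k] TensorAlgebra k W)) :=
  LinearMap.lTensor _ (LinearMap.lTensor _ (firstLetter k W)) ∘ₗ markLetter k W
end Letters

section Hochschild
variable {k : Type u} [Field k] {A : Type w} [Ring A] [Algebra k A]

/-- The augmentation ideal `Ā` of an augmented algebra. -/
abbrev AugIdeal (ε : A →ₐ[k] k) : Submodule k A := LinearMap.ker ε.toLinearMap

/-- The projection `A → Ā`, `a ↦ a - ε(a) 1`. -/
def toAug (ε : A →ₐ[k] k) : A →ₗ[k] AugIdeal ε :=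
  LinearMap.codRestrict _ (LinearMap.id - Algebra.linearMap k A ∘ₗ ε.toLinearMap)
    (fun a => by simp)

/-- The product `Ā ⊗ Ā → Ā`. -/
def augMul (ε : A →ₐ[k] k) : AugIdeal ε ⊗[k] AugIdeal ε →ₗ[k] AugIdeal ε :=
  toAug ε ∘ₗ LinearMap.mul' k A ∘ₗ
    TensorProduct.map (AugIdeal ε).subtype (AugIdeal ε).subtype

/-- The restriction to `Ā` of an automorphism `σ` with `σ(Ā) = Ā`. -/
def augAut (ε : A →ₐ[k] k) (σ : A ≃ₐ[k] A) : AugIdeal ε →ₗ[k] AugIdeal ε :=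
  toAug ε ∘ₗ σ.toLinearMap ∘ₗ (AugIdeal ε).subtype

/-- The space `⨁ₙ A ⊗ Ā^{⊗ n}` of reduced Hochschild chains with coefficients in a bimodule with
underlying space `A`; the chain `(a₀, a₁, …, aₙ)` is `a₀ ⊗ (a₁ ⋯ aₙ)` with `a₁ ⋯ aₙ ∈ T(Ā)`. -/
abbrev HochChain (ε : A →ₐ[k] k) : Type max u w := A ⊗[k] TensorAlgebra k (AugIdeal ε)

/-- The space `CHₙ = A ⊗ Ā^{⊗ n}`. -/
def hochDeg (ε : A →ₐ[k] k) (n : ℕ) : Submodule k (HochChain ε) :=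
  Submodule.span k {z | ∃ a : A, ∃ x ∈ wordsOfLength k (AugIdeal ε) n, z = a ⊗ₜ[k] x}

variable (ε : A →ₐ[k] k) (σ : A ≃ₐ[k] A)

/-- `(a₀, a₁, …, aₙ) ↦ (a₀ σ(a₁), a₂, …, aₙ)`. -/
def hochFirst : HochChain ε →ₗ[k] HochChain ε :=
  LinearMap.rTensor _ (LinearMap.mul' k A ∘ₗ
      LinearMap.lTensor A (σ.toLinearMap ∘ₗ (AugIdeal ε).subtype)) ∘ₗ
    (TensorProduct.assoc k A (AugIdeal ε) (TensorAlgebra k (AugIdeal ε))).symm.toLinearMap ∘ₗ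
    LinearMap.lTensor A (firstLetter k (AugIdeal ε))

/-- `(a₀, a₁, …, aₙ) ↦ ∑_{i = 1}^{n - 1} (-1)^i (a₀, a₁, …, aᵢ aᵢ₊₁, …, aₙ)`. -/
def hochInner : HochChain ε →ₗ[k] HochChain ε :=
  -LinearMap.lTensor A (LinearMap.mul' k _ ∘ₗ
      TensorProduct.map (lengthParity k (AugIdeal ε))
        (LinearMap.mul' k _ ∘ₗ LinearMap.rTensor _ (TensorAlgebra.ι k ∘ₗ augMul ε) ∘ₗ
          (TensorProduct.assoc k (AugIdeal ε) (AugIdeal ε)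
            (TensorAlgebra k (AugIdeal ε))).symm.toLinearMap) ∘ₗ
      markTwoLetters k (AugIdeal ε))

/-- `(a₀, a₁, …, aₙ) ↦ (-1)^n (aₙ a₀, a₁, …, aₙ₋₁)` for `n ≥ 1`, and `(a₀) ↦ 0`. -/
def hochLast : HochChain ε →ₗ[k] HochChain ε :=
  -((TensorProduct.comm k (TensorAlgebra k (AugIdeal ε)) A).toLinearMap ∘ₗ
    TensorProduct.map (lengthParity k (AugIdeal ε))
      (LinearMap.mul' k A ∘ₗ LinearMap.rTensor A (AugIdeal ε).subtype) ∘ₗ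
    (TensorProduct.assoc k (TensorAlgebra k (AugIdeal ε)) (AugIdeal ε) A).toLinearMap ∘ₗ
    (TensorProduct.comm k A (TensorAlgebra k (AugIdeal ε) ⊗[k] AugIdeal ε)).toLinearMap ∘ₗ
    LinearMap.lTensor A (lastLetter k (AugIdeal ε)))

/-- The Hochschild boundary on `CH_•(A; A_σ)`, where the bimodule `A_σ` is `A` with
`a · m · c = a m σ(c)`: the map `b (a₀, a₁, …, aₙ) = (a₀ σ(a₁), a₂, …, aₙ)
+ ∑_{i = 1}^{n - 1} (-1)^i (a₀, …, aᵢ aᵢ₊₁, …, aₙ) + (-1)^n (aₙ a₀, a₁, …, aₙ₋₁)`. -/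
def hochB : HochChain ε →ₗ[k] HochChain ε := hochFirst ε σ + hochInner ε + hochLast ε

/-- `T (a₀, a₁, …, aₙ) = (σ(a₀), σ(a₁), …, σ(aₙ))`. -/
def hochT : HochChain ε →ₗ[k] HochChain ε :=
  TensorProduct.map σ.toLinearMap (tmap (augAut ε σ)).toLinearMap

/-- The operator `B (a₀, a₁, …, aₙ) =
∑_{i = 1}^{n + 1} (-1)^{n i} (1, aᵢ, …, aₙ, a₀, σ(a₁), …, σ(aᵢ₋₁))` of degree `1`, with `a₀`
replaced by its component in `Ā`. Here `u = a₁ ⋯ aᵢ₋₁` and `v = aᵢ ⋯ aₙ` give the sign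
`(-1)^{n i} = (-1)^{|v| (|u| + 1)}`. -/
def hochConnes : HochChain ε →ₗ[k] HochChain ε :=
  TensorProduct.mk k A _ 1 ∘ₗ LinearMap.mul' k _ ∘ₗ
    (TensorProduct.comm k _ _).toLinearMap ∘ₗ
    LinearMap.rTensor _ (LinearMap.mul' k _ ∘ₗ
      TensorProduct.map (TensorAlgebra.ι k ∘ₗ toAug ε) (tmap (augAut ε σ)).toLinearMap) ∘ₗ
    (TensorProduct.assoc k A (TensorAlgebra k (AugIdeal ε))
      (TensorAlgebra k (AugIdeal ε))).symm.toLinearMap ∘ₗ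
    LinearMap.lTensor A (LinearMap.lTensor _ (lengthParity k (AugIdeal ε)) ∘ₗ
      koszulSign (lengthParity k (AugIdeal ε)) (lengthParity k (AugIdeal ε)) ∘ₗ deconc)
end Hochschild

section Nakayama
open CategoryTheory CategoryTheory.Abelian
variable (k : Type u) [Field k] (A : Type w) [Ring A] [Algebra k A]

/-- `A` as a left module over `A^e = A ⊗ A^op`, by `(a ⊗ c) · x = a x c`. -/
def bimod : ModuleCat.{w} (A ⊗[k] Aᵐᵒᵖ) :=
  letI := instModuleTensorProductMop k A
  ModuleCat.of (A ⊗[k] Aᵐᵒᵖ) A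

/-- `A ⊗ A` with its outer bimodule structure, that is, the left regular module `A^e`. -/
def outerBimod : ModuleCat.{w} (A ⊗[k] Aᵐᵒᵖ) := ModuleCat.of (A ⊗[k] Aᵐᵒᵖ) (A ⊗[k] Aᵐᵒᵖ)

variable {A} in
/-- The inner bimodule structure `x ⊗ y ↦ a · (x ⊗ y) · c = x c ⊗ a y` on `A ⊗ A`, which is by
endomorphisms of the outer one (right multiplication by `c ⊗ a` on `A^e = A ⊗ A^op`). -/
def innerAct (a c : A) : outerBimod k A ⟶ outerBimod k A :=
  ModuleCat.ofHom (LinearMap.toSpanSingleton (A ⊗[k] Aᵐᵒᵖ) (A ⊗[k] Aᵐᵒᵖ)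
    (c ⊗ₜ[k] MulOpposite.op a))

/-- `A` is homologically smooth: it has a bounded resolution by finitely generated projective
`A^e`-modules. -/
def IsHomologicallySmooth : Prop :=
  ∃ P : ProjectiveResolution (bimod k A),
    (∀ i, Module.Finite (A ⊗[k] Aᵐᵒᵖ) (P.complex.X i)) ∧
      ∃ N, ∀ i, N < i → Limits.IsZero (P.complex.X i)

variable {A} in
/-- `Ext^i_{A^e}(A, A ⊗ A)` is zero for `i ≠ n`, and for `i = n` it is isomorphic, as a bimodule
by the inner structure of `A ⊗ A`, to `A_σ`, the space `A` with `a · x · c = a x σ(c)`. -/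
structure HasNakayamaAut (n : ℕ) (σ : A ≃ₐ[k] A) : Prop where
  ext_eq_zero : ∀ i, i ≠ n → Subsingleton (Ext (bimod k A) (outerBimod k A) i)
  ext_equiv : ∃ e : A ≃+ Ext (bimod k A) (outerBimod k A) n, ∀ a x c : A,
    e (a * x * σ c) = (e x).comp (Ext.mk₀ (innerAct k a c)) (add_zero n)
end Nakayama

section Regular
variable {k : Type u} [Field k] {V : Type v} [AddCommGroup V] [Module k V]
  {R : Submodule k (V ⊗[k] V)}

/-- The connected graded algebra `A = T(V) / (R)` is Artin-Schelter regular of dimension `n` with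
Nakayama automorphism `σ`, in the form: it is homologically smooth, and `σ` is an automorphism of
the graded algebra `A` such that `Ext^i_{A^e}(A, A ⊗ A)` is `A_σ` for `i = n` and `0` otherwise. -/
structure IsASRegular (n : ℕ) (σ : QuadAlg R ≃ₐ[k] QuadAlg R) : Prop where
  smooth : IsHomologicallySmooth k (QuadAlg R)
  graded : IsGradedAut σ
  nakayama : HasNakayamaAut k n σ

/-- `σ` is semisimple, that is, diagonalizable: `A` is spanned by eigenvectors of `σ`. -/
def IsSemisimpleAut (σ : QuadAlg R ≃ₐ[k] QuadAlg R) : Prop :=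
  ⨆ μ : k, Module.End.eigenspace (σ.toLinearMap : Module.End k (QuadAlg R)) μ = ⊤

variable (R) in
/-- The degree `n` part `A^¡ₙ` of `A^¡`. -/
def dualDeg (n : ℕ) : Submodule k (KoszulDual R) := (dualPiece R n).comap (incl R)

variable (R) in
/-- `c ↦ (-1)^{|c|} c` on `A^¡`. -/
def dualParity : KoszulDual R →ₗ[k] KoszulDual R :=
  dualMap (-LinearMap.id) (by
    have : TensorProduct.map (-LinearMap.id : V →ₗ[k] V) (-LinearMap.id : V →ₗ[k] V) =
        LinearMap.id := by ext; simp [TensorProduct.neg_tmul, TensorProduct.tmul_neg]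
    simp [this])

variable (R) in
/-- The map `κ : A^¡ → A^¡₁ = V = A₁ ⊆ A`. -/
def kappa : KoszulDual R →ₗ[k] QuadAlg R :=
  QuadAlg.ι R ∘ₗ TensorAlgebra.ιInv ∘ₗ incl R

variable (R) in
/-- The underlying space `A ⊗ A^¡` of the Koszul complexes. -/
abbrev KoszulChain : Type max u v := QuadAlg R ⊗[k] KoszulDual R

variable (R) in
/-- The space `A ⊗ A^¡ₙ`. -/
def koszulDeg (n : ℕ) : Submodule k (KoszulChain R) :=
  Submodule.span k {z | ∃ a : QuadAlg R, ∃ c ∈ dualDeg R n, z = a ⊗ₜ[k] c}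

/-- `a ⊗ c ↦ ∑ a f(c') ⊗ c''`, where `Δ c = ∑ c' ⊗ c''`. -/
def mulLeftFactor (f : KoszulDual R →ₗ[k] QuadAlg R) : KoszulChain R →ₗ[k] KoszulChain R :=
  LinearMap.rTensor _ (LinearMap.mul' k _ ∘ₗ LinearMap.lTensor _ f) ∘ₗ
    (TensorProduct.assoc k (QuadAlg R) (KoszulDual R) (KoszulDual R)).symm.toLinearMap ∘ₗ
    LinearMap.lTensor _ Coalgebra.comul

/-- `a ⊗ c ↦ ∑ f(c'') a ⊗ c'`, where `Δ c = ∑ c' ⊗ c''`. -/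
def mulRightFactor (f : KoszulDual R →ₗ[k] QuadAlg R) : KoszulChain R →ₗ[k] KoszulChain R :=
  (TensorProduct.comm k (KoszulDual R) (QuadAlg R)).toLinearMap ∘ₗ
    LinearMap.lTensor _ (LinearMap.mul' k _ ∘ₗ LinearMap.rTensor _ f) ∘ₗ
    (TensorProduct.assoc k (KoszulDual R) (KoszulDual R) (QuadAlg R)).toLinearMap ∘ₗ
    (TensorProduct.comm k (QuadAlg R) (KoszulDual R ⊗[k] KoszulDual R)).toLinearMap ∘ₗ
    LinearMap.lTensor _ Coalgebra.comul

variable (R) in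
/-- `A` is Koszul: the Koszul complex `⋯ → A ⊗ A^¡₂ → A ⊗ A^¡₁ → A → k → 0`, with differential
`a ⊗ v₁ ⋯ vₘ ↦ a v₁ ⊗ v₂ ⋯ vₘ`, is exact. (Exactness at `k` is clear.) -/
def IsKoszul : Prop :=
  (∀ z ∈ koszulDeg R 0,
    TensorProduct.map (QuadAlg.aug R).toLinearMap Coalgebra.counit z = (0 : k ⊗[k] k) →
      ∃ y ∈ koszulDeg R 1, mulLeftFactor (kappa R) y = z) ∧
  ∀ m, ∀ z ∈ koszulDeg R (m + 1), mulLeftFactor (kappa R) z = 0 →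
    ∃ y ∈ koszulDeg R (m + 2), mulLeftFactor (kappa R) y = z

/-- The differential of the twisted Koszul complex `K_•(A_σ)`, which has `Kₘ = A_σ ⊗ A^¡ₘ`:
`b (a ⊗ v₁ ⋯ vₘ) = a σ(v₁) ⊗ v₂ ⋯ vₘ + (-1)^m vₘ a ⊗ v₁ ⋯ vₘ₋₁`. -/
def koszulB (σ : QuadAlg R ≃ₐ[k] QuadAlg R) : KoszulChain R →ₗ[k] KoszulChain R :=
  mulLeftFactor (σ.toLinearMap ∘ₗ kappa R) +
    mulRightFactor (kappa R) ∘ₗ LinearMap.lTensor _ (dualParity R)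

/-! The Hochschild complex of the graded coalgebra `C = A^¡` with coefficients in the
cobimodule `_σ C`, which is `C` with left coaction `m ↦ ∑ σ(m') ⊗ m''` and right coaction
`m ↦ ∑ m' ⊗ m''`. -/

variable (R) in
/-- The kernel `C̄` of the counit. -/
abbrev DualAug : Submodule k (KoszulDual R) := LinearMap.ker (Coalgebra.counit (R := k))

variable (R) in
/-- The coaugmentation element `1 ∈ k = C₀`. -/
def dualOne : KoszulDual R := ⟨1, dualPiece_le 0 one_mem_dualPiece⟩

variable (R) in
/-- The projection `C → C̄`, `c ↦ c - ε(c) 1`. -/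
def toDualAug : KoszulDual R →ₗ[k] DualAug R :=
  LinearMap.codRestrict _
    (LinearMap.id - LinearMap.toSpanSingleton k _ (dualOne R) ∘ₗ Coalgebra.counit) (by
      have : Coalgebra.counit (R := k) (dualOne R) = 1 := map_one TensorAlgebra.algebraMapInv
      intro c
      simp [this])

/-- The restriction to `C̄` of a map `f : C → C` with `f(C̄) ⊆ C̄`. -/
def restrictAug (f : KoszulDual R →ₗ[k] KoszulDual R) : DualAug R →ₗ[k] DualAug R :=
  toDualAug R ∘ₗ f ∘ₗ (DualAug R).subtype

variable (R) in
/-- The cobar construction `Ω(C) = T(s⁻¹C̄)` as an algebra; `a₁ ⋯ aₙ` stands for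
`(s⁻¹a₁, …, s⁻¹aₙ)`, of degree `∑ (|aᵢ| - 1)`. -/
abbrev Cobar : Type max u v := TensorAlgebra k (DualAug R)

/-- `a₁ ⋯ aₙ ↦ f(a₁) ⋯ f(aₙ)` on `Ω(C)`, for a map `f : C → C` with `f(C̄) ⊆ C̄`. -/
def cobarMap (f : KoszulDual R →ₗ[k] KoszulDual R) : Cobar R →ₗ[k] Cobar R :=
  (tmap (k := k) (W := DualAug R) (W' := DualAug R) (restrictAug f)).toLinearMap

variable (R) in
/-- `ω ↦ (-1)^{|ω|} ω` on `Ω(C)`. -/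
def cobarParity : Cobar R →ₗ[k] Cobar R :=
  cobarMap (-dualParity R)

variable (R) in
/-- The map `C → Ω(C)` that sends `c` to the letter `c - ε(c) 1 ∈ C̄`. -/
def letter : KoszulDual R →ₗ[k] Cobar R := TensorAlgebra.ι k ∘ₗ toDualAug R

variable (R) in
/-- The differential of the cobar construction: `a₁ ⋯ aₙ ↦
∑ᵢ ∑ (-1)^{|a₁| + ⋯ + |aᵢ₋₁| + (i - 1) + |aᵢ'|} a₁ ⋯ aᵢ₋₁ aᵢ' aᵢ'' aᵢ₊₁ ⋯ aₙ`. -/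
def cobarD : Cobar R →ₗ[k] Cobar R :=
  LinearMap.mul' k _ ∘ₗ
    TensorProduct.map (cobarParity R)
      (LinearMap.mul' k _ ∘ₗ LinearMap.rTensor _ (LinearMap.mul' k _ ∘ₗ
        TensorProduct.map (letter R ∘ₗ dualParity R) (letter R) ∘ₗ
        Coalgebra.comul ∘ₗ (DualAug R).subtype)) ∘ₗ
    markLetter k (DualAug R)

variable (R) in
/-- The space `⨁ₙ C̄^{⊗ n} ⊗ C` of Hochschild chains of `C` with coefficients in a cobimodule with
underlying space `C`; the chain `(a₁, …, aₙ, m)` is `(a₁ ⋯ aₙ) ⊗ m`. -/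
abbrev CoHochChain : Type max u v := Cobar R ⊗[k] KoszulDual R

variable (R) in
/-- The chains of total degree `d`: the span of the chains `(a₁, …, aₙ, m)` with homogeneous
`aᵢ ∈ C̄` and `m ∈ C` such that `∑ (|aᵢ| - 1) + |m| = d`. -/
def coHochDeg (d : ℕ) : Submodule k (CoHochChain R) :=
  Submodule.span k {z | ∃ (l : List (ℕ × DualAug R)) (p : ℕ) (m : KoszulDual R),
    (∀ x ∈ l, (x.2 : KoszulDual R) ∈ dualDeg R (x.1 + 1)) ∧ m ∈ dualDeg R p ∧
    (l.map Prod.fst).sum + p = d ∧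
    z = (l.map fun x => TensorAlgebra.ι k x.2).prod ⊗ₜ[k] m}

variable (R) in
/-- `ω ⊗ m ↦ (dω) ⊗ m`. -/
def coHochInner : CoHochChain R →ₗ[k] CoHochChain R := LinearMap.rTensor _ (cobarD R)

/-- `ω ⊗ m ↦ ∑ (-1)^{|ω| + |m'|} ω σ(m') ⊗ m''`, from the left coaction of `_σ C`. -/
def coHochLeft (s : KoszulDual R →ₗ[k] KoszulDual R) : CoHochChain R →ₗ[k] CoHochChain R :=
  LinearMap.rTensor _ (LinearMap.mul' k _ ∘ₗ
      TensorProduct.map (cobarParity R) (letter R ∘ₗ s ∘ₗ dualParity R)) ∘ₗ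
    (TensorProduct.assoc k (Cobar R) (KoszulDual R) (KoszulDual R)).symm.toLinearMap ∘ₗ
    LinearMap.lTensor _ Coalgebra.comul

variable (R) in
/-- `ω ⊗ m ↦ -∑ (-1)^{|m''| (|ω| + |m'| + 1)} m'' ω ⊗ m'`, from the right coaction of `_σ C`. -/
def coHochRight : CoHochChain R →ₗ[k] CoHochChain R :=
  -(LinearMap.rTensor _ (LinearMap.mul' k _) ∘ₗ
    (TensorProduct.assoc k (Cobar R) (Cobar R) (KoszulDual R)).symm.toLinearMap ∘ₗ
    LinearMap.rTensor _ (letter R ∘ₗ dualParity R) ∘ₗ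
    koszulSign (dualParity R) (TensorProduct.map (cobarParity R) (dualParity R)) ∘ₗ
    (TensorProduct.comm k (Cobar R ⊗[k] KoszulDual R) (KoszulDual R)).toLinearMap ∘ₗ
    (TensorProduct.assoc k (Cobar R) (KoszulDual R) (KoszulDual R)).symm.toLinearMap ∘ₗ
    LinearMap.lTensor _ Coalgebra.comul)

/-- The boundary of the Hochschild complex of `C` with coefficients in `_σ C`, for `s` the action
of `σ` on `C`. -/
def coHochB (s : KoszulDual R →ₗ[k] KoszulDual R) : CoHochChain R →ₗ[k] CoHochChain R :=
  coHochInner R + coHochLeft s + coHochRight R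

/-- `T (a₁, …, aₙ, m) = (σ(a₁), …, σ(aₙ), σ(m))`. -/
def coHochT (s : KoszulDual R →ₗ[k] KoszulDual R) : CoHochChain R →ₗ[k] CoHochChain R :=
  TensorProduct.map (cobarMap s) s

/-- `a₁ ⋯ aₙ ↦ ∑_{i = 1}^{n} ± aᵢ₊₁ ⋯ aₙ σ(a₁) ⋯ σ(aᵢ₋₁) ⊗ aᵢ`, with the sign
`(-1)^{|v| |u|}` of the exchange of `u = a₁ ⋯ aᵢ` and `v = aᵢ₊₁ ⋯ aₙ` in `Ω(C)`. -/
def coRotate (s : KoszulDual R →ₗ[k] KoszulDual R) : Cobar R →ₗ[k] CoHochChain R :=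
  TensorProduct.map (LinearMap.mul' k _ ∘ₗ
      LinearMap.lTensor _ (cobarMap s)) (DualAug R).subtype ∘ₗ
    (TensorProduct.assoc k (Cobar R) (Cobar R) (DualAug R)).symm.toLinearMap ∘ₗ
    (TensorProduct.comm k (Cobar R ⊗[k] DualAug R) (Cobar R)).toLinearMap ∘ₗ
    LinearMap.rTensor _ (lastLetter k (DualAug R)) ∘ₗ
    koszulSign (cobarParity R) (cobarParity R) ∘ₗ deconc (k := k) (W := DualAug R)

/-- The operator `B (a₁, …, aₙ, m) =
(-1)^{|ω|} ε(m) ∑_{i = 1}^{n} ± (aᵢ₊₁, …, aₙ, σ(a₁), …, σ(aᵢ₋₁), aᵢ)` of degree `1`, with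
`ω = a₁ ⋯ aₙ` and the signs `±` as in `coRotate`. -/
def coHochConnes (s : KoszulDual R →ₗ[k] KoszulDual R) : CoHochChain R →ₗ[k] CoHochChain R :=
  coRotate s ∘ₗ cobarParity R ∘ₗ (TensorProduct.rid k (Cobar R)).toLinearMap ∘ₗ
    LinearMap.lTensor _ Coalgebra.counit

variable (R) in
/-- The map `K_•(A_σ) → CH_•(A; A_σ)`, `a ⊗ v₁ ⋯ vₘ ↦ (a, v₁, …, vₘ)`. -/
def koszulToHoch : KoszulChain R →ₗ[k] HochChain (QuadAlg.aug R) :=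
  LinearMap.lTensor _
    ((tmap (toAug (QuadAlg.aug R) ∘ₗ QuadAlg.ι R)).toLinearMap ∘ₗ incl R)

variable (R) in
/-- The map `CH_•(C; _σ C) → K_•(A_σ)`, `(a₁, …, aₙ, m) ↦ κ(a₁) ⋯ κ(aₙ) ⊗ m`. -/
def coHochToKoszul : CoHochChain R →ₗ[k] KoszulChain R :=
  LinearMap.rTensor _
    (TensorAlgebra.lift k (kappa R ∘ₗ (DualAug R).subtype)).toLinearMap

/-- Hochschild homology `HH_n(A; A_σ)`. -/
abbrev HH (σ : QuadAlg R ≃ₐ[k] QuadAlg R) (n : ℕ) : Type max u v :=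
  Homology (hochB (QuadAlg.aug R) σ) (hochDeg (QuadAlg.aug R)) n

/-- The homology `H_n(K_•(A_σ))` of the twisted Koszul complex. -/
abbrev HK (σ : QuadAlg R ≃ₐ[k] QuadAlg R) (n : ℕ) : Type max u v :=
  Homology (koszulB σ) (koszulDeg R) n

/-- The coalgebra Hochschild homology `HH_n(A^¡; _σ A^¡)`. -/
abbrev coHH (σ : QuadAlg R ≃ₐ[k] QuadAlg R) (hσ : IsGradedAut σ) (n : ℕ) : Type max u v :=
  Homology (coHochB (dualAut σ hσ)) (coHochDeg R) n
end Regular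
end
end KoszulHH

open KoszulHH

/-!
Write `C = A^¡`, `Ω(C)` for the cobar construction, and `T(Ā)` with the differential `barD` for the
bar construction of `A`; signs are omitted in this description.

**Gradings.** An `ℕ`-grading is encoded by an operator that is diagonalizable with eigenvalues
`2^n` (`IsGradedBy`), so that all statements about complexes can be proved for the total spaces and
total differentials. A map that is bijective on homology in this sense gives isomorphisms in every
degree (`exists_homology_equiv`). Besides the homological degree there is the weight, the internal
degree of `A` and `C`, which is needed for the following perturbation argument
(`exists_of_lowersWeight`): if `d = d₀ + h`, where `h` strictly lowers the weight of one tensor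
factor and `d₀` preserves it, then exactness for `d₀` implies exactness for `d`.

**The isomorphism `Φ`.** The inclusion of `C` into the bar construction is a quasi-isomorphism.
Indeed, `A ⊗ C → A ⊗ T(Ā)` is a map between two resolutions of `k`, the Koszul complex, exact by
assumption, and the one-sided bar complex, which has the contraction `oneBarS`. The statement for
`C → T(Ā)` follows from this by induction on the weight (`IsKoszul.mem_of_barD_mem_weight`), since
the part of the differential that multiplies a letter into `A` lowers the weight of the second
factor. In the twisted complexes too the remaining parts of the differential lower this weight, and
the perturbation argument shows that the injective map `K_•(A_σ) → CH_•(A; A_σ)` has an acyclic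
cokernel (`IsKoszul.exists_of_hochB_mem`).

**The isomorphism `Ψ`.** Dually, `Ω(C) ⊗ C` with the differential from the left coaction is
contractible onto `k` (`coHochOneSided_contraction`) and maps onto the Koszul complex. Hence the
kernel of `Ω(C) → A` is acyclic, again by induction on the weight
(`IsKoszul.mem_of_cobarD_eq_zero_weight`), and the kernel of the surjection
`CH_•(C; _σ C) → K_•(A_σ)` is acyclic by perturbation (`IsKoszul.exists_of_coHochB_eq_zero`).

**Connes operators.** On the Hochschild chains of `A` and of `C`, one has `b B + B b = T - 1` and
`b B + B b = 1 - T` (`hochB_hochConnes`, `coHochB_coHochConnes`). As `σ` is diagonalizable, so is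
`T`. A cycle `z` with `T z = μ z` and `μ ≠ 1` is then a multiple of `b B z`, so every class has a
`T`-fixed representative, and on `T`-fixed chains `B` anticommutes with `b`; thus `B ∘ π`, with the
projection `π` onto the `T`-fixed chains, induces the Connes operator (`exists_connesOperator`).
The identity for `C` is deduced from the bimodule complex `Ω(C) ⊗ C ⊗ Ω(C)`, on which the derivation
`ω ↦ ∑ u ⊗ a ⊗ v`, the sum over `ω = u a v` with a letter `a`, is a homotopy between `1 ⊗ 1 ⊗ ω`
and `ω ⊗ 1 ⊗ 1` (`bimodD_markD`). Cyclic rotation maps this complex to `CH_•(C; _σ C)`, and `B` is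
the rotation of the derivation.

**Compatibility.** Let `f : CH_•(C; _σ C) → CH_•(A; A_σ)` be the composite of the two comparison
maps, and `κ : Ω(C) → A` the map of algebras that extends the projection `C → V`. The operators
`f B` and `B f` do not agree on chains, but they are homotopic by the operator
`ω ⊗ m ↦ ∑ ± (κ(v), m, κ(u), a)`, the sum over `ω = u a v` with a letter `a`, where `m` and `a` are
read as words in `V ⊆ Ā` (`connesHomotopy_homotopy`). It is obtained from the same derivation, by
means of the map `u ⊗ c ⊗ v ↦ (κ(v), m, κ(u), c)`, whose boundary is computed in
`hochB_cyclicChain`. Hence the two composites agree on homology (`connesOperator_comm`).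
-/

namespace KoszulHH
noncomputable section
universe u v w x

/-! ### Shortcuts for the synthesis of instances -/

section Instances
variable {k : Type u} [Field k]

instance {M : Type v} {N : Type w} [AddCommMonoid M] [AddCommMonoid N] [Module k M] [Module k N] :
    AddMonoidHomClass (M →ₗ[k] N) M N := inferInstance

instance {M : Type v} {N : Type w} [AddCommMonoid M] [AddCommMonoid N] [Module k M] [Module k N] :
    ZeroHomClass (M →ₗ[k] N) M N := inferInstance

instance {M : Type v} {N : Type w} [AddCommMonoid M] [AddCommMonoid N] [Module k M] [Module k N] :
    AddHomClass (M →ₗ[k] N) M N := inferInstance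

instance {M : Type v} {N : Type w} [AddCommMonoid M] [AddCommMonoid N] [Module k M] [Module k N] :
    MulActionHomClass (M →ₗ[k] N) k M N := inferInstance

instance {M : Type v} {N : Type w} [AddCommMonoid M] [AddCommMonoid N] [Module k M] [Module k N] :
    AddMonoidHomClass (M ≃ₗ[k] N) M N := inferInstance

instance {M : Type v} {N : Type w} [AddCommMonoid M] [AddCommMonoid N] [Module k M] [Module k N] :
    ZeroHomClass (M ≃ₗ[k] N) M N := inferInstance

instance {M : Type v} {N : Type w} [AddCommMonoid M] [AddCommMonoid N] [Module k M] [Module k N] :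
    AddHomClass (M ≃ₗ[k] N) M N := inferInstance

instance {M : Type v} {N : Type w} [AddCommMonoid M] [AddCommMonoid N] [Module k M] [Module k N] :
    MulActionHomClass (M ≃ₗ[k] N) k M N := inferInstance

instance {W : Type v} [AddCommGroup W] [Module k W] : AddCommGroup (TensorAlgebra k W) :=
  inferInstance

instance {W : Type v} [AddCommGroup W] [Module k W] : Algebra k (TensorAlgebra k W) :=
  inferInstance

instance {W : Type v} [AddCommGroup W] [Module k W] : Module k (TensorAlgebra k W) :=
  inferInstance

end Instances

/-! ### Diagonalizable operators and the gradings that they encode -/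

section Diagonalizable
variable {k : Type u} [Field k] {X : Type v} [AddCommGroup X] [Module k X]
  {Y : Type w} [AddCommGroup Y] [Module k Y]

/-- `f` is diagonalizable with all eigenvalues in `S`: the space is spanned by eigenvectors of `f`
with eigenvalues in `S`. -/
def IsDiagIn (S : Set k) (f : X →ₗ[k] X) : Prop :=
  Submodule.span k {x | ∃ μ ∈ S, f x = μ • x} = ⊤

lemma IsDiagIn.induction {S : Set k} {f : X →ₗ[k] X} (h : IsDiagIn S f) {P : X → Prop}
    (h0 : P 0) (hadd : ∀ x y, P x → P y → P (x + y))
    (heig : ∀ μ ∈ S, ∀ x, f x = μ • x → P x) (x : X) : P x := by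
  have hx : x ∈ Submodule.span k {x | ∃ μ ∈ S, f x = μ • x} := by rw [h]; trivial
  have := Submodule.closure_induction (p := fun x _ => P x) h0
    (fun x y _ _ => hadd x y) (fun r x hx => ?_) hx
  · exact this
  · obtain ⟨μ, hμ, hf⟩ := hx
    exact heig μ hμ _ (by rw [map_smul, hf, smul_comm])

lemma IsDiagIn.mono {S S' : Set k} {f : X →ₗ[k] X} (h : IsDiagIn S f) (hS : S ⊆ S') :
    IsDiagIn S' f := by
  rw [IsDiagIn, eq_top_iff] at h ⊢
  refine h.trans (Submodule.span_mono ?_)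
  rintro x ⟨μ, hμ, hx⟩
  exact ⟨μ, hS hμ, hx⟩

lemma isDiagIn_of_iSup {f : X →ₗ[k] X}
    (h : ⨆ μ : k, Module.End.eigenspace (f : Module.End k X) μ = ⊤) :
    IsDiagIn Set.univ f := by
  rw [IsDiagIn, eq_top_iff, ← h, iSup_le_iff]
  intro μ x hx
  exact Submodule.subset_span ⟨μ, trivial, Module.End.mem_eigenspace_iff.1 hx⟩

lemma IsDiagIn.iSup {S : Set k} {f : X →ₗ[k] X} (h : IsDiagIn S f) :
    ⨆ μ : k, Module.End.eigenspace (f : Module.End k X) μ = ⊤ := by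
  rw [IsDiagIn] at h
  rw [eq_top_iff, ← h, Submodule.span_le]
  rintro x ⟨μ, -, hx⟩
  exact Submodule.mem_iSup_of_mem μ (Module.End.mem_eigenspace_iff.2 hx)

lemma IsDiagIn.isCompl {S : Set k} {f : X →ₗ[k] X} (h : IsDiagIn S f) (μ : k) :
    IsCompl (Module.End.eigenspace (f : Module.End k X) μ)
      (⨆ ν ∈ {ν : k | ν ≠ μ}, Module.End.eigenspace (f : Module.End k X) ν) := by
  constructor
  · exact (Module.End.eigenspaces_iSupIndep (f : Module.End k X)).disjoint_biSup (by simp)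
  · rw [codisjoint_iff, eq_top_iff, ← h.iSup, iSup_le_iff]
    intro ν
    by_cases hν : ν = μ
    · subst hν; exact le_sup_left
    · exact le_sup_of_le_right (le_biSup (Module.End.eigenspace (f : Module.End k X)) hν)

open Classical in
/-- The projection onto the eigenspace of `f` for `μ` along the other eigenspaces; it is `0` if
the eigenvectors of `f` do not span. -/
def eproj (f : X →ₗ[k] X) (μ : k) : X →ₗ[k] X :=
  if h : IsDiagIn Set.univ f then Submodule.projection _ _ (h.isCompl μ) else 0

lemma IsDiagIn.univ {S : Set k} {f : X →ₗ[k] X} (h : IsDiagIn S f) : IsDiagIn Set.univ f :=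
  h.mono (Set.subset_univ S)

lemma eproj_same {S : Set k} {f : X →ₗ[k] X} (h : IsDiagIn S f) {μ : k} {x : X}
    (hx : f x = μ • x) : eproj f μ x = x := by
  rw [eproj, dif_pos h.univ]
  exact Submodule.projection_apply_left (h.univ.isCompl μ)
    ⟨x, Module.End.mem_eigenspace_iff.2 hx⟩

lemma eproj_ne {f : X →ₗ[k] X} {μ ν : k} {x : X} (hx : f x = ν • x) (hν : ν ≠ μ) :
    eproj f μ x = 0 := by
  rw [eproj]
  split_ifs with h
  · refine (Submodule.projection_apply_eq_zero_iff (h.isCompl μ)).2 ?_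
    exact le_biSup (Module.End.eigenspace (f : Module.End k X)) (show ν ∈ {ν | ν ≠ μ} from hν)
      (Module.End.mem_eigenspace_iff.2 hx)
  · rfl

lemma map_eproj {S : Set k} {f : X →ₗ[k] X} (h : IsDiagIn S f) (μ : k) (x : X) :
    f (eproj f μ x) = μ • eproj f μ x := by
  induction x using h.induction with
  | h0 => simp
  | hadd x y hx hy => simp only [map_add, hx, hy, smul_add]
  | heig ν _ x hx =>
    by_cases hν : ν = μ
    · subst hν; rw [eproj_same h hx, hx]
    · rw [eproj_ne hx hν]; simp

/-- A map that multiplies eigenvalues by `c` commutes with the projections to the eigenspaces. -/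
lemma eproj_comm_smul {S S' : Set k} {f : X →ₗ[k] X} {f' : Y →ₗ[k] Y} (h : IsDiagIn S f)
    (h' : IsDiagIn S' f') (g : X →ₗ[k] Y) {c : k} (hc : c ≠ 0)
    (hg : ∀ x, f' (g x) = c • g (f x)) (μ : k) (x : X) :
    g (eproj f μ x) = eproj f' (c * μ) (g x) := by
  induction x using h.induction with
  | h0 => simp
  | hadd x y hx hy => simp only [map_add, hx, hy]
  | heig ν _ x hx =>
    have h2 : f' (g x) = (c * ν) • g x := by rw [hg, hx, map_smul, smul_smul]
    by_cases hν : ν = μ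
    · subst hν; rw [eproj_same h hx, eproj_same h' h2]
    · rw [eproj_ne hx hν, eproj_ne h2 (by simpa [hc] using hν), map_zero]

lemma eproj_comm {S S' : Set k} {f : X →ₗ[k] X} {f' : Y →ₗ[k] Y} (h : IsDiagIn S f)
    (h' : IsDiagIn S' f') (g : X →ₗ[k] Y) (hg : ∀ x, f' (g x) = g (f x)) (μ : k) (x : X) :
    g (eproj f μ x) = eproj f' μ (g x) := by
  simpa using eproj_comm_smul h h' g one_ne_zero (by simpa using hg) μ x

/-- Diagonalizability is inherited by quotients. -/
lemma IsDiagIn.of_surjective {S : Set k} {f : X →ₗ[k] X} {f' : Y →ₗ[k] Y} (h : IsDiagIn S f)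
    (g : X →ₗ[k] Y) (hg : ∀ x, f' (g x) = g (f x)) (hs : Function.Surjective g) :
    IsDiagIn S f' := by
  rw [IsDiagIn, eq_top_iff]
  rintro y -
  obtain ⟨x, rfl⟩ := hs y
  induction x using h.induction with
  | h0 => simp
  | hadd x y hx hy => rw [map_add]; exact Submodule.add_mem _ hx hy
  | heig μ hμ x hx => exact Submodule.subset_span ⟨μ, hμ, by rw [hg, hx, map_smul]⟩

/-- Components of elements of a stable subspace are in the subspace. -/
lemma eproj_mem {S : Set k} {f : X →ₗ[k] X} (h : IsDiagIn S f) {K : Submodule k X}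
    (hK : ∀ x ∈ K, f x ∈ K) (μ : k) {x : X} (hx : x ∈ K) : eproj f μ x ∈ K := by
  have hK' : K ≤ K.comap f := hK
  have hc : ∀ x, K.mapQ K f hK' (K.mkQ x) = K.mkQ (f x) := fun x => rfl
  have := eproj_comm h (h.of_surjective K.mkQ hc K.mkQ_surjective) K.mkQ hc μ x
  rw [(Submodule.Quotient.mk_eq_zero K).2 hx |> fun h => (show K.mkQ x = 0 from h), map_zero]
    at this
  exact (Submodule.Quotient.mk_eq_zero K).1 this

/-- Every vector is the sum of finitely many of its components. -/
lemma IsDiagIn.exists_sum {S : Set k} {f : X →ₗ[k] X} (h : IsDiagIn S f) (x : X) :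
    ∃ s : Finset k, (↑s ⊆ S) ∧ x = ∑ μ ∈ s, eproj f μ x := by
  classical
  suffices H : ∃ s : Finset k, (↑s ⊆ S) ∧ ∀ t : Finset k, s ⊆ t → x = ∑ μ ∈ t, eproj f μ x by
    obtain ⟨s, hs, h⟩ := H
    exact ⟨s, hs, h s subset_rfl⟩
  induction x using h.induction with
  | h0 => exact ⟨∅, by simp⟩
  | hadd x y hx hy =>
    obtain ⟨s, hs, hx⟩ := hx
    obtain ⟨s', hs', hy⟩ := hy
    refine ⟨s ∪ s', by simp [hs, hs'], fun t ht => ?_⟩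
    simp only [map_add, Finset.sum_add_distrib]
    rw [← hx t (Finset.union_subset_left ht), ← hy t (Finset.union_subset_right ht)]
  | heig μ hμ x hx =>
    refine ⟨{μ}, by simpa using hμ, fun t ht => ?_⟩
    rw [Finset.sum_eq_single_of_mem μ (ht (by simp)) fun ν _ hν => eproj_ne hx hν.symm,
      eproj_same h hx]

/-- Diagonalizability is inherited by stable subspaces. -/
lemma IsDiagIn.of_injective {S : Set k} {f : X →ₗ[k] X} {f' : Y →ₗ[k] Y} (h' : IsDiagIn S f')
    (g : X →ₗ[k] Y) (hg : ∀ x, f' (g x) = g (f x)) (hi : Function.Injective g) :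
    IsDiagIn S f := by
  rw [IsDiagIn, eq_top_iff]
  rintro x -
  obtain ⟨s, hs, hx⟩ := h'.exists_sum (g x)
  have : ∀ μ, ∃ z, g z = eproj f' μ (g x) := fun μ =>
    eproj_mem h' (K := LinearMap.range g) (by rintro _ ⟨z, rfl⟩; exact ⟨f z, (hg z).symm⟩) μ
      ⟨x, rfl⟩
  choose z hz using this
  have hx' : x = ∑ μ ∈ s, z μ := hi (by rw [map_sum, hx]; simp only [hz])
  rw [hx']
  refine Submodule.sum_mem _ fun μ hμ => Submodule.subset_span ⟨μ, hs hμ, hi ?_⟩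
  rw [← hg, map_smul, hz, map_eproj h']

lemma IsDiagIn.tensor {S S' S'' : Set k} {f : X →ₗ[k] X} {f' : Y →ₗ[k] Y} (h : IsDiagIn S f)
    (h' : IsDiagIn S' f') (hS : ∀ a ∈ S, ∀ b ∈ S', a * b ∈ S'') :
    IsDiagIn S'' (TensorProduct.map f f') := by
  rw [IsDiagIn, eq_top_iff]
  rintro z -
  induction z using TensorProduct.induction_on with
  | zero => simp
  | add x y hx hy => exact Submodule.add_mem _ hx hy
  | tmul x y =>
    induction x using h.induction with
    | h0 => simp
    | hadd a b ha hb => rw [TensorProduct.add_tmul]; exact Submodule.add_mem _ ha hb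
    | heig μ hμ x hx =>
      induction y using h'.induction with
      | h0 => simp
      | hadd a b ha hb => rw [TensorProduct.tmul_add]; exact Submodule.add_mem _ ha hb
      | heig ν hν y hy =>
        refine Submodule.subset_span ⟨μ * ν, hS μ hμ ν hν, ?_⟩
        rw [TensorProduct.map_tmul, hx, hy, TensorProduct.smul_tmul_smul]

lemma isDiagIn_id : IsDiagIn ({1} : Set k) (LinearMap.id : X →ₗ[k] X) := by
  rw [IsDiagIn, eq_top_iff]
  rintro x -
  exact Submodule.subset_span ⟨1, rfl, by simp⟩

@[simp] lemma tmap_ι {W : Type v} [AddCommGroup W] [Module k W] {W' : Type w} [AddCommGroup W']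
    [Module k W'] (f : W →ₗ[k] W') (a : W) :
    tmap f (TensorAlgebra.ι k a) = TensorAlgebra.ι k (f a) := by
  simp [tmap]

/-- The eigenvalues of `f` on words are products of eigenvalues on letters, so they stay in a
multiplicative monoid. -/
lemma IsDiagIn.tmap {S : Set k} {S' : Submonoid k} {f : X →ₗ[k] X} (h : IsDiagIn S f)
    (hS : S ⊆ S') : IsDiagIn (S' : Set k) (KoszulHH.tmap f).toLinearMap := by
  rw [IsDiagIn, eq_top_iff]
  rintro x -
  induction x using words_induction with
  | h1 => exact Submodule.subset_span ⟨1, S'.one_mem, by simp⟩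
  | hsmul r x hx => exact Submodule.smul_mem _ _ hx
  | hadd x y hx hy => exact Submodule.add_mem _ hx hy
  | hι a x hx =>
    induction hx using Submodule.span_induction with
    | zero => simp
    | add x y _ _ hx hy => rw [mul_add]; exact Submodule.add_mem _ hx hy
    | smul c x _ hx => rw [mul_smul_comm]; exact Submodule.smul_mem _ _ hx
    | mem x hx =>
      obtain ⟨μ, hμ, hx⟩ := hx
      induction a using h.induction with
      | h0 => simp
      | hadd a b ha hb => rw [map_add, add_mul]; exact Submodule.add_mem _ ha hb
      | heig ν hν a ha =>
        refine Submodule.subset_span ⟨ν * μ, S'.mul_mem (hS hν) hμ, ?_⟩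
        rw [AlgHom.toLinearMap_apply] at hx ⊢
        rw [map_mul, hx, tmap_ι, ha, map_smul, smul_mul_smul_comm]

end Diagonalizable

section Weights
variable {k : Type u} [Field k] {X : Type v} [AddCommGroup X] [Module k X]
  {Y : Type w} [AddCommGroup Y] [Module k Y]

variable (k) in
/-- The powers of `2`. An operator that is diagonalizable with eigenvalues `2^n` encodes an
`ℕ`-grading, with the eigenspace of `2^n` as the part of degree `n`. -/
def pow2 : Submonoid k := Submonoid.powers 2

variable (k) in
/-- The eigenvalues `2^n` with `n ≥ 1`, which correspond to the positive degrees. -/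
def pow2pos : Set k := {μ | ∃ n : ℕ, μ = 2 ^ (n + 1)}

lemma mem_pow2 {μ : k} : μ ∈ pow2 k ↔ ∃ n : ℕ, μ = 2 ^ n := by
  simp [pow2, Submonoid.mem_powers_iff, eq_comm]

lemma pow2pos_subset : pow2pos k ⊆ (pow2 k : Set k) := by
  rintro _ ⟨n, rfl⟩
  exact mem_pow2.2 ⟨_, rfl⟩

lemma two_pow_inj [CharZero k] {m n : ℕ} : (2 : k) ^ m = 2 ^ n ↔ m = n := by
  constructor
  · intro h
    have : ((2 ^ m : ℕ) : k) = ((2 ^ n : ℕ) : k) := by push_cast; exact h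
    exact Nat.pow_right_injective le_rfl (Nat.cast_injective this)
  · rintro rfl; rfl

/-- The part of degree `< p` of the grading given by the operator `g`. -/
def degLT (g : Y →ₗ[k] Y) (p : ℕ) : Submodule k Y :=
  Submodule.span k {y | ∃ q < p, g y = (2 : k) ^ q • y}

lemma mem_degLT {g : Y →ₗ[k] Y} {p q : ℕ} (h : q < p) {y : Y} (hy : g y = (2 : k) ^ q • y) :
    y ∈ degLT g p := Submodule.subset_span ⟨q, h, hy⟩

lemma degLT_zero (g : Y →ₗ[k] Y) : degLT g 0 = ⊥ := by
  simp [degLT]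

lemma degLT_mono {g : Y →ₗ[k] Y} {p q : ℕ} (h : p ≤ q) : degLT g p ≤ degLT g q := by
  refine Submodule.span_mono ?_
  rintro y ⟨r, hr, hy⟩
  exact ⟨r, hr.trans_le h, hy⟩

lemma exists_mem_degLT {g : Y →ₗ[k] Y} (h : IsDiagIn (pow2 k : Set k) g) (y : Y) :
    ∃ p, y ∈ degLT g p := by
  induction y using h.induction with
  | h0 => exact ⟨0, Submodule.zero_mem _⟩
  | hadd x y hx hy =>
    obtain ⟨p, hp⟩ := hx
    obtain ⟨q, hq⟩ := hy
    exact ⟨max p q, Submodule.add_mem _ (degLT_mono (le_max_left _ _) hp)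
      (degLT_mono (le_max_right _ _) hq)⟩
  | heig μ hμ y hy =>
    obtain ⟨n, rfl⟩ := mem_pow2.1 hμ
    exact ⟨n + 1, mem_degLT (Nat.lt_succ_self n) hy⟩

lemma sub_eproj_mem_degLT {g : Y →ₗ[k] Y} (h : IsDiagIn (pow2 k : Set k) g) {p : ℕ} {y : Y}
    [CharZero k] (hy : y ∈ degLT g (p + 1)) : y - eproj g (2 ^ p) y ∈ degLT g p := by
  induction hy using Submodule.span_induction with
  | zero => simp
  | add x y _ _ hx hy => rw [map_add, add_sub_add_comm]; exact Submodule.add_mem _ hx hy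
  | smul c x _ hx => rw [map_smul, ← smul_sub]; exact Submodule.smul_mem _ _ hx
  | mem x hx =>
    obtain ⟨q, hq, hx⟩ := hx
    by_cases hqp : q = p
    · subst hqp; rw [eproj_same h hx, sub_self]; exact Submodule.zero_mem _
    · rw [eproj_ne hx (by rwa [Ne, two_pow_inj]), sub_zero]
      exact mem_degLT (by omega) hx

lemma eproj_degLT {g : Y →ₗ[k] Y} {p q : ℕ} {y : Y}
    [CharZero k] (hy : y ∈ degLT g p) (hpq : p ≤ q) : eproj g (2 ^ q) y = 0 := by
  induction hy using Submodule.span_induction with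
  | zero => simp
  | add x y _ _ hx hy => rw [map_add, hx, hy, add_zero]
  | smul c x _ hx => rw [map_smul, hx, smul_zero]
  | mem x hx =>
    obtain ⟨r, hr, hx⟩ := hx
    exact eproj_ne hx (by rw [Ne, two_pow_inj]; omega)

/-- If the left factor has positive degrees only, then in a tensor of total degree `p` the right
factor has degrees `< p`. -/
lemma mem_range_lTensor_degLT [CharZero k] {f : X →ₗ[k] X} {g : Y →ₗ[k] Y}
    (hf : IsDiagIn (pow2pos k) f) (hg : IsDiagIn (pow2 k : Set k) g) {p : ℕ} {z : X ⊗[k] Y}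
    (hz : TensorProduct.map f g z = (2 : k) ^ p • z) :
    z ∈ LinearMap.range (LinearMap.lTensor X (degLT g p).subtype) := by
  have hfg : IsDiagIn (pow2 k : Set k) (TensorProduct.map f g) :=
    hf.tensor hg fun a ha b hb => (pow2 k).mul_mem (pow2pos_subset ha) hb
  rw [← eproj_same hfg hz]
  clear hz
  induction z using TensorProduct.induction_on with
  | zero => simp
  | add x y hx hy => rw [map_add]; exact Submodule.add_mem _ hx hy
  | tmul x y =>
    induction x using hf.induction with
    | h0 => simp
    | hadd a b ha hb => rw [TensorProduct.add_tmul, map_add]; exact Submodule.add_mem _ ha hb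
    | heig μ hμ x hx =>
      induction y using hg.induction with
      | h0 => simp
      | hadd a b ha hb => rw [TensorProduct.tmul_add, map_add]; exact Submodule.add_mem _ ha hb
      | heig ν hν y hy =>
        obtain ⟨m, rfl⟩ := hμ
        obtain ⟨q, rfl⟩ := mem_pow2.1 hν
        have hxy : TensorProduct.map f g (x ⊗ₜ y) = (2 : k) ^ (m + 1 + q) • x ⊗ₜ[k] y := by
          rw [TensorProduct.map_tmul, hx, hy, TensorProduct.smul_tmul_smul,
            pow_add _ (m + 1) q]
        by_cases hp : m + 1 + q = p
        · subst hp
          rw [eproj_same hfg hxy]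
          exact ⟨x ⊗ₜ ⟨y, mem_degLT (by omega) hy⟩, by simp⟩
        · rw [eproj_ne hxy (by rwa [Ne, two_pow_inj])]
          exact Submodule.zero_mem _

end Weights

/-! ### Homology and gradings -/

section HomologyTools
variable {k : Type u} [Field k] {X : Type v} [AddCommGroup X] [Module k X]
  {Y : Type w} [AddCommGroup Y] [Module k Y]

/-- The operator `N` is diagonalizable, and `G n` is its eigenspace for `2^n`. -/
structure IsGradedBy (N : X →ₗ[k] X) (G : ℕ → Submodule k X) : Prop where
  diag : IsDiagIn (pow2 k : Set k) N
  mem_iff : ∀ n x, x ∈ G n ↔ N x = (2 : k) ^ n • x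

lemma isGradedBy_of_le [CharZero k] {N : X →ₗ[k] X} {G : ℕ → Submodule k X}
    (hle : ∀ n, ∀ x ∈ G n, N x = (2 : k) ^ n • x) (htop : ∀ x, x ∈ ⨆ n, G n) :
    IsGradedBy N G := by
  have hd : IsDiagIn (pow2 k : Set k) N := by
    rw [IsDiagIn, eq_top_iff]
    rintro x -
    refine (iSup_le fun n y hy => ?_ : ⨆ n, G n ≤ _) (htop x)
    exact Submodule.subset_span ⟨2 ^ n, mem_pow2.2 ⟨n, rfl⟩, hle n y hy⟩
  refine ⟨hd, fun n x => ⟨hle n x, fun hx => ?_⟩⟩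
  rw [← eproj_same hd hx]
  refine (iSup_le fun m y hy => ?_ : ⨆ n, G n ≤ (G n).comap (eproj N (2 ^ n))) (htop x)
  rw [Submodule.mem_comap]
  by_cases h : m = n
  · subst h; rwa [eproj_same hd (hle m y hy)]
  · rw [eproj_ne (hle m y hy) (by rwa [Ne, two_pow_inj])]
    exact Submodule.zero_mem _

namespace IsGradedBy
variable {N : X →ₗ[k] X} {G : ℕ → Submodule k X}

/-- For a differential `d` of degree `-1`, a boundary of degree `n` is the boundary of a chain of
degree `n + 1`. -/
lemma exists_of_eq [CharZero k] (hG : IsGradedBy N G) {d : X →ₗ[k] X}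
    (hd : ∀ x, N (d x) = (2 : k)⁻¹ • d (N x)) {n : ℕ} {y : X} (hy : d y ∈ G n) :
    ∃ z ∈ G (n + 1), d z = d y := by
  refine ⟨eproj N (2 ^ (n + 1)) y, (hG.mem_iff _ _).2 (map_eproj hG.diag _ _), ?_⟩
  rw [eproj_comm_smul hG.diag hG.diag d (inv_ne_zero two_ne_zero) hd, pow_succ',
    inv_mul_cancel_left₀ two_ne_zero, eproj_same hG.diag ((hG.mem_iff _ _).1 hy)]

lemma eproj_mem_of_comm (hG : IsGradedBy N G) {S : Set k} {T : X →ₗ[k] X} (hT : IsDiagIn S T)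
    (hTN : ∀ x, N (T x) = T (N x)) (μ : k) {n : ℕ} {x : X} (hx : x ∈ G n) :
    eproj T μ x ∈ G n := by
  refine eproj_mem hT (fun y hy => ?_) μ hx
  rw [hG.mem_iff] at hy ⊢
  rw [hTN, hy, map_smul]

end IsGradedBy

/-- A map of complexes, up to a scalar in the compatibility with the differentials, that is
bijective on homology in the ungraded sense induces isomorphisms in each degree. -/
theorem exists_homology_equiv [CharZero k] {d N : X →ₗ[k] X} {G : ℕ → Submodule k X}
    {d' N' : Y →ₗ[k] Y} {G' : ℕ → Submodule k Y} (hG : IsGradedBy N G) (hG' : IsGradedBy N' G')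
    (hd : ∀ x, N (d x) = (2 : k)⁻¹ • d (N x)) (hd' : ∀ x, N' (d' x) = (2 : k)⁻¹ • d' (N' x))
    (f : X →ₗ[k] Y) (hf : ∀ x, N' (f x) = f (N x)) {c : k} (hc : c ≠ 0)
    (hfd : ∀ x, d' (f x) = c • f (d x))
    (hinj : ∀ x y, d x = 0 → d' y = f x → ∃ w, d w = x)
    (hsurj : ∀ y, d' y = 0 → ∃ x w, d x = 0 ∧ y = f x + d' w) :
    ∃ Φ : ∀ n, Homology d G n ≃ₗ[k] Homology d' G' n, IsInducedBy f Φ := by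
  have hfG : ∀ n, ∀ x ∈ G n, f x ∈ G' n := fun n x hx => by
    rw [hG.mem_iff] at hx
    rw [hG'.mem_iff, hf, hx, map_smul]
  have hcyc : ∀ n, ∀ x ∈ cycles d G n, f x ∈ cycles d' G' n := fun n x hx =>
    ⟨hfG n x hx.1, by
      change d' (f x) = 0
      rw [hfd, LinearMap.mem_ker.1 hx.2]; simp⟩
  have hbd : ∀ n, ((G (n + 1)).map d).submoduleOf (cycles d G n) ≤
      (((G' (n + 1)).map d').submoduleOf (cycles d' G' n)).comap (f.restrict (hcyc n)) := by
    rintro n ⟨x, hx⟩ ⟨y, hy, hyx⟩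
    refine ⟨c⁻¹ • f y, Submodule.smul_mem _ _ (hfG _ y hy), ?_⟩
    have hyx' : d y = x := hyx
    rw [map_smul, hfd, smul_smul, inv_mul_cancel₀ hc, one_smul, hyx']
    rfl
  let F : ∀ n, Homology d G n →ₗ[k] Homology d' G' n := fun n =>
    Submodule.mapQ _ _ (f.restrict (hcyc n)) (hbd n)
  have hF : ∀ n, Function.Bijective (F n) := by
    intro n
    constructor
    · rw [← LinearMap.ker_eq_bot, LinearMap.ker_eq_bot']
      intro q hq
      obtain ⟨⟨x, hx⟩, rfl⟩ := Submodule.mkQ_surjective _ q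
      obtain ⟨y, -, hy⟩ := (Submodule.Quotient.mk_eq_zero _).1 hq
      obtain ⟨w, hw⟩ := hinj x y (LinearMap.mem_ker.1 hx.2) hy
      obtain ⟨z, hz, hzw⟩ := hG.exists_of_eq hd (y := w) (by rw [hw]; exact hx.1)
      exact (Submodule.Quotient.mk_eq_zero _).2 ⟨z, hz, hzw.trans hw⟩
    · intro q
      obtain ⟨⟨y, hy⟩, rfl⟩ := Submodule.mkQ_surjective _ q
      obtain ⟨x, w, hx, hxw⟩ := hsurj y (LinearMap.mem_ker.1 hy.2)
      have hNx := map_eproj hG.diag (2 ^ n) x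
      have hdx : d (eproj N (2 ^ n) x) = 0 := by
        rw [eproj_comm_smul hG.diag hG.diag d (inv_ne_zero two_ne_zero) hd, hx, map_zero]
      have hx' : eproj N (2 ^ n) x ∈ cycles d G n := ⟨(hG.mem_iff _ _).2 hNx, hdx⟩
      refine ⟨homologyClass ⟨_, hx'⟩, ?_⟩
      refine (Submodule.Quotient.eq _).2 ?_
      refine ⟨-eproj N' (2 ^ (n + 1)) w, ?_, ?_⟩
      · exact Submodule.neg_mem _ ((hG'.mem_iff _ _).2 (map_eproj hG'.diag _ _))
      · have h2 := congrArg (eproj N' (2 ^ n)) hxw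
        rw [eproj_same hG'.diag ((hG'.mem_iff _ _).1 hy.1), map_add,
          ← eproj_comm hG.diag hG'.diag f hf] at h2
        rw [map_neg, eproj_comm_smul hG'.diag hG'.diag d' (inv_ne_zero two_ne_zero) hd', pow_succ',
          inv_mul_cancel_left₀ two_ne_zero]
        change _ = f (eproj N (2 ^ n) x) - y
        rw [h2]; abel
  exact ⟨fun n => LinearEquiv.ofBijective (F n) (hF n), fun n z hz => ⟨hcyc n z hz, rfl⟩⟩

/-- If `dB + Bd = c (T - 1)` with `T` diagonalizable, then `T` acts as the identity on homology,
and `B` induces a Connes operator. -/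
theorem exists_connesOperator {d N T B : X →ₗ[k] X} {G : ℕ → Submodule k X}
    (hG : IsGradedBy N G)
    (hT : IsDiagIn Set.univ T) (hTN : ∀ x, N (T x) = T (N x)) (hTd : ∀ x, T (d x) = d (T x))
    (hBN : ∀ x, N (B x) = (2 : k) • B (N x)) {c : k} (hc : c ≠ 0)
    (hB : ∀ x, d (B x) + B (d x) = c • (T x - x)) :
    ∃ β : ∀ n, Homology d G n →ₗ[k] Homology d G (n + 1), IsConnesOperator d G T B β := by
  have hBG : ∀ n, ∀ x ∈ G n, B x ∈ G (n + 1) := fun n x hx => by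
    rw [hG.mem_iff] at hx ⊢
    rw [hBN, hx, map_smul, smul_smul, pow_succ']
  have hfix : ∀ x, T (eproj T 1 x) = eproj T 1 x := fun x => by
    simpa using map_eproj hT 1 x
  have hdT : ∀ μ x, d (eproj T μ x) = eproj T μ (d x) := eproj_comm hT hT d hTd
  have hBfix : ∀ x, T x = x → d (B x) + B (d x) = 0 := fun x hx => by rw [hB, hx]; simp
  have hcyc : ∀ n, ∀ x ∈ cycles d G n, (B ∘ₗ eproj T 1) x ∈ cycles d G (n + 1) := by
    intro n x hx
    refine ⟨hBG n _ (hG.eproj_mem_of_comm hT hTN 1 hx.1), ?_⟩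
    have := hBfix _ (hfix x)
    rw [hdT, LinearMap.mem_ker.1 hx.2, map_zero, map_zero, add_zero] at this
    exact this
  have hbd : ∀ n, ((G (n + 1)).map d).submoduleOf (cycles d G n) ≤
      (((G (n + 1 + 1)).map d).submoduleOf (cycles d G (n + 1))).comap
        ((B ∘ₗ eproj T 1).restrict (hcyc n)) := by
    rintro n ⟨x, hx⟩ ⟨y, hy, hyx⟩
    -- on `T`-fixed chains `B` anticommutes with `d`
    refine ⟨-B (eproj T 1 y), Submodule.neg_mem _
      (hBG _ _ (hG.eproj_mem_of_comm hT hTN 1 hy)), ?_⟩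
    have hyx' : d y = x := hyx
    have := hBfix _ (hfix y)
    rw [map_neg]
    change _ = B (eproj T 1 x)
    rw [← hyx', ← hdT, neg_eq_iff_add_eq_zero, this]
  refine ⟨fun n => Submodule.mapQ _ _ ((B ∘ₗ eproj T 1).restrict (hcyc n)) (hbd n), ?_, ?_⟩
  · intro n q
    obtain ⟨⟨x, hx⟩, rfl⟩ := Submodule.mkQ_surjective _ q
    have hx1 : eproj T 1 x ∈ cycles d G n :=
      ⟨hG.eproj_mem_of_comm hT hTN 1 hx.1, by
        change d (eproj T 1 x) = 0
        rw [hdT, LinearMap.mem_ker.1 hx.2, map_zero]⟩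
    refine ⟨eproj T 1 x, hx1, hfix x, (Submodule.Quotient.eq _).2 ?_⟩
    -- the component of a cycle for an eigenvalue `μ ≠ 1` is `d B` of itself up to a scalar
    have key : ∀ μ : k, μ ≠ 1 → eproj T μ x ∈ (G (n + 1)).map d := by
      intro μ hμ
      have h1 := hB (eproj T μ x)
      rw [hdT, LinearMap.mem_ker.1 hx.2, map_zero, map_zero, add_zero, map_eproj hT,
        show μ • eproj T μ x - eproj T μ x = (μ - 1) • eproj T μ x by rw [sub_smul, one_smul],
        smul_smul] at h1
      have h2 : c * (μ - 1) ≠ 0 := mul_ne_zero hc (sub_ne_zero.2 hμ)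
      refine ⟨(c * (μ - 1))⁻¹ • B (eproj T μ x), Submodule.smul_mem _ _
        (hBG _ _ (hG.eproj_mem_of_comm hT hTN μ hx.1)), ?_⟩
      rw [map_smul, h1, smul_smul, inv_mul_cancel₀ h2, one_smul]
    obtain ⟨s, -, hs⟩ := hT.exists_sum (x - eproj T 1 x)
    have h3 : x - eproj T 1 x ∈ (G (n + 1)).map d := by
      rw [hs]
      refine Submodule.sum_mem _ fun μ _ => ?_
      by_cases hμ : μ = 1
      · subst hμ
        rw [map_sub, eproj_same hT (map_eproj hT 1 x), sub_self]
        exact Submodule.zero_mem _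
      · rw [map_sub, eproj_ne (map_eproj hT 1 x) (Ne.symm hμ), sub_zero]
        exact key μ hμ
    have h4 := Submodule.neg_mem _ h3
    rw [neg_sub] at h4
    exact h4
  · intro n z hz hTz
    have hz1 : eproj T 1 z = z := eproj_same hT (by simpa using hTz)
    have h1 : B z ∈ cycles d G (n + 1) := by
      have := hcyc n z hz
      rwa [LinearMap.comp_apply, hz1] at this
    refine ⟨h1, congrArg homologyClass (Subtype.ext ?_)⟩
    change B (eproj T 1 z) = B z
    rw [hz1]

end HomologyTools

/-! ### Words in the tensor algebra -/

section Words
variable {k : Type u} [Field k] {W : Type v} [AddCommGroup W] [Module k W]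
  {Z : Type w} [AddCommGroup Z] [Module k Z]

/-- Linear maps on `T(W)` that agree on `1` and on the products `a x` with a letter `a` agree. -/
lemma words_ext {f g : TensorAlgebra k W →ₗ[k] Z} (h1 : f 1 = g 1)
    (hι : ∀ a x, f (TensorAlgebra.ι k a * x) = g (TensorAlgebra.ι k a * x))
    (x : TensorAlgebra k W) : f x = g x := by
  induction x using words_induction with
  | h1 => exact h1
  | hsmul r x hx => simp [hx]
  | hadd x y hx hy => simp [hx, hy]
  | hι a x _ => exact hι a x

lemma words_induction_right {P : TensorAlgebra k W → Prop} (h1 : P 1)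
    (hsmul : ∀ (r : k) x, P x → P (r • x)) (hι : ∀ a x, P x → P (x * TensorAlgebra.ι k a))
    (hadd : ∀ x y, P x → P y → P (x + y)) (x : TensorAlgebra k W) : P x := by
  have key : ∀ x y : TensorAlgebra k W, P y → P (y * x) := by
    intro x
    induction x using words_induction with
    | h1 => intro y hy; simpa using hy
    | hsmul r x hx => intro y hy; rw [mul_smul_comm]; exact hsmul _ _ (hx y hy)
    | hι a x hx => intro y hy; rw [← mul_assoc]; exact hx _ (hι a y hy)
    | hadd a b ha hb => intro y hy; rw [mul_add]; exact hadd _ _ (ha _ hy) (hb _ hy)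
  simpa using key x 1 h1

lemma words_ext_right {f g : TensorAlgebra k W →ₗ[k] Z} (h1 : f 1 = g 1)
    (hι : ∀ a x, f (x * TensorAlgebra.ι k a) = g (x * TensorAlgebra.ι k a))
    (x : TensorAlgebra k W) : f x = g x := by
  induction x using words_induction_right with
  | h1 => exact h1
  | hsmul r x hx => simp [hx]
  | hadd x y hx hy => simp [hx, hy]
  | hι a x _ => exact hι a x

/-- Linear maps on `T(W)` that agree on words of length at most one and on the products
`a b x` with letters `a`, `b` agree. -/
lemma words_ext₂ {f g : TensorAlgebra k W →ₗ[k] Z} (h1 : f 1 = g 1)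
    (h2 : ∀ a, f (TensorAlgebra.ι k a) = g (TensorAlgebra.ι k a))
    (h3 : ∀ a b x, f (TensorAlgebra.ι k a * (TensorAlgebra.ι k b * x)) =
      g (TensorAlgebra.ι k a * (TensorAlgebra.ι k b * x)))
    (x : TensorAlgebra k W) : f x = g x := by
  refine words_ext h1 (fun a x => ?_) x
  refine words_ext (f := f ∘ₗ LinearMap.mulLeft k (TensorAlgebra.ι k a))
    (g := g ∘ₗ LinearMap.mulLeft k (TensorAlgebra.ι k a)) ?_ (fun b y => ?_) x
  · simpa using h2 a
  · simpa using h3 a b y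

lemma words_ext₂_right {f g : TensorAlgebra k W →ₗ[k] Z} (h1 : f 1 = g 1)
    (h2 : ∀ a, f (TensorAlgebra.ι k a) = g (TensorAlgebra.ι k a))
    (h3 : ∀ a b x, f (x * TensorAlgebra.ι k a * TensorAlgebra.ι k b) =
      g (x * TensorAlgebra.ι k a * TensorAlgebra.ι k b))
    (x : TensorAlgebra k W) : f x = g x := by
  refine words_ext_right h1 (fun b x => ?_) x
  refine words_ext_right (f := f ∘ₗ LinearMap.mulRight k (TensorAlgebra.ι k b))
    (g := g ∘ₗ LinearMap.mulRight k (TensorAlgebra.ι k b)) ?_ (fun a y => ?_) x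
  · simpa using h2 b
  · simpa using h3 a b y

/-- Linear maps on `T(W)` that agree on words of length at most one and on the products `a x b` with
letters `a`, `b` agree. -/
lemma words_ext_ends {f g : TensorAlgebra k W →ₗ[k] Z} (h1 : f 1 = g 1)
    (h2 : ∀ a, f (TensorAlgebra.ι k a) = g (TensorAlgebra.ι k a))
    (h3 : ∀ a b x, f (TensorAlgebra.ι k a * x * TensorAlgebra.ι k b) =
      g (TensorAlgebra.ι k a * x * TensorAlgebra.ι k b))
    (x : TensorAlgebra k W) : f x = g x := by
  refine words_ext h1 (fun b x => ?_) x
  refine words_ext_right (f := f ∘ₗ LinearMap.mulLeft k (TensorAlgebra.ι k b))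
    (g := g ∘ₗ LinearMap.mulLeft k (TensorAlgebra.ι k b)) ?_ (fun a y => ?_) x
  · simpa using h2 b
  · simpa [mul_assoc] using h3 b a y

/-- The word with letters `l` in the tensor algebra. -/
def word (l : List W) : TensorAlgebra k W := (l.map (TensorAlgebra.ι k)).prod

@[simp] lemma word_nil : word (k := k) ([] : List W) = 1 := rfl

@[simp] lemma word_cons (a : W) (l : List W) :
    word (k := k) (a :: l) = TensorAlgebra.ι k a * word l := by simp [word]

@[simp] lemma word_append (l l' : List W) :
    word (k := k) (l ++ l') = word l * word l' := by simp [word]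

lemma words_ext_list {f g : TensorAlgebra k W →ₗ[k] Z} (h : ∀ l : List W, f (word l) = g (word l))
    (x : TensorAlgebra k W) : f x = g x := by
  have : ∀ (x : TensorAlgebra k W) (l : List W), f (x * word l) = g (x * word l) := by
    intro x
    induction x using words_induction_right with
    | h1 => simpa using h
    | hsmul r x hx => intro l; simp [hx]
    | hadd x y hx hy => intro l; simp [add_mul, hx, hy]
    | hι a x hx => intro l; rw [mul_assoc, ← word_cons]; exact hx _
  simpa using this x []

@[simp] lemma ιInv_one : TensorAlgebra.ιInv (1 : TensorAlgebra k W) = 0 := by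
  let _ : Module kᵐᵒᵖ W := Module.compHom _ ((RingHom.id k).fromOpposite mul_comm)
  have : IsCentralScalar k W := ⟨fun r m => rfl⟩
  exact congrArg TrivSqZeroExt.snd
    (map_one (TensorAlgebra.toTrivSqZeroExt : TensorAlgebra k W →ₐ[k] TrivSqZeroExt k W))

@[simp] lemma ιInv_ι (a : W) : TensorAlgebra.ιInv (TensorAlgebra.ι k a) = a :=
  TensorAlgebra.ι_leftInverse a

@[simp] lemma algebraMapInv_ι (a : W) :
    TensorAlgebra.algebraMapInv (TensorAlgebra.ι k a) = 0 := by
  simp [TensorAlgebra.algebraMapInv]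

lemma ιInv_ι_mul (a : W) (x : TensorAlgebra k W) :
    TensorAlgebra.ιInv (TensorAlgebra.ι k a * x) = TensorAlgebra.algebraMapInv x • a := by
  induction x using words_induction with
  | h1 => simp
  | hsmul r x hx => simp only [mul_smul_comm, map_smul, hx, smul_assoc]
  | hadd x y hx hy => simp [mul_add, hx, hy, add_smul]
  | hι b x hx =>
    simp [TensorAlgebra.ιInv, TensorAlgebra.toTrivSqZeroExt]

lemma ιInv_mul_ι (a : W) (x : TensorAlgebra k W) :
    TensorAlgebra.ιInv (x * TensorAlgebra.ι k a) = TensorAlgebra.algebraMapInv x • a := by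
  induction x using words_induction with
  | h1 => simp
  | hsmul r x hx => simp only [smul_mul_assoc, map_smul, hx, smul_assoc]
  | hadd x y hx hy => simp [add_mul, hx, hy, add_smul]
  | hι b x hx =>
    simp [mul_assoc, ιInv_ι_mul]

@[simp] lemma firstLetter_one : firstLetter k W 1 = 0 := by
  simp [firstLetter]

@[simp] lemma firstLetter_ι_mul (a : W) (x : TensorAlgebra k W) :
    firstLetter k W (TensorAlgebra.ι k a * x) = a ⊗ₜ x := by
  have h : TensorAlgebra.ιInv ∘ₗ LinearMap.mulLeft k (TensorAlgebra.ι k a) =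
      LinearMap.toSpanSingleton k W a ∘ₗ (TensorAlgebra.algebraMapInv (M := W)).toLinearMap := by
    ext y; simp [ιInv_ι_mul]
  rw [firstLetter, LinearMap.comp_apply, deconc_ι_mul, map_add, ← LinearMap.comp_apply
    (LinearMap.rTensor _ _) (LinearMap.rTensor _ _), ← LinearMap.rTensor_comp, h,
    LinearMap.rTensor_comp, LinearMap.comp_apply, deconc_counit_left]
  simp

@[simp] lemma firstLetter_ι (a : W) : firstLetter k W (TensorAlgebra.ι k a) = a ⊗ₜ 1 := by
  simpa using firstLetter_ι_mul (k := k) a 1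

lemma deconc_mul_ι (x : TensorAlgebra k W) (a : W) :
    deconc (x * TensorAlgebra.ι k a) = (x * TensorAlgebra.ι k a) ⊗ₜ 1 +
      LinearMap.lTensor _ (LinearMap.mulRight k (TensorAlgebra.ι k a)) (deconc x) := by
  induction x using words_induction with
  | h1 => have := deconc_ι_mul (k := k) a 1; simp at this; simp [this, add_comm]
  | hsmul r x hx => simp [hx, TensorProduct.smul_tmul']
  | hadd x y hx hy => simp only [add_mul, map_add, hx, hy, TensorProduct.add_tmul]; abel
  | hι b x hx =>
    rw [mul_assoc, deconc_ι_mul, hx, deconc_ι_mul, map_add, map_add,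
      ← LinearMap.comp_apply (LinearMap.rTensor _ _) (LinearMap.lTensor _ _),
      ← LinearMap.comp_apply (LinearMap.lTensor _ _) (LinearMap.rTensor _ _),
      LinearMap.rTensor_comp_lTensor, LinearMap.lTensor_comp_rTensor]
    simp only [LinearMap.rTensor_tmul, LinearMap.mulLeft_apply, LinearMap.lTensor_tmul,
      LinearMap.mulRight_apply, mul_assoc]
    abel

@[simp] lemma lastLetter_one : lastLetter k W 1 = 0 := by
  simp [lastLetter]

@[simp] lemma lastLetter_mul_ι (x : TensorAlgebra k W) (a : W) :
    lastLetter k W (x * TensorAlgebra.ι k a) = x ⊗ₜ a := by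
  have h : TensorAlgebra.ιInv ∘ₗ LinearMap.mulRight k (TensorAlgebra.ι k a) =
      LinearMap.toSpanSingleton k W a ∘ₗ (TensorAlgebra.algebraMapInv (M := W)).toLinearMap := by
    ext y; simp [ιInv_mul_ι]
  rw [lastLetter, LinearMap.comp_apply, deconc_mul_ι, map_add, ← LinearMap.comp_apply
    (LinearMap.lTensor _ _) (LinearMap.lTensor _ _), ← LinearMap.lTensor_comp, h,
    LinearMap.lTensor_comp, LinearMap.comp_apply, deconc_counit_right]
  simp

@[simp] lemma lastLetter_ι (a : W) : lastLetter k W (TensorAlgebra.ι k a) = 1 ⊗ₜ a := by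
  simpa using lastLetter_mul_ι (k := k) 1 a

lemma markLetter_ι_mul (a : W) (x : TensorAlgebra k W) :
    markLetter k W (TensorAlgebra.ι k a * x) = 1 ⊗ₜ (a ⊗ₜ x) +
      LinearMap.rTensor _ (LinearMap.mulLeft k (TensorAlgebra.ι k a)) (markLetter k W x) := by
  rw [markLetter, LinearMap.comp_apply, deconc_ι_mul, map_add, LinearMap.lTensor_tmul,
    firstLetter_ι_mul, ← LinearMap.comp_apply (LinearMap.lTensor _ _) (LinearMap.rTensor _ _),
    LinearMap.lTensor_comp_rTensor, ← LinearMap.rTensor_comp_lTensor]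
  rfl

@[simp] lemma markLetter_one : markLetter k W 1 = 0 := by simp [markLetter]

@[simp] lemma markTwoLetters_one : markTwoLetters k W 1 = 0 := by simp [markTwoLetters]

lemma markTwoLetters_ι_mul (a : W) (x : TensorAlgebra k W) :
    markTwoLetters k W (TensorAlgebra.ι k a * x) = 1 ⊗ₜ (a ⊗ₜ firstLetter k W x) +
      LinearMap.rTensor _ (LinearMap.mulLeft k (TensorAlgebra.ι k a)) (markTwoLetters k W x) := by
  rw [markTwoLetters, LinearMap.comp_apply, markLetter_ι_mul, map_add, LinearMap.lTensor_tmul,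
    LinearMap.lTensor_tmul, ← LinearMap.comp_apply (LinearMap.lTensor _ _) (LinearMap.rTensor _ _),
    LinearMap.lTensor_comp_rTensor, ← LinearMap.rTensor_comp_lTensor]
  rfl

lemma lengthParity_mul (x y : TensorAlgebra k W) :
    lengthParity k W (x * y) = lengthParity k W x * lengthParity k W y := by
  simp [lengthParity]

@[simp] lemma lengthParity_one : lengthParity k W 1 = 1 := by simp [lengthParity]

@[simp] lemma lengthParity_ι (a : W) :
    lengthParity k W (TensorAlgebra.ι k a) = -TensorAlgebra.ι k a := by
  simp [lengthParity]

lemma lengthParity_word (l : List W) :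
    lengthParity k W (word l) = (-1 : k) ^ l.length • word l := by
  induction l with
  | nil => simp
  | cons a l ih => simp [lengthParity_mul, ih, pow_succ]

@[simp] lemma lengthParity_lengthParity (x : TensorAlgebra k W) :
    lengthParity k W (lengthParity k W x) = x := by
  induction x using words_induction with
  | h1 => simp
  | hsmul r x hx => simp [hx]
  | hadd x y hx hy => simp [hx, hy]
  | hι a x hx => simp [lengthParity_mul, hx]

/-- The Koszul sign on a pair of elements of given parities. -/
lemma koszulSign_tmul [CharZero k] {X : Type v} [AddCommGroup X] [Module k X] {Y : Type w}
    [AddCommGroup Y] [Module k Y] (f : X →ₗ[k] X) (g : Y →ₗ[k] Y) {p q : ℕ} {x : X} {y : Y}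
    (hx : f x = (-1 : k) ^ p • x) (hy : g y = (-1 : k) ^ q • y) :
    koszulSign f g (x ⊗ₜ y) = (-1 : k) ^ (p * q) • x ⊗ₜ y := by
  have h2 : (2 : k) ≠ 0 := two_ne_zero
  simp only [koszulSign, LinearMap.smul_apply, LinearMap.sub_apply, LinearMap.add_apply,
    LinearMap.id_apply, LinearMap.rTensor_tmul, LinearMap.lTensor_tmul, TensorProduct.map_tmul,
    hx, hy, TensorProduct.smul_tmul_smul]
  rw [← TensorProduct.smul_tmul', TensorProduct.tmul_smul]
  have : ∀ t : X ⊗[k] Y, (2 : k)⁻¹ • (t + (-1 : k) ^ p • t + (-1 : k) ^ q • t -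
      ((-1 : k) ^ p * (-1) ^ q) • t) = ((2 : k)⁻¹ * (1 + (-1) ^ p + (-1) ^ q -
      (-1) ^ p * (-1) ^ q)) • t := fun t => by module
  rw [this]
  congr 1
  rcases Nat.even_or_odd p with hp | hp <;> rcases Nat.even_or_odd q with hq | hq <;>
    simp [hp.neg_one_pow, hq.neg_one_pow, pow_mul] <;> norm_num
end Words

/-! ### The bar construction and the Hochschild boundary of an algebra -/

section BarDifferential
variable {k : Type u} [Field k] {A : Type w} [Ring A] [Algebra k A] (ε : A →ₐ[k] k)

local notation "T" => TensorAlgebra k (AugIdeal ε)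
local notation "τ" => TensorAlgebra.ι k (M := AugIdeal ε)
local notation "par" => lengthParity k (AugIdeal ε)

lemma augIdeal_apply (a : AugIdeal ε) : ε a = 0 := a.2

@[simp] lemma coe_toAug (a : A) : (toAug ε a : A) = a - algebraMap k A (ε a) := rfl

@[simp] lemma toAug_coe (a : AugIdeal ε) : toAug ε (a : A) = a := by
  ext; simp [augIdeal_apply]

@[simp] lemma toAug_one : toAug ε 1 = 0 := by ext; simp

@[simp] lemma coe_augMul (a b : AugIdeal ε) : (augMul ε (a ⊗ₜ b) : A) = a * b := by
  simp [augMul, augIdeal_apply]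

lemma toAug_coe_mul (a b : AugIdeal ε) : toAug ε ((a : A) * b) = augMul ε (a ⊗ₜ b) := by
  rw [← coe_augMul, toAug_coe]

lemma augMul_assoc (a b c : AugIdeal ε) :
    augMul ε (augMul ε (a ⊗ₜ b) ⊗ₜ c) = augMul ε (a ⊗ₜ augMul ε (b ⊗ₜ c)) := by
  ext; simp [mul_assoc]

/-- The operator `b₁ ⋯ bₙ ↦ (a b₁) b₂ ⋯ bₙ` on `T(Ā)`, with `1 ↦ 0`. -/
def mulFirst (a : AugIdeal ε) : T →ₗ[k] T :=
  LinearMap.mul' k _ ∘ₗ LinearMap.rTensor _ (TensorAlgebra.ι k ∘ₗ augMul ε ∘ₗ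
    TensorProduct.mk k _ _ a) ∘ₗ firstLetter k (AugIdeal ε)

@[simp] lemma mulFirst_one (a : AugIdeal ε) : mulFirst ε a 1 = 0 := by simp [mulFirst]

@[simp] lemma mulFirst_ι_mul (a b : AugIdeal ε) (x : T) :
    mulFirst ε a (τ b * x) = τ (augMul ε (a ⊗ₜ b)) * x := by simp [mulFirst]

@[simp] lemma mulFirst_ι (a b : AugIdeal ε) :
    mulFirst ε a (τ b) = τ (augMul ε (a ⊗ₜ b)) := by simp [mulFirst]

/-- The differential `a₁ ⋯ aₙ ↦ ∑ (-1)^i a₁ ⋯ (aᵢ aᵢ₊₁) ⋯ aₙ` of the bar construction `T(Ā)`. -/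
def barD : T →ₗ[k] T :=
  -(LinearMap.mul' k _ ∘ₗ
      TensorProduct.map (lengthParity k (AugIdeal ε))
        (LinearMap.mul' k _ ∘ₗ LinearMap.rTensor _ (TensorAlgebra.ι k ∘ₗ augMul ε) ∘ₗ
          (TensorProduct.assoc k (AugIdeal ε) (AugIdeal ε)
            (TensorAlgebra k (AugIdeal ε))).symm.toLinearMap) ∘ₗ
      markTwoLetters k (AugIdeal ε))

lemma hochInner_eq : hochInner ε = LinearMap.lTensor A (barD ε) := by
  rw [hochInner, barD, LinearMap.lTensor_neg]

@[simp] lemma barD_one : barD ε 1 = 0 := by simp [barD]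

lemma barD_ι_mul (a : AugIdeal ε) (x : T) :
    barD ε (τ a * x) = -mulFirst ε a x - τ a * barD ε x := by
  have h1 : ∀ z : T ⊗[k] (AugIdeal ε ⊗[k] (AugIdeal ε ⊗[k] T)),
      (LinearMap.mul' k _ ∘ₗ TensorProduct.map (lengthParity k (AugIdeal ε))
        (LinearMap.mul' k _ ∘ₗ LinearMap.rTensor _ (TensorAlgebra.ι k ∘ₗ augMul ε) ∘ₗ
          (TensorProduct.assoc k (AugIdeal ε) (AugIdeal ε)
            (TensorAlgebra k (AugIdeal ε))).symm.toLinearMap))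
        (LinearMap.rTensor _ (LinearMap.mulLeft k (τ a)) z) =
      -(τ a * (LinearMap.mul' k _ ∘ₗ TensorProduct.map (lengthParity k (AugIdeal ε))
        (LinearMap.mul' k _ ∘ₗ LinearMap.rTensor _ (TensorAlgebra.ι k ∘ₗ augMul ε) ∘ₗ
          (TensorProduct.assoc k (AugIdeal ε) (AugIdeal ε)
            (TensorAlgebra k (AugIdeal ε))).symm.toLinearMap)) z) := by
    intro z
    induction z using TensorProduct.induction_on with
    | zero => simp
    | add x y hx hy => simp only [map_add, hx, hy, mul_add, neg_add]
    | tmul u y => simp [lengthParity_mul, mul_assoc]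
  have h2 : ∀ z : AugIdeal ε ⊗[k] T,
      (LinearMap.mul' k _ ∘ₗ LinearMap.rTensor _ (TensorAlgebra.ι k ∘ₗ augMul ε) ∘ₗ
          (TensorProduct.assoc k (AugIdeal ε) (AugIdeal ε)
            (TensorAlgebra k (AugIdeal ε))).symm.toLinearMap) (a ⊗ₜ z) =
      LinearMap.mul' k _ (LinearMap.rTensor _ (TensorAlgebra.ι k ∘ₗ augMul ε ∘ₗ
        TensorProduct.mk k _ _ a) z) := by
    intro z
    induction z using TensorProduct.induction_on with
    | zero => simp
    | add x y hx hy => rw [TensorProduct.tmul_add, map_add, map_add, map_add, hx, hy]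
    | tmul u y => simp
  rw [barD, LinearMap.neg_apply, ← LinearMap.comp_assoc, LinearMap.comp_apply,
    markTwoLetters_ι_mul, map_add, h1, LinearMap.comp_apply, TensorProduct.map_tmul, h2]
  simp [mulFirst]
  abel

@[simp] lemma barD_ι (a : AugIdeal ε) : barD ε (τ a) = 0 := by
  simpa using barD_ι_mul ε a 1

lemma mulFirst_mul (b a : AugIdeal ε) (x y : T) :
    mulFirst ε b (x * τ a * y) = mulFirst ε b (x * τ a) * y := by
  refine words_ext (f := mulFirst ε b ∘ₗ LinearMap.mulRight k y ∘ₗ LinearMap.mulRight k (τ a))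
    (g := LinearMap.mulRight k y ∘ₗ mulFirst ε b ∘ₗ LinearMap.mulRight k (τ a)) ?_ ?_ x
  · simp
  · intro c x; simp [mul_assoc]

/-- The bar differential of a word, cut at a letter `a`: the products of neighbours are those in
`x a` and those in `a y`. -/
lemma barD_mul_ι_mul (x : T) (a : AugIdeal ε) (y : T) :
    barD ε (x * τ a * y) = barD ε (x * τ a) * y + par x * barD ε (τ a * y) := by
  induction x using words_induction with
  | h1 => simp
  | hsmul r x hx => simp only [smul_mul_assoc, map_smul, hx, smul_add]
  | hadd x z hx hz => simp only [add_mul, map_add, hx, hz]; abel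
  | hι b x hx =>
    rw [mul_assoc, mul_assoc, ← mul_assoc x, barD_ι_mul, hx, mulFirst_mul, mul_assoc (τ b),
      barD_ι_mul ε b, lengthParity_mul, lengthParity_ι]
    noncomm_ring

lemma barD_mul_ι_mul_ι (x : T) (a b : AugIdeal ε) :
    barD ε (x * τ a * τ b) = barD ε (x * τ a) * τ b - par x * τ (augMul ε (a ⊗ₜ b)) := by
  rw [barD_mul_ι_mul, barD_ι_mul]; simp [sub_eq_add_neg]

/-- The bar differential is odd. -/
lemma barD_parity (x : T) : barD ε (par x) = -par (barD ε x) := by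
  refine words_ext₂ (f := barD ε ∘ₗ par) (g := -(par ∘ₗ barD ε)) ?_ ?_ ?_ x
  · simp
  · simp
  · intro a b x
    induction x using words_induction generalizing a b with
    | h1 => simp [lengthParity_mul, barD_ι_mul]
    | hsmul r x hx => simp only [mul_smul_comm, map_smul, hx]
    | hadd x y hx hy => simp only [mul_add, map_add, hx, hy]
    | hι c x hx =>
      have h := hx b c
      simp only [LinearMap.comp_apply, LinearMap.neg_apply] at h ⊢
      rw [lengthParity_mul, lengthParity_ι, barD_ι_mul ε a, neg_mul, map_neg, barD_ι_mul, h]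
      simp only [lengthParity_mul, mulFirst_ι_mul, lengthParity_ι, neg_mul, map_neg, map_sub,
        mul_neg]

lemma barD_barD (x : T) : barD ε (barD ε x) = 0 := by
  refine words_ext₂ (f := barD ε ∘ₗ barD ε) (g := 0) ?_ ?_ ?_ x
  · simp
  · simp
  · intro a b x
    induction x using words_induction generalizing a b with
    | h1 => simp [barD_ι_mul]
    | hsmul r x hx => simp only [mul_smul_comm, map_smul, hx]
    | hadd x y hx hy => simp only [mul_add, map_add, hx, hy]
    | hι c x hx =>
      have h := hx b c
      simp only [LinearMap.comp_apply, LinearMap.zero_apply] at h ⊢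
      rw [barD_ι_mul ε a, map_sub, barD_ι_mul ε a, h, barD_ι_mul ε b]
      simp only [mulFirst_ι_mul, map_neg, barD_ι_mul ε (augMul ε _), map_sub, barD_ι_mul ε c,
        augMul_assoc]
      noncomm_ring

variable (σ : A ≃ₐ[k] A)

@[simp] lemma hochFirst_one (a : A) : hochFirst ε σ (a ⊗ₜ 1) = 0 := by simp [hochFirst]

@[simp] lemma hochFirst_ι_mul (a : A) (b : AugIdeal ε) (x : T) :
    hochFirst ε σ (a ⊗ₜ (τ b * x)) = (a * σ b) ⊗ₜ x := by simp [hochFirst]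

@[simp] lemma hochFirst_ι (a : A) (b : AugIdeal ε) :
    hochFirst ε σ (a ⊗ₜ τ b) = (a * σ b) ⊗ₜ 1 := by simp [hochFirst]

@[simp] lemma hochInner_tmul (a : A) (x : T) :
    hochInner ε (a ⊗ₜ x) = a ⊗ₜ barD ε x := by simp [hochInner_eq]

@[simp] lemma hochLast_one (a : A) : hochLast ε (a ⊗ₜ 1) = 0 := by simp [hochLast]

@[simp] lemma hochLast_mul_ι (a : A) (b : AugIdeal ε) (x : T) :
    hochLast ε (a ⊗ₜ (x * τ b)) = -((b * a) ⊗ₜ par x) := by simp [hochLast]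

@[simp] lemma hochLast_ι (a : A) (b : AugIdeal ε) :
    hochLast ε (a ⊗ₜ τ b) = -((b * a) ⊗ₜ 1) := by simp [hochLast]

lemma hoch_ext {Z : Type v} [AddCommGroup Z] [Module k Z] {f g : HochChain ε →ₗ[k] Z}
    (h : ∀ a x, f (a ⊗ₜ x) = g (a ⊗ₜ x)) : f = g := TensorProduct.ext' h

lemma hochFirst_hochFirst (z : HochChain ε) : hochFirst ε σ (hochFirst ε σ z) +
    hochFirst ε σ (hochInner ε z) + hochInner ε (hochFirst ε σ z) = 0 := by
  have : hochFirst ε σ ∘ₗ hochFirst ε σ + hochFirst ε σ ∘ₗ hochInner ε +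
      hochInner ε ∘ₗ hochFirst ε σ = 0 := by
    refine hoch_ext ε fun a x => ?_
    refine words_ext₂ (f := (hochFirst ε σ ∘ₗ hochFirst ε σ + hochFirst ε σ ∘ₗ hochInner ε +
      hochInner ε ∘ₗ hochFirst ε σ) ∘ₗ TensorProduct.mk k _ _ a) (g := 0) ?_ ?_ ?_ x
    · simp
    · simp
    · intro b c x
      simp [barD_ι_mul ε b, TensorProduct.tmul_sub, TensorProduct.tmul_neg, mul_assoc]
      abel
  exact LinearMap.congr_fun this z

lemma hochLast_hochLast (z : HochChain ε) : hochLast ε (hochLast ε z) +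
    hochLast ε (hochInner ε z) + hochInner ε (hochLast ε z) = 0 := by
  have : hochLast ε ∘ₗ hochLast ε + hochLast ε ∘ₗ hochInner ε +
      hochInner ε ∘ₗ hochLast ε = 0 := by
    refine hoch_ext ε fun a x => ?_
    refine words_ext₂_right (f := (hochLast ε ∘ₗ hochLast ε + hochLast ε ∘ₗ hochInner ε +
      hochInner ε ∘ₗ hochLast ε) ∘ₗ TensorProduct.mk k _ _ a) (g := 0) ?_ ?_ ?_ x
    · simp
    · simp
    · intro b c x
      simp only [LinearMap.comp_apply, LinearMap.add_apply, LinearMap.zero_apply,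
        TensorProduct.mk_apply, hochLast_mul_ι, hochInner_tmul, barD_mul_ι_mul_ι,
        TensorProduct.tmul_sub, map_sub, map_neg, barD_parity, TensorProduct.tmul_neg]
      simp only [lengthParity_mul, lengthParity_ι, mul_neg, TensorProduct.tmul_neg, map_neg,
        hochLast_mul_ι, lengthParity_lengthParity, coe_augMul, mul_assoc (b : A)]
      abel
  exact LinearMap.congr_fun this z

lemma hochFirst_hochLast (z : HochChain ε) :
    hochFirst ε σ (hochLast ε z) + hochLast ε (hochFirst ε σ z) = 0 := by
  have : hochFirst ε σ ∘ₗ hochLast ε + hochLast ε ∘ₗ hochFirst ε σ = 0 := by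
    refine hoch_ext ε fun a x => ?_
    refine words_ext_ends (f := (hochFirst ε σ ∘ₗ hochLast ε + hochLast ε ∘ₗ hochFirst ε σ) ∘ₗ
      TensorProduct.mk k _ _ a) (g := 0) ?_ ?_ ?_ x
    · simp
    · simp
    · intro b c x
      have h1 : hochLast ε (a ⊗ₜ (τ b * x * τ c)) = (c * a : A) ⊗ₜ (τ b * par x) := by
        rw [hochLast_mul_ι, lengthParity_mul]; simp [TensorProduct.tmul_neg]
      simp [mul_assoc] at h1
      simp [mul_assoc, h1]
  exact LinearMap.congr_fun this z

lemma hochB_hochB (z : HochChain ε) : hochB ε σ (hochB ε σ z) = 0 := by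
  have h1 := hochFirst_hochFirst ε σ z
  have h2 := hochLast_hochLast ε z
  have h3 := hochFirst_hochLast ε σ z
  have h4 : hochInner ε (hochInner ε z) = 0 := by
    rw [hochInner_eq, ← LinearMap.comp_apply, ← LinearMap.lTensor_comp]
    rw [show barD ε ∘ₗ barD ε = 0 from LinearMap.ext (barD_barD ε)]
    simp
  calc _ = (hochFirst ε σ (hochFirst ε σ z) + hochFirst ε σ (hochInner ε z) +
        hochInner ε (hochFirst ε σ z)) + (hochLast ε (hochLast ε z) +
        hochLast ε (hochInner ε z) + hochInner ε (hochLast ε z)) +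
        (hochFirst ε σ (hochLast ε z) + hochLast ε (hochFirst ε σ z)) +
        hochInner ε (hochInner ε z) := by
        simp only [hochB, LinearMap.add_apply, map_add]; abel
    _ = 0 := by rw [h1, h2, h3, h4]; simp

/-- The one-sided bar complex `A ⊗ T(Ā)`, with differential
`(a₀, …, aₙ) ↦ (a₀ a₁, …, aₙ) + ∑ (-1)^i (a₀, …, aᵢ aᵢ₊₁, …, aₙ)`. -/
def oneBarD : HochChain ε →ₗ[k] HochChain ε := hochFirst ε AlgEquiv.refl + hochInner ε

lemma oneBarD_oneBarD (z : HochChain ε) : oneBarD ε (oneBarD ε z) = 0 := by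
  have h1 := hochFirst_hochFirst ε AlgEquiv.refl z
  have h4 : hochInner ε (hochInner ε z) = 0 := by
    rw [hochInner_eq, ← LinearMap.comp_apply, ← LinearMap.lTensor_comp]
    rw [show barD ε ∘ₗ barD ε = 0 from LinearMap.ext (barD_barD ε)]
    simp
  calc _ = (hochFirst ε AlgEquiv.refl (hochFirst ε AlgEquiv.refl z) +
        hochFirst ε AlgEquiv.refl (hochInner ε z) +
        hochInner ε (hochFirst ε AlgEquiv.refl z)) + hochInner ε (hochInner ε z) := by
        simp only [oneBarD, LinearMap.add_apply, map_add]; abel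
    _ = 0 := by rw [h1, h4]; simp

/-- The contraction `(a₀, …, aₙ) ↦ (1, a₀, …, aₙ)` of the one-sided bar complex. -/
def oneBarS : HochChain ε →ₗ[k] HochChain ε :=
  TensorProduct.mk k A _ 1 ∘ₗ LinearMap.mul' k _ ∘ₗ
    LinearMap.rTensor _ (TensorAlgebra.ι k ∘ₗ toAug ε)

@[simp] lemma oneBarS_tmul (a : A) (x : T) :
    oneBarS ε (a ⊗ₜ x) = 1 ⊗ₜ (τ (toAug ε a) * x) := by simp [oneBarS]

/-- The projection of `A ⊗ T(Ā)` onto `k`. -/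
def hochAug : HochChain ε →ₗ[k] k :=
  LinearMap.mul' k k ∘ₗ
    TensorProduct.map ε.toLinearMap (TensorAlgebra.algebraMapInv (M := AugIdeal ε)).toLinearMap

@[simp] lemma hochAug_tmul (a : A) (x : T) :
    hochAug ε (a ⊗ₜ x) = ε a * TensorAlgebra.algebraMapInv x := by simp [hochAug]

/-- The one-sided bar complex is a resolution of `k`, since it is contractible onto the span of
`1 ⊗ 1`. -/
lemma oneBar_contraction (z : HochChain ε) :
    oneBarD ε (oneBarS ε z) + oneBarS ε (oneBarD ε z) = z - hochAug ε z • (1 ⊗ₜ 1) := by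
  have : oneBarD ε ∘ₗ oneBarS ε + oneBarS ε ∘ₗ oneBarD ε =
      LinearMap.id - LinearMap.toSpanSingleton k _ (1 ⊗ₜ 1) ∘ₗ hochAug ε := by
    refine hoch_ext ε fun a x => ?_
    refine words_ext (f := (oneBarD ε ∘ₗ oneBarS ε + oneBarS ε ∘ₗ oneBarD ε) ∘ₗ
      TensorProduct.mk k _ _ a) (g := (LinearMap.id - LinearMap.toSpanSingleton k _ (1 ⊗ₜ 1) ∘ₗ
        hochAug ε) ∘ₗ TensorProduct.mk k _ _ a) ?_ ?_ x
    · simp [oneBarD, TensorProduct.sub_tmul, Algebra.algebraMap_eq_smul_one,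
        TensorProduct.smul_tmul']
    · intro b x
      have h1 : toAug ε (a * b) = augMul ε (toAug ε a ⊗ₜ b) + ε a • b := by
        ext; simp [sub_mul, augIdeal_apply, Algebra.smul_def]
      simp [oneBarD, barD_ι_mul ε (toAug ε a), h1, TensorProduct.sub_tmul,
        TensorProduct.tmul_sub, TensorProduct.tmul_neg, add_mul, TensorProduct.tmul_add,
        Algebra.algebraMap_eq_smul_one, TensorProduct.smul_tmul']
      abel
  exact LinearMap.congr_fun this z

lemma hochAug_oneBarD (z : HochChain ε) : hochAug ε (oneBarD ε z) = 0 := by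
  have : hochAug ε ∘ₗ oneBarD ε = 0 := by
    refine hoch_ext ε fun a x => ?_
    refine words_ext₂ (f := hochAug ε ∘ₗ oneBarD ε ∘ₗ TensorProduct.mk k _ _ a) (g := 0)
      ?_ ?_ ?_ x
    · simp [oneBarD]
    · intro b; simp [oneBarD, augIdeal_apply]
    · intro b c x; simp [oneBarD, augIdeal_apply, barD_ι_mul ε b]
  exact LinearMap.congr_fun this z
end BarDifferential

/-! ### The Connes operator on the Hochschild chains of an algebra -/

section HochConnes
variable {k : Type u} [Field k] {A : Type w} [Ring A] [Algebra k A] (ε : A →ₐ[k] k)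

local notation "T" => TensorAlgebra k (AugIdeal ε)
local notation "τ" => TensorAlgebra.ι k (M := AugIdeal ε)
local notation "par" => lengthParity k (AugIdeal ε)

/-- The bar differential is a coderivation of the deconcatenation coproduct. -/
lemma deconc_barD (x : T) : deconc (barD ε x) =
    LinearMap.rTensor _ (barD ε) (deconc x) +
      TensorProduct.map par (barD ε) (deconc x) := by
  have hF : ∀ (a : AugIdeal ε) (x : T), deconc (mulFirst ε a x) =
      1 ⊗ₜ mulFirst ε a x + LinearMap.rTensor _ (mulFirst ε a) (deconc x) := by
    intro a x
    refine words_ext (f := deconc ∘ₗ mulFirst ε a) (g := TensorProduct.mk k _ _ 1 ∘ₗ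
      mulFirst ε a + LinearMap.rTensor _ (mulFirst ε a) ∘ₗ deconc) ?_ ?_ x
    · simp
    · intro b x
      have h : mulFirst ε a ∘ₗ LinearMap.mulLeft k (τ b) =
          LinearMap.mulLeft k (τ (augMul ε (a ⊗ₜ b))) := by ext y; simp
      simp only [LinearMap.comp_apply, mulFirst_ι_mul, LinearMap.add_apply,
        TensorProduct.mk_apply, deconc_ι_mul, map_add, LinearMap.rTensor_tmul, mulFirst_one,
        TensorProduct.zero_tmul, zero_add]
      rw [← LinearMap.comp_apply (LinearMap.rTensor _ _) (LinearMap.rTensor _ _),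
        ← LinearMap.rTensor_comp, h]
  induction x using words_induction with
  | h1 => simp
  | hsmul r x hx => simp [hx]
  | hadd x y hx hy => simp only [map_add, hx, hy]; abel
  | hι a x hx =>
    have e1 : barD ε ∘ₗ LinearMap.mulLeft k (τ a) =
        -mulFirst ε a - LinearMap.mulLeft k (τ a) ∘ₗ barD ε := by ext y; simp [barD_ι_mul]
    have e2 : par ∘ₗ LinearMap.mulLeft k (τ a) = -(LinearMap.mulLeft k (τ a) ∘ₗ par) := by
      ext y; simp [lengthParity_mul]
    have e3 : ∀ z : T ⊗[k] T, LinearMap.rTensor _ (LinearMap.mulLeft k (τ a))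
        (TensorProduct.map par (barD ε) z) =
        -TensorProduct.map par (barD ε) (LinearMap.rTensor _ (LinearMap.mulLeft k (τ a)) z) := by
      intro z
      induction z using TensorProduct.induction_on with
      | zero => simp
      | add x y hx hy => simp only [map_add, hx, hy]; abel
      | tmul x y => simp [lengthParity_mul, TensorProduct.neg_tmul]
    have e4 : LinearMap.rTensor T (barD ε) (LinearMap.rTensor T (LinearMap.mulLeft k (τ a))
        (deconc x)) = -LinearMap.rTensor T (mulFirst ε a) (deconc x) -
        LinearMap.rTensor T (LinearMap.mulLeft k (τ a)) (LinearMap.rTensor T (barD ε)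
          (deconc x)) := by
      rw [← LinearMap.rTensor_comp_apply, e1, LinearMap.rTensor_sub, LinearMap.rTensor_neg,
        LinearMap.sub_apply, LinearMap.neg_apply, LinearMap.rTensor_comp_apply]
    rw [barD_ι_mul, map_sub, map_neg, hF, deconc_ι_mul, hx, map_add, e3, deconc_ι_mul, map_add,
      e4, map_add, LinearMap.rTensor_tmul, TensorProduct.map_tmul, barD_one, lengthParity_one,
      TensorProduct.zero_tmul, barD_ι_mul, TensorProduct.tmul_sub, TensorProduct.tmul_neg]
    abel

variable (σ : A ≃ₐ[k] A)

local notation "s" => tmap (augAut ε σ)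

/-- The operator `u ⊗ v ↦ (-1)^{|v| (|u| + 1)} (1, v, a, σ(u))`, so that `B (a ⊗ x)` is its
value at the deconcatenation of `x`. -/
def hochRot (a : A) : T ⊗[k] T →ₗ[k] HochChain ε :=
  TensorProduct.mk k A _ 1 ∘ₗ LinearMap.mul' k _ ∘ₗ
    (TensorProduct.comm k _ _).toLinearMap ∘ₗ
    LinearMap.rTensor _ (LinearMap.mulLeft k (τ (toAug ε a)) ∘ₗ (s).toLinearMap) ∘ₗ
    LinearMap.lTensor _ par ∘ₗ koszulSign par par

lemma hochConnes_tmul (a : A) (x : T) :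
    hochConnes ε σ (a ⊗ₜ x) = hochRot ε σ a (deconc x) := by
  have h : ∀ z : T ⊗[k] T, LinearMap.rTensor T (LinearMap.mul' k T ∘ₗ
        TensorProduct.map (TensorAlgebra.ι k ∘ₗ toAug ε) (s).toLinearMap)
        ((TensorProduct.assoc k A T T).symm (a ⊗ₜ z)) =
      LinearMap.rTensor _ (LinearMap.mulLeft k (τ (toAug ε a)) ∘ₗ (s).toLinearMap) z := by
    intro z
    induction z using TensorProduct.induction_on with
    | zero => simp
    | add x y hx hy => rw [TensorProduct.tmul_add, map_add, map_add, map_add, hx, hy]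
    | tmul u v => simp
  simp only [hochConnes, hochRot, LinearMap.comp_apply, LinearMap.lTensor_tmul,
    LinearEquiv.coe_coe]
  rw [h]

variable [CharZero k]

lemma hochRot_tmul (a : A) {u v : T} {p q : ℕ} (hu : par u = (-1 : k) ^ p • u)
    (hv : par v = (-1 : k) ^ q • v) :
    hochRot ε σ a (u ⊗ₜ v) = (-1 : k) ^ (q * (p + 1)) • 1 ⊗ₜ (v * (τ (toAug ε a) * s u)) := by
  rw [hochRot, LinearMap.comp_apply, LinearMap.comp_apply, LinearMap.comp_apply,
    LinearMap.comp_apply, LinearMap.comp_apply, koszulSign_tmul _ _ hu hv]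
  simp only [map_smul, LinearMap.lTensor_tmul, hv, TensorProduct.tmul_smul, smul_smul]
  rw [← pow_add]
  congr 1
  ring

/-- The summand of `B (a, l₁, l₂)` given by the cut between the words `l₁` and `l₂`. -/
def hochRotWord (a : A) (l₁ l₂ : List (AugIdeal ε)) : HochChain ε :=
  (-1 : k) ^ (l₂.length * (l₁.length + 1)) •
    1 ⊗ₜ (word l₂ * (τ (toAug ε a) * s (word l₁)))

omit [CharZero k] in
lemma deconc_word' {W : Type v} [AddCommGroup W] [Module k W] (l : List W) :
    deconc (word (k := k) l) =
      ∑ i ∈ Finset.range (l.length + 1), word (l.take i) ⊗ₜ[k] word (l.drop i) := deconc_word l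

lemma hochConnes_word (a : A) (l : List (AugIdeal ε)) : hochConnes ε σ (a ⊗ₜ word l) =
    ∑ i ∈ Finset.range (l.length + 1), hochRotWord ε σ a (l.take i) (l.drop i) := by
  rw [hochConnes_tmul, deconc_word', map_sum]
  exact Finset.sum_congr rfl fun i _ =>
    hochRot_tmul ε σ a (lengthParity_word _) (lengthParity_word _)

omit [CharZero k] in
lemma parity_tmap {W : Type v} [AddCommGroup W] [Module k W] (f : W →ₗ[k] W)
    (x : TensorAlgebra k W) : lengthParity k W (tmap f x) = tmap f (lengthParity k W x) := by
  induction x using words_induction with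
  | h1 => simp
  | hsmul r x hx => simp [hx]
  | hadd x y hx hy => simp [hx, hy]
  | hι a x hx => simp [lengthParity_mul, hx]

variable {σ} (hε : ∀ a, ε (σ a) = ε a)
include hε

omit [CharZero k] in
lemma coe_augAut (a : AugIdeal ε) : (augAut ε σ a : A) = σ a := by
  simp [augAut, hε, augIdeal_apply]

omit [CharZero k] in
lemma barD_tmap (x : T) : barD ε (s x) = s (barD ε x) := by
  refine words_ext₂ (f := barD ε ∘ₗ (s).toLinearMap) (g := (s).toLinearMap ∘ₗ barD ε) ?_ ?_ ?_ x
  · simp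
  · simp
  · intro a b x
    have hm : ∀ a b, augMul ε (augAut ε σ a ⊗ₜ augAut ε σ b) = augAut ε σ (augMul ε (a ⊗ₜ b)) := by
      intro a b; ext; simp [coe_augAut ε hε]
    induction x using words_induction generalizing a b with
    | h1 => simp [barD_ι_mul, hm]
    | hsmul r x hx => simp only [mul_smul_comm, map_smul, hx]
    | hadd x y hx hy => simp only [mul_add, map_add, hx, hy]
    | hι c x hx =>
      have h := hx b c
      simp only [LinearMap.comp_apply, AlgHom.toLinearMap_apply] at h ⊢
      rw [map_mul, tmap_ι, barD_ι_mul ε (augAut ε σ a), h, barD_ι_mul ε a]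
      simp [hm]

omit [CharZero k] in
/-- The first term of the boundary of the rotation at one cut cancels against the last term for the
rotation at the next cut. -/
lemma hochFirst_add_hochLast_rot (a y : AugIdeal ε) (l₁ l₂ : List (AugIdeal ε)) :
    hochFirst ε σ (hochRotWord ε σ a l₁ (y :: l₂)) +
      hochLast ε (hochRotWord ε σ a (l₁ ++ [y]) l₂) = 0 := by
  have h1 : word l₂ * (τ a * s (word (l₁ ++ [y]))) =
      (word l₂ * (τ a * s (word l₁))) * τ (augAut ε σ y) := by simp [mul_assoc]
  have h2 : par (word l₂ * (τ a * s (word l₁))) =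
      (-1 : k) ^ (l₂.length + l₁.length + 1) • (word l₂ * (τ a * s (word l₁))) := by
    simp only [lengthParity_mul, lengthParity_word, lengthParity_ι, parity_tmap, map_smul]
    simp only [smul_mul_assoc, mul_smul_comm, neg_mul, mul_neg, smul_neg, smul_smul]
    rw [← neg_smul]; congr 1; ring
  simp only [hochRotWord, toAug_coe, map_smul]
  rw [h1, hochLast_mul_ι, h2, word_cons, mul_assoc, hochFirst_ι_mul, coe_augAut ε hε]
  simp only [List.length_cons, List.length_append, List.length_nil, TensorProduct.tmul_smul,
    smul_neg, smul_smul, one_mul, mul_one]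
  rw [← sub_eq_add_neg, sub_eq_zero]
  congr 1
  rcases Nat.even_or_odd l₁.length with hp | hp <;> rcases Nat.even_or_odd l₂.length with hq | hq <;>
    simp [pow_add, pow_mul, mul_add, hp.neg_one_pow, hq.neg_one_pow]

omit [CharZero k] in
/-- After the cancellation between neighbouring cuts, the two extreme cuts leave `T - 1`. -/
lemma sum_hochFirst_hochLast_rot (a : AugIdeal ε) (l : List (AugIdeal ε)) :
    ∑ i ∈ Finset.range (l.length + 1), (hochFirst ε σ (hochRotWord ε σ a (l.take i) (l.drop i)) +
      hochLast ε (hochRotWord ε σ a (l.take i) (l.drop i))) =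
    σ a ⊗ₜ s (word l) - (a : A) ⊗ₜ word l := by
  rw [Finset.sum_add_distrib, Finset.sum_range_succ, Finset.sum_range_succ' _ l.length]
  have h1 : hochFirst ε σ (hochRotWord ε σ a (l.take l.length) (l.drop l.length)) =
      σ a ⊗ₜ s (word l) := by simp [hochRotWord]
  have h2 : hochLast ε (hochRotWord ε σ a (l.take 0) (l.drop 0)) = -((a : A) ⊗ₜ word l) := by
    simp [hochRotWord, lengthParity_word, smul_smul, ← mul_pow]
  have h3 : ∑ i ∈ Finset.range l.length,
        hochFirst ε σ (hochRotWord ε σ a (l.take i) (l.drop i)) +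
      ∑ i ∈ Finset.range l.length,
        hochLast ε (hochRotWord ε σ a (l.take (i + 1)) (l.drop (i + 1))) = 0 := by
    rw [← Finset.sum_add_distrib]
    refine Finset.sum_eq_zero fun i hi => ?_
    have hi' : i < l.length := Finset.mem_range.1 hi
    rw [List.drop_eq_getElem_cons hi', ← List.take_concat_get' l i hi']
    exact hochFirst_add_hochLast_rot ε hε a _ _ _
  rw [h1, h2]
  linear_combination (norm := module) h3

omit hε in
/-- The value of `B` on the last term of the boundary accounts for the products with `a₀` from the
left in `hochConnes_hochInner`. -/
lemma hochConnes_hochLast (a : AugIdeal ε) (l : List (AugIdeal ε)) :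
    hochConnes ε σ (hochLast ε ((a : A) ⊗ₜ word l)) =
    -∑ i ∈ Finset.range (l.length + 1),
      (-1 : k) ^ ((l.drop i).length * ((l.take i).length + 1)) • (1 : A) ⊗ₜ[k]
        ((barD ε (word (l.drop i) * τ a) - barD ε (word (l.drop i)) * τ a) *
          s (word (l.take i))) := by
  rcases List.eq_nil_or_concat' l with rfl | ⟨l, y, rfl⟩
  · simp
  · rw [word_append, word_cons, word_nil, mul_one, hochLast_mul_ι, lengthParity_word,
      map_neg, TensorProduct.tmul_smul, map_smul, hochConnes_word, List.length_append,
      List.length_singleton, Finset.sum_range_succ _ (l.length + 1)]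
    have h0 : (l ++ [y]).drop (l.length + 1) = [] := by simp
    rw [h0]
    simp only [word_nil, one_mul, barD_ι, barD_one, zero_mul, sub_zero, TensorProduct.tmul_zero,
      smul_zero, add_zero, Finset.smul_sum, neg_inj]
    refine Finset.sum_congr rfl fun i hi => ?_
    have hi' : i ≤ l.length := Nat.lt_succ_iff.1 (Finset.mem_range.1 hi)
    obtain ⟨q, hq⟩ := Nat.exists_eq_add_of_le hi'
    rw [List.drop_append_of_le_length hi', List.take_append_of_le_length hi', hochRotWord,
      word_append, word_cons, word_nil, mul_one, barD_mul_ι_mul_ι, sub_sub_cancel_left,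
      lengthParity_word, toAug_coe_mul]
    simp only [List.length_drop, List.length_take, List.length_append, List.length_singleton,
      smul_mul_assoc, neg_mul, TensorProduct.tmul_neg, TensorProduct.tmul_smul, smul_smul, smul_neg, hq, Nat.add_sub_cancel_left, mul_assoc]
    rw [← neg_smul]
    congr 1
    rcases Nat.even_or_odd i with hp | hp <;> rcases Nat.even_or_odd q with hq | hq <;>
      simp [pow_add, pow_mul, mul_add, add_mul, hp.neg_one_pow, hq.neg_one_pow]

/-- The value of `B` on the first term of the boundary accounts for the products with `a₀` from the
right in `hochConnes_hochInner`. -/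
lemma hochConnes_hochFirst (a : AugIdeal ε) (l : List (AugIdeal ε)) :
    hochConnes ε σ (hochFirst ε σ ((a : A) ⊗ₜ word l)) =
    -∑ i ∈ Finset.range (l.length + 1),
      (-1 : k) ^ ((l.drop i).length * ((l.take i).length + 1)) • (1 : A) ⊗ₜ[k]
        (par (word (l.drop i)) * (barD ε (τ a * s (word (l.take i))) +
          τ a * barD ε (s (word (l.take i))))) := by
  cases l with
  | nil => simp
  | cons y l =>
    rw [word_cons, hochFirst_ι_mul, hochConnes_word, List.length_cons,
      Finset.sum_range_succ' _ (l.length + 1)]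
    simp only [List.take_zero, List.drop_zero, word_nil, map_one, mul_one, barD_ι, barD_one,
      mul_zero, TensorProduct.tmul_zero, smul_zero, add_zero, ← Finset.sum_neg_distrib]
    refine Finset.sum_congr rfl fun i hi => ?_
    have hi' : i ≤ l.length := Nat.lt_succ_iff.1 (Finset.mem_range.1 hi)
    obtain ⟨q, hq⟩ := Nat.exists_eq_add_of_le hi'
    rw [hochRotWord, ← coe_augAut ε hε, toAug_coe_mul, List.take_succ_cons, List.drop_succ_cons,
      word_cons, map_mul (s), tmap_ι, barD_ι_mul, sub_add_cancel, mulFirst_ι_mul,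
      lengthParity_word]
    simp only [List.length_drop, List.length_take, List.length_cons,
      smul_mul_assoc, mul_neg, TensorProduct.tmul_neg, TensorProduct.tmul_smul, smul_smul, smul_neg, hq, Nat.add_sub_cancel_left, neg_neg]
    congr 1
    rcases Nat.even_or_odd i with hp | hp <;> rcases Nat.even_or_odd q with hq | hq <;>
      simp [pow_add, pow_mul, mul_add, hp.neg_one_pow, hq.neg_one_pow]

/-- The products of neighbours in `b B + B b` cancel, except for those with `a₀` in the rotated words
`v a₀ σ(u)`, which do not occur in the differentials of `u` and `v`. -/
lemma hochConnes_hochInner (a : AugIdeal ε) (l : List (AugIdeal ε)) :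
    hochInner ε (hochConnes ε σ ((a : A) ⊗ₜ word l)) +
      hochConnes ε σ (hochInner ε ((a : A) ⊗ₜ word l)) =
    (∑ i ∈ Finset.range (l.length + 1),
      (-1 : k) ^ ((l.drop i).length * ((l.take i).length + 1)) • (1 : A) ⊗ₜ[k]
        ((barD ε (word (l.drop i) * τ a) - barD ε (word (l.drop i)) * τ a) *
          s (word (l.take i)))) +
    ∑ i ∈ Finset.range (l.length + 1),
      (-1 : k) ^ ((l.drop i).length * ((l.take i).length + 1)) • (1 : A) ⊗ₜ[k]
        (par (word (l.drop i)) * (barD ε (τ a * s (word (l.take i))) +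
          τ a * barD ε (s (word (l.take i))))) := by
  rw [hochInner_tmul, hochConnes_tmul ε σ _ (barD ε (word l)), deconc_barD, hochConnes_word,
    deconc_word']
  simp only [map_sum, ← Finset.sum_add_distrib, map_add]
  refine Finset.sum_congr rfl fun i _ => ?_
  generalize l.take i = l₁
  generalize l.drop i = l₂
  have hp : par (barD ε (word l₁)) = (-1 : k) ^ (l₁.length + 1) • barD ε (word l₁) := by
    rw [← neg_inj, ← barD_parity, lengthParity_word, map_smul, pow_succ]; simp
  have hq : par (barD ε (word l₂)) = (-1 : k) ^ (l₂.length + 1) • barD ε (word l₂) := by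
    rw [← neg_inj, ← barD_parity, lengthParity_word, map_smul, pow_succ]; simp
  rw [LinearMap.rTensor_tmul, TensorProduct.map_tmul, hochRot_tmul ε σ a hp (lengthParity_word _),
    hochRot_tmul ε σ a (p := l₁.length) (q := l₂.length + 1) (by
      rw [lengthParity_word, map_smul, lengthParity_word]) hq]
  rw [hochRotWord, map_smul, hochInner_tmul, toAug_coe, ← mul_assoc (word l₂), barD_mul_ι_mul,
    lengthParity_word, lengthParity_word, map_smul, barD_tmap ε hε]
  have e1 : (-1 : k) ^ (l₂.length * (l₁.length + 1 + 1)) =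
      (-1) ^ (l₂.length * (l₁.length + 1)) * (-1) ^ l₂.length := by
    ring
  have e2 : (-1 : k) ^ ((l₂.length + 1) * (l₁.length + 1)) =
      -((-1) ^ (l₂.length * (l₁.length + 1)) * (-1) ^ l₁.length) := by
    ring
  have e3 : (-1 : k) ^ l₁.length * (-1) ^ l₁.length = 1 := by rw [← mul_pow]; simp
  rw [e1, e2]
  simp only [mul_add, sub_mul, TensorProduct.tmul_add, TensorProduct.tmul_sub, smul_mul_assoc,
    mul_smul_comm, TensorProduct.tmul_smul, smul_add, smul_sub, smul_smul, mul_assoc, neg_mul, e3,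
    neg_smul, mul_one]
  abel

/-- For `a₀ = 1` the operator `B` itself vanishes, and in `B b` only the first and the last term of
`b` matter; their contributions telescope with those of `hochConnes_hochLast_one`. -/
lemma hochConnes_hochFirst_one (l : List (AugIdeal ε)) :
    hochConnes ε σ (hochFirst ε σ (1 ⊗ₜ word l)) =
    ∑ i ∈ Finset.range l.length, (-1 : k) ^ ((l.length - (i + 1)) * (i + 1)) •
      (1 : A) ⊗ₜ[k] (word (l.drop (i + 1)) * s (word (l.take (i + 1)))) := by
  cases l with
  | nil => simp
  | cons y l =>
    rw [word_cons, hochFirst_ι_mul, one_mul, hochConnes_word, List.length_cons]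
    refine Finset.sum_congr rfl fun i hi => ?_
    have hi' : i ≤ l.length := Nat.lt_succ_iff.1 (Finset.mem_range.1 hi)
    rw [hochRotWord, ← coe_augAut ε hε, toAug_coe]
    simp [min_eq_left hi']

omit hε in
lemma hochConnes_hochLast_one (l : List (AugIdeal ε)) :
    hochConnes ε σ (hochLast ε (1 ⊗ₜ word l)) =
    -∑ i ∈ Finset.range l.length, (-1 : k) ^ ((l.length - i) * i) •
      (1 : A) ⊗ₜ[k] (word (l.drop i) * s (word (l.take i))) := by
  rcases List.eq_nil_or_concat' l with rfl | ⟨l, y, rfl⟩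
  · simp
  · rw [word_append, word_cons, word_nil, mul_one, hochLast_mul_ι, lengthParity_word,
      map_neg, TensorProduct.tmul_smul, map_smul, mul_one, hochConnes_word, List.length_append,
      List.length_singleton, Finset.smul_sum, neg_inj]
    refine Finset.sum_congr rfl fun i hi => ?_
    have hi' : i ≤ l.length := Nat.lt_succ_iff.1 (Finset.mem_range.1 hi)
    obtain ⟨q, hq⟩ := Nat.exists_eq_add_of_le hi'
    rw [List.drop_append_of_le_length hi', List.take_append_of_le_length hi', hochRotWord,
      word_append, word_cons, word_nil, mul_one, toAug_coe]
    simp only [List.length_drop, List.length_take, smul_smul,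
      hq, Nat.add_sub_cancel_left, mul_assoc,
      show i + q + 1 - i = q + 1 by omega]
    congr 1
    rcases Nat.even_or_odd i with hp | hp <;> rcases Nat.even_or_odd q with hq | hq <;>
      simp [pow_add, pow_mul, mul_add, add_mul, hp.neg_one_pow, hq.neg_one_pow]

/-- The twisted cyclic structure: `T - 1` is null-homotopic by Connes' operator. -/
theorem hochB_hochConnes (z : HochChain ε) :
    hochB ε σ (hochConnes ε σ z) + hochConnes ε σ (hochB ε σ z) = hochT ε σ z - z := by
  have : hochB ε σ ∘ₗ hochConnes ε σ + hochConnes ε σ ∘ₗ hochB ε σ =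
      hochT ε σ - LinearMap.id := by
    refine hoch_ext ε fun a x => ?_
    refine words_ext_list (f := (hochB ε σ ∘ₗ hochConnes ε σ + hochConnes ε σ ∘ₗ hochB ε σ) ∘ₗ
      TensorProduct.mk k _ _ a) (g := (hochT ε σ - LinearMap.id) ∘ₗ TensorProduct.mk k _ _ a)
      (fun l => ?_) x
    -- `B` only sees the component of `a` in `Ā`, so scalars are treated separately
    obtain ⟨a', r, ha⟩ : ∃ (a' : AugIdeal ε) (r : k), a = a' + r • 1 :=
      ⟨toAug ε a, ε a, by simp [Algebra.algebraMap_eq_smul_one]⟩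
    have h1 : hochB ε σ (hochConnes ε σ ((a' : A) ⊗ₜ word l)) +
        hochConnes ε σ (hochB ε σ ((a' : A) ⊗ₜ word l)) =
        σ a' ⊗ₜ s (word l) - (a' : A) ⊗ₜ word l := by
      have e1 := hochConnes_hochInner ε hε a' l
      have e2 := hochConnes_hochFirst ε hε a' l
      have e3 := hochConnes_hochLast ε (σ := σ) a' l
      have e4 := sum_hochFirst_hochLast_rot ε hε a' l
      simp only [hochB, LinearMap.add_apply, map_add]
      rw [Finset.sum_add_distrib, ← map_sum, ← map_sum, ← hochConnes_word] at e4
      linear_combination (norm := module) e1 + e2 + e3 + e4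
    have h2 : hochB ε σ (hochConnes ε σ (1 ⊗ₜ word l)) +
        hochConnes ε σ (hochB ε σ (1 ⊗ₜ word l)) =
        1 ⊗ₜ s (word l) - 1 ⊗ₜ word l := by
      have e0 : ∀ x, hochConnes ε σ (1 ⊗ₜ x) = 0 := fun x => by
        rw [hochConnes_tmul]
        simp [hochRot]
      have e2 := hochConnes_hochFirst_one ε hε l
      have e3 := hochConnes_hochLast_one ε (σ := σ) l
      have e4 := Finset.sum_range_sub (fun i => (-1 : k) ^ ((l.length - i) * i) •
        (1 : A) ⊗ₜ[k] (word (l.drop i) * s (word (l.take i)))) l.length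
      rw [Finset.sum_sub_distrib] at e4
      simp at e4
      simp only [hochB, LinearMap.add_apply, map_add, hochInner_tmul, e0, map_zero]
      rw [e2, e3, ← e4]
      abel
    simp only [LinearMap.comp_apply, LinearMap.add_apply, LinearMap.sub_apply,
      LinearMap.id_apply, ha, map_add, map_smul, LinearMap.smul_apply, TensorProduct.mk_apply]
    have h3 : hochT ε σ ((a' : A) ⊗ₜ word l) = σ a' ⊗ₜ s (word l) := rfl
    have h4 : hochT ε σ (1 ⊗ₜ word l) = 1 ⊗ₜ s (word l) := by simp [hochT]
    rw [h3, h4]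
    have h2' := congrArg (r • ·) h2
    simp only [smul_add, smul_sub] at h2'
    linear_combination (norm := module) h1 + h2'
  exact LinearMap.congr_fun this z

end HochConnes

/-! ### The Koszul dual coalgebra and its cobar construction -/

section DualMaps
variable {k : Type u} [Field k] {V : Type v} [AddCommGroup V] [Module k V]
  {R : Submodule k (V ⊗[k] V)}

lemma tmap_comp {W : Type v} [AddCommGroup W] [Module k W] {W' : Type w} [AddCommGroup W']
    [Module k W'] {W'' : Type x} [AddCommGroup W''] [Module k W''] (g : W' →ₗ[k] W'')
    (f : W →ₗ[k] W') (y : TensorAlgebra k W) : tmap g (tmap f y) = tmap (g ∘ₗ f) y := by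
  induction y using words_induction with
  | h1 => simp
  | hsmul r x hx => simp [hx]
  | hadd x y hx hy => simp [hx, hy]
  | hι a x hx => simp [hx]

lemma tmap_id {W : Type v} [AddCommGroup W] [Module k W] (y : TensorAlgebra k W) :
    tmap (LinearMap.id : W →ₗ[k] W) y = y := by
  induction y using words_induction with
  | h1 => simp
  | hsmul r x hx => simp [hx]
  | hadd x y hx hy => simp [hx, hy]
  | hι a x hx => simp [hx]

lemma deconc_tmap {W : Type v} [AddCommGroup W] [Module k W] {W' : Type w} [AddCommGroup W']
    [Module k W'] (f : W →ₗ[k] W') (y : TensorAlgebra k W) :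
    deconc (tmap f y) = TensorProduct.map (tmap f).toLinearMap (tmap f).toLinearMap (deconc y) := by
  induction y using words_induction with
  | h1 => simp
  | hsmul r x hx => simp [hx]
  | hadd x y hx hy => simp [hx, hy]
  | hι a x hx =>
    have h : LinearMap.mulLeft k (TensorAlgebra.ι k (f a)) ∘ₗ (tmap f).toLinearMap =
        (tmap f).toLinearMap ∘ₗ LinearMap.mulLeft k (TensorAlgebra.ι k a) := by ext y; simp
    rw [map_mul, tmap_ι, deconc_ι_mul, hx, deconc_ι_mul, map_add, TensorProduct.map_tmul,
      ← LinearMap.comp_apply (LinearMap.rTensor _ _), LinearMap.rTensor_comp_map, h,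
      ← LinearMap.comp_apply (TensorProduct.map _ _) (LinearMap.rTensor _ _),
      LinearMap.map_comp_rTensor]
    simp

@[simp] lemma algebraMapInv_tmap {W : Type v} [AddCommGroup W] [Module k W] {W' : Type w}
    [AddCommGroup W'] [Module k W'] (f : W →ₗ[k] W') (y : TensorAlgebra k W) :
    TensorAlgebra.algebraMapInv (tmap f y) = TensorAlgebra.algebraMapInv y := by
  induction y using words_induction with
  | h1 => simp
  | hsmul r x hx => simp [hx]
  | hadd x y hx hy => simp [hx, hy]
  | hι a x hx => simp

@[simp] lemma incl_dualMap (f : V →ₗ[k] V) (hf : R.map (TensorProduct.map f f) ≤ R)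
    (c : KoszulDual R) : incl R (dualMap f hf c) = tmap f (incl R c) := rfl

lemma map_incl_injective :
    Function.Injective (TensorProduct.map (incl R) (incl R)) :=
  TensorProduct.map_injective_of_flat_flat _ _ incl_injective incl_injective

lemma map_incl_comul (c : KoszulDual R) :
    TensorProduct.map (incl R) (incl R) (Coalgebra.comul (R := k) c) = deconc (incl R c) :=
  map_subtype_dualComul c

lemma counit_eq (c : KoszulDual R) :
    Coalgebra.counit (R := k) c = TensorAlgebra.algebraMapInv (incl R c) := rfl

lemma incl_dualOne : incl R (dualOne R) = 1 := rfl

@[simp] lemma counit_dualOne : Coalgebra.counit (R := k) (dualOne R) = 1 := by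
  rw [counit_eq, incl_dualOne, map_one]

@[simp] lemma comul_dualOne :
    Coalgebra.comul (R := k) (dualOne R) = dualOne R ⊗ₜ dualOne R := by
  apply map_incl_injective
  rw [map_incl_comul, incl_dualOne]
  simp [incl_dualOne]

/-- Morphisms of coaugmented coalgebras `A^¡ → A^¡`. -/
structure IsCoaugHom (s : KoszulDual R →ₗ[k] KoszulDual R) : Prop where
  comul : ∀ c, Coalgebra.comul (R := k) (s c) = TensorProduct.map s s (Coalgebra.comul c)
  counit : ∀ c, Coalgebra.counit (R := k) (s c) = Coalgebra.counit c
  one : s (dualOne R) = dualOne R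

lemma isCoaugHom_dualMap (f : V →ₗ[k] V) (hf : R.map (TensorProduct.map f f) ≤ R) :
    IsCoaugHom (dualMap f hf) where
  comul c := by
    apply map_incl_injective
    rw [map_incl_comul, incl_dualMap, deconc_tmap, ← map_incl_comul]
    generalize Coalgebra.comul (R := k) c = z
    induction z using TensorProduct.induction_on with
    | zero => simp
    | add x y hx hy => simp only [map_add, hx, hy]
    | tmul x y => simp
  counit c := by rw [counit_eq, counit_eq, incl_dualMap, algebraMapInv_tmap]
  one := incl_injective (by rw [incl_dualMap, incl_dualOne, map_one])

lemma isCoaugHom_id : IsCoaugHom (LinearMap.id : KoszulDual R →ₗ[k] KoszulDual R) where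
  comul c := by simp
  counit c := rfl
  one := rfl

lemma isCoaugHom_parity : IsCoaugHom (dualParity R) := isCoaugHom_dualMap _ _

@[simp] lemma dualParity_dualParity (c : KoszulDual R) : dualParity R (dualParity R c) = c := by
  apply incl_injective
  rw [dualParity, incl_dualMap, incl_dualMap, tmap_comp]
  convert tmap_id _
  ext; simp

@[simp] lemma dualParity_one : dualParity R (dualOne R) = dualOne R := isCoaugHom_parity.one

@[simp] lemma coe_toDualAug (c : KoszulDual R) : (toDualAug R c : KoszulDual R) =
    c - Coalgebra.counit (R := k) c • dualOne R := rfl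

lemma counit_coe (a : DualAug R) : Coalgebra.counit (R := k) (a : KoszulDual R) = 0 := a.2

@[simp] lemma toDualAug_coe (a : DualAug R) : toDualAug R (a : KoszulDual R) = a := by
  ext; simp

@[simp] lemma toDualAug_one : toDualAug R (dualOne R) = 0 := by ext; simp

@[simp] lemma letter_one : letter R (dualOne R) = 0 := by simp [letter]

lemma letter_coe (a : DualAug R) : letter R (a : KoszulDual R) = TensorAlgebra.ι k a := by
  simp [letter]

lemma letter_coe_toDualAug (c : KoszulDual R) :
    letter R (toDualAug R c : KoszulDual R) = letter R c := by simp [letter]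

lemma coe_restrictAug {s : KoszulDual R →ₗ[k] KoszulDual R}
    (hs : ∀ c, Coalgebra.counit (R := k) c = 0 → Coalgebra.counit (R := k) (s c) = 0)
    (a : DualAug R) : (restrictAug s a : KoszulDual R) = s a := by
  simp [restrictAug, hs _ (counit_coe a)]

lemma cobarMap_mul (s : KoszulDual R →ₗ[k] KoszulDual R) (x y : Cobar R) :
    cobarMap s (x * y) = cobarMap s x * cobarMap s y :=
  map_mul (tmap (restrictAug s)) x y

@[simp] lemma cobarMap_one (s : KoszulDual R →ₗ[k] KoszulDual R) : cobarMap s 1 = 1 :=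
  map_one (tmap (restrictAug s))

lemma toDualAug_map {s : KoszulDual R →ₗ[k] KoszulDual R} (hs : IsCoaugHom s)
    (c : KoszulDual R) : toDualAug R (s c) = restrictAug s (toDualAug R c) := by
  ext
  rw [coe_restrictAug (fun c hc => by rw [hs.counit, hc])]
  simp [hs.counit, hs.one]

@[simp] lemma cobarMap_letter {s : KoszulDual R →ₗ[k] KoszulDual R} (hs : IsCoaugHom s)
    (c : KoszulDual R) : cobarMap s (letter R c) = letter R (s c) := by
  simp [letter, cobarMap, toDualAug_map hs]

lemma cobarParity_mul (x y : Cobar R) :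
    cobarParity R (x * y) = cobarParity R x * cobarParity R y := cobarMap_mul _ x y

@[simp] lemma cobarParity_one : cobarParity R 1 = 1 := cobarMap_one _

@[simp] lemma cobarParity_letter (c : KoszulDual R) :
    cobarParity R (letter R c) = -letter R (dualParity R c) := by
  have h : restrictAug (-dualParity R) = -restrictAug (dualParity R) := by
    simp [restrictAug, LinearMap.neg_comp, LinearMap.comp_neg]
  simp only [cobarParity, cobarMap, letter, LinearMap.comp_apply, AlgHom.toLinearMap_apply,
    tmap_ι, h, LinearMap.neg_apply, map_neg, toDualAug_map isCoaugHom_parity]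

lemma cobar_induction {Q : Cobar R → Prop} (h1 : Q 1)
    (hsmul : ∀ (r : k) x, Q x → Q (r • x)) (hι : ∀ c x, Q x → Q (letter R c * x))
    (hadd : ∀ x y, Q x → Q y → Q (x + y)) (x : Cobar R) : Q x :=
  words_induction h1 hsmul (fun a x hx => by rw [← letter_coe]; exact hι _ _ hx) hadd x

@[simp] lemma cobarParity_cobarParity (x : Cobar R) : cobarParity R (cobarParity R x) = x := by
  induction x using cobar_induction with
  | h1 => simp
  | hsmul r x hx => simp [hx]
  | hadd x y hx hy => simp [hx, hy]
  | hι c x hx => simp [cobarParity_mul, hx]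

end DualMaps

section CobarDifferential
variable {k : Type u} [Field k] {V : Type v} [AddCommGroup V] [Module k V]
  {R : Submodule k (V ⊗[k] V)}

local notation "ℓ" => letter R
local notation "P" => dualParity R
local notation "PΩ" => cobarParity R
local notation "Δ" => Coalgebra.comul (R := k) (A := KoszulDual R)

lemma coassoc_apply' (c : KoszulDual R) :
    TensorProduct.assoc k _ _ _ (LinearMap.rTensor _ Δ (Δ c)) = LinearMap.lTensor _ Δ (Δ c) :=
  Coalgebra.coassoc_apply c

/-- Two sums over the iterated coproduct `∑ c' ⊗ c'' ⊗ c'''`, one obtained by splitting the left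
factor of `Δ c` and one by splitting the right factor, agree. -/
lemma sweedler₃ {Z : Type w} [AddCommGroup Z] [Module k Z]
    (H : KoszulDual R ⊗[k] (KoszulDual R ⊗[k] KoszulDual R) →ₗ[k] Z)
    (F G : KoszulDual R ⊗[k] KoszulDual R →ₗ[k] Z)
    (hF : ∀ a b, F (a ⊗ₜ b) = H (TensorProduct.assoc k _ _ _ (Δ a ⊗ₜ b)))
    (hG : ∀ a b, G (a ⊗ₜ b) = H (a ⊗ₜ Δ b)) (c : KoszulDual R) : F (Δ c) = G (Δ c) := by
  have h1 : F = H ∘ₗ (TensorProduct.assoc k _ _ _).toLinearMap ∘ₗ LinearMap.rTensor _ Δ :=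
    TensorProduct.ext' fun a b => by rw [hF]; rfl
  have h2 : G = H ∘ₗ LinearMap.lTensor _ Δ := TensorProduct.ext' fun a b => by rw [hG]; rfl
  rw [h1, h2]
  simp only [LinearMap.comp_apply, LinearEquiv.coe_coe]
  rw [coassoc_apply']

variable (R) in
/-- The cobar differential of a letter, `c ↦ ∑ (-1)^{|c'|} c' c''`. -/
def letterD : KoszulDual R →ₗ[k] Cobar R :=
  LinearMap.mul' k _ ∘ₗ TensorProduct.map (ℓ ∘ₗ P) ℓ ∘ₗ Δ

@[simp] lemma letterD_one : letterD R (dualOne R) = 0 := by simp [letterD]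

@[simp] lemma cobarD_one : cobarD R 1 = 0 := by simp [cobarD]

lemma letterD_toDualAug (c : KoszulDual R) : letterD R (toDualAug R c) = letterD R c := by
  simp

lemma cobarD_letter_mul (c : KoszulDual R) (x : Cobar R) :
    cobarD R (ℓ c * x) = letterD R c * x + PΩ (ℓ c) * cobarD R x := by
  have h : ∀ (a : DualAug R) (g : DualAug R ⊗[k] Cobar R →ₗ[k] Cobar R)
      (z : Cobar R ⊗[k] (DualAug R ⊗[k] Cobar R)),
      LinearMap.mul' k _ (TensorProduct.map PΩ g (LinearMap.rTensor _
        (LinearMap.mulLeft k (TensorAlgebra.ι k a)) z)) =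
      PΩ (TensorAlgebra.ι k a) * LinearMap.mul' k _ (TensorProduct.map PΩ g z) := by
    intro a g z
    induction z using TensorProduct.induction_on with
    | zero => simp
    | add x y hx hy => simp only [map_add, hx, hy, mul_add]
    | tmul x y => simp [cobarParity_mul, mul_assoc]
  rw [← letterD_toDualAug, ← letter_coe_toDualAug c, letter_coe]
  simp only [cobarD, LinearMap.comp_apply, markLetter_ι_mul, map_add, h]
  congr 1
  simp [letterD]

@[simp] lemma cobarD_letter (c : KoszulDual R) : cobarD R (ℓ c) = letterD R c := by
  simpa using cobarD_letter_mul c 1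

lemma cobarD_mul (x y : Cobar R) :
    cobarD R (x * y) = cobarD R x * y + PΩ x * cobarD R y := by
  induction x using cobar_induction with
  | h1 => simp
  | hsmul r x hx => simp [hx]
  | hadd x z hx hz => simp only [add_mul, map_add, hx, hz]; abel
  | hι c x hx =>
    rw [mul_assoc, cobarD_letter_mul, hx, cobarD_letter_mul, cobarParity_mul]
    noncomm_ring

lemma cobarParity_letterD (c : KoszulDual R) : PΩ (letterD R c) = letterD R (P c) := by
  simp only [letterD, LinearMap.comp_apply, isCoaugHom_parity.comul]
  generalize Δ c = z
  induction z using TensorProduct.induction_on with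
  | zero => simp
  | add x y hx hy => simp only [map_add, hx, hy]
  | tmul x y => simp [cobarParity_mul]

lemma cobarD_parity (x : Cobar R) : cobarD R (PΩ x) = -PΩ (cobarD R x) := by
  induction x using cobar_induction with
  | h1 => simp
  | hsmul r x hx => simp [hx]
  | hadd x z hx hz => simp only [map_add, hx, hz]; abel
  | hι c x hx =>
    rw [cobarParity_mul, cobarD_mul, hx, cobarD_letter_mul, map_add, cobarParity_mul,
      cobarParity_mul, cobarParity_letterD, cobarParity_letter, map_neg, cobarD_letter]
    noncomm_ring

lemma cobarD_letterD (c : KoszulDual R) : cobarD R (letterD R c) = 0 := by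
  let H : KoszulDual R ⊗[k] (KoszulDual R ⊗[k] KoszulDual R) →ₗ[k] Cobar R :=
    LinearMap.mul' k _ ∘ₗ TensorProduct.map ℓ
      (LinearMap.mul' k _ ∘ₗ TensorProduct.map (ℓ ∘ₗ P) ℓ)
  have key := sweedler₃ H
    (LinearMap.mul' k _ ∘ₗ TensorProduct.map (letterD R ∘ₗ P) ℓ)
    (LinearMap.mul' k _ ∘ₗ TensorProduct.map ℓ (letterD R)) (fun a b => ?_) (fun a b => ?_) c
  · have h2 : ∀ z : KoszulDual R ⊗[k] KoszulDual R,
        cobarD R (LinearMap.mul' k _ (TensorProduct.map (ℓ ∘ₗ P) ℓ z)) =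
        LinearMap.mul' k _ (TensorProduct.map (letterD R ∘ₗ P) ℓ z) -
          LinearMap.mul' k _ (TensorProduct.map ℓ (letterD R) z) := by
      intro z
      induction z using TensorProduct.induction_on with
      | zero => simp
      | add x y hx hy => simp only [map_add, hx, hy]; abel
      | tmul x y => simp [cobarD_letter_mul, sub_eq_add_neg]
    rw [letterD, LinearMap.comp_apply, LinearMap.comp_apply, h2, sub_eq_zero]
    exact key
  · simp only [LinearMap.comp_apply, TensorProduct.map_tmul, LinearMap.mul'_apply, letterD,
      isCoaugHom_parity.comul]
    generalize Δ a = z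
    induction z using TensorProduct.induction_on with
    | zero => simp
    | add x y hx hy => simp only [map_add, add_mul, hx, hy, TensorProduct.add_tmul]
    | tmul x y => simp [H, mul_assoc]
  · simp only [LinearMap.comp_apply, TensorProduct.map_tmul, LinearMap.mul'_apply, letterD, H]

/-- The cobar differential squares to zero, by coassociativity. -/
lemma cobarD_cobarD (x : Cobar R) : cobarD R (cobarD R x) = 0 := by
  induction x using cobar_induction with
  | h1 => simp
  | hsmul r x hx => simp [hx]
  | hadd x z hx hz => simp [hx, hz]
  | hι c x hx =>
    rw [cobarD_letter_mul, map_add, cobarD_mul, cobarD_mul, hx, cobarD_letterD, cobarD_parity,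
      cobarD_letter]
    simp

lemma cobarMap_letterD {s : KoszulDual R →ₗ[k] KoszulDual R} (hs : IsCoaugHom s)
    (hsP : ∀ c, s (P c) = P (s c)) (c : KoszulDual R) :
    cobarMap s (letterD R c) = letterD R (s c) := by
  simp only [letterD, LinearMap.comp_apply, hs.comul]
  generalize Δ c = z
  induction z using TensorProduct.induction_on with
  | zero => simp
  | add x y hx hy => simp only [map_add, hx, hy]
  | tmul x y => simp [cobarMap_mul, hs, hsP]

lemma cobarMap_parity {s : KoszulDual R →ₗ[k] KoszulDual R} (hs : IsCoaugHom s)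
    (hsP : ∀ c, s (P c) = P (s c)) (x : Cobar R) : cobarMap s (PΩ x) = PΩ (cobarMap s x) := by
  induction x using cobar_induction with
  | h1 => simp
  | hsmul r x hx => simp [hx]
  | hadd x z hx hz => simp only [map_add, hx, hz]
  | hι c x hx => simp [cobarMap_mul, cobarParity_mul, hx, hs, hsP]

lemma cobarMap_cobarD {s : KoszulDual R →ₗ[k] KoszulDual R} (hs : IsCoaugHom s)
    (hsP : ∀ c, s (P c) = P (s c)) (x : Cobar R) :
    cobarMap s (cobarD R x) = cobarD R (cobarMap s x) := by
  induction x using cobar_induction with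
  | h1 => simp
  | hsmul r x hx => simp [hx]
  | hadd x z hx hz => simp only [map_add, hx, hz]
  | hι c x hx =>
    rw [cobarD_letter_mul, map_add, cobarMap_mul, cobarMap_mul, cobarMap_mul, cobarD_mul, hx,
      cobarMap_letterD hs hsP, cobarMap_parity hs hsP, cobarMap_letter hs, cobarD_letter]

end CobarDifferential

/-! ### The Hochschild boundary of the coalgebra -/

section CoHoch
variable {k : Type u} [Field k] {V : Type v} [AddCommGroup V] [Module k V]
  {R : Submodule k (V ⊗[k] V)}

local notation "ℓ" => letter R
local notation "P" => dualParity R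
local notation "PΩ" => cobarParity R
local notation "Δ" => Coalgebra.comul (R := k) (A := KoszulDual R)

lemma IsCoaugHom.comp {s t : KoszulDual R →ₗ[k] KoszulDual R} (hs : IsCoaugHom s)
    (ht : IsCoaugHom t) : IsCoaugHom (s ∘ₗ t) where
  comul c := by
    rw [LinearMap.comp_apply, hs.comul, ht.comul, ← LinearMap.comp_apply,
      ← TensorProduct.map_comp]
  counit c := by rw [LinearMap.comp_apply, hs.counit, ht.counit]
  one := by rw [LinearMap.comp_apply, ht.one, hs.one]

lemma isCoaugHom_parity_pow (q : ℕ) : IsCoaugHom (P ^ q) := by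
  induction q with
  | zero => exact isCoaugHom_id
  | succ q ih => rw [pow_succ]; exact ih.comp isCoaugHom_parity

@[simp] lemma parity_pow_succ (q : ℕ) (c : KoszulDual R) : (P ^ q) (P c) = (P ^ (q + 1)) c := by
  rw [pow_succ]; rfl

@[simp] lemma parity_parity_pow (q : ℕ) (c : KoszulDual R) : P ((P ^ q) c) = (P ^ (q + 1)) c := by
  rw [pow_succ']; rfl

@[simp] lemma parity_pow_add_two (q : ℕ) (c : KoszulDual R) : (P ^ (q + 1 + 1)) c = (P ^ q) c := by
  rw [← parity_pow_succ, ← parity_pow_succ, dualParity_dualParity]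

@[simp] lemma cobarParity_pow_succ (q : ℕ) (c : Cobar R) : (PΩ ^ q) (PΩ c) = (PΩ ^ (q + 1)) c := by
  rw [pow_succ]; rfl

@[simp] lemma cobarParity_parity_pow (q : ℕ) (c : Cobar R) :
    PΩ ((PΩ ^ q) c) = (PΩ ^ (q + 1)) c := by
  rw [pow_succ']; rfl

@[simp] lemma cobarParity_pow_add_two (q : ℕ) (c : Cobar R) :
    (PΩ ^ (q + 1 + 1)) c = (PΩ ^ q) c := by
  rw [← cobarParity_pow_succ, ← cobarParity_pow_succ, cobarParity_cobarParity]

@[simp] lemma cobarParity_pow_one (q : ℕ) : (PΩ ^ q) 1 = 1 := by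
  induction q with
  | zero => rfl
  | succ q ih => rw [← cobarParity_parity_pow, ih, cobarParity_one]

lemma cobarParity_pow_mul (q : ℕ) (x y : Cobar R) :
    (PΩ ^ q) (x * y) = (PΩ ^ q) x * (PΩ ^ q) y := by
  induction q with
  | zero => rfl
  | succ q ih => simp only [← cobarParity_parity_pow, ih, cobarParity_mul]

@[simp] lemma cobarParity_pow_letter (q : ℕ) (c : KoszulDual R) :
    (PΩ ^ q) (ℓ c) = (-1 : k) ^ q • ℓ ((P ^ q) c) := by
  induction q with
  | zero => simp
  | succ q ih =>
    rw [← cobarParity_parity_pow, ih, map_smul, cobarParity_letter, parity_parity_pow, pow_succ]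
    module

lemma cobarD_parity_pow (q : ℕ) (x : Cobar R) :
    cobarD R ((PΩ ^ q) x) = (-1 : k) ^ q • (PΩ ^ q) (cobarD R x) := by
  induction q with
  | zero => simp
  | succ q ih =>
    rw [← cobarParity_parity_pow, cobarD_parity, ih, map_smul, cobarParity_parity_pow, pow_succ]
    module

lemma map_parity_pow {s : KoszulDual R →ₗ[k] KoszulDual R}
    (hsP : ∀ c, s (P c) = P (s c)) (q : ℕ) (c : KoszulDual R) : s ((P ^ q) c) = (P ^ q) (s c) := by
  induction q with
  | zero => simp
  | succ q ih => simp only [← parity_parity_pow, hsP, ih]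

lemma letterD_parity_pow (q : ℕ) (c : KoszulDual R) :
    letterD R ((P ^ q) c) =
      LinearMap.mul' k _ (TensorProduct.map (ℓ ∘ₗ P ^ (q + 1)) (ℓ ∘ₗ P ^ q) (Δ c)) := by
  simp only [letterD, LinearMap.comp_apply, (isCoaugHom_parity_pow q).comul]
  generalize Δ c = z
  induction z using TensorProduct.induction_on with
  | zero => simp
  | add x y hx hy => simp only [map_add, hx, hy]
  | tmul x y => simp

lemma coHochLeft_tmul (s : KoszulDual R →ₗ[k] KoszulDual R) (x : Cobar R) (m : KoszulDual R) :
    coHochLeft s (x ⊗ₜ m) =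
      TensorProduct.map (LinearMap.mulLeft k (PΩ x) ∘ₗ ℓ ∘ₗ s ∘ₗ P) LinearMap.id (Δ m) := by
  simp only [coHochLeft, LinearMap.comp_apply, LinearMap.lTensor_tmul]
  generalize Δ m = z
  induction z using TensorProduct.induction_on with
  | zero => simp
  | add x y hx hy => simp only [map_add, hx, hy, TensorProduct.tmul_add]
  | tmul x y => simp

/-- `ω ⊗ m ↦ ∑ ℓ(m'') ω ⊗ m'` with the sign `(-1)^{q |m''| + 1}`. On chains of total parity `q`
this is `coHochRight`. -/
def coHochRightOf (q : ℕ) : CoHochChain R →ₗ[k] CoHochChain R :=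
  -(LinearMap.rTensor _ (LinearMap.mul' k _ ∘ₗ
      (TensorProduct.comm k (Cobar R) (Cobar R)).toLinearMap ∘ₗ LinearMap.lTensor _ (ℓ ∘ₗ P ^ q)) ∘ₗ
    (TensorProduct.assoc k (Cobar R) (KoszulDual R) (KoszulDual R)).symm.toLinearMap ∘ₗ
    LinearMap.lTensor _ ((TensorProduct.comm k _ _).toLinearMap ∘ₗ Coalgebra.comul))

lemma coHochRightOf_tmul (q : ℕ) (x : Cobar R) (m : KoszulDual R) :
    coHochRightOf q (x ⊗ₜ m) =
      -TensorProduct.map (LinearMap.mulRight k x ∘ₗ ℓ ∘ₗ P ^ q) LinearMap.id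
        (TensorProduct.comm k _ _ (Δ m)) := by
  simp only [coHochRightOf, LinearMap.comp_apply, LinearMap.lTensor_tmul, LinearMap.neg_apply]
  generalize Δ m = z
  induction z using TensorProduct.induction_on with
  | zero => simp
  | add x y hx hy =>
    simp only [map_add, neg_add, TensorProduct.tmul_add] at hx hy ⊢
    rw [hx, hy]
  | tmul x y => simp

variable (R) in
/-- `ω ⊗ m ↦ (-1)^{|ω| + |m|} ω ⊗ m`. -/
def coHochParity : CoHochChain R →ₗ[k] CoHochChain R := TensorProduct.map PΩ P

@[simp] lemma coHochParity_tmul (x : Cobar R) (m : KoszulDual R) :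
    coHochParity R (x ⊗ₜ m) = PΩ x ⊗ₜ P m := rfl

@[simp] lemma coHochParity_coHochParity (z : CoHochChain R) :
    coHochParity R (coHochParity R z) = z := by
  induction z using TensorProduct.induction_on with
  | zero => simp
  | add x y hx hy => simp only [map_add, hx, hy]
  | tmul x y => simp

/-- The operator `(-1)^{|x| |y|}` turns into a power of the parity of one factor once the total
parity is known: `coHochRight` is given by `coHochRightOf 0` on even and by `coHochRightOf 1`
on odd chains. -/
lemma coHochRight_eq (z : CoHochChain R) :
    coHochRight R z = (2 : k)⁻¹ • (coHochRightOf 0 (z + coHochParity R z) +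
      coHochRightOf 1 (z - coHochParity R z)) := by
  induction z using TensorProduct.induction_on with
  | zero => simp
  | add x y hx hy => simp only [map_add, hx, hy, map_sub]; module
  | tmul x m =>
    simp only [map_add, map_sub, coHochParity_tmul, coHochRightOf_tmul,
      isCoaugHom_parity.comul]
    simp only [coHochRight, LinearMap.neg_apply, LinearMap.comp_apply, LinearMap.lTensor_tmul]
    generalize Δ m = z
    induction z using TensorProduct.induction_on with
    | zero => simp
    | add a b ha hb =>
      simp only [map_add, TensorProduct.tmul_add] at ha hb ⊢
      linear_combination (norm := module) ha + hb
    | tmul a b =>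
      simp [koszulSign]
      module

section
variable {s : KoszulDual R →ₗ[k] KoszulDual R}

lemma coHochInner_tmul (x : Cobar R) (m : KoszulDual R) :
    coHochInner R (x ⊗ₜ m) = cobarD R x ⊗ₜ m := rfl

lemma coHochInner_coHochInner (z : CoHochChain R) : coHochInner R (coHochInner R z) = 0 := by
  induction z using TensorProduct.induction_on with
  | zero => simp
  | add x y hx hy => simp [map_add, hx, hy]
  | tmul x m => simp [coHochInner_tmul, cobarD_cobarD]

lemma coHochLeft_coHochLeft (hs : IsCoaugHom s) (hsP : ∀ c, s (P c) = P (s c))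
    (z : CoHochChain R) :
    coHochLeft s (coHochLeft s z) + coHochInner R (coHochLeft s z) +
      coHochLeft s (coHochInner R z) = 0 := by
  induction z using TensorProduct.induction_on with
  | zero => simp
  | add x y hx hy =>
    simp only [map_add]
    linear_combination (norm := module) hx + hy
  | tmul x m =>
    let H : KoszulDual R ⊗[k] (KoszulDual R ⊗[k] KoszulDual R) →ₗ[k] CoHochChain R :=
      LinearMap.rTensor _ (LinearMap.mul' k _ ∘ₗ
        TensorProduct.map (LinearMap.mulLeft k x ∘ₗ ℓ ∘ₗ s) (ℓ ∘ₗ s ∘ₗ P)) ∘ₗ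
      (TensorProduct.assoc k _ _ _).symm.toLinearMap
    let F : KoszulDual R ⊗[k] KoszulDual R →ₗ[k] CoHochChain R :=
      TensorProduct.map (LinearMap.mulLeft k x ∘ₗ letterD R ∘ₗ s ∘ₗ P) LinearMap.id
    let G : KoszulDual R ⊗[k] KoszulDual R →ₗ[k] CoHochChain R :=
      LinearMap.rTensor _ (LinearMap.mul' k _) ∘ₗ
      (TensorProduct.assoc k _ _ _).symm.toLinearMap ∘ₗ
      TensorProduct.map (LinearMap.mulLeft k x ∘ₗ ℓ ∘ₗ s)
        (TensorProduct.map (ℓ ∘ₗ s ∘ₗ P) LinearMap.id ∘ₗ Δ)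
    have key := sweedler₃ H F G (fun a b => ?_) (fun a b => ?_) m
    · rw [coHochInner_tmul, coHochLeft_tmul, coHochLeft_tmul]
      have e : ∀ z : KoszulDual R ⊗[k] KoszulDual R,
          coHochLeft s (TensorProduct.map (LinearMap.mulLeft k (PΩ x) ∘ₗ ℓ ∘ₗ s ∘ₗ P)
            LinearMap.id z) = - G z := by
        intro z
        induction z using TensorProduct.induction_on with
        | zero => simp
        | add a b ha hb => simp only [map_add, ha, hb]; abel
        | tmul a b =>
          simp only [TensorProduct.map_tmul, LinearMap.comp_apply, LinearMap.mulLeft_apply,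
            LinearMap.id_apply, coHochLeft_tmul, G]
          generalize Δ b = y
          induction y using TensorProduct.induction_on with
          | zero => simp
          | add a b ha hb => simp only [map_add, TensorProduct.tmul_add, ha, hb]; abel
          | tmul b c => simp [cobarParity_mul, ← hsP, TensorProduct.neg_tmul]
      have e' : ∀ z : KoszulDual R ⊗[k] KoszulDual R,
          coHochInner R (TensorProduct.map (LinearMap.mulLeft k (PΩ x) ∘ₗ ℓ ∘ₗ s ∘ₗ P)
            LinearMap.id z) + TensorProduct.map
              (LinearMap.mulLeft k (PΩ (cobarD R x)) ∘ₗ ℓ ∘ₗ s ∘ₗ P) LinearMap.id z = F z := by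
        intro z
        induction z using TensorProduct.induction_on with
        | zero => simp
        | add a b ha hb =>
          simp only [map_add]; linear_combination (norm := module) ha + hb
        | tmul a b =>
          simp only [TensorProduct.map_tmul, LinearMap.comp_apply, LinearMap.mulLeft_apply,
            LinearMap.id_apply, coHochInner_tmul, cobarD_mul, cobarD_parity,
            cobarParity_cobarParity, cobarD_letter, F, ← TensorProduct.add_tmul]
          congr 1
          noncomm_ring
      rw [add_assoc, e', e, key]
      abel
    · simp only [F, H, TensorProduct.map_tmul, LinearMap.comp_apply, letterD, hs.comul,
        isCoaugHom_parity.comul]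
      generalize Δ a = y
      induction y using TensorProduct.induction_on with
      | zero => simp
      | add a b ha hb =>
        simp only [map_add, TensorProduct.add_tmul, ha, hb]
      | tmul c d => simp [hsP, mul_assoc]
    · simp only [G, H, TensorProduct.map_tmul, LinearMap.comp_apply]
      generalize Δ b = y
      induction y using TensorProduct.induction_on with
      | zero => simp
      | add a b ha hb => simp only [map_add, TensorProduct.tmul_add, ha, hb]
      | tmul c d => simp

lemma coHochRight_coHochLeft (q : ℕ) (z : CoHochChain R) :
    coHochRightOf (q + 1) (coHochLeft s z) + coHochLeft s (coHochRightOf q z) = 0 := by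
  induction z using TensorProduct.induction_on with
  | zero => simp
  | add x y hx hy =>
    simp only [map_add]
    linear_combination (norm := module) hx + hy
  | tmul x m =>
    let H : KoszulDual R ⊗[k] (KoszulDual R ⊗[k] KoszulDual R) →ₗ[k] CoHochChain R :=
      LinearMap.rTensor _ (LinearMap.mul' k _) ∘ₗ
      (TensorProduct.assoc k _ _ _).symm.toLinearMap ∘ₗ
      TensorProduct.map (ℓ ∘ₗ P ^ (q + 1))
        (TensorProduct.map (LinearMap.mulLeft k (PΩ x) ∘ₗ ℓ ∘ₗ s ∘ₗ P) LinearMap.id) ∘ₗ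
      (TensorProduct.comm k _ _).toLinearMap ∘ₗ
      (TensorProduct.assoc k _ _ _).symm.toLinearMap
    let F : KoszulDual R ⊗[k] KoszulDual R →ₗ[k] CoHochChain R :=
      -(coHochLeft s ∘ₗ TensorProduct.map (LinearMap.mulRight k x ∘ₗ ℓ ∘ₗ P ^ q) LinearMap.id ∘ₗ
        (TensorProduct.comm k _ _).toLinearMap)
    let G : KoszulDual R ⊗[k] KoszulDual R →ₗ[k] CoHochChain R :=
      -(coHochRightOf (q + 1) ∘ₗ
        TensorProduct.map (LinearMap.mulLeft k (PΩ x) ∘ₗ ℓ ∘ₗ s ∘ₗ P) LinearMap.id)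
    have key := sweedler₃ H F G (fun a b => ?_) (fun a b => ?_) m
    · rw [coHochLeft_tmul, coHochRightOf_tmul]
      simp only [F, G, LinearMap.comp_apply, LinearMap.neg_apply, LinearEquiv.coe_coe] at key
      rw [map_neg]
      linear_combination (norm := module) key
    · simp only [F, H, TensorProduct.map_tmul, LinearMap.comp_apply, LinearMap.neg_apply,
        LinearEquiv.coe_coe, TensorProduct.comm_tmul, coHochLeft_tmul]
      generalize Δ a = y
      induction y using TensorProduct.induction_on with
      | zero => simp
      | add a b ha hb =>
        simp only [map_add, TensorProduct.add_tmul, ← ha, ← hb]; abel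
      | tmul c d => simp [cobarParity_mul, mul_assoc, TensorProduct.neg_tmul]
    · simp only [G, H, TensorProduct.map_tmul, LinearMap.comp_apply, LinearMap.neg_apply,
        LinearEquiv.coe_coe, coHochRightOf_tmul]
      generalize Δ b = y
      induction y using TensorProduct.induction_on with
      | zero => simp
      | add a b ha hb => simp only [map_add, TensorProduct.tmul_add, ← ha, ← hb]; abel
      | tmul c d => simp [mul_assoc]

lemma coHochRightOf_coHochRightOf (q : ℕ) (z : CoHochChain R) :
    coHochRightOf (q + 1) (coHochRightOf q z) + coHochInner R (coHochRightOf q z) +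
      coHochRightOf (q + 1) (coHochInner R z) = 0 := by
  induction z using TensorProduct.induction_on with
  | zero => simp
  | add x y hx hy =>
    simp only [map_add]
    linear_combination (norm := module) hx + hy
  | tmul x m =>
    let H : KoszulDual R ⊗[k] (KoszulDual R ⊗[k] KoszulDual R) →ₗ[k] CoHochChain R :=
      (TensorProduct.comm k _ _).toLinearMap ∘ₗ
      LinearMap.lTensor _ (LinearMap.mulRight k x ∘ₗ LinearMap.mul' k _ ∘ₗ
        TensorProduct.map (ℓ ∘ₗ P ^ (q + 1)) (ℓ ∘ₗ P ^ q))
    let F : KoszulDual R ⊗[k] KoszulDual R →ₗ[k] CoHochChain R :=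
      -(coHochRightOf (q + 1) ∘ₗ
        TensorProduct.map (LinearMap.mulRight k x ∘ₗ ℓ ∘ₗ P ^ q) LinearMap.id ∘ₗ
        (TensorProduct.comm k _ _).toLinearMap)
    let G : KoszulDual R ⊗[k] KoszulDual R →ₗ[k] CoHochChain R :=
      TensorProduct.map (LinearMap.mulRight k x ∘ₗ letterD R ∘ₗ P ^ q) LinearMap.id ∘ₗ
        (TensorProduct.comm k _ _).toLinearMap
    have key := sweedler₃ H F G (fun a b => ?_) (fun a b => ?_) m
    · rw [coHochInner_tmul, coHochRightOf_tmul, coHochRightOf_tmul]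
      have e' : ∀ z : KoszulDual R ⊗[k] KoszulDual R,
          coHochInner R (TensorProduct.map (LinearMap.mulRight k x ∘ₗ ℓ ∘ₗ P ^ q)
            LinearMap.id (TensorProduct.comm k _ _ z)) + TensorProduct.map
              (LinearMap.mulRight k (cobarD R x) ∘ₗ ℓ ∘ₗ P ^ (q + 1)) LinearMap.id
              (TensorProduct.comm k _ _ z) = G z := by
        intro z
        induction z using TensorProduct.induction_on with
        | zero => simp
        | add a b ha hb =>
          simp only [map_add]; linear_combination (norm := module) ha + hb
        | tmul a b =>
          simp [G, coHochInner_tmul, cobarD_letter_mul, ← TensorProduct.add_tmul]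
      have e := e' (Δ m)
      simp only [F, LinearMap.comp_apply, LinearMap.neg_apply, LinearEquiv.coe_coe] at key
      rw [map_neg, map_neg]
      linear_combination (norm := module) key - e
    · simp only [F, H, TensorProduct.map_tmul, LinearMap.comp_apply, LinearMap.neg_apply,
        LinearEquiv.coe_coe, TensorProduct.comm_tmul, coHochRightOf_tmul]
      generalize Δ a = y
      induction y using TensorProduct.induction_on with
      | zero => simp
      | add a b ha hb =>
        simp only [map_add, TensorProduct.add_tmul, ← ha, ← hb]; abel
      | tmul c d => simp [mul_assoc]
    · simp only [G, H, TensorProduct.map_tmul, LinearMap.comp_apply,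
        LinearEquiv.coe_coe, TensorProduct.comm_tmul, LinearMap.id_apply, LinearMap.lTensor_tmul,
        letterD_parity_pow]

/-- The boundary on chains of total parity `q`. -/
def coHochBOf (s : KoszulDual R →ₗ[k] KoszulDual R) (q : ℕ) : CoHochChain R →ₗ[k] CoHochChain R :=
  coHochInner R + coHochLeft s + coHochRightOf q

lemma coHochBOf_coHochBOf (hs : IsCoaugHom s) (hsP : ∀ c, s (P c) = P (s c)) (q : ℕ)
    (z : CoHochChain R) : coHochBOf s (q + 1) (coHochBOf s q z) = 0 := by
  simp only [coHochBOf, LinearMap.add_apply, map_add]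
  linear_combination (norm := module) coHochInner_coHochInner z + coHochLeft_coHochLeft hs hsP z +
    coHochRight_coHochLeft q z + coHochRightOf_coHochRightOf q z

lemma coHochRight_of_parity [CharZero k] {q : ℕ} {z : CoHochChain R}
    (hz : coHochParity R z = (-1 : k) ^ q • z) : coHochRight R z = coHochRightOf q z := by
  have h2 : ∀ q, coHochRightOf (R := R) (q + 1 + 1) = coHochRightOf q := by
    intro q
    refine TensorProduct.ext' fun x m => ?_
    have : P ^ (q + 1 + 1) = P ^ q := LinearMap.ext fun c => parity_pow_add_two q c
    rw [coHochRightOf_tmul, coHochRightOf_tmul, this]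
  have h0 : ∀ n, coHochRightOf (R := R) (n + n) = coHochRightOf 0 := by
    intro n
    induction n with
    | zero => rfl
    | succ n ih => rw [show n + 1 + (n + 1) = n + n + 1 + 1 by ring, h2, ih]
  have h1 : ∀ n, coHochRightOf (R := R) (2 * n + 1) = coHochRightOf 1 := by
    intro n
    induction n with
    | zero => rfl
    | succ n ih => rw [show 2 * (n + 1) + 1 = 2 * n + 1 + 1 + 1 by ring, h2, ih]
  rw [coHochRight_eq, hz]
  rcases Nat.even_or_odd q with hq | hq
  · rw [hq.neg_one_pow]
    obtain ⟨n, rfl⟩ := hq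
    rw [h0, one_smul, sub_self, map_zero, map_add]
    module
  · rw [hq.neg_one_pow]
    obtain ⟨n, rfl⟩ := hq
    rw [h1, show z + (-1 : k) • z = 0 by module, show z - (-1 : k) • z = (2 : k) • z by module,
      map_zero, map_smul]
    module

lemma coHochB_of_parity [CharZero k] {q : ℕ} {z : CoHochChain R}
    (hz : coHochParity R z = (-1 : k) ^ q • z) : coHochB s z = coHochBOf s q z := by
  simp only [coHochB, coHochBOf, LinearMap.add_apply, coHochRight_of_parity hz]

lemma coHochParity_coHochLeft (hsP : ∀ c, s (P c) = P (s c))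
    (z : CoHochChain R) :
    coHochParity R (coHochLeft s z) = -coHochLeft s (coHochParity R z) := by
  induction z using TensorProduct.induction_on with
  | zero => simp
  | add x y hx hy => simp only [map_add, hx, hy, neg_add]
  | tmul x m =>
    simp only [coHochParity_tmul, coHochLeft_tmul, isCoaugHom_parity.comul]
    generalize Δ m = z
    induction z using TensorProduct.induction_on with
    | zero => simp
    | add a b ha hb => simp only [map_add, ha, hb, neg_add]
    | tmul a b => simp [cobarParity_mul, TensorProduct.neg_tmul, hsP]

lemma coHochParity_coHochRightOf (q : ℕ) (z : CoHochChain R) :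
    coHochParity R (coHochRightOf q z) = -coHochRightOf q (coHochParity R z) := by
  induction z using TensorProduct.induction_on with
  | zero => simp
  | add x y hx hy => simp only [map_add, hx, hy, neg_add]
  | tmul x m =>
    simp only [coHochParity_tmul, coHochRightOf_tmul, isCoaugHom_parity.comul]
    generalize Δ m = z
    induction z using TensorProduct.induction_on with
    | zero => simp
    | add a b ha hb => simp only [map_add, neg_add] at ha hb ⊢; rw [ha, hb]
    | tmul a b => simp [cobarParity_mul, TensorProduct.neg_tmul]

lemma coHochParity_coHochBOf (hsP : ∀ c, s (P c) = P (s c)) (q : ℕ)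
    (z : CoHochChain R) :
    coHochParity R (coHochBOf s q z) = -coHochBOf s q (coHochParity R z) := by
  have h : coHochParity R (coHochInner R z) = -coHochInner R (coHochParity R z) := by
    induction z using TensorProduct.induction_on with
    | zero => simp
    | add x y hx hy => simp only [map_add, hx, hy, neg_add]
    | tmul x m => simp [coHochInner_tmul, cobarD_parity, TensorProduct.neg_tmul]
  simp only [coHochBOf, LinearMap.add_apply, map_add, h, coHochParity_coHochLeft hsP,
    coHochParity_coHochRightOf]
  abel

/-- A property of chains that is additive holds for all of them if it holds for those of
definite total parity. -/
lemma coHoch_parity_induction [CharZero k] {Q : CoHochChain R → Prop}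
    (hadd : ∀ x y, Q x → Q y → Q (x + y))
    (h : ∀ (q : ℕ) z, coHochParity R z = (-1 : k) ^ q • z → Q z) (z : CoHochChain R) : Q z := by
  have hz : z = (2 : k)⁻¹ • (z + coHochParity R z) + (2 : k)⁻¹ • (z - coHochParity R z) := by
    module
  rw [hz]
  refine hadd _ _ (h 0 _ ?_) (h 1 _ ?_)
  · simp [add_comm]
  · simp only [map_smul, map_sub, coHochParity_coHochParity]; module

/-- `b` squares to zero. The sign of the right coaction involves the total parity of a chain, which
`b` changes, so this is `coHochBOf_coHochBOf` on chains of each parity. -/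
lemma coHochB_coHochB [CharZero k] (hs : IsCoaugHom s) (hsP : ∀ c, s (P c) = P (s c))
    (z : CoHochChain R) : coHochB s (coHochB s z) = 0 := by
  induction z using coHoch_parity_induction with
  | hadd x y hx hy => rw [map_add, map_add, hx, hy, add_zero]
  | h q z hz =>
    rw [coHochB_of_parity hz, coHochB_of_parity (q := q + 1), coHochBOf_coHochBOf hs hsP]
    rw [coHochParity_coHochBOf hsP, hz, map_smul, pow_succ]
    module
end
end CoHoch

/-! ### The bimodule resolution of the cobar construction -/

section Bimodule
variable {k : Type u} [Field k] {V : Type v} [AddCommGroup V] [Module k V]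
  {R : Submodule k (V ⊗[k] V)}

local notation "ℓ" => letter R
local notation "P" => dualParity R
local notation "PΩ" => cobarParity R
local notation "Δ" => Coalgebra.comul (R := k) (A := KoszulDual R)
local notation "ε" => Coalgebra.counit (R := k) (A := KoszulDual R)

lemma comul_counit_left {Z : Type w} [AddCommGroup Z] [Module k Z]
    (F : KoszulDual R ⊗[k] KoszulDual R →ₗ[k] Z) (f : KoszulDual R →ₗ[k] Z)
    (h : ∀ a b, F (a ⊗ₜ b) = ε a • f b) (c : KoszulDual R) : F (Δ c) = f c := by
  have e : F = f ∘ₗ (TensorProduct.lid k _).toLinearMap ∘ₗ LinearMap.rTensor _ ε :=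
    TensorProduct.ext' fun a b => by rw [h]; simp
  rw [e, LinearMap.comp_apply, LinearMap.comp_apply, Coalgebra.rTensor_counit_comul]
  simp

lemma comul_counit_right {Z : Type w} [AddCommGroup Z] [Module k Z]
    (F : KoszulDual R ⊗[k] KoszulDual R →ₗ[k] Z) (f : KoszulDual R →ₗ[k] Z)
    (h : ∀ a b, F (a ⊗ₜ b) = ε b • f a) (c : KoszulDual R) : F (Δ c) = f c := by
  have e : F = f ∘ₗ (TensorProduct.rid k _).toLinearMap ∘ₗ LinearMap.lTensor _ ε :=
    TensorProduct.ext' fun a b => by rw [h]; simp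
  rw [e, LinearMap.comp_apply, LinearMap.comp_apply, Coalgebra.lTensor_counit_comul]
  simp

variable (R) in
/-- The free `Ω(C)`-bimodule `Ω(C) ⊗ C ⊗ Ω(C)` on `C`. -/
abbrev CobarBimod : Type max u v := CoHochChain R ⊗[k] Cobar R

instance : AddCommGroup (CobarBimod R) := TensorProduct.addCommGroup

variable (R) in
/-- The parity of elements of `Ω(C) ⊗ C ⊗ Ω(C)`. -/
def bimodParity : CobarBimod R →ₗ[k] CobarBimod R := TensorProduct.map (coHochParity R) PΩ

variable (R) in
/-- The differential `ω ⊗ m ↦ dω ⊗ m + ∑ (-1)^{|ω| + |m'|} ω m' ⊗ m''` of `Ω(C) ⊗ C`, from the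
left coaction alone. -/
def coHochOneSided : CoHochChain R →ₗ[k] CoHochChain R := coHochInner R + coHochLeft LinearMap.id

variable (R) in
/-- `u ⊗ c ⊗ v ↦ ∑ u ⊗ c' ⊗ c'' v`. -/
def bimodCoact : CobarBimod R →ₗ[k] CobarBimod R :=
  LinearMap.lTensor _ (LinearMap.mul' k _ ∘ₗ LinearMap.rTensor _ ℓ) ∘ₗ
    (TensorProduct.assoc k (CoHochChain R) (KoszulDual R) (Cobar R)).toLinearMap ∘ₗ
    LinearMap.rTensor _ ((TensorProduct.assoc k (Cobar R) (KoszulDual R)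
      (KoszulDual R)).symm.toLinearMap ∘ₗ LinearMap.lTensor _ Δ)

lemma bimodCoact_tmul (u : Cobar R) (c : KoszulDual R) (v : Cobar R) :
    bimodCoact R ((u ⊗ₜ c) ⊗ₜ v) =
      TensorProduct.map (TensorProduct.mk k _ _ u) (LinearMap.mulRight k v ∘ₗ ℓ) (Δ c) := by
  simp only [bimodCoact, LinearMap.comp_apply, LinearMap.lTensor_tmul, LinearMap.rTensor_tmul]
  generalize Δ c = z
  induction z using TensorProduct.induction_on with
  | zero => simp
  | add x y hx hy => simp only [map_add, TensorProduct.tmul_add, TensorProduct.add_tmul, hx, hy]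
  | tmul x y => simp

variable (R) in
/-- The differential of `Ω(C) ⊗ C ⊗ Ω(C)` for which it is the resolution of `Ω(C)` as a bimodule
over itself: `c ↦ ∑ ± c' ⊗ c'' ⊗ 1 - ∑ 1 ⊗ (-1)^{|c|} c' ⊗ c''` on the generators. -/
def bimodD : CobarBimod R →ₗ[k] CobarBimod R :=
  LinearMap.rTensor _ (coHochOneSided R) +
    (LinearMap.lTensor _ (cobarD R) - bimodCoact R) ∘ₗ LinearMap.rTensor _ (coHochParity R)

lemma bimodD_tmul (z : CoHochChain R) (v : Cobar R) :
    bimodD R (z ⊗ₜ v) = coHochOneSided R z ⊗ₜ v +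
      (coHochParity R z ⊗ₜ cobarD R v - bimodCoact R (coHochParity R z ⊗ₜ v)) := rfl

variable (R) in
/-- The left action of `Ω(C)` on `Ω(C) ⊗ C ⊗ Ω(C)`. -/
def bimodLeft (x : Cobar R) : CobarBimod R →ₗ[k] CobarBimod R :=
  LinearMap.rTensor _ (LinearMap.rTensor _ (LinearMap.mulLeft k x))

variable (R) in
/-- The right action of `Ω(C)` on `Ω(C) ⊗ C ⊗ Ω(C)`. -/
def bimodRight (x : Cobar R) : CobarBimod R →ₗ[k] CobarBimod R :=
  LinearMap.lTensor _ (LinearMap.mulRight k x)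

@[simp] lemma bimodLeft_tmul (x u v : Cobar R) (c : KoszulDual R) :
    bimodLeft R x ((u ⊗ₜ c) ⊗ₜ v) = ((x * u) ⊗ₜ c) ⊗ₜ v := rfl

@[simp] lemma bimodRight_tmul (x v : Cobar R) (z : CoHochChain R) :
    bimodRight R x (z ⊗ₜ v) = z ⊗ₜ (v * x) := rfl

@[simp] lemma bimodParity_tmul (v : Cobar R) (z : CoHochChain R) :
    bimodParity R (z ⊗ₜ v) = coHochParity R z ⊗ₜ PΩ v := rfl

/-- An additive property of elements of `Ω(C) ⊗ C ⊗ Ω(C)` holds if it holds for `u ⊗ c ⊗ v`. -/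
lemma bimod_induction {Q : CobarBimod R → Prop} (h0 : Q 0)
    (hadd : ∀ x y, Q x → Q y → Q (x + y))
    (h : ∀ u c v, Q ((u ⊗ₜ c) ⊗ₜ v)) (z : CobarBimod R) : Q z := by
  induction z using TensorProduct.induction_on with
  | zero => exact h0
  | add x y hx hy => exact hadd x y hx hy
  | tmul z v =>
    induction z using TensorProduct.induction_on with
    | zero => simpa using h0
    | add x y hx hy => rw [TensorProduct.add_tmul]; exact hadd _ _ hx hy
    | tmul u c => exact h u c v

lemma coHochOneSided_mul (x u : Cobar R) (c : KoszulDual R) :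
    coHochOneSided R ((x * u) ⊗ₜ c) = (cobarD R x * u) ⊗ₜ c +
      LinearMap.rTensor _ (LinearMap.mulLeft k (PΩ x)) (coHochOneSided R (u ⊗ₜ c)) := by
  simp only [coHochOneSided, LinearMap.add_apply, coHochInner_tmul, coHochLeft_tmul, map_add,
    cobarD_mul, LinearMap.rTensor_tmul, LinearMap.mulLeft_apply, cobarParity_mul,
    TensorProduct.add_tmul]
  rw [← LinearMap.comp_apply (LinearMap.rTensor _ _), LinearMap.rTensor_comp_map,
    ← LinearMap.comp_assoc, LinearMap.mulLeft_mul]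
  abel

lemma bimodD_left (x : Cobar R) (z : CobarBimod R) :
    bimodD R (bimodLeft R x z) = bimodLeft R (cobarD R x) z + bimodLeft R (PΩ x) (bimodD R z) := by
  induction z using bimod_induction with
  | h0 => simp
  | hadd y z hy hz => simp only [map_add, hy, hz]; abel
  | h u c v =>
    simp only [bimodLeft_tmul, bimodD_tmul, coHochOneSided_mul, map_add, map_sub,
      coHochParity_tmul, cobarParity_mul, bimodCoact_tmul, TensorProduct.add_tmul]
    have : TensorProduct.map (TensorProduct.mk k _ _ (PΩ x * PΩ u))
        (LinearMap.mulRight k v ∘ₗ ℓ) (Δ (P c)) = bimodLeft R (PΩ x)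
        (TensorProduct.map (TensorProduct.mk k _ _ (PΩ u)) (LinearMap.mulRight k v ∘ₗ ℓ)
          (Δ (P c))) := by
      generalize Δ (P c) = z
      induction z using TensorProduct.induction_on with
      | zero => simp
      | add x y hx hy => simp only [map_add, hx, hy]
      | tmul x y => simp
    rw [this, add_assoc]
    rfl

lemma bimodD_right (x : Cobar R) (z : CobarBimod R) :
    bimodD R (bimodRight R x z) =
      bimodRight R x (bimodD R z) + bimodRight R (cobarD R x) (bimodParity R z) := by
  induction z using bimod_induction with
  | h0 => simp
  | hadd y z hy hz => simp only [map_add, hy, hz]; abel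
  | h u c v =>
    simp only [bimodRight_tmul, bimodD_tmul, map_add, map_sub, bimodParity_tmul,
      coHochParity_tmul, cobarD_mul, bimodCoact_tmul, TensorProduct.tmul_add]
    have : TensorProduct.map (TensorProduct.mk k _ _ (PΩ u))
        (LinearMap.mulRight k (v * x) ∘ₗ ℓ) (Δ (P c)) = bimodRight R x
        (TensorProduct.map (TensorProduct.mk k _ _ (PΩ u)) (LinearMap.mulRight k v ∘ₗ ℓ)
          (Δ (P c))) := by
      generalize Δ (P c) = z
      induction z using TensorProduct.induction_on with
      | zero => simp
      | add x y hx hy => simp only [map_add, hx, hy]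
      | tmul x y => simp [mul_assoc]
    rw [this]
    abel

variable (R) in
/-- The derivation of degree `1`, `ω ↦ -∑ (-1)^{|u| + |a|} u ⊗ a ⊗ v` over all ways to write
`ω = u a v` with a letter `a`. -/
def markD : Cobar R →ₗ[k] CobarBimod R :=
  -((LinearMap.rTensor _ (TensorProduct.map PΩ (P ∘ₗ (DualAug R).subtype))) ∘ₗ
    (TensorProduct.assoc k (Cobar R) (DualAug R) (Cobar R)).symm.toLinearMap ∘ₗ
    markLetter k (DualAug R))

@[simp] lemma markD_one : markD R 1 = 0 := by simp [markD]

lemma markD_letter_mul (c : KoszulDual R) (x : Cobar R) :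
    markD R (ℓ c * x) = bimodLeft R (PΩ (ℓ c)) (markD R x) -
      (1 ⊗ₜ P (toDualAug R c)) ⊗ₜ x := by
  have h : ∀ (a : DualAug R) (z : Cobar R ⊗[k] (DualAug R ⊗[k] Cobar R)),
      LinearMap.rTensor _ (TensorProduct.map PΩ (P ∘ₗ (DualAug R).subtype))
        ((TensorProduct.assoc k (Cobar R) (DualAug R) (Cobar R)).symm (LinearMap.rTensor _
        (LinearMap.mulLeft k (TensorAlgebra.ι k a)) z)) =
      bimodLeft R (PΩ (TensorAlgebra.ι k a)) (LinearMap.rTensor _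
        (TensorProduct.map PΩ (P ∘ₗ (DualAug R).subtype))
        ((TensorProduct.assoc k (Cobar R) (DualAug R) (Cobar R)).symm z)) := by
    intro a z
    induction z using TensorProduct.induction_on with
    | zero => simp
    | add x y hx hy => simp only [map_add, hx, hy]
    | tmul x y =>
      induction y using TensorProduct.induction_on with
      | zero => simp
      | add x y hx hy => simp only [map_add, TensorProduct.tmul_add, hx, hy]
      | tmul b y => simp [cobarParity_mul]
  rw [← letter_coe_toDualAug c, letter_coe]
  simp only [markD, LinearMap.comp_apply, markLetter_ι_mul, map_add, LinearMap.neg_apply,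
    LinearEquiv.coe_coe, h, map_neg]
  simp only [TensorProduct.assoc_symm_tmul, LinearMap.rTensor_tmul, TensorProduct.map_tmul,
    cobarParity_one, LinearMap.comp_apply, Submodule.subtype_apply]
  abel

lemma markD_letter (c : KoszulDual R) : markD R (ℓ c) = -((1 ⊗ₜ P (toDualAug R c)) ⊗ₜ 1) := by
  simpa using markD_letter_mul c 1

lemma bimodLeft_mul (x y : Cobar R) (z : CobarBimod R) :
    bimodLeft R (x * y) z = bimodLeft R x (bimodLeft R y z) := by
  induction z using bimod_induction with
  | h0 => simp
  | hadd y z hy hz => simp only [map_add, hy, hz]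
  | h u c v => simp [mul_assoc]

lemma bimodLeft_right (x y : Cobar R) (z : CobarBimod R) :
    bimodLeft R x (bimodRight R y z) = bimodRight R y (bimodLeft R x z) := by
  induction z using bimod_induction with
  | h0 => simp
  | hadd y z hy hz => simp only [map_add, hy, hz]
  | h u c v => simp

lemma bimodLeft_smul (r : k) (x : Cobar R) (z : CobarBimod R) :
    bimodLeft R (r • x) z = r • bimodLeft R x z := by
  induction z using bimod_induction with
  | h0 => simp
  | hadd y z hy hz => simp only [map_add, hy, hz, smul_add]
  | h u c v => simp [TensorProduct.smul_tmul']

lemma bimodLeft_neg (x : Cobar R) (z : CobarBimod R) :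
    bimodLeft R (-x) z = -bimodLeft R x z := by
  simpa using bimodLeft_smul (-1) x z

lemma bimodLeft_add (x y : Cobar R) (z : CobarBimod R) :
    bimodLeft R (x + y) z = bimodLeft R x z + bimodLeft R y z := by
  induction z using bimod_induction with
  | h0 => simp
  | hadd y z hy hz => simp only [map_add, hy, hz]; abel
  | h u c v => simp [add_mul, TensorProduct.add_tmul]

lemma bimodLeft_one (z : CobarBimod R) : bimodLeft R 1 z = z := by
  induction z using bimod_induction with
  | h0 => simp
  | hadd y z hy hz => simp only [map_add, hy, hz]
  | h u c v => simp

lemma markD_mul (x y : Cobar R) :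
    markD R (x * y) = bimodRight R y (markD R x) + bimodLeft R (PΩ x) (markD R y) := by
  induction x using cobar_induction with
  | h1 => simp [bimodLeft_one]
  | hsmul r x hx => simp [hx, bimodLeft_smul]
  | hadd x z hx hz => simp only [add_mul, map_add, hx, hz, bimodLeft_add]; abel
  | hι c x hx =>
    rw [mul_assoc, markD_letter_mul, hx, markD_letter_mul, cobarParity_mul]
    simp only [map_add, map_sub, bimodRight_tmul, bimodLeft_mul, bimodLeft_right]
    abel

lemma markD_parity (x : Cobar R) : markD R (PΩ x) = -bimodParity R (markD R x) := by
  induction x using cobar_induction with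
  | h1 => simp
  | hsmul r x hx => simp [hx]
  | hadd x z hx hz => simp only [map_add, hx, hz]; abel
  | hι c x hx =>
    have h : ∀ (x : Cobar R) (z : CobarBimod R),
        bimodParity R (bimodLeft R x z) = bimodLeft R (PΩ x) (bimodParity R z) := by
      intro x z
      induction z using bimod_induction with
      | h0 => simp
      | hadd y z hy hz => simp only [map_add, hy, hz]
      | h u c v => simp [cobarParity_mul]
    have hb : (toDualAug R (P c) : KoszulDual R) = P (toDualAug R c) := by
      simp [isCoaugHom_parity.counit]
    rw [cobarParity_mul, markD_mul, hx, cobarParity_letter, markD_letter_mul, map_sub, h, map_neg,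
      markD_letter, hb]
    simp
    abel

/-- `markD` exhibits the bimodule `Ω(C) ⊗ C ⊗ Ω(C)` as a cone: up to homotopy its two
augmentations `1 ⊗ 1 ⊗ ω` and `ω ⊗ 1 ⊗ 1` agree. -/
lemma bimodD_markD (x : Cobar R) : bimodD R (markD R x) + markD R (cobarD R x) =
    (1 ⊗ₜ dualOne R) ⊗ₜ x - (x ⊗ₜ dualOne R) ⊗ₜ 1 := by
  have hletter : ∀ c : KoszulDual R, bimodD R (markD R (ℓ c)) + markD R (letterD R c) =
      (1 ⊗ₜ dualOne R) ⊗ₜ ℓ c - (ℓ c ⊗ₜ dualOne R) ⊗ₜ 1 := by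
    intro c
    rw [← letter_coe_toDualAug, ← letterD_toDualAug]
    generalize toDualAug R c = a
    let F₁ : KoszulDual R ⊗[k] KoszulDual R →ₗ[k] CobarBimod R :=
      (TensorProduct.mk k _ _).flip 1 ∘ₗ
        TensorProduct.map ℓ (P ∘ₗ (LinearMap.id - (DualAug R).subtype ∘ₗ toDualAug R))
    let F₂ : KoszulDual R ⊗[k] KoszulDual R →ₗ[k] CobarBimod R :=
      TensorProduct.map (TensorProduct.mk k _ _ 1 ∘ₗ
        (LinearMap.id - (DualAug R).subtype ∘ₗ toDualAug R)) ℓ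
    have h1 := comul_counit_right F₁ ((TensorProduct.mk k _ _).flip 1 ∘ₗ
      (TensorProduct.mk k _ _).flip (dualOne R) ∘ₗ ℓ) (fun b c => by simp [F₁]) (a : KoszulDual R)
    have h2 := comul_counit_left F₂ (TensorProduct.mk k _ _ (1 ⊗ₜ dualOne R) ∘ₗ ℓ)
      (fun b c => by simp [F₂, TensorProduct.smul_tmul']) (a : KoszulDual R)
    simp only [LinearMap.comp_apply, LinearMap.flip_apply, TensorProduct.mk_apply] at h1 h2
    rw [← h1, ← h2, letterD, LinearMap.comp_apply, LinearMap.comp_apply, markD_letter, map_neg,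
      bimodD_tmul, coHochOneSided, LinearMap.add_apply, coHochInner_tmul, coHochLeft_tmul,
      cobarD_one, coHochParity_tmul, bimodCoact_tmul, toDualAug_coe, dualParity_dualParity,
      isCoaugHom_parity.comul]
    simp only [TensorProduct.zero_tmul, zero_add, TensorProduct.tmul_zero, zero_sub,
      cobarParity_one]
    generalize Δ (a : KoszulDual R) = z
    induction z using TensorProduct.induction_on with
    | zero => simp
    | add x y hx hy =>
      simp only [map_add, TensorProduct.add_tmul]
      linear_combination (norm := module) hx + hy
    | tmul b c =>
      have hb : ∀ c, P (toDualAug R (P c) : KoszulDual R) = toDualAug R c := fun c => by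
        simp [isCoaugHom_parity.counit]
      simp only [F₁, F₂, TensorProduct.map_tmul, LinearMap.comp_apply, LinearMap.mul'_apply,
        markD_mul, markD_letter, hb, cobarParity_letter, dualParity_dualParity, map_neg,
        bimodRight_tmul, bimodLeft_tmul, one_mul, mul_one, LinearMap.mulLeft_apply,
        LinearMap.mulRight_apply, LinearMap.id_apply, LinearMap.sub_apply,
        Submodule.subtype_apply, TensorProduct.mk_apply, LinearMap.flip_apply,
        TensorProduct.tmul_sub, TensorProduct.sub_tmul, TensorProduct.neg_tmul]
      simp only [coe_toDualAug, map_sub, map_smul, dualParity_one, TensorProduct.tmul_sub,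
        TensorProduct.sub_tmul]
      module
  induction x using cobar_induction with
  | h1 => simp
  | hsmul r x hx => rw [map_smul, map_smul, map_smul, map_smul, ← smul_add, hx]; simp [smul_sub, TensorProduct.smul_tmul']
  | hadd x z hx hz =>
    simp only [map_add, TensorProduct.tmul_add, TensorProduct.add_tmul]
    linear_combination (norm := module) hx + hz
  | hι c x hx =>
    have e1 := congrArg (bimodRight R x) (hletter c)
    have e2 := congrArg (bimodLeft R (ℓ c)) hx
    simp only [map_add, map_sub, bimodRight_tmul, bimodLeft_tmul, one_mul, mul_one] at e1 e2
    rw [markD_mul, map_add, bimodD_right, bimodD_left, cobarD_mul, map_add, markD_mul, markD_mul,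
      cobarD_parity, cobarParity_cobarParity, cobarD_letter, markD_parity]
    rw [bimodLeft_neg]
    simp only [map_neg]
    linear_combination (norm := module) e1 + e2
end Bimodule

/-! ### The Connes operator on the Hochschild chains of the coalgebra -/

section CoConnes
variable {k : Type u} [Field k] {V : Type v} [AddCommGroup V] [Module k V]
  {R : Submodule k (V ⊗[k] V)}

local notation "ℓ" => letter R
local notation "P" => dualParity R
local notation "PΩ" => cobarParity R
local notation "Δ" => Coalgebra.comul (R := k) (A := KoszulDual R)
local notation "ε" => Coalgebra.counit (R := k) (A := KoszulDual R)

/-- The map `u ⊗ c ⊗ v ↦ (-1)^{(q + 1) |v|} v s(u) ⊗ c`, which on elements of total parity `q`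
is the twisted cyclic rotation `(-1)^{|v| (|u| + |c|)} v s(u) ⊗ c`. -/
def bimodRotate (s : KoszulDual R →ₗ[k] KoszulDual R) (q : ℕ) : CobarBimod R →ₗ[k] CoHochChain R :=
  LinearMap.rTensor _ (LinearMap.mul' k _ ∘ₗ TensorProduct.map (PΩ ^ (q + 1)) (cobarMap s)) ∘ₗ
    (TensorProduct.assoc k (Cobar R) (Cobar R) (KoszulDual R)).symm.toLinearMap ∘ₗ
    (TensorProduct.comm k (CoHochChain R) (Cobar R)).toLinearMap

@[simp] lemma bimodRotate_tmul (s : KoszulDual R →ₗ[k] KoszulDual R) (q : ℕ) (u : Cobar R)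
    (c : KoszulDual R) (v : Cobar R) : bimodRotate s q ((u ⊗ₜ c) ⊗ₜ v) =
      ((PΩ ^ (q + 1)) v * cobarMap s u) ⊗ₜ c := rfl

variable {s : KoszulDual R →ₗ[k] KoszulDual R}

lemma bimodRotate_add_two (q : ℕ) : bimodRotate s (q + 1 + 1) = bimodRotate s q := by
  refine LinearMap.ext fun z => ?_
  induction z using bimod_induction with
  | h0 => simp
  | hadd y z hy hz => simp only [map_add, hy, hz]
  | h u c v => simp

lemma bimodRotate_oneSided (hs : IsCoaugHom s) (hsP : ∀ c, s (P c) = P (s c)) (q : ℕ)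
    (z : CobarBimod R) :
    bimodRotate s (q + 1) (LinearMap.rTensor _ (coHochOneSided R) z) =
      coHochLeft s (bimodRotate s q z) +
        bimodRotate s (q + 1) (LinearMap.rTensor _ (coHochInner R) z) := by
  induction z using bimod_induction with
  | h0 => simp
  | hadd y z hy hz => simp only [map_add, hy, hz]; abel
  | h u c v =>
    simp only [LinearMap.rTensor_tmul, coHochOneSided, LinearMap.add_apply,
      TensorProduct.add_tmul, map_add, bimodRotate_tmul, coHochLeft_tmul]
    rw [add_comm]
    congr 1
    generalize Δ c = z
    induction z using TensorProduct.induction_on with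
    | zero => simp
    | add x y hx hy => simp only [map_add, TensorProduct.add_tmul, hx, hy]
    | tmul a b =>
      simp [cobarMap_mul, cobarParity_mul, cobarMap_parity hs hsP, hs]

lemma bimodRotate_right (hsP : ∀ c, s (P c) = P (s c)) (hs : IsCoaugHom s) (q : ℕ)
    (z : CobarBimod R) :
    (-1 : k) ^ q • bimodRotate s (q + 1) (LinearMap.lTensor _ (cobarD R ∘ₗ PΩ) z -
        bimodCoact R (LinearMap.lTensor _ PΩ z)) +
      bimodRotate s (q + 1) (LinearMap.rTensor _ (coHochInner R) z) =
      coHochInner R (bimodRotate s q z) + coHochRightOf q (bimodRotate s q z) := by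
  induction z using bimod_induction with
  | h0 => simp
  | hadd y z hy hz =>
    simp only [map_add, map_sub] at hy hz ⊢
    linear_combination (norm := module) hy + hz
  | h u c v =>
    have e : ∀ z : KoszulDual R ⊗[k] KoszulDual R, (-1 : k) ^ q •
        -bimodRotate s (q + 1) (TensorProduct.map (TensorProduct.mk k _ _ u)
          (LinearMap.mulRight k (PΩ v) ∘ₗ ℓ) z) =
        -TensorProduct.map (LinearMap.mulRight k ((PΩ ^ (q + 1)) v * cobarMap s u) ∘ₗ ℓ ∘ₗ P ^ q)
          LinearMap.id (TensorProduct.comm k _ _ z) := by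
      intro z
      induction z using TensorProduct.induction_on with
      | zero => simp
      | add x y hx hy =>
        simp only [map_add, neg_add, smul_add] at hx hy ⊢
        rw [hx, hy]
      | tmul a b =>
        simp only [TensorProduct.map_tmul, TensorProduct.mk_apply, LinearMap.comp_apply,
          LinearMap.mulRight_apply, bimodRotate_tmul, TensorProduct.comm_tmul, LinearMap.id_apply,
          cobarParity_pow_mul, cobarParity_pow_letter, cobarParity_pow_succ,
          cobarParity_pow_add_two, smul_mul_assoc, mul_assoc]
        rcases neg_one_pow_eq_or k q with hq | hq <;>
          (simp [hq, TensorProduct.neg_tmul]; try module)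
    rw [LinearMap.lTensor_tmul, LinearMap.lTensor_tmul, bimodCoact_tmul, map_sub, sub_eq_add_neg,
      smul_add, e, LinearMap.rTensor_tmul, coHochInner_tmul, bimodRotate_tmul, bimodRotate_tmul,
      bimodRotate_tmul, coHochInner_tmul, coHochRightOf_tmul, cobarD_mul, cobarD_parity_pow,
      cobarMap_cobarD hs hsP, TensorProduct.add_tmul]
    simp only [LinearMap.comp_apply, cobarD_parity, map_neg, cobarParity_pow_succ,
      cobarParity_parity_pow, cobarParity_pow_add_two, smul_mul_assoc]
    simp only [pow_succ (-1 : k)]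
    rcases neg_one_pow_eq_or k q with hq | hq <;>
      simp only [hq, mul_neg, neg_mul, mul_one, neg_neg, one_smul, neg_smul,
        TensorProduct.neg_tmul] <;> module

/-- The rotation maps the bimodule differential to the Hochschild boundary. -/
lemma coHochBOf_bimodRotate (hs : IsCoaugHom s) (hsP : ∀ c, s (P c) = P (s c)) {q : ℕ}
    {z : CobarBimod R} (hz : bimodParity R z = (-1 : k) ^ q • z) :
    coHochBOf s q (bimodRotate s q z) = bimodRotate s (q + 1) (bimodD R z) := by
  have h1 : bimodD R z = LinearMap.rTensor _ (coHochOneSided R) z +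
      (-1 : k) ^ q • (LinearMap.lTensor _ (cobarD R ∘ₗ PΩ) z -
        bimodCoact R (LinearMap.lTensor _ PΩ z)) := by
    have h2 : ∀ z, bimodD R z = LinearMap.rTensor _ (coHochOneSided R) z +
        (LinearMap.lTensor _ (cobarD R ∘ₗ PΩ) (bimodParity R z) -
          bimodCoact R (LinearMap.lTensor _ PΩ (bimodParity R z))) := by
      intro z
      induction z using bimod_induction with
      | h0 => simp
      | hadd y z hy hz =>
        simp only [map_add, hy, hz]; abel
      | h u c v => simp [bimodD_tmul]
    rw [h2, hz]
    simp only [map_smul, smul_sub]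
  rw [h1, map_add, map_smul, bimodRotate_oneSided hs hsP]
  have := bimodRotate_right hsP hs q z
  simp only [coHochBOf, LinearMap.add_apply]
  linear_combination (norm := module) -this

variable (R) in
/-- `ω ⊗ m ↦ ε(m) ω`. -/
def coHochCounit : CoHochChain R →ₗ[k] Cobar R :=
  (TensorProduct.rid k (Cobar R)).toLinearMap ∘ₗ LinearMap.lTensor _ ε

@[simp] lemma coHochCounit_tmul (x : Cobar R) (m : KoszulDual R) :
    coHochCounit R (x ⊗ₜ m) = ε m • x := rfl

/-- The operator `coHochConnes` on chains of total parity `q`. -/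
def coHochConnesOf (s : KoszulDual R →ₗ[k] KoszulDual R) (q : ℕ) :
    CoHochChain R →ₗ[k] CoHochChain R :=
  bimodRotate s (q + 1) ∘ₗ markD R ∘ₗ coHochCounit R

lemma lastLetter_parity (x : Cobar R) : lastLetter k (DualAug R) (PΩ x) =
    (-1 : k) • TensorProduct.map PΩ (restrictAug P) (lastLetter k (DualAug R) x) := by
  have hr : restrictAug (-P) = -restrictAug P := by
    simp [restrictAug, LinearMap.neg_comp, LinearMap.comp_neg]
  induction x using words_induction_right with
  | h1 => simp [lastLetter]
  | hsmul r x hx => simp only [map_smul, hx, smul_comm r]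
  | hadd x y hx hy => simp only [map_add, hx, hy, smul_add]
  | hι a x hx =>
    rw [cobarParity_mul, lastLetter_mul_ι]
    have : PΩ (TensorAlgebra.ι k a) = TensorAlgebra.ι k (-restrictAug P a) := by
      rw [cobarParity, cobarMap, AlgHom.toLinearMap_apply, tmap_ι, hr]; rfl
    rw [this, lastLetter_mul_ι, TensorProduct.map_tmul, TensorProduct.tmul_neg]
    module

lemma markLetter_eq {W : Type w} [AddCommGroup W] [Module k W] (x : TensorAlgebra k W) :
    markLetter k W x = TensorProduct.assoc k _ _ _ (LinearMap.rTensor _ (lastLetter k W)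
      (deconc x)) := by
  have h : ∀ z : TensorAlgebra k W ⊗[k] TensorAlgebra k W, TensorProduct.assoc k _ _ _
      (LinearMap.rTensor _ (lastLetter k W) z) =
      LinearMap.lTensor _ (LinearMap.rTensor _ TensorAlgebra.ιInv) (TensorProduct.assoc k _ _ _
        (LinearMap.rTensor _ deconc z)) := by
    intro z
    induction z using TensorProduct.induction_on with
    | zero => simp
    | add x y hx hy => simp only [map_add, hx, hy]
    | tmul x y =>
      simp only [LinearMap.rTensor_tmul, lastLetter, LinearMap.comp_apply]
      generalize deconc x = z
      induction z using TensorProduct.induction_on with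
      | zero => simp
      | add x y hx hy => simp only [map_add, TensorProduct.add_tmul, hx, hy]
      | tmul x z => simp
  rw [h, deconc_coassoc, markLetter, LinearMap.comp_apply, ← LinearMap.comp_apply
    (LinearMap.lTensor _ _) (LinearMap.lTensor _ _), ← LinearMap.lTensor_comp]
  rfl

/-- `B` is the rotation of the derivation `markD`, by `coHochConnesOf 0` on even and by
`coHochConnesOf 1` on odd chains; the averages are the components of `z` of either parity. -/
lemma coHochConnes_eq (z : CoHochChain R) :
    coHochConnes s z = (2 : k)⁻¹ • (coHochConnesOf s 0 (z + coHochParity R z) +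
      coHochConnesOf s 1 (z - coHochParity R z)) := by
  induction z using TensorProduct.induction_on with
  | zero => simp
  | add x y hx hy => simp only [map_add, hx, hy, map_sub]; module
  | tmul x m =>
    simp only [coHochConnes, coHochConnesOf, LinearMap.comp_apply, map_add, map_sub,
      coHochParity_tmul, coHochCounit_tmul, isCoaugHom_parity.counit, map_smul,
      LinearMap.lTensor_tmul, LinearEquiv.coe_coe, TensorProduct.rid_tmul]
    suffices h : coRotate s (PΩ x) = (2 : k)⁻¹ •
        (bimodRotate s (0 + 1) (markD R x) + bimodRotate s (0 + 1) (markD R (PΩ x)) +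
        (bimodRotate s (1 + 1) (markD R x) - bimodRotate s (1 + 1) (markD R (PΩ x)))) by
      rw [h]; module
    have hP : deconc (PΩ x) = TensorProduct.map PΩ PΩ (deconc x) := deconc_tmap _ x
    simp only [coRotate, LinearMap.comp_apply, markD, LinearMap.neg_apply, markLetter_eq,
      LinearEquiv.coe_coe, LinearEquiv.symm_apply_apply, map_neg, hP]
    generalize deconc x = z
    induction z using TensorProduct.induction_on with
    | zero => simp
    | add x y hx hy =>
      simp only [map_add] at hx hy ⊢
      linear_combination (norm := module) hx + hy
    | tmul U v =>
      simp only [koszulSign, LinearMap.smul_apply, LinearMap.add_apply, LinearMap.sub_apply,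
        LinearMap.id_apply, TensorProduct.map_tmul, LinearMap.rTensor_tmul,
        LinearMap.lTensor_tmul, cobarParity_cobarParity, map_smul, map_add, map_sub,
        lastLetter_parity]
      generalize lastLetter k (DualAug R) U = y
      induction y using TensorProduct.induction_on with
      | zero => simp
      | add x y hx hy =>
        simp only [map_add, smul_add, TensorProduct.add_tmul] at hx hy ⊢
        linear_combination (norm := module) hx + hy
      | tmul u a =>
        have ha : (restrictAug P a : KoszulDual R) = P a :=
          coe_restrictAug (fun c hc => by rw [isCoaugHom_parity.counit, hc]) a
        simp [← TensorProduct.smul_tmul', -neg_smul, ha]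
        module

lemma coHochConnesOf_add_two (q : ℕ) :
    coHochConnesOf s (q + 1 + 1) = coHochConnesOf s q := by
  rw [coHochConnesOf, bimodRotate_add_two, coHochConnesOf]

lemma coHochConnes_of_parity [CharZero k] {q : ℕ} {z : CoHochChain R}
    (hz : coHochParity R z = (-1 : k) ^ q • z) : coHochConnes s z = coHochConnesOf s q z := by
  have h0 : ∀ n, coHochConnesOf s (n + n) = coHochConnesOf s 0 := by
    intro n
    induction n with
    | zero => rfl
    | succ n ih =>
      rw [show n + 1 + (n + 1) = n + n + 1 + 1 by ring, coHochConnesOf_add_two, ih]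
  have h1 : ∀ n, coHochConnesOf s (2 * n + 1) = coHochConnesOf s 1 := by
    intro n
    induction n with
    | zero => rfl
    | succ n ih =>
      rw [show 2 * (n + 1) + 1 = 2 * n + 1 + 1 + 1 by ring, coHochConnesOf_add_two, ih]
  rw [coHochConnes_eq, hz]
  rcases Nat.even_or_odd q with hq | hq
  · rw [hq.neg_one_pow]
    obtain ⟨n, rfl⟩ := hq
    rw [h0, one_smul, sub_self, map_zero, map_add]
    module
  · rw [hq.neg_one_pow]
    obtain ⟨n, rfl⟩ := hq
    rw [h1, show z + (-1 : k) • z = 0 by module, show z - (-1 : k) • z = (2 : k) • z by module,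
      map_zero, map_smul]
    module

lemma coHochCounit_left (z : CoHochChain R) : coHochCounit R (coHochLeft s z) =
    LinearMap.mul' k _ (TensorProduct.map PΩ (ℓ ∘ₗ s ∘ₗ P) z) := by
  induction z using TensorProduct.induction_on with
  | zero => simp
  | add x y hx hy => simp only [map_add, hx, hy]
  | tmul x m =>
    rw [coHochLeft_tmul]
    exact comul_counit_right (coHochCounit R ∘ₗ TensorProduct.map
      (LinearMap.mulLeft k (PΩ x) ∘ₗ ℓ ∘ₗ s ∘ₗ P) LinearMap.id)
      (LinearMap.mulLeft k (PΩ x) ∘ₗ ℓ ∘ₗ s ∘ₗ P) (fun a b => by simp) m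

lemma coHochCounit_right (q : ℕ) (z : CoHochChain R) : coHochCounit R (coHochRightOf q z) =
    -LinearMap.mul' k _ (TensorProduct.map (ℓ ∘ₗ P ^ q) LinearMap.id
      (TensorProduct.comm k _ _ z)) := by
  induction z using TensorProduct.induction_on with
  | zero => simp
  | add x y hx hy => simp only [map_add, hx, hy, neg_add]
  | tmul x m =>
    rw [coHochRightOf_tmul, map_neg]
    congr 1
    exact comul_counit_left (coHochCounit R ∘ₗ TensorProduct.map
      (LinearMap.mulRight k x ∘ₗ ℓ ∘ₗ P ^ q) LinearMap.id ∘ₗ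
      (TensorProduct.comm k _ _).toLinearMap)
      (LinearMap.mulRight k x ∘ₗ ℓ ∘ₗ P ^ q) (fun a b => by simp) m

lemma coHochCounit_inner (z : CoHochChain R) :
    coHochCounit R (coHochInner R z) = cobarD R (coHochCounit R z) := by
  induction z using TensorProduct.induction_on with
  | zero => simp
  | add x y hx hy => simp only [map_add, hx, hy]
  | tmul x m => simp [coHochInner_tmul]

lemma coHochCounit_parity (z : CoHochChain R) :
    coHochCounit R (coHochParity R z) = PΩ (coHochCounit R z) := by
  induction z using TensorProduct.induction_on with
  | zero => simp
  | add x y hx hy => simp only [map_add, hx, hy]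
  | tmul x m => simp [isCoaugHom_parity.counit]

lemma parity_pow_of_parity {X : Type w} [AddCommGroup X] [Module k X] {f : Module.End k X} {q : ℕ}
    {x : X} (hx : f x = (-1 : k) ^ q • x) : (f ^ (q + 1)) x = x := by
  have h : ∀ n, (f ^ n) x = (-1 : k) ^ (n * q) • x := by
    intro n
    induction n with
    | zero => simp
    | succ n ih => rw [pow_succ', Module.End.mul_apply, ih, map_smul, hx, smul_smul]; ring_nf
  rw [h, (Nat.even_mul_succ_self q |> fun h => by rwa [mul_comm] at h : Even ((q + 1) * q)).neg_one_pow,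
    one_smul]

/-- The cyclic invariance that makes the terms of `b B + B b` coming from the two coactions cancel:
`ω a` and `± a ω` have the same rotations, up to those that move the letter `a` itself. -/
lemma bimodRotate_markD_cyclic (hs : IsCoaugHom s) (hsP : ∀ c, s (P c) = P (s c)) (q : ℕ)
    (x : Cobar R) (m : KoszulDual R) :
    bimodRotate s q (markD R (x * ℓ (s m))) -
      (-1 : k) ^ q • bimodRotate s q (markD R (ℓ ((P ^ q) m) * x)) =
    (-1 : k) ^ q • (((PΩ ^ (q + 1)) x) ⊗ₜ (P ^ (q + 1)) (toDualAug R m : KoszulDual R)) -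
      cobarMap s (PΩ x) ⊗ₜ P (s (toDualAug R m)) := by
  have e : ∀ z : CobarBimod R, bimodRotate s q (bimodRight R (ℓ (s m)) z) =
      (-1 : k) ^ (q + 1) • bimodRotate s q (bimodLeft R (ℓ ((P ^ (q + 1)) m)) z) := by
    intro z
    induction z using bimod_induction with
    | h0 => simp
    | hadd y z hy hz => simp only [map_add, hy, hz, smul_add]
    | h u c v =>
      simp [cobarParity_pow_mul, cobarMap_mul, hs, map_parity_pow hsP, mul_assoc,
        TensorProduct.smul_tmul']
  have hb : ∀ f : KoszulDual R →ₗ[k] KoszulDual R, IsCoaugHom f →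
      (toDualAug R (f m) : KoszulDual R) = f (toDualAug R m) := fun f hf => by
    simp [hf.counit, hf.one]
  rw [markD_mul, markD_letter_mul, map_add, map_sub, e, markD_letter, map_neg, map_neg, bimodLeft_tmul,
    bimodRotate_tmul, bimodRotate_tmul, cobarParity_letter, bimodLeft_neg, map_neg,
    parity_parity_pow]
  rw [hb s hs, hb _ (isCoaugHom_parity_pow q), parity_parity_pow, cobarParity_pow_one,
    cobarMap_one, mul_one, mul_one, one_mul, pow_succ (-1 : k)]
  module

lemma coHochT_tmul (x : Cobar R) (m : KoszulDual R) :
    coHochT s (x ⊗ₜ m) = cobarMap s x ⊗ₜ s m := rfl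

/-- `b B + B b = 1 - T`. With `w = ε(m) ω`, the rotation of `d (markD w) + markD (d w)` gives the
boundary terms `w ⊗ 1` and `σ(w) ⊗ 1`, and the terms of `B b` from the coactions, by cyclic
invariance, the rest of `1 - T`. -/
lemma coHochB_coHochConnes [CharZero k] (hs : IsCoaugHom s) (hsP : ∀ c, s (P c) = P (s c))
    (z : CoHochChain R) :
    coHochB s (coHochConnes s z) + coHochConnes s (coHochB s z) = z - coHochT s z := by
  induction z using coHoch_parity_induction with
  | hadd x y hx hy =>
    simp only [map_add]
    linear_combination (norm := module) hx + hy
  | h q z hz =>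
    set w := coHochCounit R z with hw
    have hwP : PΩ w = (-1 : k) ^ q • w := by rw [hw, ← coHochCounit_parity, hz, map_smul]
    have hD : bimodParity R (markD R w) = (-1 : k) ^ (q + 1) • markD R w := by
      have := markD_parity w
      rw [hwP, map_smul] at this
      rw [pow_succ]
      linear_combination (norm := module) this
    have hBz : coHochParity R (coHochConnesOf s q z) =
        (-1 : k) ^ (q + 1) • coHochConnesOf s q z := by
      have h : ∀ y : CobarBimod R, coHochParity R (bimodRotate s (q + 1) y) =
          bimodRotate s (q + 1) (bimodParity R y) := by
        intro y
        induction y using bimod_induction with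
        | h0 => simp
        | hadd y z hy hz => simp only [map_add, hy, hz]
        | h u c v => simp [cobarParity_mul, cobarMap_parity hs hsP]
      simp only [coHochConnesOf, LinearMap.comp_apply, h, ← hw, hD, map_smul]
    have hbz : coHochParity R (coHochBOf s q z) = (-1 : k) ^ (q + 1) • coHochBOf s q z := by
      rw [coHochParity_coHochBOf hsP, hz, map_smul, pow_succ]
      module
    have e1 : ∀ z : CoHochChain R,
        bimodRotate s q (markD R (LinearMap.mul' k _ (TensorProduct.map LinearMap.id (ℓ ∘ₗ s) z))) -
        (-1 : k) ^ q • bimodRotate s q (markD R (LinearMap.mul' k _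
          (TensorProduct.map (ℓ ∘ₗ P ^ q) LinearMap.id (TensorProduct.comm k _ _ z)))) =
        (-1 : k) ^ q • ((coHochParity R ^ (q + 1)) z -
          (PΩ ^ (q + 1)) (coHochCounit R z) ⊗ₜ dualOne R) -
        (coHochT s (coHochParity R z) - cobarMap s (PΩ (coHochCounit R z)) ⊗ₜ dualOne R) := by
      intro z
      induction z using TensorProduct.induction_on with
      | zero => simp
      | add x y hx hy =>
        simp only [map_add, TensorProduct.add_tmul]
        linear_combination (norm := module) hx + hy
      | tmul x m =>
        have hpow : ∀ n, (coHochParity R ^ n) (x ⊗ₜ m) = (PΩ ^ n) x ⊗ₜ (P ^ n) m := by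
          intro n
          induction n with
          | zero => rfl
          | succ n ih => rw [pow_succ', Module.End.mul_apply, ih]; simp
        have := bimodRotate_markD_cyclic hs hsP q x m
        simp only [TensorProduct.map_tmul, TensorProduct.comm_tmul, LinearMap.comp_apply,
          LinearMap.mul'_apply, LinearMap.id_apply, hpow, coHochParity_tmul, coHochT_tmul,
          coHochCounit_tmul]
        rw [this]
        simp only [coe_toDualAug, map_sub, map_smul, TensorProduct.tmul_sub, hs.one, hsP,
          TensorProduct.tmul_smul, TensorProduct.smul_tmul', dualParity_one,
          (isCoaugHom_parity_pow (q + 1)).one]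
    have e2 : LinearMap.mul' k _ (TensorProduct.map PΩ (ℓ ∘ₗ s ∘ₗ P) z) =
        (-1 : k) ^ q • LinearMap.mul' k _ (TensorProduct.map LinearMap.id (ℓ ∘ₗ s) z) := by
      rw [← map_smul, ← map_smul, ← hz, coHochParity, ← LinearMap.comp_apply (TensorProduct.map _ _),
        ← TensorProduct.map_comp]
      rfl
    have e3 := e1 z
    rw [parity_pow_of_parity hz, ← hw, hz, parity_pow_of_parity hwP, hwP, map_smul, map_smul] at e3
    have e4 := congrArg (bimodRotate s q) (bimodD_markD w)
    rw [map_add, map_sub, bimodRotate_tmul, bimodRotate_tmul, parity_pow_of_parity hwP,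
      cobarMap_one, cobarParity_pow_one, one_mul, mul_one] at e4
    rw [coHochConnes_of_parity hz, coHochB_of_parity hBz, coHochB_of_parity hz,
      coHochConnes_of_parity hbz]
    simp only [coHochConnesOf, LinearMap.comp_apply, ← hw, bimodRotate_add_two]
    rw [coHochBOf_bimodRotate hs hsP hD, bimodRotate_add_two]
    simp only [coHochBOf, LinearMap.add_apply, map_add, coHochCounit_inner, coHochCounit_left,
      coHochCounit_right, e2, map_neg, map_smul, ← hw]
    have hqq : (-1 : k) ^ q * (-1 : k) ^ q = 1 := by rw [← mul_pow]; simp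
    have e5 := congrArg (fun y => (-1 : k) ^ q • y) e3
    simp only [smul_sub, smul_smul, hqq, one_smul, TensorProduct.smul_tmul'] at e5
    linear_combination (norm := module) e4 + e5

variable (R) in
/-- `ω a ⊗ m ↦ ± ε(m) ω ⊗ a`, the contraction of the complex `Ω(C) ⊗ C`. -/
def coHochS : CoHochChain R →ₗ[k] CoHochChain R :=
  TensorProduct.map PΩ (P ∘ₗ (DualAug R).subtype) ∘ₗ lastLetter k (DualAug R) ∘ₗ coHochCounit R

/-- The complex `Ω(C) ⊗ C` is contractible onto the span of `1 ⊗ 1`. -/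
lemma coHochOneSided_contraction (z : CoHochChain R) :
    coHochOneSided R (coHochS R z) + coHochS R (coHochOneSided R z) =
      z - TensorAlgebra.algebraMapInv (coHochCounit R z) • (1 ⊗ₜ dualOne R) := by
  have h1 : ∀ x : Cobar R, coHochOneSided R (coHochS R (x ⊗ₜ dualOne R)) +
      coHochS R (cobarD R x ⊗ₜ dualOne R) = x ⊗ₜ dualOne R -
        TensorAlgebra.algebraMapInv x • (1 ⊗ₜ dualOne R) := by
    have hS : ∀ x, coHochS R (x ⊗ₜ dualOne R) =
        TensorProduct.map PΩ (P ∘ₗ (DualAug R).subtype) (lastLetter k (DualAug R) x) := by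
      intro x; simp [coHochS]
    have hSl : ∀ x c, coHochS R ((x * ℓ c) ⊗ₜ dualOne R) =
        PΩ x ⊗ₜ P (toDualAug R c : KoszulDual R) := by
      intro x c
      rw [hS, letter, LinearMap.comp_apply, lastLetter_mul_ι]
      rfl
    intro x
    induction x using words_induction_right with
    | h1 => rw [hS]; simp
    | hsmul r x hx =>
      simp only [map_smul, ← TensorProduct.smul_tmul'] at hx ⊢
      linear_combination (norm := module) r • hx
    | hadd x y hx hy =>
      simp only [map_add, TensorProduct.add_tmul] at hx hy ⊢
      linear_combination (norm := module) hx + hy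
    | hι a x _ =>
      let F : KoszulDual R ⊗[k] KoszulDual R →ₗ[k] CoHochChain R :=
        TensorProduct.map (LinearMap.mulLeft k x ∘ₗ ℓ)
          (P ∘ₗ (LinearMap.id - (DualAug R).subtype ∘ₗ toDualAug R))
      have h2 := comul_counit_right F ((TensorProduct.mk k _ _).flip (dualOne R) ∘ₗ
        LinearMap.mulLeft k x ∘ₗ ℓ) (fun b c => by simp [F]) (a : KoszulDual R)
      simp only [LinearMap.comp_apply, LinearMap.flip_apply, TensorProduct.mk_apply,
        LinearMap.mulLeft_apply] at h2
      have h3 : coHochS R ((PΩ x * letterD R (a : KoszulDual R)) ⊗ₜ dualOne R) =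
          -TensorProduct.map (LinearMap.mulLeft k x ∘ₗ ℓ)
            (P ∘ₗ (DualAug R).subtype ∘ₗ toDualAug R) (Δ (a : KoszulDual R)) := by
        rw [letterD, LinearMap.comp_apply, LinearMap.comp_apply]
        generalize Δ (a : KoszulDual R) = z
        induction z using TensorProduct.induction_on with
        | zero => simp
        | add x y hx hy => simp only [map_add, mul_add, TensorProduct.add_tmul, hx, hy]; abel
        | tmul b c =>
          simp only [TensorProduct.map_tmul, LinearMap.mul'_apply, LinearMap.comp_apply,
            ← mul_assoc, hSl, cobarParity_mul, cobarParity_cobarParity, cobarParity_letter,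
            dualParity_dualParity, mul_neg, TensorProduct.neg_tmul, LinearMap.mulLeft_apply,
            Submodule.subtype_apply]
      have h4 : coHochOneSided R (PΩ x ⊗ₜ P (a : KoszulDual R)) =
          -(PΩ (cobarD R x) ⊗ₜ P (a : KoszulDual R)) +
          TensorProduct.map (LinearMap.mulLeft k x ∘ₗ ℓ) P (Δ (a : KoszulDual R)) := by
        rw [coHochOneSided, LinearMap.add_apply, coHochInner_tmul, coHochLeft_tmul, cobarD_parity,
          TensorProduct.neg_tmul, isCoaugHom_parity.comul, ← LinearMap.comp_apply
          (TensorProduct.map _ _), ← TensorProduct.map_comp, cobarParity_cobarParity]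
        congr 3
        ext c
        simp
      have h5 : F (Δ (a : KoszulDual R)) =
          TensorProduct.map (LinearMap.mulLeft k x ∘ₗ ℓ) P (Δ (a : KoszulDual R)) -
          TensorProduct.map (LinearMap.mulLeft k x ∘ₗ ℓ)
            (P ∘ₗ (DualAug R).subtype ∘ₗ toDualAug R) (Δ (a : KoszulDual R)) := by
        generalize Δ (a : KoszulDual R) = z
        induction z using TensorProduct.induction_on with
        | zero => simp
        | add x y hx hy => simp only [map_add, hx, hy]; abel
        | tmul b c => simp [F, TensorProduct.tmul_sub]
      rw [← letter_coe, hSl, cobarD_mul, cobarD_letter, TensorProduct.add_tmul, map_add, hSl,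
        toDualAug_coe, h3, h4, ← h2, h5]
      have : TensorAlgebra.algebraMapInv (x * ℓ (a : KoszulDual R)) = 0 := by
        rw [letter_coe, map_mul, algebraMapInv_ι, mul_zero]
      rw [this]
      module
  have h6 : coHochS R (coHochLeft LinearMap.id z) =
      z - coHochCounit R z ⊗ₜ dualOne R := by
    rw [coHochS, LinearMap.comp_apply, LinearMap.comp_apply, coHochCounit_left]
    induction z using TensorProduct.induction_on with
    | zero => simp
    | add x y hx hy =>
      simp only [map_add, TensorProduct.add_tmul] at hx hy ⊢
      rw [hx, hy]; abel
    | tmul x m =>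
      simp only [TensorProduct.map_tmul, LinearMap.mul'_apply, LinearMap.comp_apply, letter,
        lastLetter_mul_ι, LinearMap.id_apply, cobarParity_cobarParity, Submodule.subtype_apply,
        coHochCounit_tmul]
      simp [isCoaugHom_parity.counit, TensorProduct.tmul_sub, TensorProduct.smul_tmul']
  have h7 := h1 (coHochCounit R z)
  have h8 : ∀ y, coHochS R (coHochCounit R y ⊗ₜ dualOne R) = coHochS R y := by
    intro y; simp [coHochS]
  rw [h8, ← coHochCounit_inner, h8] at h7
  rw [coHochOneSided, LinearMap.add_apply (coHochInner R) _ z, map_add, h6]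
  rw [coHochOneSided] at h7
  linear_combination (norm := module) h7

lemma coHochOneSided_coHochOneSided (z : CoHochChain R) :
    coHochOneSided R (coHochOneSided R z) = 0 := by
  simp only [coHochOneSided, LinearMap.add_apply, map_add]
  linear_combination (norm := module) coHochInner_coHochInner z +
    coHochLeft_coHochLeft isCoaugHom_id (fun _ => rfl) z

end CoConnes

/-! ### The comparison maps -/

section WordProducts
variable {k : Type u} [Field k] {W : Type v} [AddCommGroup W] [Module k W]

lemma firstLetter_mul (x y : TensorAlgebra k W) : firstLetter k W (x * y) =
    LinearMap.lTensor W (LinearMap.mulRight k y) (firstLetter k W x) +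
      TensorAlgebra.algebraMapInv x • firstLetter k W y := by
  refine words_ext (f := firstLetter k W ∘ₗ LinearMap.mulRight k y)
    (g := LinearMap.lTensor W (LinearMap.mulRight k y) ∘ₗ firstLetter k W +
      LinearMap.toSpanSingleton k _ (firstLetter k W y) ∘ₗ
        (TensorAlgebra.algebraMapInv (M := W)).toLinearMap) ?_ ?_ x
  · simp
  · intro a x; simp [mul_assoc]

lemma lastLetter_mul (x y : TensorAlgebra k W) : lastLetter k W (x * y) =
    LinearMap.rTensor W (LinearMap.mulLeft k x) (lastLetter k W y) +
      TensorAlgebra.algebraMapInv y • lastLetter k W x := by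
  refine words_ext_right (f := lastLetter k W ∘ₗ LinearMap.mulLeft k x)
    (g := LinearMap.rTensor W (LinearMap.mulLeft k x) ∘ₗ lastLetter k W +
      LinearMap.toSpanSingleton k _ (lastLetter k W x) ∘ₗ
        (TensorAlgebra.algebraMapInv (M := W)).toLinearMap) ?_ ?_ y
  · simp
  · intro a x; simp [← mul_assoc]

lemma ιInv_tmap {W' : Type w} [AddCommGroup W'] [Module k W'] (f : W →ₗ[k] W')
    (x : TensorAlgebra k W) :
    TensorAlgebra.ιInv (tmap f x) = f (TensorAlgebra.ιInv x) := by
  refine words_ext (f := TensorAlgebra.ιInv ∘ₗ (tmap f).toLinearMap)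
    (g := f ∘ₗ TensorAlgebra.ιInv) ?_ ?_ x
  · simp
  · intro a x; simp [ιInv_ι_mul]

end WordProducts

section BarProducts
variable {k : Type u} [Field k] {A : Type w} [Ring A] [Algebra k A] (ε : A →ₐ[k] k)

local notation "T" => TensorAlgebra k (AugIdeal ε)
local notation "τ" => TensorAlgebra.ι k (M := AugIdeal ε)
local notation "par" => lengthParity k (AugIdeal ε)

/-- `(u a) ⊗ (b v) ↦ (-1)^{|u|} u (a b) v`, the part of the bar differential of a product that
multiplies the last letter of the first factor and the first letter of the second one. -/
def barCross : (T ⊗[k] AugIdeal ε) ⊗[k] (AugIdeal ε ⊗[k] T) →ₗ[k] T :=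
  LinearMap.mul' k _ ∘ₗ TensorProduct.map par
    (LinearMap.mul' k _ ∘ₗ LinearMap.rTensor _ (TensorAlgebra.ι k ∘ₗ augMul ε) ∘ₗ
      (TensorProduct.assoc k _ _ _).symm.toLinearMap) ∘ₗ
    (TensorProduct.assoc k _ _ _).toLinearMap

@[simp] lemma barCross_tmul (x y : T) (a b : AugIdeal ε) :
    barCross ε ((x ⊗ₜ a) ⊗ₜ (b ⊗ₜ y)) = par x * (τ (augMul ε (a ⊗ₜ b)) * y) := by
  simp [barCross]

lemma mulFirst_eq_barCross (a : AugIdeal ε) (x : T) :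
    mulFirst ε a x = barCross ε ((1 ⊗ₜ a) ⊗ₜ firstLetter k _ x) := by
  refine words_ext (f := mulFirst ε a)
    (g := barCross ε ∘ₗ TensorProduct.mk k _ _ (1 ⊗ₜ a) ∘ₗ firstLetter k _) ?_ ?_ x
  · simp
  · intro b x; simp

lemma barD_mul (x y : T) : barD ε (x * y) = barD ε x * y + par x * barD ε y -
    barCross ε (lastLetter k _ x ⊗ₜ firstLetter k _ y) := by
  induction x using words_induction with
  | h1 => simp
  | hsmul r x hx =>
    simp only [smul_mul_assoc, map_smul, hx, smul_add, smul_sub, ← TensorProduct.smul_tmul']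
  | hadd x z hx hz =>
    simp only [add_mul, map_add, hx, hz, TensorProduct.add_tmul]; abel
  | hι a x hx =>
    have h1 : mulFirst ε a (x * y) =
        mulFirst ε a x * y + TensorAlgebra.algebraMapInv x • mulFirst ε a y := by
      refine words_ext (f := mulFirst ε a ∘ₗ LinearMap.mulRight k y)
        (g := LinearMap.mulRight k y ∘ₗ mulFirst ε a +
          LinearMap.toSpanSingleton k _ (mulFirst ε a y) ∘ₗ
            (TensorAlgebra.algebraMapInv (M := AugIdeal ε)).toLinearMap) ?_ ?_ x
      · simp
      · intro b x; simp [mul_assoc]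
    have h2 : ∀ (l : T ⊗[k] AugIdeal ε) (z : AugIdeal ε ⊗[k] T),
        barCross ε (LinearMap.rTensor _ (LinearMap.mulLeft k (τ a)) l ⊗ₜ z) =
        -(τ a * barCross ε (l ⊗ₜ z)) := by
      intro l z
      induction l using TensorProduct.induction_on with
      | zero => simp
      | add x y hx hy =>
        simp only [map_add, TensorProduct.add_tmul, hx, hy, mul_add, neg_add]
      | tmul u b =>
        induction z using TensorProduct.induction_on with
        | zero => simp
        | add x y hx hy =>
          simp only [map_add, TensorProduct.tmul_add, hx, hy, mul_add, neg_add]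
        | tmul c v => simp [lengthParity_mul, mul_assoc]
    rw [mul_assoc, barD_ι_mul, h1, hx, barD_ι_mul, lengthParity_mul, lengthParity_ι,
      lastLetter_mul, TensorProduct.add_tmul, map_add, h2, ← TensorProduct.smul_tmul', map_smul,
      lastLetter_ι, ← mulFirst_eq_barCross]
    simp only [mul_add, mul_sub, sub_mul, neg_mul, mul_assoc]
    abel

lemma hochFirst_eq (σ : A ≃ₐ[k] A) (a : A) (x : T) : hochFirst ε σ (a ⊗ₜ x) =
    LinearMap.rTensor _ (LinearMap.mulLeft k a ∘ₗ σ.toLinearMap ∘ₗ (AugIdeal ε).subtype)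
      (firstLetter k _ x) := by
  refine words_ext (f := hochFirst ε σ ∘ₗ TensorProduct.mk k _ _ a)
    (g := LinearMap.rTensor _ (LinearMap.mulLeft k a ∘ₗ σ.toLinearMap ∘ₗ (AugIdeal ε).subtype) ∘ₗ
      firstLetter k _) ?_ ?_ x
  · simp
  · intro b x; simp

lemma hochLast_eq (a : A) (x : T) : hochLast ε (a ⊗ₜ x) =
    -TensorProduct.map (LinearMap.mulRight k a ∘ₗ (AugIdeal ε).subtype) par
      (TensorProduct.comm k _ _ (lastLetter k _ x)) := by
  refine words_ext_right (f := hochLast ε ∘ₗ TensorProduct.mk k _ _ a)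
    (g := -(TensorProduct.map (LinearMap.mulRight k a ∘ₗ (AugIdeal ε).subtype) par ∘ₗ
      (TensorProduct.comm k _ _).toLinearMap ∘ₗ lastLetter k _)) ?_ ?_ x
  · simp
  · intro b x; simp

end BarProducts

section KoszulMaps
variable {k : Type u} [Field k] {V : Type v} [AddCommGroup V] [Module k V]
  {R : Submodule k (V ⊗[k] V)}

local notation "ℓ" => letter R
local notation "P" => dualParity R
local notation "PΩ" => cobarParity R
local notation "Δ" => Coalgebra.comul (R := k) (A := KoszulDual R)
local notation "ε" => Coalgebra.counit (R := k) (A := KoszulDual R)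
local notation "κ" => kappa R
local notation "A" => QuadAlg R
local notation "εA" => QuadAlg.aug R
local notation "BA" => TensorAlgebra k (AugIdeal (QuadAlg.aug R))
local notation "par" => lengthParity k (AugIdeal (QuadAlg.aug R))

@[simp] lemma aug_mk (x : TensorAlgebra k V) :
    εA (QuadAlg.mk R x) = TensorAlgebra.algebraMapInv x := by
  rw [QuadAlg.aug, QuadAlg.lift_mk]; rfl

@[simp] lemma aug_ι (v : V) : εA (QuadAlg.ι R v) = 0 := by
  rw [QuadAlg.ι, LinearMap.comp_apply, AlgHom.toLinearMap_apply, aug_mk, algebraMapInv_ι]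

@[simp] lemma aug_kappa (c : KoszulDual R) : εA (κ c) = 0 := aug_ι _

@[simp] lemma kappa_one : κ (dualOne R) = 0 := by
  rw [kappa, LinearMap.comp_apply, LinearMap.comp_apply, incl_dualOne, ιInv_one, map_zero]

@[simp] lemma kappa_parity (c : KoszulDual R) : κ (P c) = -κ c := by
  simp only [kappa, LinearMap.comp_apply, dualParity, incl_dualMap, ιInv_tmap]
  simp

lemma kappa_parity_pow (q : ℕ) (c : KoszulDual R) : κ ((P ^ q) c) = (-1 : k) ^ q • κ c := by
  induction q with
  | zero => simp
  | succ q ih =>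
    rw [← parity_parity_pow, kappa_parity, ih, pow_succ]; module

@[simp] lemma kappa_dualAut {σ : A ≃ₐ[k] A} (hσ : IsGradedAut σ) (c : KoszulDual R) :
    κ (dualAut σ hσ c) = σ (κ c) := by
  simp only [kappa, LinearMap.comp_apply, dualAut, incl_dualMap, ιInv_tmap, ι_onGen hσ]

variable (R) in
/-- `κ` as a map to the augmentation ideal. -/
def kappaAug : KoszulDual R →ₗ[k] AugIdeal (QuadAlg.aug R) := toAug εA ∘ₗ κ

@[simp] lemma coe_kappaAug (c : KoszulDual R) : (kappaAug R c : A) = κ c := by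
  simp [kappaAug]

/-- For a word `x`, both sides vanish unless `x = a b` has length two, and then they are the product
`a b` in `A`. -/
lemma mk_wordsProj_two (x : TensorAlgebra k V) :
    LinearMap.mul' k _ (TensorProduct.map (QuadAlg.ι R ∘ₗ TensorAlgebra.ιInv)
      (QuadAlg.ι R ∘ₗ TensorAlgebra.ιInv) (deconc x)) = QuadAlg.mk R (wordsProj 2 x) := by
  have hone : ∀ x : TensorAlgebra k V,
      wordsProj 0 x = algebraMap k _ (TensorAlgebra.algebraMapInv x) := by
    intro x
    refine words_ext (f := wordsProj 0) (g := Algebra.linearMap k _ ∘ₗ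
      (TensorAlgebra.algebraMapInv (M := V)).toLinearMap) ?_ ?_ x
    · simp [wordsProj_same (k := k) (W := V) (n := 0) (x := 1)
        (by simp [wordsOfLength, Submodule.mem_one])]
    · intro a x; simp [wordsProj_zero_ι_mul]
  have h0 : ∀ n, 0 < n → wordsProj n (1 : TensorAlgebra k V) = 0 := fun n hn =>
    wordsProj_ne (n := 0) (by simp [wordsOfLength, Submodule.mem_one]) (by omega)
  have h1 : ∀ x : TensorAlgebra k V,
      QuadAlg.ι R (TensorAlgebra.ιInv x) = QuadAlg.mk R (wordsProj 1 x) := by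
    intro x
    refine words_ext (f := QuadAlg.ι R ∘ₗ TensorAlgebra.ιInv)
      (g := (QuadAlg.mk R).toLinearMap ∘ₗ wordsProj 1) ?_ ?_ x
    · simp [h0]
    · intro a x
      simp only [LinearMap.comp_apply, ιInv_ι_mul, wordsProj_ι_mul a 0, hone,
        AlgHom.toLinearMap_apply, map_mul, map_smul, QuadAlg.ι, AlgHom.commutes]
      rw [← Algebra.commutes, Algebra.smul_def]
  refine words_ext (f := LinearMap.mul' k _ ∘ₗ
    TensorProduct.map (QuadAlg.ι R ∘ₗ TensorAlgebra.ιInv)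
      (QuadAlg.ι R ∘ₗ TensorAlgebra.ιInv) ∘ₗ deconc)
    (g := (QuadAlg.mk R).toLinearMap ∘ₗ wordsProj 2) ?_ ?_ x
  · simp [h0]
  · intro a x
    have h2 : ∀ z : TensorAlgebra k V ⊗[k] TensorAlgebra k V,
        TensorProduct.map (QuadAlg.ι R ∘ₗ TensorAlgebra.ιInv)
        (QuadAlg.ι R ∘ₗ TensorAlgebra.ιInv) (LinearMap.rTensor _
          (LinearMap.mulLeft k (TensorAlgebra.ι k a)) z) =
        TensorProduct.map (LinearMap.toSpanSingleton k _ (QuadAlg.ι R a))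
          (QuadAlg.ι R ∘ₗ TensorAlgebra.ιInv)
          (LinearMap.rTensor _ TensorAlgebra.algebraMapInv.toLinearMap z) := by
      intro z
      induction z using TensorProduct.induction_on with
      | zero => simp
      | add x y hx hy => simp only [map_add, hx, hy]
      | tmul y z => simp [ιInv_ι_mul]
    simp only [LinearMap.comp_apply, deconc_ι_mul, map_add, h2, deconc_counit_left]
    rw [wordsProj_ι_mul a 1, AlgHom.toLinearMap_apply, map_mul, ← AlgHom.toLinearMap_apply,
      ← LinearMap.comp_apply (QuadAlg.mk R).toLinearMap (TensorAlgebra.ι k), ← QuadAlg.ι, ← h1 x]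
    simp

/-- `∑ κ(c') κ(c'') = 0`, since `A^¡₂ = R`. -/
lemma kappa_mul_kappa (c : KoszulDual R) :
    LinearMap.mul' k _ (TensorProduct.map κ κ (Δ c)) = 0 := by
  have h : TensorProduct.map κ κ (Δ c) = TensorProduct.map (QuadAlg.ι R ∘ₗ TensorAlgebra.ιInv)
      (QuadAlg.ι R ∘ₗ TensorAlgebra.ιInv) (deconc (incl R c)) := by
    rw [← map_incl_comul, ← LinearMap.comp_apply (TensorProduct.map _ _)
      (TensorProduct.map (incl R) (incl R)), ← TensorProduct.map_comp]
    rfl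
  rw [h, mk_wordsProj_two]
  have hc := incl_mem c
  refine Submodule.iSup_induction _ (motive := fun x => QuadAlg.mk R (wordsProj 2 x) = 0) hc ?_
    (by simp) (fun x y hx hy => by simp [hx, hy])
  intro n x hx
  rw [mem_dualPiece] at hx
  by_cases hn : n = 2
  · subst hn
    rw [wordsProj_same hx.1]
    have := hx.2 0 0 rfl
    simp only [wordsOfLength, pow_zero, one_mul, mul_one] at this
    exact QuadAlg.mk_relations this
  · rw [wordsProj_ne hx.1 hn, map_zero]

variable (R) in
/-- The inclusion `A^¡ → T(Ā)` into the bar construction of `A`. -/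
def dualToBar : KoszulDual R →ₗ[k] BA :=
  (tmap (toAug (QuadAlg.aug R) ∘ₗ QuadAlg.ι R)).toLinearMap ∘ₗ incl R

local notation "j" => dualToBar R

@[simp] lemma koszulToHoch_tmul (a : A) (c : KoszulDual R) :
    koszulToHoch R (a ⊗ₜ c) = a ⊗ₜ j c := rfl

@[simp] lemma dualToBar_one : j (dualOne R) = 1 := by
  rw [dualToBar, LinearMap.comp_apply, incl_dualOne]; simp

@[simp] lemma algebraMapInv_dualToBar (c : KoszulDual R) :
    TensorAlgebra.algebraMapInv (j c) = ε c := algebraMapInv_tmap _ _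

lemma deconc_dualToBar (c : KoszulDual R) : deconc (j c) = TensorProduct.map j j (Δ c) := by
  rw [dualToBar, LinearMap.comp_apply, AlgHom.toLinearMap_apply, deconc_tmap, ← map_incl_comul,
    ← LinearMap.comp_apply, ← TensorProduct.map_comp]

lemma ιInv_dualToBar (c : KoszulDual R) : TensorAlgebra.ιInv (j c) = kappaAug R c :=
  ιInv_tmap _ _

lemma firstLetter_dualToBar (c : KoszulDual R) :
    firstLetter k _ (j c) = TensorProduct.map (kappaAug R) j (Δ c) := by
  rw [firstLetter, LinearMap.comp_apply, deconc_dualToBar, ← LinearMap.comp_apply,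
    LinearMap.rTensor_comp_map, show TensorAlgebra.ιInv ∘ₗ j = kappaAug R from
      LinearMap.ext ιInv_dualToBar]

lemma lastLetter_dualToBar (c : KoszulDual R) :
    lastLetter k _ (j c) = TensorProduct.map j (kappaAug R) (Δ c) := by
  rw [lastLetter, LinearMap.comp_apply, deconc_dualToBar, ← LinearMap.comp_apply,
    LinearMap.lTensor_comp_map, show TensorAlgebra.ιInv ∘ₗ j = kappaAug R from
      LinearMap.ext ιInv_dualToBar]

@[simp] lemma lengthParity_dualToBar (c : KoszulDual R) : par (j c) = j (P c) := by
  simp only [lengthParity, dualToBar, LinearMap.comp_apply, AlgHom.toLinearMap_apply, dualParity,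
    incl_dualMap, tmap_comp]
  congr 2
  ext; simp

/-- A word in `A^¡` is its first letter times the rest. -/
lemma sum_kappaAug_mul (c : KoszulDual R) : LinearMap.mul' k _
    (TensorProduct.map (TensorAlgebra.ι k ∘ₗ kappaAug R) j (Δ c)) = j c - ε c • 1 := by
  have h : ∀ x : BA, LinearMap.mul' k _ (LinearMap.rTensor _ (TensorAlgebra.ι k)
      (firstLetter k _ x)) = x - TensorAlgebra.algebraMapInv x • 1 := by
    intro x
    refine words_ext (f := LinearMap.mul' k _ ∘ₗ LinearMap.rTensor _ (TensorAlgebra.ι k) ∘ₗ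
      firstLetter k _) (g := LinearMap.id - LinearMap.toSpanSingleton k _ 1 ∘ₗ
        (TensorAlgebra.algebraMapInv (M := AugIdeal (QuadAlg.aug R))).toLinearMap) ?_ ?_ x
    · simp
    · intro a x; simp
  have := h (j c)
  rwa [firstLetter_dualToBar, ← LinearMap.comp_apply (LinearMap.rTensor _ _),
    LinearMap.rTensor_comp_map, algebraMapInv_dualToBar] at this

/-- `A^¡` consists of cycles of the bar construction. -/
@[simp] lemma barD_dualToBar (c : KoszulDual R) : barD εA (j c) = 0 := by
  have h1 : ∀ c : KoszulDual R, LinearMap.mul' k _ (LinearMap.rTensor _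
      (TensorAlgebra.ι k ∘ₗ augMul εA) ((TensorProduct.assoc k _ _ _).symm
        (LinearMap.lTensor _ (firstLetter k _) (firstLetter k _ (j c))))) = 0 := by
    intro c
    let H : KoszulDual R ⊗[k] (KoszulDual R ⊗[k] KoszulDual R) →ₗ[k] BA :=
      LinearMap.mul' k _ ∘ₗ LinearMap.rTensor _ (TensorAlgebra.ι k ∘ₗ augMul εA) ∘ₗ
        (TensorProduct.assoc k _ _ _).symm.toLinearMap ∘ₗ
        TensorProduct.map (kappaAug R) (TensorProduct.map (kappaAug R) j)
    have key := sweedler₃ H 0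
      (LinearMap.mul' k _ ∘ₗ LinearMap.rTensor _ (TensorAlgebra.ι k ∘ₗ augMul εA) ∘ₗ
        (TensorProduct.assoc k _ _ _).symm.toLinearMap ∘ₗ
        LinearMap.lTensor _ (firstLetter k _) ∘ₗ TensorProduct.map (kappaAug R) j)
      (fun a b => ?_) (fun a b => ?_) c
    · rw [firstLetter_dualToBar]
      exact key.symm
    · have e : ∀ z : KoszulDual R ⊗[k] KoszulDual R, H (TensorProduct.assoc k _ _ _ (z ⊗ₜ b)) =
          TensorAlgebra.ι k (toAug εA (LinearMap.mul' k _ (TensorProduct.map κ κ z))) * j b := by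
        intro z
        induction z using TensorProduct.induction_on with
        | zero => simp
        | add x y hx hy => simp only [map_add, TensorProduct.add_tmul, hx, hy, add_mul]
        | tmul x y => simp [H, ← toAug_coe_mul]
      rw [e, kappa_mul_kappa]
      simp
    · simp [H, firstLetter_dualToBar]
  rw [barD, LinearMap.neg_apply, LinearMap.comp_apply, LinearMap.comp_apply, markTwoLetters,
    LinearMap.comp_apply, markLetter, LinearMap.comp_apply, deconc_dualToBar]
  generalize Δ c = z
  have h2 : TensorProduct.map par
      (LinearMap.mul' k _ ∘ₗ LinearMap.rTensor _ (TensorAlgebra.ι k ∘ₗ augMul εA) ∘ₗ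
          (TensorProduct.assoc k _ _ _).symm.toLinearMap)
      (LinearMap.lTensor _ (LinearMap.lTensor _ (firstLetter k _)) (LinearMap.lTensor _
        (firstLetter k _) (TensorProduct.map j j z))) = 0 := by
    induction z using TensorProduct.induction_on with
    | zero => simp
    | add x y hx hy => rw [map_add, map_add, map_add, map_add, hx, hy, add_zero]
    | tmul x y =>
      simp only [TensorProduct.map_tmul, LinearMap.lTensor_tmul, LinearMap.comp_apply,
        LinearEquiv.coe_coe, h1, TensorProduct.tmul_zero]
  rw [h2]
  simp

variable (R) in
/-- The quasi-isomorphism `Ω(A^¡) → A`, the multiplicative extension of `κ`. -/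
def cobarToAlg : Cobar R →ₐ[k] A := TensorAlgebra.lift k (κ ∘ₗ (DualAug R).subtype)

local notation "κΩ" => cobarToAlg R

@[simp] lemma coHochToKoszul_tmul (x : Cobar R) (m : KoszulDual R) :
    coHochToKoszul R (x ⊗ₜ m) = κΩ x ⊗ₜ m := rfl

@[simp] lemma cobarToAlg_letter (c : KoszulDual R) : κΩ (ℓ c) = κ c := by
  simp [cobarToAlg, letter]

@[simp] lemma cobarToAlg_parity (x : Cobar R) : κΩ (PΩ x) = κΩ x := by
  induction x using cobar_induction with
  | h1 => simp
  | hsmul r x hx => simp [hx]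
  | hadd x y hx hy => simp [hx, hy]
  | hι c x hx => simp [cobarParity_mul, hx]

@[simp] lemma cobarToAlg_parity_pow (q : ℕ) (x : Cobar R) : κΩ ((PΩ ^ q) x) = κΩ x := by
  induction q with
  | zero => rfl
  | succ q ih => rw [← cobarParity_parity_pow, cobarToAlg_parity, ih]

@[simp] lemma cobarToAlg_cobarD (x : Cobar R) : κΩ (cobarD R x) = 0 := by
  have h : ∀ c, κΩ (letterD R c) = 0 := by
    intro c
    have e : ∀ z : KoszulDual R ⊗[k] KoszulDual R,
        κΩ (LinearMap.mul' k _ (TensorProduct.map (ℓ ∘ₗ P) ℓ z)) =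
        -LinearMap.mul' k _ (TensorProduct.map κ κ z) := by
      intro z
      induction z using TensorProduct.induction_on with
      | zero => simp
      | add x y hx hy => simp only [map_add, hx, hy, neg_add]
      | tmul x y => simp
    rw [letterD, LinearMap.comp_apply, LinearMap.comp_apply, e, kappa_mul_kappa, neg_zero]
  induction x using cobar_induction with
  | h1 => simp
  | hsmul r x hx => simp [hx]
  | hadd x y hx hy => simp [hx, hy]
  | hι c x hx => simp [cobarD_letter_mul, hx, h]

lemma cobarToAlg_map {σ : A ≃ₐ[k] A} (hσ : IsGradedAut σ) (x : Cobar R) :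
    κΩ (cobarMap (dualAut σ hσ) x) = σ (κΩ x) := by
  have hs : IsCoaugHom (dualAut σ hσ) := isCoaugHom_dualMap _ _
  induction x using cobar_induction with
  | h1 => simp
  | hsmul r x hx => simp [hx]
  | hadd x y hx hy => simp [hx, hy]
  | hι c x hx => rw [cobarMap_mul, map_mul, hx, cobarMap_letter hs]; simp

lemma mulLeftFactor_tmul (f : KoszulDual R →ₗ[k] A) (a : A) (c : KoszulDual R) :
    mulLeftFactor f (a ⊗ₜ c) = TensorProduct.map (LinearMap.mulLeft k a ∘ₗ f) LinearMap.id (Δ c) := by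
  simp only [mulLeftFactor, LinearMap.comp_apply, LinearMap.lTensor_tmul]
  generalize Δ c = z
  induction z using TensorProduct.induction_on with
  | zero => simp
  | add x y hx hy => simp only [map_add, TensorProduct.tmul_add, hx, hy]
  | tmul x y => simp

lemma mulRightFactor_tmul (f : KoszulDual R →ₗ[k] A) (a : A) (c : KoszulDual R) :
    mulRightFactor f (a ⊗ₜ c) = TensorProduct.map (LinearMap.mulRight k a ∘ₗ f) LinearMap.id
      (TensorProduct.comm k _ _ (Δ c)) := by
  simp only [mulRightFactor, LinearMap.comp_apply, LinearMap.lTensor_tmul]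
  generalize Δ c = z
  induction z using TensorProduct.induction_on with
  | zero => simp
  | add x y hx hy => simp only [map_add, TensorProduct.tmul_add, hx, hy]
  | tmul x y => simp

lemma coHochToKoszul_coHochRightOf (q : ℕ) (z : CoHochChain R) :
    coHochToKoszul R (coHochRightOf q z) =
      (-1 : k) ^ (q + 1) • mulRightFactor κ (coHochToKoszul R z) := by
  induction z using TensorProduct.induction_on with
  | zero => simp
  | add x y hx hy => simp only [map_add, hx, hy, smul_add]
  | tmul x m =>
    rw [coHochRightOf_tmul, coHochToKoszul_tmul, mulRightFactor_tmul]
    generalize Δ m = z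
    induction z using TensorProduct.induction_on with
    | zero => simp
    | add x y hx hy =>
      simp only [map_add, neg_add, smul_add] at hx hy ⊢
      rw [hx, hy]
    | tmul a b =>
      simp only [TensorProduct.comm_tmul, TensorProduct.map_tmul, LinearMap.comp_apply,
        LinearMap.mulRight_apply, LinearMap.id_apply, map_neg, coHochToKoszul_tmul, map_mul,
        cobarToAlg_letter, kappa_parity_pow, smul_mul_assoc, ← TensorProduct.smul_tmul', pow_succ]
      module

@[simp] lemma coHochToKoszul_coHochInner (z : CoHochChain R) :
    coHochToKoszul R (coHochInner R z) = 0 := by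
  induction z using TensorProduct.induction_on with
  | zero => simp
  | add x y hx hy => simp only [map_add, hx, hy, add_zero]
  | tmul x m => simp [coHochInner_tmul]

lemma coHochToKoszul_coHochLeft {s : KoszulDual R →ₗ[k] KoszulDual R} {f : A →ₗ[k] A}
    (hf : ∀ c, κ (s c) = f (κ c)) (z : CoHochChain R) :
    coHochToKoszul R (coHochLeft s z) = -mulLeftFactor (f ∘ₗ κ) (coHochToKoszul R z) := by
  induction z using TensorProduct.induction_on with
  | zero => simp
  | add x y hx hy => simp only [map_add, hx, hy, neg_add]
  | tmul x m =>
    rw [coHochLeft_tmul, coHochToKoszul_tmul, mulLeftFactor_tmul]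
    generalize Δ m = z
    induction z using TensorProduct.induction_on with
    | zero => simp
    | add x y hx hy => simp only [map_add, hx, hy, neg_add]
    | tmul a b => simp [TensorProduct.neg_tmul, hf]

/-- `coHochToKoszul` is a map of complexes up to the sign `-1`. -/
lemma coHochToKoszul_coHochB [CharZero k] {σ : A ≃ₐ[k] A} (hσ : IsGradedAut σ) (z : CoHochChain R) :
    coHochToKoszul R (coHochB (dualAut σ hσ) z) = -koszulB σ (coHochToKoszul R z) := by
  have h3 : ∀ z, coHochToKoszul R (coHochParity R z) =
      LinearMap.lTensor _ P (coHochToKoszul R z) := by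
    intro z
    induction z using TensorProduct.induction_on with
    | zero => simp
    | add x y hx hy => simp only [map_add, hx, hy]
    | tmul x m => simp
  have h4 : coHochToKoszul R (coHochRight R z) =
      -mulRightFactor κ (LinearMap.lTensor _ P (coHochToKoszul R z)) := by
    rw [coHochRight_eq, map_smul, map_add, coHochToKoszul_coHochRightOf,
      coHochToKoszul_coHochRightOf, map_add, map_sub, h3, map_add, map_sub]
    module
  simp only [coHochB, koszulB, LinearMap.add_apply, LinearMap.comp_apply, map_add, h4,
    coHochToKoszul_coHochInner,
    coHochToKoszul_coHochLeft (f := σ.toLinearMap) (fun c => kappa_dualAut hσ c)]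
  abel

lemma koszulToHoch_koszulB (σ : A ≃ₐ[k] A) (z : KoszulChain R) :
    koszulToHoch R (koszulB σ z) = hochB εA σ (koszulToHoch R z) := by
  induction z using TensorProduct.induction_on with
  | zero => simp
  | add x y hx hy => simp only [map_add, hx, hy]
  | tmul a c =>
    simp only [koszulB, hochB, LinearMap.add_apply, LinearMap.comp_apply, LinearMap.lTensor_tmul,
      koszulToHoch_tmul, hochInner_tmul, barD_dualToBar, TensorProduct.tmul_zero, add_zero,
      map_add, hochFirst_eq, hochLast_eq, firstLetter_dualToBar, lastLetter_dualToBar,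
      mulLeftFactor_tmul, mulRightFactor_tmul, isCoaugHom_parity.comul]
    generalize Δ c = z
    induction z using TensorProduct.induction_on with
    | zero => simp
    | add x y hx hy =>
      simp only [map_add] at hx hy ⊢
      linear_combination (norm := module) hx + hy
    | tmul x y => simp [TensorProduct.neg_tmul]

/-- On the one-sided complexes, `A ⊗ A^¡` is a subcomplex of the bar resolution `A ⊗ T(Ā)`. -/
lemma koszulToHoch_mulLeftFactor (z : KoszulChain R) :
    koszulToHoch R (mulLeftFactor κ z) = oneBarD εA (koszulToHoch R z) := by
  induction z using TensorProduct.induction_on with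
  | zero => simp
  | add x y hx hy => simp only [map_add, hx, hy]
  | tmul a c =>
    simp only [oneBarD, LinearMap.add_apply, koszulToHoch_tmul, hochInner_tmul, barD_dualToBar,
      TensorProduct.tmul_zero, add_zero, hochFirst_eq, firstLetter_dualToBar, mulLeftFactor_tmul]
    generalize Δ c = z
    induction z using TensorProduct.induction_on with
    | zero => simp
    | add x y hx hy => simp only [map_add, hx, hy]
    | tmul x y => simp

end KoszulMaps

/-! ### The homotopy between the two Connes operators -/

section Homotopy
variable {k : Type u} [Field k] {V : Type v} [AddCommGroup V] [Module k V]
  {R : Submodule k (V ⊗[k] V)}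

local notation "ℓ" => letter R
local notation "P" => dualParity R
local notation "PΩ" => cobarParity R
local notation "Δ" => Coalgebra.comul (R := k) (A := KoszulDual R)
local notation "ε" => Coalgebra.counit (R := k) (A := KoszulDual R)
local notation "κ" => kappa R
local notation "A" => QuadAlg R
local notation "εA" => QuadAlg.aug R
local notation "BA" => TensorAlgebra k (AugIdeal (QuadAlg.aug R))
local notation "par" => lengthParity k (AugIdeal (QuadAlg.aug R))
local notation "j" => dualToBar R
local notation "κΩ" => cobarToAlg R

lemma bimodRight_add (x y : Cobar R) (z : CobarBimod R) :
    bimodRight R (x + y) z = bimodRight R x z + bimodRight R y z := by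
  induction z using bimod_induction with
  | h0 => simp
  | hadd y z hy hz => simp only [map_add, hy, hz]; abel
  | h u c v => simp [mul_add, TensorProduct.tmul_add]

lemma bimodRight_smul (r : k) (x : Cobar R) (z : CobarBimod R) :
    bimodRight R (r • x) z = r • bimodRight R x z := by
  induction z using bimod_induction with
  | h0 => simp
  | hadd y z hy hz => simp only [map_add, hy, hz, smul_add]
  | h u c v => simp

variable (R) in
/-- The Hochschild letter `[κ(ω)]` of an element `ω` of the cobar construction. -/
def cobarLetter : Cobar R →ₗ[k] BA :=
  TensorAlgebra.ι k ∘ₗ toAug (QuadAlg.aug R) ∘ₗ (cobarToAlg R).toLinearMap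

lemma cobarLetter_apply (u : Cobar R) :
    cobarLetter R u = TensorAlgebra.ι k (toAug (QuadAlg.aug R) (κΩ u)) := rfl

variable (R) in
/-- For `m ∈ A^¡`, the map `u ⊗ c ⊗ v ↦ κ(v) ⊗ m [κ(u)] c` to the Hochschild chains of `A`. -/
def cyclicChain : KoszulDual R →ₗ[k] CobarBimod R →ₗ[k] HochChain (QuadAlg.aug R) :=
  (LinearMap.lTensorHom A ∘ₗ LinearMap.mul k BA ∘ₗ dualToBar R).compl₂
    ((TensorProduct.comm k _ _).toLinearMap ∘ₗ TensorProduct.map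
      (LinearMap.mul' k BA ∘ₗ TensorProduct.map (cobarLetter R) (dualToBar R))
      (cobarToAlg R).toLinearMap)

@[simp] lemma cyclicChain_tmul (m : KoszulDual R) (u v : Cobar R) (c : KoszulDual R) :
    cyclicChain R m ((u ⊗ₜ c) ⊗ₜ v) = κΩ v ⊗ₜ (j m * (cobarLetter R u * j c)) := rfl

/-- The part of the boundary of `cyclicChain` that takes a letter from `m`. -/
def cyclicPairing (s : KoszulDual R →ₗ[k] KoszulDual R) (x : CobarBimod R) :
    KoszulDual R ⊗[k] KoszulDual R →ₗ[k] HochChain (QuadAlg.aug R) :=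
  TensorProduct.lift (LinearMap.mk₂ k
    (fun a b => cyclicChain R b (bimodRight R (ℓ (s a)) x) -
      cyclicChain R (P a) (bimodLeft R (ℓ b) x))
    (fun a b c => by simp only [map_add, bimodRight_add, LinearMap.add_apply]; abel)
    (fun r a b => by
      simp only [map_smul, bimodRight_smul, LinearMap.smul_apply, smul_sub])
    (fun a b c => by simp only [map_add, bimodLeft_add, LinearMap.add_apply]; abel)
    (fun r a b => by
      simp only [map_smul, bimodLeft_smul, LinearMap.smul_apply, smul_sub]))

lemma cyclicPairing_tmul (s : KoszulDual R →ₗ[k] KoszulDual R) (x : CobarBimod R)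
    (a b : KoszulDual R) : cyclicPairing s x (a ⊗ₜ b) =
      cyclicChain R b (bimodRight R (ℓ (s a)) x) - cyclicChain R (P a) (bimodLeft R (ℓ b) x) := rfl

lemma cyclicPairing_add (s : KoszulDual R →ₗ[k] KoszulDual R) (x y : CobarBimod R)
    (z : KoszulDual R ⊗[k] KoszulDual R) :
    cyclicPairing s (x + y) z = cyclicPairing s x z + cyclicPairing s y z := by
  induction z using TensorProduct.induction_on with
  | zero => simp
  | add x y hx hy => simp only [map_add, hx, hy]; abel
  | tmul a b => simp only [cyclicPairing_tmul, map_add]; abel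

lemma cyclicPairing_zero (s : KoszulDual R →ₗ[k] KoszulDual R)
    (z : KoszulDual R ⊗[k] KoszulDual R) : cyclicPairing s 0 z = 0 := by
  induction z using TensorProduct.induction_on with
  | zero => simp
  | add x y hx hy => rw [map_add, hx, hy, add_zero]
  | tmul a b => simp [cyclicPairing_tmul]

variable (R) in
/-- `u ⊗ c ⊗ v ↦ ε(c) κ(u) κ(v)`. -/
def bimodAug : CobarBimod R →ₗ[k] A :=
  LinearMap.mul' k A ∘ₗ TensorProduct.map
    ((cobarToAlg R).toLinearMap ∘ₗ coHochCounit R) (cobarToAlg R).toLinearMap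

@[simp] lemma bimodAug_tmul (u v : Cobar R) (c : KoszulDual R) :
    bimodAug R ((u ⊗ₜ c) ⊗ₜ v) = ε c • (κΩ u * κΩ v) := by
  simp [bimodAug]

/-- The terms of `bimodAug` vanish on `markD`, since the letters are in the kernel of the counit. -/
lemma bimodAug_markD (x : Cobar R) : bimodAug R (markD R x) = 0 := by
  have h : ∀ (y : Cobar R) (z : CobarBimod R), bimodAug R (bimodLeft R y z) =
      κΩ y * bimodAug R z := by
    intro y z
    induction z using bimod_induction with
    | h0 => simp
    | hadd y z hy hz => simp only [map_add, hy, hz, mul_add]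
    | h u c v => simp [mul_assoc]
  induction x using cobar_induction with
  | h1 => simp
  | hsmul r x hx => simp [hx]
  | hadd x y hx hy => simp [hx, hy]
  | hι c x hx =>
    rw [markD_letter_mul, map_sub, h, hx, bimodAug_tmul]
    simp [isCoaugHom_parity.counit]

/-- A word in `A^¡` is its last letter after the rest. -/
lemma sum_mul_kappaAug (m : KoszulDual R) : LinearMap.mul' k _
    (TensorProduct.map (j ∘ₗ P) (TensorAlgebra.ι k ∘ₗ kappaAug R) (Δ m)) =
      ε m • 1 - j (P m) := by
  have h : ∀ x : BA, LinearMap.mul' k _ (TensorProduct.map par (TensorAlgebra.ι k)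
      (lastLetter k _ x)) = TensorAlgebra.algebraMapInv x • 1 - par x := by
    intro x
    refine words_ext_right (f := LinearMap.mul' k _ ∘ₗ TensorProduct.map par
      (TensorAlgebra.ι k) ∘ₗ lastLetter k _)
      (g := LinearMap.toSpanSingleton k _ 1 ∘ₗ
        (TensorAlgebra.algebraMapInv (M := AugIdeal (QuadAlg.aug R))).toLinearMap - par) ?_ ?_ x
    · simp
    · intro a x; simp [lengthParity_mul]
  have := h (j m)
  rw [lastLetter_dualToBar, ← LinearMap.comp_apply (TensorProduct.map _ _),
    ← TensorProduct.map_comp, algebraMapInv_dualToBar, lengthParity_dualToBar] at this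
  rw [← this]
  congr 3
  ext x; simp

lemma aug_gradedAut {σ : A ≃ₐ[k] A} (hσ : IsGradedAut σ) (a : A) : εA (σ a) = εA a := by
  obtain ⟨x, rfl⟩ := RingQuot.mkAlgHom_surjective k (QuadRel R) a
  have h : ((QuadAlg.aug R).comp σ.toAlgHom).comp (QuadAlg.mk R) =
      (QuadAlg.aug R).comp (QuadAlg.mk R) := by
    refine TensorAlgebra.hom_ext (LinearMap.ext fun v => ?_)
    change εA (σ (QuadAlg.ι R v)) = εA (QuadAlg.ι R v)
    rw [← ι_onGen hσ, aug_ι, aug_ι]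
  exact DFunLike.congr_fun h x

/-- The bar differential of `m [κ(u)] c`. Since `m` and `c` are cycles of the bar construction, only
the products of `κ(u)` with the last letter of `m` and with the first letter of `c` remain. -/
lemma hochInner_cyclicChain (m c : KoszulDual R) (u v : Cobar R) :
    hochInner εA (cyclicChain R m ((u ⊗ₜ c) ⊗ₜ v)) =
        - κΩ v ⊗ₜ (LinearMap.mul' k _ (TensorProduct.map (j ∘ₗ P)
            (LinearMap.mulRight k (j c) ∘ₗ TensorAlgebra.ι k ∘ₗ toAug εA ∘ₗ
              LinearMap.mulRight k (κΩ u) ∘ₗ κ) (Δ m))) +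
        εA (κΩ u) • κΩ v ⊗ₜ ((ε m • 1 - j (P m)) * j c) -
        κΩ v ⊗ₜ (j (P m) * LinearMap.mul' k _ (TensorProduct.map (TensorAlgebra.ι k ∘ₗ toAug εA ∘ₗ
              LinearMap.mulLeft k (κΩ u) ∘ₗ κ) j (Δ c))) +
        εA (κΩ u) • κΩ v ⊗ₜ (j (P m) * (j c - ε c • 1)) := by
  have hτ : ∀ a, augMul εA (kappaAug R a ⊗ₜ toAug εA (κΩ u)) =
      toAug εA (κ a * κΩ u) - εA (κΩ u) • kappaAug R a := by
    intro a
    rw [kappaAug, LinearMap.comp_apply]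
    ext
    simp [coe_augMul, mul_sub, Algebra.algebraMap_eq_smul_one]
  have hτ' : ∀ a, augMul εA (toAug εA (κΩ u) ⊗ₜ kappaAug R a) =
      toAug εA (κΩ u * κ a) - εA (κΩ u) • kappaAug R a := by
    intro a
    rw [kappaAug, LinearMap.comp_apply]
    ext
    simp [coe_augMul, sub_mul, Algebra.algebraMap_eq_smul_one]
  have h1 : barCross εA (lastLetter k _ (j m) ⊗ₜ firstLetter k _ (cobarLetter R u * j c)) =
      LinearMap.mul' k _ (TensorProduct.map (j ∘ₗ P)
        (LinearMap.mulRight k (j c) ∘ₗ TensorAlgebra.ι k ∘ₗ toAug εA ∘ₗ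
          LinearMap.mulRight k (κΩ u) ∘ₗ κ) (Δ m)) -
      εA (κΩ u) • (LinearMap.mul' k _ (TensorProduct.map (j ∘ₗ P)
        (TensorAlgebra.ι k ∘ₗ kappaAug R) (Δ m)) * j c) := by
    rw [lastLetter_dualToBar, cobarLetter_apply, firstLetter_ι_mul]
    generalize Δ m = z
    induction z using TensorProduct.induction_on with
    | zero => simp
    | add x y hx hy =>
      simp only [map_add, TensorProduct.add_tmul, hx, hy, add_mul, smul_add]; abel
    | tmul a b =>
      rw [TensorProduct.map_tmul, barCross_tmul, hτ]
      simp [mul_sub, sub_mul, mul_assoc]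
  have h2 : mulFirst εA (toAug εA (κΩ u)) (j c) =
      LinearMap.mul' k _ (TensorProduct.map (TensorAlgebra.ι k ∘ₗ toAug εA ∘ₗ
          LinearMap.mulLeft k (κΩ u) ∘ₗ κ) j (Δ c)) -
      εA (κΩ u) • LinearMap.mul' k _ (TensorProduct.map (TensorAlgebra.ι k ∘ₗ kappaAug R)
        j (Δ c)) := by
    rw [mulFirst_eq_barCross, firstLetter_dualToBar]
    generalize Δ c = z
    induction z using TensorProduct.induction_on with
    | zero => simp
    | add x y hx hy =>
      simp only [map_add, TensorProduct.tmul_add, hx, hy, smul_add]; abel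
    | tmul a b =>
      rw [TensorProduct.map_tmul, barCross_tmul, hτ']
      simp [sub_mul]
  rw [cyclicChain_tmul, hochInner_tmul, barD_mul, h1, barD_dualToBar, cobarLetter_apply,
    barD_ι_mul, h2, barD_dualToBar, lengthParity_dualToBar, sum_kappaAug_mul,
    sum_mul_kappaAug]
  simp only [mul_zero, zero_mul, sub_mul, mul_sub, smul_mul_assoc, one_mul, mul_smul_comm,
    mul_one, TensorProduct.tmul_sub, TensorProduct.tmul_add, TensorProduct.tmul_smul,
    TensorProduct.tmul_zero, TensorProduct.tmul_neg, mul_neg, smul_sub]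
  module

/-- The terms of `bimodD` that come from the differentials of `u` and `v` vanish, because
`Ω(C) → A` is zero on boundaries. -/
lemma cyclicChain_bimodD (m c : KoszulDual R) (u v : Cobar R) :
    cyclicChain R (P m) (bimodD R ((u ⊗ₜ c) ⊗ₜ v)) =
        TensorProduct.map (LinearMap.mulRight k (κΩ v) ∘ₗ κ)
          (LinearMap.mulLeft k (j (P m) * cobarLetter R u) ∘ₗ j ∘ₗ P)
          (TensorProduct.comm k _ _ (Δ c)) -
        κΩ v ⊗ₜ (j (P m) * LinearMap.mul' k _ (TensorProduct.map (TensorAlgebra.ι k ∘ₗ toAug εA ∘ₗ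
              LinearMap.mulLeft k (κΩ u) ∘ₗ κ) j (Δ c))) := by
  rw [bimodD_tmul, coHochOneSided, LinearMap.add_apply, coHochInner_tmul, coHochLeft_tmul,
    coHochParity_tmul, bimodCoact_tmul, isCoaugHom_parity.comul]
  simp only [TensorProduct.add_tmul, map_add, map_sub, cyclicChain_tmul]
  simp only [cobarLetter_apply, cobarToAlg_cobarD, map_zero, zero_mul, mul_zero,
    TensorProduct.zero_tmul, TensorProduct.tmul_zero]
  generalize Δ c = z
  induction z using TensorProduct.induction_on with
  | zero => simp
  | add x y hx hy =>
    simp only [map_add, TensorProduct.add_tmul, mul_add, TensorProduct.tmul_add] at hx hy ⊢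
    linear_combination (norm := module) hx + hy
  | tmul a b =>
    simp [cobarLetter_apply, TensorProduct.neg_tmul, TensorProduct.tmul_neg]
    abel

/-- The Hochschild boundary of `κ(v) ⊗ m [κ(u)] c`: apart from the letters taken from `m`, it is
given by the differential of the bimodule `Ω(C) ⊗ C ⊗ Ω(C)`. -/
lemma hochB_cyclicChain {σ : A ≃ₐ[k] A} (hσ : IsGradedAut σ) (m : KoszulDual R)
    (x : CobarBimod R) : hochB εA σ (cyclicChain R m x) =
      cyclicPairing (dualAut σ hσ) x (Δ m) +
      ε m • koszulToHoch R (coHochToKoszul R (bimodRotate (dualAut σ hσ) 0 x)) +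
      cyclicChain R (P m) (bimodD R x) - bimodAug R x ⊗ₜ j (P m) := by
  induction x using bimod_induction with
  | h0 => simp [cyclicPairing_zero]
  | hadd y z hy hz =>
    simp only [map_add, cyclicPairing_add, hy, hz, TensorProduct.add_tmul, smul_add]
    abel
  | h u c v =>
    have hfirst : hochFirst εA σ (cyclicChain R m ((u ⊗ₜ c) ⊗ₜ v)) =
        TensorProduct.map (LinearMap.mulLeft k (κΩ v) ∘ₗ σ.toLinearMap ∘ₗ κ)
          (LinearMap.mulRight k (cobarLetter R u * j c) ∘ₗ j) (Δ m) +
        ε m • (κΩ v * σ (κΩ u - algebraMap k A (εA (κΩ u)))) ⊗ₜ j c := by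
      rw [cyclicChain_tmul, hochFirst_eq, firstLetter_mul, firstLetter_dualToBar,
        algebraMapInv_dualToBar, cobarLetter_apply, firstLetter_ι_mul, map_add, map_smul,
        LinearMap.rTensor_tmul]
      congr 1
      · generalize Δ m = z
        induction z using TensorProduct.induction_on with
        | zero => simp
        | add x y hx hy => simp only [map_add, hx, hy]
        | tmul a b => simp
    have hlast : hochLast εA (cyclicChain R m ((u ⊗ₜ c) ⊗ₜ v)) =
        TensorProduct.map (LinearMap.mulRight k (κΩ v) ∘ₗ κ)
          (LinearMap.mulLeft k (j (P m) * cobarLetter R u) ∘ₗ j ∘ₗ P)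
          (TensorProduct.comm k _ _ (Δ c)) -
        ε c • ((κΩ u - algebraMap k A (εA (κΩ u))) * κΩ v) ⊗ₜ j (P m) := by
      rw [cyclicChain_tmul, hochLast_eq, ← mul_assoc, lastLetter_mul, lastLetter_dualToBar,
        algebraMapInv_dualToBar, cobarLetter_apply, lastLetter_mul_ι, map_add, map_smul, map_add,
        map_smul, neg_add, sub_eq_add_neg]
      congr 1
      · generalize Δ c = z
        induction z using TensorProduct.induction_on with
        | zero => simp
        | add x y hx hy => simp only [map_add, neg_add, hx, hy]
        | tmul a b => simp [lengthParity_mul, TensorProduct.tmul_neg]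
      · simp
    have hpair : cyclicPairing (dualAut σ hσ) ((u ⊗ₜ c) ⊗ₜ v) (Δ m) =
        TensorProduct.map (LinearMap.mulLeft k (κΩ v) ∘ₗ σ.toLinearMap ∘ₗ κ)
          (LinearMap.mulRight k (cobarLetter R u * j c) ∘ₗ j) (Δ m) -
        κΩ v ⊗ₜ (LinearMap.mul' k _ (TensorProduct.map (j ∘ₗ P)
            (LinearMap.mulRight k (j c) ∘ₗ TensorAlgebra.ι k ∘ₗ toAug εA ∘ₗ
              LinearMap.mulRight k (κΩ u) ∘ₗ κ) (Δ m))) := by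
      generalize Δ m = z
      induction z using TensorProduct.induction_on with
      | zero => simp
      | add x y hx hy =>
        simp only [map_add, TensorProduct.tmul_add, hx, hy]
        abel
      | tmul a b => simp [cyclicPairing_tmul, cobarLetter_apply, mul_assoc]
    have hZ : koszulToHoch R (coHochToKoszul R (bimodRotate (dualAut σ hσ) 0
        ((u ⊗ₜ c) ⊗ₜ v))) = (κΩ v * σ (κΩ u)) ⊗ₜ j c := by
      rw [bimodRotate_tmul, coHochToKoszul_tmul, koszulToHoch_tmul, map_mul,
        cobarToAlg_parity_pow, cobarToAlg_map]
    simp only [hochB, LinearMap.add_apply, hfirst, hlast, hochInner_cyclicChain, cyclicChain_bimodD, hpair, hZ, bimodAug_tmul,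
      map_sub, mul_sub, sub_mul, TensorProduct.sub_tmul, TensorProduct.tmul_sub,
      map_smul, map_one, Algebra.algebraMap_eq_smul_one, smul_mul_assoc, one_mul, mul_one,
      mul_smul_comm, TensorProduct.tmul_smul, ← TensorProduct.smul_tmul']
    module

end Homotopy

section Parity
variable {k : Type u} [Field k] [CharZero k] {X : Type v} [AddCommGroup X] [Module k X]
  {Y : Type w} [AddCommGroup Y] [Module k Y]

/-- An additive property of tensors holds for all of them if it holds for tensors of elements of
definite parity. -/
@[elab_as_elim]
lemma tensor_parity_induction {f : X →ₗ[k] X} {g : Y →ₗ[k] Y} (hf : ∀ x, f (f x) = x)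
    (hg : ∀ y, g (g y) = y) {Q : X ⊗[k] Y → Prop} (hadd : ∀ x y, Q x → Q y → Q (x + y))
    (h : ∀ p < 2, ∀ q < 2, ∀ x y, f x = (-1 : k) ^ p • x → g y = (-1 : k) ^ q • y → Q (x ⊗ₜ y))
    (z : X ⊗[k] Y) : Q z := by
  induction z using TensorProduct.induction_on with
  | zero => simpa using h 0 (by omega) 0 (by omega) 0 0 (by simp) (by simp)
  | add x y hx hy => exact hadd x y hx hy
  | tmul x y =>
    have hx : x = (2 : k)⁻¹ • (x + f x) + (2 : k)⁻¹ • (x - f x) := by module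
    have hy : y = (2 : k)⁻¹ • (y + g y) + (2 : k)⁻¹ • (y - g y) := by module
    have hx0 : f ((2 : k)⁻¹ • (x + f x)) = (-1 : k) ^ 0 • (2 : k)⁻¹ • (x + f x) := by
      simp only [map_smul, map_add, hf]; module
    have hx1 : f ((2 : k)⁻¹ • (x - f x)) = (-1 : k) ^ 1 • (2 : k)⁻¹ • (x - f x) := by
      simp only [map_smul, map_sub, hf]; module
    have hy0 : g ((2 : k)⁻¹ • (y + g y)) = (-1 : k) ^ 0 • (2 : k)⁻¹ • (y + g y) := by
      simp only [map_smul, map_add, hg]; module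
    have hy1 : g ((2 : k)⁻¹ • (y - g y)) = (-1 : k) ^ 1 • (2 : k)⁻¹ • (y - g y) := by
      simp only [map_smul, map_sub, hg]; module
    rw [hx, hy, TensorProduct.add_tmul, TensorProduct.tmul_add, TensorProduct.tmul_add]
    exact hadd _ _
      (hadd _ _ (h 0 (by omega) 0 (by omega) _ _ hx0 hy0) (h 0 (by omega) 1 (by omega) _ _ hx0 hy1))
      (hadd _ _ (h 1 (by omega) 0 (by omega) _ _ hx1 hy0) (h 1 (by omega) 1 (by omega) _ _ hx1 hy1))

/-- The same for tensors `z` that have a definite total parity. -/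
@[elab_as_elim]
lemma tensor_total_parity_induction {f : X →ₗ[k] X} {g : Y →ₗ[k] Y} (hf : ∀ x, f (f x) = x)
    (hg : ∀ y, g (g y) = y) {Q : X ⊗[k] Y → Prop} {r : ℕ}
    (hadd : ∀ x y, Q x → Q y → Q (x + y))
    (h : ∀ p < 2, ∀ q < 2, (-1 : k) ^ r = (-1) ^ (p + q) → ∀ x y, f x = (-1 : k) ^ p • x →
      g y = (-1 : k) ^ q • y → Q (x ⊗ₜ y))
    (z : X ⊗[k] Y) (hz : TensorProduct.map f g z = (-1 : k) ^ r • z) : Q z := by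
  have h0 : Q 0 := by
    rcases neg_one_pow_eq_or k r with hr | hr
    · simpa using h 0 (by omega) 0 (by omega) (by simpa using hr) 0 0 (by simp) (by simp)
    · simpa using h 0 (by omega) 1 (by omega) (by simpa using hr) 0 0 (by simp) (by simp)
  have hrr : (-1 : k) ^ r * (-1) ^ r = 1 := by rw [← mul_pow]; simp
  have key : ∀ z, Q ((2 : k)⁻¹ • (z + (-1 : k) ^ r • TensorProduct.map f g z)) := by
    intro z
    induction z using tensor_parity_induction hf hg with
    | hadd x y hx hy =>
      have := hadd _ _ hx hy
      convert this using 1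
      simp only [map_add]; module
    | h p hp q hq x y hx hy =>
      have e : (2 : k)⁻¹ • (x ⊗ₜ[k] y + (-1 : k) ^ r • TensorProduct.map f g (x ⊗ₜ y)) =
          ((2 : k)⁻¹ * (1 + (-1 : k) ^ r * (-1) ^ (p + q))) • x ⊗ₜ y := by
        rw [TensorProduct.map_tmul, hx, hy, TensorProduct.smul_tmul_smul, ← pow_add]; module
      rw [e]
      by_cases hs : (-1 : k) ^ r = (-1) ^ (p + q)
      · rw [← hs, hrr, one_add_one_eq_two, inv_mul_cancel₀ two_ne_zero, one_smul]
        exact h p hp q hq hs x y hx hy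
      · have : (1 : k) + (-1 : k) ^ r * (-1) ^ (p + q) = 0 := by
          rcases neg_one_pow_eq_or k r with h1 | h1 <;>
            rcases neg_one_pow_eq_or k (p + q) with h2 | h2 <;> simp [h1, h2] at hs ⊢
        rw [this, mul_zero, zero_smul]
        exact h0
  have := key z
  rwa [hz, smul_smul, hrr, one_smul, ← two_smul k z, smul_smul, inv_mul_cancel₀ two_ne_zero,
    one_smul] at this

end Parity

section Homotopy
variable {k : Type u} [Field k] [CharZero k] {V : Type v} [AddCommGroup V] [Module k V]
  {R : Submodule k (V ⊗[k] V)}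

local notation "ℓ" => letter R
local notation "P" => dualParity R
local notation "PΩ" => cobarParity R
local notation "Δ" => Coalgebra.comul (R := k) (A := KoszulDual R)
local notation "ε" => Coalgebra.counit (R := k) (A := KoszulDual R)
local notation "κ" => kappa R
local notation "A" => QuadAlg R
local notation "εA" => QuadAlg.aug R
local notation "BA" => TensorAlgebra k (AugIdeal (QuadAlg.aug R))
local notation "par" => lengthParity k (AugIdeal (QuadAlg.aug R))
local notation "j" => dualToBar R
local notation "κΩ" => cobarToAlg R

variable (R) in
/-- The homotopy `ω ⊗ m ↦ ∑ ± κ(v) ⊗ m [κ(u)] a`, over all ways to write `ω = u a v` with a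
letter `a`, between the two ways to go from `Ω(C) ⊗ C` to the Hochschild chains of `A` by means of
a Connes operator. -/
def connesHomotopy : CoHochChain R →ₗ[k] HochChain (QuadAlg.aug R) :=
  -(TensorProduct.lift (cyclicChain R).flip ∘ₗ LinearMap.rTensor _ (markD R) ∘ₗ
    koszulSign (cobarParity R) (dualParity R))

omit [CharZero k] in
lemma cyclicChain_right_eq_zero (m : KoszulDual R) {y : Cobar R} (hy : κΩ y = 0)
    (x : CobarBimod R) : cyclicChain R m (bimodRight R y x) = 0 := by
  induction x using bimod_induction with
  | h0 => simp
  | hadd y z hy hz => simp only [map_add, hy, hz, add_zero]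
  | h u c v => simp [hy]

omit [CharZero k] in
lemma cyclicChain_left_eq_zero (m : KoszulDual R) {y : Cobar R} (hy : κΩ y = 0)
    (x : CobarBimod R) : cyclicChain R m (bimodLeft R y x) = 0 := by
  induction x using bimod_induction with
  | h0 => simp
  | hadd y z hy hz => simp only [map_add, hy, hz, add_zero]
  | h u c v => simp [hy, cobarLetter_apply]

lemma connesHomotopy_tmul {p q : ℕ} {x : Cobar R} {m : KoszulDual R}
    (hx : PΩ x = (-1 : k) ^ p • x) (hm : P m = (-1 : k) ^ q • m) :
    connesHomotopy R (x ⊗ₜ m) = (-1 : k) ^ (p * q + 1) • cyclicChain R m (markD R x) := by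
  rw [connesHomotopy, LinearMap.neg_apply, LinearMap.comp_apply, LinearMap.comp_apply,
    koszulSign_tmul _ _ hx hm, map_smul, map_smul, LinearMap.rTensor_tmul,
    TensorProduct.lift.tmul, LinearMap.flip_apply, pow_succ]
  module

omit [CharZero k] in
lemma tmap_augAut_dualToBar {σ : A ≃ₐ[k] A} (hσ : IsGradedAut σ) (c : KoszulDual R) :
    tmap (augAut εA σ) (j c) = j (dualAut σ hσ c) := by
  simp only [dualToBar, LinearMap.comp_apply, AlgHom.toLinearMap_apply, dualAut, incl_dualMap,
    tmap_comp]
  congr 2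
  refine LinearMap.ext fun v => ?_
  ext
  simp [coe_augAut _ (aug_gradedAut hσ), ι_onGen hσ, aug_gradedAut hσ]

lemma cobarToAlg_of_odd {x : Cobar R} (hx : PΩ x = (-1 : k) ^ 1 • x) : κΩ x = 0 := by
  have h := cobarToAlg_parity x
  rw [hx, map_smul] at h
  linear_combination (norm := module) (-2 : k)⁻¹ • h

lemma kappa_of_even {c : KoszulDual R} (hc : P c = (-1 : k) ^ 0 • c) : κ c = 0 := by
  have h := kappa_parity c
  rw [hc, map_smul] at h
  linear_combination (norm := module) (2 : k)⁻¹ • h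

lemma counit_of_odd {c : KoszulDual R} (hc : P c = (-1 : k) ^ 1 • c) : ε c = 0 := by
  have h := isCoaugHom_parity.counit c
  rw [hc, map_smul] at h
  simp only [pow_one, smul_eq_mul] at h
  linear_combination (-2 : k)⁻¹ * h

/-- The signs in `connesHomotopy_pairing_tmul`. The hypotheses say that `κ : Ω(C) → A` kills odd
elements, that `κ : C → A` kills even ones, and that the counit kills odd ones. -/
lemma pairing_signs {M : Type*} [AddCommGroup M] [Module k M] {p q α β : ℕ} (hp : p < 2)
    (hq : q < 2) (hα : α < 2) (hβ : β < 2) (hr : (-1 : k) ^ q = (-1) ^ (α + β))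
    {y₁ y₂ t₁ t₂ : M} {e : k} (h₁ : p = 1 → t₁ = 0) (h₂ : p = 1 → t₂ = 0) (h₃ : α = 0 → y₁ = 0)
    (h₄ : β = 0 → y₂ = 0) (h₅ : α = 1 → e = 0) :
    (-1 : k) ^ (p + α) • (-1 : k) ^ ((p + α + 1) * β + 1) •
        (y₁ - (-1 : k) ^ p • ((-1 : k) ^ α • t₁ - e • t₂)) -
      (-1 : k) ^ (β * (p + q)) • (-1 : k) ^ ((p + β + 1) * α + 1) • (-1 : k) ^ (β + 1) • y₂ =
    (-1 : k) ^ (p * q) • (y₁ - (-1 : k) ^ α • y₂) + (-1 : k) ^ (β * (α + 1)) • t₁ -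
      (-1 : k) ^ ((p + 1) * q) • e • t₂ := by
  have h11 : (-1 : k) ≠ 1 := fun h => by
    have : (2 : k) = 0 := by linear_combination -h
    exact two_ne_zero this
  obtain rfl | rfl : p = 0 ∨ p = 1 := by omega
  all_goals obtain rfl | rfl : q = 0 ∨ q = 1 := by omega
  all_goals obtain rfl | rfl : α = 0 ∨ α = 1 := by omega
  all_goals obtain rfl | rfl : β = 0 ∨ β = 1 := by omega
  all_goals first
    | (exfalso; revert hr; simp [h11, h11.symm]; done)
    | (simp only [zero_ne_one, one_ne_zero, forall_true_left, IsEmpty.forall_iff]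
        at h₁ h₂ h₃ h₄ h₅
       simp [*]
       try module)

omit [CharZero k] in
lemma dualAut_parity {σ : A ≃ₐ[k] A} (hσ : IsGradedAut σ) (c : KoszulDual R) :
    dualAut σ hσ (P c) = P (dualAut σ hσ c) := by
  apply incl_injective
  simp only [dualAut, dualParity, incl_dualMap, tmap_comp]
  congr 2
  ext; simp

/-- The formula of `connesHomotopy_pairing` for a single term `a ⊗ b` of the coproduct of `m`, with
factors of definite parity. -/
lemma connesHomotopy_pairing_tmul {σ : A ≃ₐ[k] A} (hσ : IsGradedAut σ) {p q α β : ℕ} (hp : p < 2)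
    (hq : q < 2) (hα : α < 2) (hβ : β < 2) (hr : (-1 : k) ^ q = (-1) ^ (α + β)) {x : Cobar R}
    (hx : PΩ x = (-1 : k) ^ p • x) {a b : KoszulDual R} (ha : P a = (-1 : k) ^ α • a)
    (hb : P b = (-1 : k) ^ β • b) :
    connesHomotopy R ((PΩ x * ℓ (dualAut σ hσ (P a))) ⊗ₜ b) -
      connesHomotopy R ((ℓ ((P ^ (p + q)) b) * x) ⊗ₜ a) =
    (-1 : k) ^ (p * q) • cyclicPairing (dualAut σ hσ) (markD R x) (a ⊗ₜ b) +
      hochRot εA σ (κΩ x) (j a ⊗ₜ j b) -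
      (-1 : k) ^ ((p + 1) * q) • ε a • (1 ⊗ₜ (j b * cobarLetter R x)) := by
  have hs : IsCoaugHom (dualAut σ hσ) := isCoaugHom_dualMap _ _
  have hsP : ∀ c, dualAut σ hσ (P c) = P (dualAut σ hσ c) := dualAut_parity hσ
  have hsa : P (dualAut σ hσ a) = (-1 : k) ^ α • dualAut σ hσ a := by rw [← hsP, ha, map_smul]
  have hy1 : PΩ (x * ℓ (dualAut σ hσ a)) =
      (-1 : k) ^ (p + α + 1) • (x * ℓ (dualAut σ hσ a)) := by
    rw [cobarParity_mul, hx, cobarParity_letter, hsa, pow_add, pow_add]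
    simp only [map_smul, smul_mul_assoc, mul_smul_comm, mul_neg]
    module
  have hy2 : PΩ (ℓ b * x) = (-1 : k) ^ (p + β + 1) • (ℓ b * x) := by
    rw [cobarParity_mul, hx, cobarParity_letter, hb, pow_add, pow_add]
    simp only [map_smul, smul_mul_assoc, mul_smul_comm, neg_mul]
    module
  have hpow : ∀ n, (P ^ n) b = (-1 : k) ^ (β * n) • b := by
    intro n
    induction n with
    | zero => simp
    | succ n ih => rw [← parity_parity_pow, ih, map_smul, hb, smul_smul, ← pow_add]; rfl
  have e1 : cyclicChain R b (markD R (x * ℓ (dualAut σ hσ a))) =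
      cyclicChain R b (bimodRight R (ℓ (dualAut σ hσ a)) (markD R x)) -
      (-1 : k) ^ p • 1 ⊗ₜ (j b * (cobarLetter R x *
        ((-1 : k) ^ α • j (dualAut σ hσ a) - ε a • 1))) := by
    rw [markD_mul, markD_letter, map_add, map_neg, map_neg, hx, bimodLeft_smul, bimodLeft_tmul,
      map_smul, cyclicChain_tmul]
    simp [hsa, hs.counit]
    module
  have e2 : cyclicChain R a (markD R (ℓ b * x)) =
      (-1 : k) ^ (β + 1) • cyclicChain R a (bimodLeft R (ℓ b) (markD R x)) := by
    rw [markD_letter_mul, map_sub, cyclicChain_tmul, cobarLetter_apply, cobarParity_letter,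
      bimodLeft_neg, hb, map_smul, bimodLeft_smul]
    simp [pow_succ]
  have e3 : hochRot εA σ (κΩ x) (j a ⊗ₜ j b) =
      (-1 : k) ^ (β * (α + 1)) • 1 ⊗ₜ (j b * (cobarLetter R x * j (dualAut σ hσ a))) := by
    rw [hochRot_tmul _ _ _ (p := α) (q := β) (by simp [ha]) (by simp [hb]),
      tmap_augAut_dualToBar hσ, cobarLetter_apply]
  have e4 : cyclicPairing (dualAut σ hσ) (markD R x) (a ⊗ₜ b) =
      cyclicChain R b (bimodRight R (ℓ (dualAut σ hσ a)) (markD R x)) -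
      (-1 : k) ^ α • cyclicChain R a (bimodLeft R (ℓ b) (markD R x)) := by
    rw [cyclicPairing_tmul, ha, map_smul, LinearMap.smul_apply]
  have e5 : connesHomotopy R ((PΩ x * ℓ (dualAut σ hσ (P a))) ⊗ₜ b) = (-1 : k) ^ (p + α) •
      connesHomotopy R ((x * ℓ (dualAut σ hσ a)) ⊗ₜ b) := by
    rw [hx, ha, map_smul, map_smul, smul_mul_smul_comm, ← pow_add, ← TensorProduct.smul_tmul',
      map_smul]
  have e6 : connesHomotopy R ((ℓ ((P ^ (p + q)) b) * x) ⊗ₜ a) = (-1 : k) ^ (β * (p + q)) •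
      connesHomotopy R ((ℓ b * x) ⊗ₜ a) := by
    rw [hpow, map_smul, smul_mul_assoc, ← TensorProduct.smul_tmul', map_smul]
  have hx1 : p = 1 → cobarLetter R x = 0 := by
    rintro rfl; rw [cobarLetter_apply, cobarToAlg_of_odd hx]; simp
  have ha0 : α = 0 → cyclicChain R b (bimodRight R (ℓ (dualAut σ hσ a)) (markD R x)) = 0 := by
    rintro rfl
    refine cyclicChain_right_eq_zero _ ?_ _
    rw [cobarToAlg_letter, kappa_dualAut, kappa_of_even ha, map_zero]
  have hb0 : β = 0 → cyclicChain R a (bimodLeft R (ℓ b) (markD R x)) = 0 := by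
    rintro rfl
    refine cyclicChain_left_eq_zero _ ?_ _
    rw [cobarToAlg_letter, kappa_of_even hb]
  have ha1 : α = 1 → ε a = 0 := by rintro rfl; exact counit_of_odd ha
  have e7 : (1 : A) ⊗ₜ[k] (j b * (cobarLetter R x *
      ((-1 : k) ^ α • j (dualAut σ hσ a) - ε a • 1))) =
      (-1 : k) ^ α • 1 ⊗ₜ (j b * (cobarLetter R x * j (dualAut σ hσ a))) -
        ε a • 1 ⊗ₜ (j b * cobarLetter R x) := by
    rw [mul_sub, mul_sub, TensorProduct.tmul_sub, mul_smul_comm, mul_smul_comm, mul_smul_comm,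
      mul_smul_comm, mul_one, TensorProduct.tmul_smul, TensorProduct.tmul_smul]
  rw [e5, e6, connesHomotopy_tmul hy1 hb, connesHomotopy_tmul hy2 ha, e1, e2, e3, e4, e7]
  exact pairing_signs hp hq hα hβ hr (fun h => by rw [hx1 h, zero_mul, mul_zero,
    TensorProduct.tmul_zero]) (fun h => by rw [hx1 h, mul_zero, TensorProduct.tmul_zero]) ha0 hb0
    ha1

/-- The part of the homotopy formula that involves the coproduct of `m`. -/
lemma connesHomotopy_pairing {σ : A ≃ₐ[k] A} (hσ : IsGradedAut σ) {p q : ℕ} (hp : p < 2)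
    (hq : q < 2) {x : Cobar R} {m : KoszulDual R} (hx : PΩ x = (-1 : k) ^ p • x)
    (hm : P m = (-1 : k) ^ q • m) :
    connesHomotopy R (coHochLeft (dualAut σ hσ) (x ⊗ₜ m)) +
      connesHomotopy R (coHochRightOf (p + q) (x ⊗ₜ m)) =
    (-1 : k) ^ (p * q) • cyclicPairing (dualAut σ hσ) (markD R x) (Δ m) +
      hochConnes εA σ (κΩ x ⊗ₜ j m) -
      (-1 : k) ^ ((p + 1) * q) • (1 ⊗ₜ (j m * cobarLetter R x)) := by
  let E : KoszulDual R ⊗[k] KoszulDual R →ₗ[k] HochChain (QuadAlg.aug R) :=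
    TensorProduct.mk k A BA 1 ∘ₗ LinearMap.mulRight k (cobarLetter R x) ∘ₗ j ∘ₗ
      (TensorProduct.lid k _).toLinearMap ∘ₗ LinearMap.rTensor _ ε
  have hE : E (Δ m) = 1 ⊗ₜ (j m * cobarLetter R x) :=
    comul_counit_left E (TensorProduct.mk k A BA 1 ∘ₗ LinearMap.mulRight k (cobarLetter R x) ∘ₗ j)
      (fun a b => by simp [E]) m
  let F₁ : KoszulDual R ⊗[k] KoszulDual R →ₗ[k] HochChain (QuadAlg.aug R) :=
    connesHomotopy R ∘ₗ TensorProduct.map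
      (LinearMap.mulLeft k (PΩ x) ∘ₗ ℓ ∘ₗ dualAut σ hσ ∘ₗ P) LinearMap.id
  let F₂ : KoszulDual R ⊗[k] KoszulDual R →ₗ[k] HochChain (QuadAlg.aug R) :=
    connesHomotopy R ∘ₗ TensorProduct.map (LinearMap.mulRight k x ∘ₗ ℓ ∘ₗ P ^ (p + q))
      LinearMap.id ∘ₗ (TensorProduct.comm k _ _).toLinearMap
  let F₃ : KoszulDual R ⊗[k] KoszulDual R →ₗ[k] HochChain (QuadAlg.aug R) :=
    hochRot εA σ (κΩ x) ∘ₗ TensorProduct.map j j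
  have hF : F₁ (Δ m) - F₂ (Δ m) = (-1 : k) ^ (p * q) •
      cyclicPairing (dualAut σ hσ) (markD R x) (Δ m) + F₃ (Δ m) -
        (-1 : k) ^ ((p + 1) * q) • E (Δ m) := by
    have hz : TensorProduct.map P P (Δ m) = (-1 : k) ^ q • Δ m := by
      rw [← isCoaugHom_parity.comul, hm, map_smul]
    refine tensor_total_parity_induction dualParity_dualParity dualParity_dualParity (r := q)
      ?_ ?_ (Δ m) hz
    · intro y z hy hz
      rw [map_add, map_add, map_add, map_add, map_add]
      linear_combination (norm := module) hy + hz
    · intro α hα β hβ hr a b ha hb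
      have h := connesHomotopy_pairing_tmul hσ hp hq hα hβ hr hx ha hb
      have e1 : F₁ (a ⊗ₜ b) = connesHomotopy R ((PΩ x * ℓ (dualAut σ hσ (P a))) ⊗ₜ b) := rfl
      have e2 : F₂ (a ⊗ₜ b) = connesHomotopy R ((ℓ ((P ^ (p + q)) b) * x) ⊗ₜ a) := rfl
      have e3 : F₃ (a ⊗ₜ b) = hochRot εA σ (κΩ x) (j a ⊗ₜ j b) := rfl
      have e4 : E (a ⊗ₜ b) = ε a • (1 ⊗ₜ (j b * cobarLetter R x)) := by
        simp [E]
      rw [e1, e2, e3, e4]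
      exact h
  have e1 : coHochLeft (dualAut σ hσ) (x ⊗ₜ m) = TensorProduct.map
      (LinearMap.mulLeft k (PΩ x) ∘ₗ ℓ ∘ₗ dualAut σ hσ ∘ₗ P) LinearMap.id (Δ m) :=
    coHochLeft_tmul _ _ _
  rw [e1, coHochRightOf_tmul, hochConnes_tmul, deconc_dualToBar, map_neg, ← hE,
    ← sub_eq_add_neg]
  exact hF

/-- `connesHomotopy` is a homotopy between `f B` and `B f`, where `f` is the composite map from
`Ω(C) ⊗ C` to the Hochschild chains of `A`. -/
lemma connesHomotopy_homotopy {σ : A ≃ₐ[k] A} (hσ : IsGradedAut σ) (z : CoHochChain R) :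
    hochB εA σ (connesHomotopy R z) + connesHomotopy R (coHochB (dualAut σ hσ) z) +
      koszulToHoch R (coHochToKoszul R (coHochConnes (dualAut σ hσ) z)) -
      hochConnes εA σ (koszulToHoch R (coHochToKoszul R z)) = 0 := by
  refine tensor_parity_induction cobarParity_cobarParity dualParity_dualParity ?_ ?_ z
  · intro y z hy hz
    simp only [map_add]
    linear_combination (norm := module) hy + hz
  · intro p hp q hq x m hx hm
    have hz : coHochParity R (x ⊗ₜ m) = (-1 : k) ^ (p + q) • x ⊗ₜ m := by
      rw [coHochParity_tmul, hx, hm, TensorProduct.smul_tmul_smul, pow_add]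
    have hdx : PΩ (cobarD R x) = (-1 : k) ^ (p + 1) • cobarD R x := by
      have := cobarD_parity x
      rw [hx, map_smul] at this
      rw [pow_succ]
      linear_combination (norm := module) this
    have h1 : connesHomotopy R (cobarD R x ⊗ₜ m) = (-1 : k) ^ ((p + 1) * q) •
        (1 ⊗ₜ (j m * cobarLetter R x) + cyclicChain R m (bimodD R (markD R x))) := by
      have h := congrArg (cyclicChain R m) (bimodD_markD x)
      rw [map_add, map_sub, cyclicChain_tmul, cyclicChain_tmul, cobarLetter_apply 1, map_one,
        toAug_one, map_zero, zero_mul, mul_zero, TensorProduct.tmul_zero,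
        dualToBar_one, mul_one] at h
      rw [connesHomotopy_tmul hdx hm, pow_succ]
      linear_combination (norm := module) -(-1 : k) ^ ((p + 1) * q) • h
    have h2 : koszulToHoch R (coHochToKoszul R (coHochConnes (dualAut σ hσ) (x ⊗ₜ m))) =
        ε m • koszulToHoch R (coHochToKoszul R (bimodRotate (dualAut σ hσ) 0 (markD R x))) := by
      have h3 : ∀ (n : ℕ) (y : CobarBimod R),
          coHochToKoszul R (bimodRotate (dualAut σ hσ) n y) =
          coHochToKoszul R (bimodRotate (dualAut σ hσ) 0 y) := by
        intro n y
        induction y using bimod_induction with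
        | h0 => simp
        | hadd y z hy hz => simp only [map_add, hy, hz]
        | h u c v => simp
      rw [coHochConnes_of_parity hz, coHochConnesOf, LinearMap.comp_apply, LinearMap.comp_apply,
        coHochCounit_tmul, map_smul, map_smul, map_smul, map_smul, h3]
    have h3 := connesHomotopy_pairing hσ hp hq hx hm
    have h4 : q = 1 → ε m = 0 := by rintro rfl; exact counit_of_odd hm
    rw [coHochB_of_parity hz, coHochBOf, LinearMap.add_apply, LinearMap.add_apply, map_add,
      map_add, coHochInner_tmul, h1, h2, connesHomotopy_tmul hx hm, map_smul,
      hochB_cyclicChain hσ, bimodAug_markD, TensorProduct.zero_tmul, hm, map_smul,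
      LinearMap.smul_apply, coHochToKoszul_tmul, koszulToHoch_tmul]
    rw [add_mul, one_mul, pow_add] at h3 ⊢
    obtain rfl | rfl : q = 0 ∨ q = 1 := by omega
    · simp only [mul_zero, pow_zero, mul_one, zero_add, pow_one] at h3 ⊢
      linear_combination (norm := module) h3
    · rw [h4 rfl]
      simp only [mul_one, pow_succ] at h3 ⊢
      linear_combination (norm := module) h3

end Homotopy

/-! ### Filtrations by weight -/

section Ascend
variable {k : Type u} [Field k] [CharZero k] {E : Type v} [AddCommGroup E] [Module k E]

/-- The operator `h` strictly lowers the weight, where the weight is given by the operator `N`. -/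
def LowersWeight (N h : E →ₗ[k] E) : Prop :=
  ∀ (q : ℕ) (z : E), N z = (2 : k) ^ q • z → h z ∈ degLT N q

omit [CharZero k] in
lemma LowersWeight.add {N h h' : E →ₗ[k] E} (H : LowersWeight N h) (H' : LowersWeight N h') :
    LowersWeight N (h + h') := fun q z hz => Submodule.add_mem _ (H q z hz) (H' q z hz)

omit [CharZero k] in
lemma LowersWeight.mem {N h : E →ₗ[k] E} (H : LowersWeight N h) {p : ℕ} {z : E}
    (hz : z ∈ degLT N (p + 1)) : h z ∈ degLT N p := by
  induction hz using Submodule.span_induction with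
  | zero => simp
  | add x y _ _ hx hy => rw [map_add]; exact Submodule.add_mem _ hx hy
  | smul r x _ hx => rw [map_smul]; exact Submodule.smul_mem _ _ hx
  | mem z hz =>
    obtain ⟨q, hq, hz⟩ := hz
    exact degLT_mono (by omega) (H q z hz)

/-- A perturbation argument: if the complex with differential `d₀` is exact relative to a
subcomplex `S`, then so is the complex with differential `d = d₀ + h`, where `h` strictly lowers
the weight. Everything is inside of a subcomplex `U`. -/
lemma exists_of_lowersWeight {N d₀ h : E →ₗ[k] E} (hN : IsDiagIn (pow2 k : Set k) N)
    (hNd : ∀ z, N (d₀ z) = d₀ (N z)) (hh : LowersWeight N h)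
    (hdd : ∀ z, (d₀ + h) ((d₀ + h) z) = 0) {S U : Submodule k E} (hSU : S ≤ U)
    (hNS : ∀ z ∈ S, N z ∈ S) (hNU : ∀ z ∈ U, N z ∈ U) (hdS : ∀ z ∈ S, (d₀ + h) z ∈ S)
    (hdU : ∀ z ∈ U, (d₀ + h) z ∈ U) (p : ℕ)
    (H : ∀ q < p, ∀ z ∈ U, N z = (2 : k) ^ q • z → d₀ z ∈ S → ∃ y ∈ S, ∃ w ∈ U, z = y + d₀ w)
    {z : E} (hzU : z ∈ U) (hz : z ∈ degLT N p) (hdz : (d₀ + h) z ∈ S) :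
    ∃ y ∈ S, ∃ w ∈ U, w ∈ degLT N p ∧ z = y + (d₀ + h) w := by
  induction p generalizing z with
  | zero =>
    rw [degLT_zero, Submodule.mem_bot] at hz
    exact ⟨0, Submodule.zero_mem _, 0, Submodule.zero_mem _, Submodule.zero_mem _, by simp [hz]⟩
  | succ p ih =>
    -- the component of top weight `p` of `(d₀ + h) z` is `d₀` of the one of `z`
    have htop : d₀ (eproj N (2 ^ p) z) ∈ S := by
      have h1 := eproj_mem hN hNS (2 ^ p) hdz
      rw [LinearMap.add_apply, map_add, eproj_degLT (hh.mem hz) le_rfl, add_zero] at h1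
      rwa [eproj_comm hN hN d₀ hNd]
    obtain ⟨y, hy, w, hw, hyw⟩ := H p (by omega) _ (eproj_mem hN hNU (2 ^ p) hzU)
      (map_eproj hN _ _) htop
    have hyw' : eproj N (2 ^ p) z = eproj N (2 ^ p) y + d₀ (eproj N (2 ^ p) w) := by
      have := congrArg (eproj N (2 ^ p)) hyw
      rwa [eproj_same hN (map_eproj hN _ _), map_add, ← eproj_comm hN hN d₀ hNd] at this
    have hyS := eproj_mem hN hNS (2 ^ p) hy
    have hwU := eproj_mem hN hNU (2 ^ p) hw
    have hwN := map_eproj hN (2 ^ p) w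
    -- subtracting the component of top weight, up to a boundary for `d₀ + h`, lowers the weight
    obtain ⟨y', hy', w', hw', hw'', e⟩ := ih (fun q hq => H q (by omega))
      (z := z - eproj N (2 ^ p) y - (d₀ + h) (eproj N (2 ^ p) w))
      (Submodule.sub_mem _ (Submodule.sub_mem _ hzU (hSU hyS)) (hdU _ hwU)) (by
        have : z - eproj N (2 ^ p) y - (d₀ + h) (eproj N (2 ^ p) w) =
            (z - eproj N (2 ^ p) z) - h (eproj N (2 ^ p) w) := by
          rw [hyw', LinearMap.add_apply]; abel
        rw [this]
        exact Submodule.sub_mem _ (sub_eproj_mem_degLT hN hz) (hh p _ hwN)) (by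
        rw [map_sub, map_sub, hdd, sub_zero]
        exact Submodule.sub_mem _ hdz (hdS _ hyS))
    refine ⟨eproj N (2 ^ p) y + y', Submodule.add_mem _ hyS hy', eproj N (2 ^ p) w + w',
      Submodule.add_mem _ hwU hw', Submodule.add_mem _ (mem_degLT (by omega) hwN)
        (degLT_mono (by omega) hw''), ?_⟩
    rw [map_add]
    linear_combination (norm := module) e

end Ascend

section TensorWeights
variable {k : Type u} [Field k] {M : Type v} [AddCommGroup M] [Module k M]
  {F : Type w} [AddCommGroup F] [Module k F] {X : Type x} [AddCommGroup X] [Module k X]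

/-- An eigenvector in `M ⊗ F` of an operator on `F` is a combination of `m ⊗ x` with
eigenvectors `x`. -/
lemma tensor_eigen_induction {g : F →ₗ[k] F} {μ : k} {Q : M ⊗[k] F → Prop} (h0 : Q 0)
    (hadd : ∀ x y, Q x → Q y → Q (x + y)) (h : ∀ m x, g x = μ • x → Q (m ⊗ₜ x))
    {z : M ⊗[k] F} (hz : LinearMap.lTensor M g z = μ • z) : Q z := by
  have hz' : z ∈ LinearMap.range
      (LinearMap.lTensor M (LinearMap.ker (g - μ • LinearMap.id)).subtype) := by
    rw [mem_range_lTensor]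
    intro φ
    have e : ∀ z : M ⊗[k] F, TensorProduct.lid k F (LinearMap.rTensor F φ
        (LinearMap.lTensor M g z)) = g (TensorProduct.lid k F (LinearMap.rTensor F φ z)) := by
      intro z
      induction z using TensorProduct.induction_on with
      | zero => simp
      | add x y hx hy => simp only [map_add, hx, hy]
      | tmul x y => simp
    rw [LinearMap.mem_ker, LinearMap.sub_apply, ← e, hz]
    simp
  obtain ⟨y, rfl⟩ := hz'
  clear hz
  induction y using TensorProduct.induction_on with
  | zero => simpa using h0
  | add x y hx hy => rw [map_add]; exact hadd _ _ hx hy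
  | tmul m x =>
    refine h m _ ?_
    have := LinearMap.mem_ker.1 x.2
    rw [LinearMap.sub_apply, sub_eq_zero] at this
    exact this

lemma lowersWeight_lTensor {g : F →ₗ[k] F} {h : M ⊗[k] F →ₗ[k] M ⊗[k] F}
    (H : ∀ (q : ℕ) m x, g x = (2 : k) ^ q • x → h (m ⊗ₜ x) ∈ degLT (LinearMap.lTensor M g) q) :
    LowersWeight (LinearMap.lTensor M g) h := by
  intro q z hz
  refine tensor_eigen_induction (Q := fun z => h z ∈ degLT (LinearMap.lTensor M g) q) ?_ ?_ ?_ hz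
  · simp
  · intro x y hx hy; rw [map_add]; exact Submodule.add_mem _ hx hy
  · exact H q

/-- If the factor in `X` has positive weights only, and the total weight of `z` is `p`, then the
factors in `F` have weights `< p`, also after applying a map `b` that preserves the weight. -/
lemma map_mem_degLT [CharZero k] {f : X →ₗ[k] X} {g : F →ₗ[k] F}
    (hf : IsDiagIn (pow2pos k) f) (hg : IsDiagIn (pow2 k : Set k) g) {p : ℕ} {z : X ⊗[k] F}
    (hz : TensorProduct.map f g z = (2 : k) ^ p • z) (a : X →ₗ[k] M) (b : F →ₗ[k] F)
    (hb : ∀ x, g (b x) = b (g x)) :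
    TensorProduct.map a b z ∈ degLT (LinearMap.lTensor M g) p := by
  obtain ⟨y, rfl⟩ := mem_range_lTensor_degLT hf hg hz
  clear hz
  induction y using TensorProduct.induction_on with
  | zero => simp
  | add x y hx hy => rw [map_add, map_add]; exact Submodule.add_mem _ hx hy
  | tmul m x =>
    rw [LinearMap.lTensor_tmul, TensorProduct.map_tmul]
    obtain ⟨x, hx⟩ := x
    change a m ⊗ₜ b x ∈ _
    induction hx using Submodule.span_induction with
    | zero => simp
    | add x y _ _ hx hy => rw [map_add, TensorProduct.tmul_add]; exact Submodule.add_mem _ hx hy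
    | smul r x _ hx => rw [map_smul, TensorProduct.tmul_smul]; exact Submodule.smul_mem _ _ hx
    | mem x hx =>
      obtain ⟨q, hq, hx⟩ := hx
      exact mem_degLT hq (by simp [hb, hx])

lemma isDiagIn_lTensor {S : Set k} {g : F →ₗ[k] F} (hg : IsDiagIn S g) :
    IsDiagIn S (LinearMap.lTensor M g) := by
  have := (isDiagIn_id (k := k) (X := M)).tensor (S'' := S) hg (fun a ha b hb => by
    rw [Set.mem_singleton_iff.1 ha, one_mul]; exact hb)
  exact this

/-- A number outside of `S` is not an eigenvalue. -/
lemma eq_zero_of_not_mem {S : Set k} {f : X →ₗ[k] X} (h : IsDiagIn S f) {μ : k} (hμ : μ ∉ S)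
    {x : X} (hx : f x = μ • x) : x = 0 := by
  have : ∀ y, eproj f μ y = 0 := fun y => by
    induction y using h.induction with
    | h0 => simp
    | hadd x y hx hy => rw [map_add, hx, hy, add_zero]
    | heig ν hν y hy => exact eproj_ne hy (fun e => hμ (e ▸ hν))
  rw [← eproj_same h hx, this]

lemma exists_add_of_mem_range_lTensor {S T : Submodule k F} {d : F →ₗ[k] F} {z : M ⊗[k] F}
    (hz : z ∈ LinearMap.range (LinearMap.lTensor M (S ⊔ T.map d).subtype)) :
    ∃ y ∈ LinearMap.range (LinearMap.lTensor M S.subtype), ∃ w, z = y + LinearMap.lTensor M d w := by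
  obtain ⟨z, rfl⟩ := hz
  induction z using TensorProduct.induction_on with
  | zero => exact ⟨0, Submodule.zero_mem _, 0, by simp⟩
  | add x y hx hy =>
    obtain ⟨y₁, h₁, w₁, e₁⟩ := hx
    obtain ⟨y₂, h₂, w₂, e₂⟩ := hy
    refine ⟨y₁ + y₂, Submodule.add_mem _ h₁ h₂, w₁ + w₂, ?_⟩
    rw [map_add, e₁, e₂, map_add]; abel
  | tmul m x =>
    obtain ⟨x, hx⟩ := x
    obtain ⟨y, hy, _, ⟨w, hw, rfl⟩, rfl⟩ := Submodule.mem_sup.1 hx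
    exact ⟨m ⊗ₜ y, ⟨m ⊗ₜ ⟨y, hy⟩, rfl⟩, m ⊗ₜ w, by simp [TensorProduct.tmul_add]⟩

end TensorWeights

/-! ### The weight gradings of the algebra, the coalgebra, and their (co)bar constructions -/

section WordWeights
variable {k : Type u} [Field k] {W : Type v} [AddCommGroup W] [Module k W]

lemma mul_firstLetter (x : TensorAlgebra k W) :
    LinearMap.mul' k _ (LinearMap.rTensor _ (TensorAlgebra.ι k) (firstLetter k W x)) =
      x - TensorAlgebra.algebraMapInv x • 1 := by
  refine words_ext (f := LinearMap.mul' k _ ∘ₗ LinearMap.rTensor _ (TensorAlgebra.ι k) ∘ₗ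
    firstLetter k W) (g := LinearMap.id - LinearMap.toSpanSingleton k _ 1 ∘ₗ
      (TensorAlgebra.algebraMapInv (M := W)).toLinearMap) ?_ ?_ x
  · simp
  · intro a x; simp

lemma firstLetter_tmap (f : W →ₗ[k] W) (x : TensorAlgebra k W) :
    firstLetter k W (tmap f x) =
      TensorProduct.map f (tmap f).toLinearMap (firstLetter k W x) := by
  refine words_ext (f := firstLetter k W ∘ₗ (tmap f).toLinearMap)
    (g := TensorProduct.map f (tmap f).toLinearMap ∘ₗ firstLetter k W) ?_ ?_ x
  · simp
  · intro a x; simp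

lemma lastLetter_tmap (f : W →ₗ[k] W) (x : TensorAlgebra k W) :
    lastLetter k W (tmap f x) =
      TensorProduct.map (tmap f).toLinearMap f (lastLetter k W x) := by
  refine words_ext_right (f := lastLetter k W ∘ₗ (tmap f).toLinearMap)
    (g := TensorProduct.map (tmap f).toLinearMap f ∘ₗ lastLetter k W) ?_ ?_ x
  · simp
  · intro a x; simp

lemma tmap_smul_id_words (c : k) {n : ℕ} {x : TensorAlgebra k W} (hx : x ∈ wordsOfLength k W n) :
    tmap (c • LinearMap.id) x = c ^ n • x := by
  refine words_ind (P := fun n x => tmap (c • LinearMap.id : W →ₗ[k] W) x = c ^ n • x)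
    ?_ ?_ ?_ ?_ hx
  · simp
  · intro n r x hx; rw [map_smul, hx, smul_comm]
  · intro n x y hx hy; rw [map_add, hx, hy, smul_add]
  · intro n a x _ hx; simp [hx, pow_succ', smul_smul, mul_comm]

lemma isDiagIn_smul_id (c : k) :
    IsDiagIn ({c} : Set k) (c • LinearMap.id : W →ₗ[k] W) := by
  rw [IsDiagIn, eq_top_iff]
  rintro x -
  exact Submodule.subset_span ⟨c, rfl, by simp⟩

lemma isDiagIn_tmap_two :
    IsDiagIn (pow2 k : Set k) (tmap ((2 : k) • LinearMap.id : W →ₗ[k] W)).toLinearMap :=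
  (isDiagIn_smul_id 2).tmap (by
    rintro _ rfl; exact mem_pow2.2 ⟨1, by simp⟩)

lemma isDiagIn_two_tensor : IsDiagIn (pow2pos k)
    (TensorProduct.map ((2 : k) • LinearMap.id : W →ₗ[k] W)
      (tmap ((2 : k) • LinearMap.id : W →ₗ[k] W)).toLinearMap) :=
  (isDiagIn_smul_id (W := W) (2 : k)).tensor isDiagIn_tmap_two (by
    rintro _ rfl b hb
    obtain ⟨n, rfl⟩ := mem_pow2.1 hb
    exact ⟨n, by rw [pow_succ']⟩)

end WordWeights

section Weights
variable {k : Type u} [Field k] {V : Type v} [AddCommGroup V] [Module k V]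
  {R : Submodule k (V ⊗[k] V)}

local notation "ℓ" => letter R
local notation "P" => dualParity R
local notation "PΩ" => cobarParity R
local notation "Δ" => Coalgebra.comul (R := k) (A := KoszulDual R)
local notation "ε" => Coalgebra.counit (R := k) (A := KoszulDual R)
local notation "κ" => kappa R
local notation "A" => QuadAlg R
local notation "εA" => QuadAlg.aug R
local notation "BA" => TensorAlgebra k (AugIdeal (QuadAlg.aug R))
local notation "par" => lengthParity k (AugIdeal (QuadAlg.aug R))
local notation "j" => dualToBar R
local notation "κΩ" => cobarToAlg R

lemma quadAlg_mk_surjective : Function.Surjective (QuadAlg.mk R) :=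
  RingQuot.mkAlgHom_surjective k (QuadRel R)

lemma quadAlg_hom_ext {B : Type w} [Ring B] [Algebra k B] {f g : A →ₐ[k] B}
    (h : ∀ v, f (QuadAlg.ι R v) = g (QuadAlg.ι R v)) (a : A) : f a = g a := by
  obtain ⟨x, rfl⟩ := quadAlg_mk_surjective a
  have e : f.comp (QuadAlg.mk R) = g.comp (QuadAlg.mk R) :=
    TensorAlgebra.hom_ext (LinearMap.ext fun v => h v)
  exact DFunLike.congr_fun e x

lemma lift_ι (c : k) (v : V) {h} : QuadAlg.lift (R := R) (c • QuadAlg.ι R) h (QuadAlg.ι R v) =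
    c • QuadAlg.ι R v := by
  change QuadAlg.lift _ _ (QuadAlg.mk R (TensorAlgebra.ι k v)) = _
  rw [QuadAlg.lift_mk]
  simp

variable (R) in
/-- The endomorphism of `A` that multiplies `A₁ = V` by the scalar `c`. -/
def algScale (c : k) : A →ₐ[k] A :=
  QuadAlg.lift (c • QuadAlg.ι R) (by
    intro r hr
    have h : TensorAlgebra.lift k (c • QuadAlg.ι R) r = (c ^ 2) • QuadAlg.mk R r := by
      have : TensorAlgebra.lift k (c • QuadAlg.ι R) =
          (QuadAlg.mk R).comp (tmap (c • LinearMap.id)) := by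
        refine TensorAlgebra.hom_ext (LinearMap.ext fun v => ?_)
        simp [QuadAlg.ι]
      rw [this, AlgHom.comp_apply, tmap_smul_id_words c (relations_le hr), map_smul]
    rw [h, QuadAlg.mk_relations hr, smul_zero])

@[simp] lemma algScale_ι (c : k) (v : V) : algScale R c (QuadAlg.ι R v) = c • QuadAlg.ι R v :=
  lift_ι c v

variable [CharZero k]

variable (R) in
/-- The automorphism of `A` that is multiplication by `2^n` on `Aₙ`. -/
def algWeight : A ≃ₐ[k] A :=
  AlgEquiv.ofAlgHom (algScale R 2) (algScale R 2⁻¹)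
    (AlgHom.ext fun a => quadAlg_hom_ext (f := (algScale R 2).comp (algScale R 2⁻¹))
      (g := AlgHom.id k _) (fun v => by simp) a)
    (AlgHom.ext fun a => quadAlg_hom_ext (f := (algScale R 2⁻¹).comp (algScale R 2))
      (g := AlgHom.id k _) (fun v => by simp) a)

@[simp] lemma algWeight_ι (v : V) : algWeight R (QuadAlg.ι R v) = (2 : k) • QuadAlg.ι R v :=
  algScale_ι 2 v

lemma isGradedAut_algWeight : IsGradedAut (algWeight R) := by
  intro n a ha
  rw [QuadAlg.deg] at ha ⊢
  have h : (LinearMap.range (QuadAlg.ι R) ^ n).map (algWeight R).toLinearMap ≤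
      LinearMap.range (QuadAlg.ι R) ^ n := by
    have := Submodule.map_pow (LinearMap.range (QuadAlg.ι R)) (algWeight R).toAlgHom n
    refine this.le.trans (pow_le_pow_left' ?_ n)
    rintro _ ⟨_, ⟨v, rfl⟩, rfl⟩
    exact ⟨(2 : k) • v, by rw [map_smul]; exact (algWeight_ι v).symm⟩
  exact h (Submodule.mem_map_of_mem ha)

lemma onGen_algWeight : onGen (algWeight R) = (2 : k) • LinearMap.id := by
  ext v
  simp [onGen, QuadAlg.toGen_ι]

lemma algWeight_mk (x : TensorAlgebra k V) :
    algWeight R (QuadAlg.mk R x) = QuadAlg.mk R (tmap ((2 : k) • LinearMap.id) x) := by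
  have e : (algWeight R).toAlgHom.comp (QuadAlg.mk R) =
      (QuadAlg.mk R).comp (tmap ((2 : k) • LinearMap.id)) := by
    refine TensorAlgebra.hom_ext (LinearMap.ext fun v => ?_)
    simpa [QuadAlg.ι] using algWeight_ι (R := R) v
  exact DFunLike.congr_fun e x

lemma isDiagIn_augWeight : IsDiagIn (pow2pos k) (augAut εA (algWeight R)) := by
  refine (isDiagIn_two_tensor (W := V)).of_surjective (toAug εA ∘ₗ (QuadAlg.mk R).toLinearMap ∘ₗ
    LinearMap.mul' k _ ∘ₗ LinearMap.rTensor _ (TensorAlgebra.ι k)) ?_ ?_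
  · intro z
    induction z using TensorProduct.induction_on with
    | zero => simp
    | add x y hx hy => simp only [map_add, hx, hy]
    | tmul v x =>
      ext
      rw [coe_augAut _ (aug_gradedAut isGradedAut_algWeight)]
      simp [algWeight_mk]
  · intro a
    obtain ⟨x, hx⟩ := quadAlg_mk_surjective (a : A)
    refine ⟨firstLetter k V x, ?_⟩
    have h0 : TensorAlgebra.algebraMapInv x = 0 := by
      rw [← aug_mk (R := R), hx]; exact augIdeal_apply _ a
    simp only [LinearMap.comp_apply]
    rw [mul_firstLetter, h0, zero_smul, sub_zero, AlgHom.toLinearMap_apply, hx, toAug_coe]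

variable (R) in
/-- Multiplication by `2^n` on the part of degree `n` of the bar construction `T(Ā)`. -/
def barWeight : BA →ₗ[k] BA := (tmap (augAut (QuadAlg.aug R) (algWeight R))).toLinearMap

lemma isDiagIn_barWeight : IsDiagIn (pow2 k : Set k) (barWeight R) :=
  isDiagIn_augWeight.tmap pow2pos_subset

lemma barD_barWeight (x : BA) : barWeight R (barD εA x) = barD εA (barWeight R x) :=
  (barD_tmap εA (aug_gradedAut isGradedAut_algWeight) x).symm

variable (R) in
/-- Multiplication by `2^n` on `A^¡ₙ`. -/
def dualWeight : KoszulDual R →ₗ[k] KoszulDual R := dualAut (algWeight R) isGradedAut_algWeight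

lemma isCoaugHom_dualWeight : IsCoaugHom (dualWeight R) := isCoaugHom_dualMap _ (onGen_relations isGradedAut_algWeight)

lemma dualWeight_parity (c : KoszulDual R) : dualWeight R (P c) = P (dualWeight R c) :=
  dualAut_parity _ c

lemma incl_dualWeight (c : KoszulDual R) :
    incl R (dualWeight R c) = tmap ((2 : k) • LinearMap.id) (incl R c) := by
  rw [dualWeight, dualAut, incl_dualMap, onGen_algWeight]

lemma barWeight_dualToBar (c : KoszulDual R) : barWeight R (j c) = j (dualWeight R c) :=
  tmap_augAut_dualToBar isGradedAut_algWeight c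

@[simp] lemma kappa_dualWeight (c : KoszulDual R) : κ (dualWeight R c) = (2 : k) • κ c := by
  rw [dualWeight, kappa_dualAut, kappa, LinearMap.comp_apply, algWeight_ι]

lemma dualAut_dualWeight {σ : A ≃ₐ[k] A} (hσ : IsGradedAut σ) (c : KoszulDual R) :
    dualAut σ hσ (dualWeight R c) = dualWeight R (dualAut σ hσ c) := by
  apply incl_injective
  simp only [dualAut, incl_dualWeight, incl_dualMap, tmap_comp]
  congr 2
  ext; simp

lemma isGradedBy_dualWeight : IsGradedBy (dualWeight R) (dualDeg R) := by
  refine isGradedBy_of_le ?_ ?_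
  · intro n c hc
    apply incl_injective
    rw [incl_dualWeight, tmap_smul_id_words 2 (mem_dualPiece.1 hc).1, map_smul]
  · intro c
    have h : ∀ x ∈ koszulDualSub R, x ∈ (⨆ n, dualDeg R n).map (incl R) := by
      intro x hx
      refine Submodule.iSup_induction (dualPiece R)
        (motive := fun x => x ∈ (⨆ n, dualDeg R n).map (incl R)) hx ?_ (Submodule.zero_mem _)
        fun x y => Submodule.add_mem _
      intro n x hx
      let c : KoszulDual R := ⟨x, dualPiece_le n hx⟩
      exact ⟨c, Submodule.mem_iSup_of_mem n (show c ∈ dualDeg R n from hx), rfl⟩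
    obtain ⟨c', hc', e⟩ := h _ (incl_mem c)
    exact incl_injective e ▸ hc'

lemma isDiagIn_dualWeight : IsDiagIn (pow2 k : Set k) (dualWeight R) := isGradedBy_dualWeight.diag

lemma isDiagIn_restrictAug_dualWeight :
    IsDiagIn (pow2pos k) (restrictAug (dualWeight R)) := by
  refine (isDiagIn_two_tensor (W := V)).of_injective
    (firstLetter k V ∘ₗ incl R ∘ₗ (DualAug R).subtype) ?_ ?_
  · intro c
    simp only [LinearMap.comp_apply, Submodule.subtype_apply]
    rw [coe_restrictAug (fun c hc => by rw [isCoaugHom_dualWeight.counit, hc]), incl_dualWeight,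
      firstLetter_tmap]
  · rw [← LinearMap.ker_eq_bot, LinearMap.ker_eq_bot']
    intro c hc
    have h := mul_firstLetter (incl R (c : KoszulDual R))
    simp only [LinearMap.comp_apply, Submodule.subtype_apply] at hc
    rw [hc, ← counit_eq, counit_coe, map_zero, map_zero, zero_smul, sub_zero] at h
    exact Subtype.ext (incl_injective (h.symm.trans (map_zero _).symm))

lemma isDiagIn_cobarWeight : IsDiagIn (pow2 k : Set k) (cobarMap (dualWeight R)) :=
  isDiagIn_restrictAug_dualWeight.tmap pow2pos_subset

/-- The component of weight `0` in `A^¡` is spanned by `1`. -/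
lemma eq_counit_smul_of_weight_zero {c : KoszulDual R} (hc : dualWeight R c = c) :
    c = ε c • dualOne R := by
  have h : restrictAug (dualWeight R) (toDualAug R c) = (1 : k) • toDualAug R c := by
    ext
    rw [coe_restrictAug (fun c hc => by rw [isCoaugHom_dualWeight.counit, hc])]
    simp [hc, isCoaugHom_dualWeight.one]
  have h1 : (1 : k) ∉ pow2pos k := by
    rintro ⟨n, hn⟩
    rw [← pow_zero (2 : k), two_pow_inj] at hn
    omega
  have h2 := congrArg Subtype.val (eq_zero_of_not_mem isDiagIn_restrictAug_dualWeight h1 h)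
  rw [coe_toDualAug] at h2
  exact sub_eq_zero.1 h2

end Weights

/-! ### From the Koszul complex to the Hochschild complex of the algebra -/

section Coordinates
variable {k : Type u} [Field k] {M : Type v} [AddCommGroup M] [Module k M]
  {F : Type w} [AddCommGroup F] [Module k F] {F' : Type x} [AddCommGroup F'] [Module k F']

lemma lid_rTensor_lTensor (φ : M →ₗ[k] k) (g : F →ₗ[k] F') (z : M ⊗[k] F) :
    TensorProduct.lid k F' (LinearMap.rTensor F' φ (LinearMap.lTensor M g z)) =
      g (TensorProduct.lid k F (LinearMap.rTensor F φ z)) := by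
  induction z using TensorProduct.induction_on with
  | zero => simp
  | add x y hx hy => simp only [map_add, hx, hy]
  | tmul x y => simp

lemma tmap_injective {f : F →ₗ[k] F'} (hf : Function.Injective f) :
    Function.Injective (tmap f) := by
  obtain ⟨g, hg⟩ := f.exists_leftInverse_of_injective (LinearMap.ker_eq_bot.2 hf)
  intro x y h
  have h' := congrArg (tmap g) h
  rwa [tmap_comp, tmap_comp, hg, tmap_id, tmap_id] at h'

lemma IsGradedBy.lTensor [CharZero k] {g : F →ₗ[k] F} {H : ℕ → Submodule k F}
    (hg : IsGradedBy g H) : IsGradedBy (LinearMap.lTensor M g)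
      (fun n => Submodule.span k {z | ∃ a : M, ∃ x ∈ H n, z = a ⊗ₜ[k] x}) := by
  refine isGradedBy_of_le ?_ ?_
  · intro n z hz
    induction hz using Submodule.span_induction with
    | zero => simp
    | add x y _ _ hx hy => rw [map_add, hx, hy, smul_add]
    | smul r x _ hx => rw [map_smul, hx, smul_comm]
    | mem z hz =>
      obtain ⟨a, x, hx, rfl⟩ := hz
      rw [LinearMap.lTensor_tmul, (hg.mem_iff n x).1 hx, TensorProduct.tmul_smul]
  · intro z
    induction z using TensorProduct.induction_on with
    | zero => exact Submodule.zero_mem _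
    | add x y hx hy => exact Submodule.add_mem _ hx hy
    | tmul a x =>
      refine IsDiagIn.induction (P := fun x => a ⊗ₜ[k] x ∈ ⨆ n,
        Submodule.span k {z | ∃ a : M, ∃ x ∈ H n, z = a ⊗ₜ[k] x}) hg.diag ?_ ?_ ?_ x
      · rw [TensorProduct.tmul_zero]; exact Submodule.zero_mem _
      · intro x y hx hy; rw [TensorProduct.tmul_add]; exact Submodule.add_mem _ hx hy
      · intro μ hμ x hx
        obtain ⟨n, rfl⟩ := mem_pow2.1 hμ
        exact Submodule.mem_iSup_of_mem n
          (Submodule.subset_span ⟨a, x, (hg.mem_iff n x).2 hx, rfl⟩)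

end Coordinates

section ToHoch
variable {k : Type u} [Field k] {V : Type v} [AddCommGroup V] [Module k V]
  {R : Submodule k (V ⊗[k] V)}

local notation "Δ" => Coalgebra.comul (R := k) (A := KoszulDual R)
local notation "ε" => Coalgebra.counit (R := k) (A := KoszulDual R)
local notation "κ" => kappa R
local notation "A" => QuadAlg R
local notation "εA" => QuadAlg.aug R
local notation "BA" => TensorAlgebra k (AugIdeal (QuadAlg.aug R))
local notation "j" => dualToBar R

lemma toAug_ι_injective : Function.Injective (toAug εA ∘ₗ QuadAlg.ι R) := by
  intro v w h
  have h' := congrArg Subtype.val h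
  simp only [LinearMap.comp_apply, coe_toAug, aug_ι, sub_zero, map_zero] at h'
  rw [← QuadAlg.toGen_ι (R := R) v, ← QuadAlg.toGen_ι (R := R) w, h']

lemma dualToBar_injective : Function.Injective j :=
  (tmap_injective toAug_ι_injective).comp incl_injective

lemma koszulToHoch_injective : Function.Injective (koszulToHoch R) :=
  Module.Flat.lTensor_preserves_injective_linearMap (M := A) j dualToBar_injective

lemma mem_range_koszulToHoch {z : HochChain εA}
    (hz : z ∈ LinearMap.range (LinearMap.lTensor A (LinearMap.range j).subtype)) :
    z ∈ LinearMap.range (koszulToHoch R) := by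
  obtain ⟨z, rfl⟩ := hz
  induction z using TensorProduct.induction_on with
  | zero => simp
  | add x y hx hy => rw [map_add]; exact Submodule.add_mem _ hx hy
  | tmul a x =>
    obtain ⟨_, c, rfl⟩ := x
    exact ⟨a ⊗ₜ c, rfl⟩

variable (R) in
/-- The augmentation `a ⊗ c ↦ ε(a) ε(c)` of the Koszul complex. -/
def koszulAug : KoszulChain R →ₗ[k] k :=
  LinearMap.mul' k k ∘ₗ TensorProduct.map (QuadAlg.aug R).toLinearMap Coalgebra.counit

@[simp] lemma koszulAug_tmul (a : A) (c : KoszulDual R) :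
    koszulAug R (a ⊗ₜ c) = εA a * ε c := by simp [koszulAug]

lemma hochAug_koszulToHoch (z : KoszulChain R) :
    hochAug εA (koszulToHoch R z) = koszulAug R z := by
  induction z using TensorProduct.induction_on with
  | zero => simp
  | add x y hx hy => simp only [map_add, hx, hy]
  | tmul a c => simp

/-- The map `ε ⊗ 1 : A ⊗ T(Ā) → T(Ā)` from the one-sided bar complex to the bar construction is a
map of complexes. -/
lemma hochEval_oneBarD (z : HochChain εA) :
    TensorProduct.lid k BA (LinearMap.rTensor BA (εA).toLinearMap (oneBarD εA z)) =
      barD εA (TensorProduct.lid k BA (LinearMap.rTensor BA (εA).toLinearMap z)) := by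
  have h : TensorProduct.lid k BA (LinearMap.rTensor BA (εA).toLinearMap
      (hochFirst εA AlgEquiv.refl z)) = 0 := by
    induction z using TensorProduct.induction_on with
    | zero => simp
    | add x y hx hy => rw [map_add, map_add, map_add, hx, hy, add_zero]
    | tmul a x =>
      rw [hochFirst_eq]
      generalize firstLetter k _ x = t
      induction t using TensorProduct.induction_on with
      | zero => simp
      | add x y hx hy => rw [map_add, map_add, map_add, hx, hy, add_zero]
      | tmul b y => simp [augIdeal_apply]
  rw [oneBarD, LinearMap.add_apply, map_add, map_add, h, zero_add, hochInner_eq,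
    lid_rTensor_lTensor]

variable [CharZero k]

lemma isGradedBy_koszulDeg :
    IsGradedBy (LinearMap.lTensor A (dualWeight R)) (koszulDeg R) :=
  isGradedBy_dualWeight.lTensor

lemma mulLeftFactor_weight {f : KoszulDual R →ₗ[k] A}
    (hf : ∀ c, f (dualWeight R c) = (2 : k) • f c) (z : KoszulChain R) :
    mulLeftFactor f (LinearMap.lTensor A (dualWeight R) z) =
      (2 : k) • LinearMap.lTensor A (dualWeight R) (mulLeftFactor f z) := by
  induction z using TensorProduct.induction_on with
  | zero => simp
  | add x y hx hy => simp only [map_add, hx, hy, smul_add]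
  | tmul a c =>
    rw [LinearMap.lTensor_tmul, mulLeftFactor_tmul, mulLeftFactor_tmul,
      isCoaugHom_dualWeight.comul]
    generalize Δ c = z
    induction z using TensorProduct.induction_on with
    | zero => simp
    | add x y hx hy => simp only [map_add, hx, hy, smul_add]
    | tmul x y => simp [hf, TensorProduct.smul_tmul']

lemma mulRightFactor_weight {f : KoszulDual R →ₗ[k] A}
    (hf : ∀ c, f (dualWeight R c) = (2 : k) • f c) (z : KoszulChain R) :
    mulRightFactor f (LinearMap.lTensor A (dualWeight R) z) =
      (2 : k) • LinearMap.lTensor A (dualWeight R) (mulRightFactor f z) := by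
  induction z using TensorProduct.induction_on with
  | zero => simp
  | add x y hx hy => simp only [map_add, hx, hy, smul_add]
  | tmul a c =>
    rw [LinearMap.lTensor_tmul, mulRightFactor_tmul, mulRightFactor_tmul,
      isCoaugHom_dualWeight.comul]
    generalize Δ c = z
    induction z using TensorProduct.induction_on with
    | zero => simp
    | add x y hx hy => simp only [map_add, hx, hy, smul_add]
    | tmul x y => simp [hf, TensorProduct.smul_tmul']

lemma koszulAug_weight (z : KoszulChain R) :
    koszulAug R (LinearMap.lTensor A (dualWeight R) z) = koszulAug R z := by
  induction z using TensorProduct.induction_on with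
  | zero => simp
  | add x y hx hy => simp only [map_add, hx, hy]
  | tmul a c => simp [isCoaugHom_dualWeight.counit]

/-- Exactness of the augmented Koszul complex, without reference to the grading. -/
lemma IsKoszul.exists_eq (hR : IsKoszul R) {z : KoszulChain R} (hz : mulLeftFactor κ z = 0)
    (h0 : koszulAug R z = 0) : ∃ y, mulLeftFactor κ y = z := by
  set N := LinearMap.lTensor A (dualWeight R)
  have hN : IsDiagIn (pow2 k : Set k) N := isGradedBy_koszulDeg.diag
  obtain ⟨s, hs, e⟩ := hN.exists_sum z
  suffices H : ∀ μ ∈ s, eproj N μ z ∈ LinearMap.range (mulLeftFactor κ) by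
    rw [e]; exact Submodule.sum_mem _ H
  intro μ hμ
  have h1 : mulLeftFactor κ (eproj N μ z) = 0 := by
    rw [eproj_comm_smul hN hN (mulLeftFactor κ) (inv_ne_zero (two_ne_zero' k)), hz, map_zero]
    intro x
    rw [mulLeftFactor_weight kappa_dualWeight, smul_smul, inv_mul_cancel₀ two_ne_zero, one_smul]
  have h2 : koszulAug R (eproj N μ z) = 0 := by
    rw [eproj_comm hN isDiagIn_id (koszulAug R) (fun x => (koszulAug_weight x).symm), h0,
      map_zero]
  obtain ⟨n, rfl⟩ := mem_pow2.1 (hs hμ)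
  have h3 := (isGradedBy_koszulDeg.mem_iff n _).2 (map_eproj hN (2 ^ n) z)
  cases n with
  | zero =>
    obtain ⟨y, -, hy⟩ := hR.1 _ h3 ((TensorProduct.lid k k).injective (by
      rw [map_zero, ← h2]
      generalize eproj N (2 ^ 0) z = t
      induction t using TensorProduct.induction_on with
      | zero => simp
      | add x y hx hy => simp only [map_add, hx, hy]
      | tmul a c => simp))
    exact ⟨y, hy⟩
  | succ n =>
    obtain ⟨y, -, hy⟩ := hR.2 n _ h3 h1
    exact ⟨y, hy⟩

lemma isDiagIn_hochBarWeight :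
    IsDiagIn (pow2 k : Set k) (LinearMap.lTensor A (barWeight R)) :=
  isDiagIn_lTensor isDiagIn_barWeight

lemma koszulToHoch_weight (z : KoszulChain R) :
    LinearMap.lTensor A (barWeight R) (koszulToHoch R z) =
      koszulToHoch R (LinearMap.lTensor A (dualWeight R) z) := by
  induction z using TensorProduct.induction_on with
  | zero => simp
  | add x y hx hy => simp only [map_add, hx, hy]
  | tmul a c => simp [barWeight_dualToBar]

lemma barWeight_mem_range {z : HochChain εA} (hz : z ∈ LinearMap.range (koszulToHoch R)) :
    LinearMap.lTensor A (barWeight R) z ∈ LinearMap.range (koszulToHoch R) := by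
  obtain ⟨z, rfl⟩ := hz
  exact ⟨_, (koszulToHoch_weight z).symm⟩

lemma hochInner_barWeight (z : HochChain εA) :
    LinearMap.lTensor A (barWeight R) (hochInner εA z) =
      hochInner εA (LinearMap.lTensor A (barWeight R) z) := by
  rw [hochInner_eq]
  induction z using TensorProduct.induction_on with
  | zero => simp
  | add x y hx hy => simp only [map_add, hx, hy]
  | tmul a c => simp [barD_barWeight]

/-- Multiplying the first letter into `A` lowers the weight of the word, as letters have positive
weight. -/
lemma lowersWeight_hochFirst (σ : A ≃ₐ[k] A) :
    LowersWeight (LinearMap.lTensor A (barWeight R)) (hochFirst εA σ) := by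
  refine lowersWeight_lTensor fun q a x hx => ?_
  rw [hochFirst_eq]
  refine map_mem_degLT isDiagIn_augWeight isDiagIn_barWeight ?_ _ LinearMap.id fun _ => rfl
  rw [← map_smul, ← hx, barWeight, AlgHom.toLinearMap_apply, firstLetter_tmap]

lemma lowersWeight_hochLast :
    LowersWeight (LinearMap.lTensor A (barWeight R)) (hochLast εA) := by
  refine lowersWeight_lTensor fun q a x hx => ?_
  rw [hochLast_eq]
  refine Submodule.neg_mem _ (map_mem_degLT isDiagIn_augWeight isDiagIn_barWeight ?_ _
    (lengthParity k (AugIdeal εA)) ?_)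
  · have h : ∀ z : BA ⊗[k] AugIdeal εA,
        TensorProduct.map (augAut εA (algWeight R)) (barWeight R) (TensorProduct.comm k _ _ z) =
        TensorProduct.comm k _ _
          (TensorProduct.map (barWeight R) (augAut εA (algWeight R)) z) := by
      intro z
      induction z using TensorProduct.induction_on with
      | zero => simp
      | add x y hx hy => simp only [map_add, hx, hy]
      | tmul a c => simp
    rw [h, ← map_smul, ← map_smul, ← hx, barWeight, AlgHom.toLinearMap_apply, lastLetter_tmap]
  · intro x
    exact (parity_tmap _ x).symm

/-- If `A^¡ → T(Ā)` is a quasi-isomorphism in weight `q`, then so is `A ⊗ A^¡ → A ⊗ T(Ā)`, for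
the differentials induced by the second factor. -/
lemma exists_of_hochInner_mem {q : ℕ}
    (H : ∀ x, barWeight R x = (2 : k) ^ q • x → barD εA x ∈ LinearMap.range j →
      x ∈ LinearMap.range j ⊔ (⊤ : Submodule k BA).map (barD εA))
    {z : HochChain εA} (hz : LinearMap.lTensor A (barWeight R) z = (2 : k) ^ q • z)
    (hdz : hochInner εA z ∈ LinearMap.range (koszulToHoch R)) :
    ∃ y ∈ LinearMap.range (koszulToHoch R), ∃ w, z = y + hochInner εA w := by
  have hz' : z ∈ LinearMap.range (LinearMap.lTensor A
      (LinearMap.range j ⊔ (⊤ : Submodule k BA).map (barD εA)).subtype) := by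
    rw [mem_range_lTensor]
    intro φ
    refine H _ ?_ ?_
    · rw [← lid_rTensor_lTensor, hz, map_smul, map_smul]
    · rw [← lid_rTensor_lTensor, ← hochInner_eq]
      obtain ⟨y, hy⟩ := hdz
      rw [← hy]
      exact ⟨_, (lid_rTensor_lTensor φ j y).symm⟩
  obtain ⟨y, hy, w, e⟩ := exists_add_of_mem_range_lTensor hz'
  exact ⟨y, mem_range_koszulToHoch hy, w, by rw [e, hochInner_eq]⟩

/-- The inclusion of `A^¡` into the bar construction of `A` is a quasi-isomorphism, in weight
`w`. The cycle `1 ⊗ x` of `A ⊗ T(Ā)` relative to `A ⊗ A^¡` is compared with the Koszul complex,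
which is exact like the one-sided bar complex. The result is mapped to `T(Ā)` by `ε ⊗ 1`,
and its component of weight `w` is the claim. -/
lemma IsKoszul.mem_of_barD_mem_weight (hR : IsKoszul R) (w : ℕ) : ∀ x : BA,
    barWeight R x = (2 : k) ^ w • x → barD εA x ∈ LinearMap.range j →
      x ∈ LinearMap.range j ⊔ (⊤ : Submodule k BA).map (barD εA) := by
  induction w using Nat.strong_induction_on with
  | _ w ih =>
  rintro x hx ⟨c, hc⟩
  set N := LinearMap.lTensor A (barWeight R)
  set S := LinearMap.range (koszulToHoch R)
  have hD : hochInner εA + hochFirst εA AlgEquiv.refl = oneBarD εA := add_comm _ _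
  have hD1 : oneBarD εA (1 ⊗ₜ x) = hochFirst εA AlgEquiv.refl (1 ⊗ₜ x) +
      koszulToHoch R (1 ⊗ₜ c) := by
    rw [oneBarD, LinearMap.add_apply, hochInner_tmul, ← hc, koszulToHoch_tmul]
  have hx1 : N (1 ⊗ₜ x) = (2 : k) ^ w • (1 ⊗ₜ x) := by
    rw [LinearMap.lTensor_tmul, hx, TensorProduct.tmul_smul]
  have hdu : (hochInner εA + hochFirst εA AlgEquiv.refl)
      (hochFirst εA AlgEquiv.refl (1 ⊗ₜ x)) ∈ S := by
    rw [hD, ← sub_eq_of_eq_add hD1, map_sub, oneBarD_oneBarD, zero_sub,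
      ← koszulToHoch_mulLeftFactor]
    exact Submodule.neg_mem _ ⟨_, rfl⟩
  -- the first letter times the rest has lower weight in `T(Ā)`, and is a cycle modulo `A ⊗ A^¡`;
  -- so it is a boundary modulo `A ⊗ A^¡`, of a chain `v` of weight less than `w`
  obtain ⟨_, ⟨y, rfl⟩, v, -, hv, e⟩ := exists_of_lowersWeight (U := ⊤) isDiagIn_hochBarWeight
    hochInner_barWeight (lowersWeight_hochFirst AlgEquiv.refl)
    (fun z => by rw [hD]; exact oneBarD_oneBarD εA z) (S := S) le_top
    (fun z hz => barWeight_mem_range hz) (fun _ _ => trivial)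
    (by
      rintro _ ⟨z, rfl⟩
      rw [hD, ← koszulToHoch_mulLeftFactor]
      exact ⟨_, rfl⟩) (fun _ _ => trivial) w
    (fun q hq z _ hz hdz => by
      obtain ⟨y, hy, w, e⟩ := exists_of_hochInner_mem (ih q hq) hz hdz
      exact ⟨y, hy, w, trivial, e⟩) trivial
    (lowersWeight_hochFirst AlgEquiv.refl w _ hx1) hdu
  rw [hD] at e
  have hz0 : oneBarD εA (1 ⊗ₜ x - v) = koszulToHoch R (y + 1 ⊗ₜ c) := by
    rw [map_sub, hD1, e, map_add]; abel
  -- the boundary of `1 ⊗ x - v` is a cycle of the Koszul complex, hence the boundary of an element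
  -- `t` of it; the cycle `1 ⊗ x - v - t` is a boundary up to a multiple of `1 ⊗ 1`
  obtain ⟨t, ht⟩ := hR.exists_eq (z := y + 1 ⊗ₜ c)
    (koszulToHoch_injective (by
      rw [koszulToHoch_mulLeftFactor, ← hz0, oneBarD_oneBarD, map_zero]))
    (by rw [← hochAug_koszulToHoch, ← hz0, hochAug_oneBarD])
  have hz1 : oneBarD εA (1 ⊗ₜ x - v - koszulToHoch R t) = 0 := by
    rw [map_sub, hz0, ← koszulToHoch_mulLeftFactor, ht, sub_self]
  have h := oneBar_contraction εA (1 ⊗ₜ x - v - koszulToHoch R t)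
  rw [hz1, map_zero, add_zero] at h
  generalize oneBarS εA (1 ⊗ₜ x - v - koszulToHoch R t) = s at h
  generalize hochAug εA (1 ⊗ₜ x - v - koszulToHoch R t) = r at h
  -- apply `ε ⊗ 1`, which is a map of complexes to the bar construction
  have hE := congrArg (fun z => TensorProduct.lid k BA (LinearMap.rTensor BA (εA).toLinearMap z)) h
  simp only [hochEval_oneBarD, map_sub, map_smul, LinearMap.rTensor_tmul, TensorProduct.lid_tmul,
    AlgHom.toLinearMap_apply, map_one, one_smul] at hE
  set K : Submodule k BA := LinearMap.range j ⊔ (⊤ : Submodule k BA).map (barD εA)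
  have hj : LinearMap.range j ≤ K := le_sup_left
  have hKN : ∀ x ∈ K, barWeight R x ∈ K := by
    intro x hx
    obtain ⟨_, ⟨c, rfl⟩, _, ⟨y, -, rfl⟩, rfl⟩ := Submodule.mem_sup.1 hx
    rw [map_add, barWeight_dualToBar, barD_barWeight]
    exact Submodule.add_mem_sup ⟨_, rfl⟩ ⟨_, trivial, rfl⟩
  -- `v` does not contribute in weight `w`
  have hv0 : eproj (barWeight R) (2 ^ w)
      (TensorProduct.lid k BA (LinearMap.rTensor BA (εA).toLinearMap v)) = 0 := by
    have h0 := eproj_comm isDiagIn_hochBarWeight isDiagIn_barWeight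
      ((TensorProduct.lid k BA).toLinearMap ∘ₗ LinearMap.rTensor BA (εA).toLinearMap)
      (fun z => (lid_rTensor_lTensor (εA).toLinearMap (barWeight R) z).symm) (2 ^ w) v
    rw [eproj_degLT hv le_rfl, map_zero] at h0
    exact h0.symm
  have hmem : x - TensorProduct.lid k BA (LinearMap.rTensor BA (εA).toLinearMap v) ∈ K := by
    have h1 : TensorProduct.lid k BA (LinearMap.rTensor BA (εA).toLinearMap (koszulToHoch R t)) ∈
        K := hj ⟨_, (lid_rTensor_lTensor (εA).toLinearMap j t).symm⟩
    have h2 : (1 : BA) ∈ K := hj ⟨dualOne R, dualToBar_one⟩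
    rw [sub_sub, eq_sub_iff_add_eq] at hE
    rw [← hE]
    exact Submodule.add_mem K (le_sup_right (a := LinearMap.range j) ⟨_, trivial, rfl⟩)
      (Submodule.add_mem K h1 (K.smul_mem r h2))
  have h4 := eproj_mem isDiagIn_barWeight hKN (2 ^ w) hmem
  rwa [map_sub, hv0, sub_zero, eproj_same isDiagIn_barWeight hx] at h4

/-- The cokernel of the map from the twisted Koszul complex to the Hochschild complex is acyclic: a
cycle relative to `A ⊗ A^¡` is homologous to an element of `A ⊗ A^¡`. -/
lemma IsKoszul.exists_of_hochB_mem (hR : IsKoszul R) (σ : A ≃ₐ[k] A) {z : HochChain εA}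
    (hz : hochB εA σ z ∈ LinearMap.range (koszulToHoch R)) :
    ∃ y w, z = koszulToHoch R y + hochB εA σ w := by
  have hD : hochInner εA + (hochFirst εA σ + hochLast εA) = hochB εA σ := by
    rw [hochB]; abel
  obtain ⟨p, hp⟩ := exists_mem_degLT isDiagIn_hochBarWeight z
  obtain ⟨_, ⟨y, rfl⟩, w, -, -, e⟩ := exists_of_lowersWeight (U := ⊤)
    (S := LinearMap.range (koszulToHoch R)) isDiagIn_hochBarWeight
    hochInner_barWeight ((lowersWeight_hochFirst σ).add lowersWeight_hochLast)
    (fun z => by rw [hD]; exact hochB_hochB εA σ z) le_top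
    (fun z hz => barWeight_mem_range hz) (fun _ _ => trivial)
    (by
      rintro _ ⟨z, rfl⟩
      rw [hD, ← koszulToHoch_koszulB]
      exact ⟨_, rfl⟩) (fun _ _ => trivial) p
    (fun q _ z _ hz hdz => by
      obtain ⟨y, hy, w, e⟩ := exists_of_hochInner_mem (hR.mem_of_barD_mem_weight q) hz hdz
      exact ⟨y, hy, w, trivial, e⟩) trivial hp (by rwa [hD])
  exact ⟨y, w, by rw [← hD]; exact e⟩

end ToHoch

/-! ### From the Hochschild complex of the coalgebra to the Koszul complex -/

section Coordinates
variable {k : Type u} [Field k] {M : Type v} [AddCommGroup M] [Module k M]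
  {F : Type w} [AddCommGroup F] [Module k F] {F' : Type x} [AddCommGroup F'] [Module k F']

lemma rid_lTensor_rTensor (φ : M →ₗ[k] k) (g : F →ₗ[k] F') (z : F ⊗[k] M) :
    TensorProduct.rid k F' (LinearMap.lTensor F' φ (LinearMap.rTensor M g z)) =
      g (TensorProduct.rid k F (LinearMap.lTensor F φ z)) := by
  induction z using TensorProduct.induction_on with
  | zero => simp
  | add x y hx hy => simp only [map_add, hx, hy]
  | tmul x y => simp

end Coordinates

section FromCoHoch
variable {k : Type u} [Field k] {V : Type v} [AddCommGroup V] [Module k V]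
  {R : Submodule k (V ⊗[k] V)}

local notation "ℓ" => letter R
local notation "P" => dualParity R
local notation "PΩ" => cobarParity R
local notation "Δ" => Coalgebra.comul (R := k) (A := KoszulDual R)
local notation "ε" => Coalgebra.counit (R := k) (A := KoszulDual R)
local notation "κ" => kappa R
local notation "A" => QuadAlg R
local notation "εA" => QuadAlg.aug R
local notation "κΩ" => cobarToAlg R

lemma aug_cobarToAlg (x : Cobar R) : εA (κΩ x) = TensorAlgebra.algebraMapInv x := by
  have h : (εA).comp (TensorAlgebra.lift k (kappa R ∘ₗ (DualAug R).subtype)) =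
      TensorAlgebra.algebraMapInv := by
    refine TensorAlgebra.hom_ext (LinearMap.ext fun c => ?_)
    simp
  exact DFunLike.congr_fun h x

/-- The contraction takes its values in `Ω(C) ⊗ C̄`, on which the augmentation vanishes. -/
lemma koszulAug_coHochS (z : CoHochChain R) :
    koszulAug R (coHochToKoszul R (coHochS R z)) = 0 := by
  rw [coHochS, LinearMap.comp_apply, LinearMap.comp_apply]
  generalize lastLetter k (DualAug R) (coHochCounit R z) = t
  induction t using TensorProduct.induction_on with
  | zero => simp
  | add x y hx hy => simp only [map_add, hx, hy, add_zero]
  | tmul x c => simp [isCoaugHom_parity.counit]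

lemma quadAlg_ι_mem_range (v : V) :
    QuadAlg.ι R v ∈ (TensorAlgebra.lift k (kappa R ∘ₗ (DualAug R).subtype)).range := by
  have h1 : TensorAlgebra.ι k v ∈ dualPiece R 1 := by
    rw [mem_dualPiece]
    exact ⟨ι_mem_words v, fun i j h => by omega⟩
  let c : KoszulDual R := ⟨TensorAlgebra.ι k v, dualPiece_le 1 h1⟩
  refine ⟨ℓ c, ?_⟩
  refine (cobarToAlg_letter c).trans ?_
  change QuadAlg.ι R (TensorAlgebra.ιInv (TensorAlgebra.ι k v)) = _
  simp

lemma cobarToAlg_surjective : Function.Surjective κΩ := by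
  intro a
  obtain ⟨x, rfl⟩ := quadAlg_mk_surjective a
  change QuadAlg.mk R x ∈ (TensorAlgebra.lift k (kappa R ∘ₗ (DualAug R).subtype)).range
  induction x using TensorAlgebra.induction with
  | algebraMap r => rw [AlgHom.commutes]; exact Subalgebra.algebraMap_mem _ r
  | ι v => exact quadAlg_ι_mem_range v
  | mul a b ha hb => rw [map_mul]; exact Subalgebra.mul_mem _ ha hb
  | add a b ha hb => rw [map_add]; exact Subalgebra.add_mem _ ha hb

lemma coHochToKoszul_surjective : Function.Surjective (coHochToKoszul R) :=
  LinearMap.rTensor_surjective (KoszulDual R) cobarToAlg_surjective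

section Functoriality
variable {s g : KoszulDual R →ₗ[k] KoszulDual R}

lemma coHochInner_coHochT (hg : IsCoaugHom g) (hgP : ∀ c, g (P c) = P (g c))
    (z : CoHochChain R) :
    coHochInner R (coHochT g z) = coHochT g (coHochInner R z) := by
  induction z using TensorProduct.induction_on with
  | zero => simp
  | add x y hx hy => simp only [map_add, hx, hy]
  | tmul x m =>
    simp only [coHochT_tmul, coHochInner_tmul, cobarMap_cobarD hg hgP]

lemma coHochLeft_coHochT (hg : IsCoaugHom g) (hgP : ∀ c, g (P c) = P (g c))
    (hgs : ∀ c, g (s c) = s (g c)) (z : CoHochChain R) :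
    coHochLeft s (coHochT g z) = coHochT g (coHochLeft s z) := by
  induction z using TensorProduct.induction_on with
  | zero => simp
  | add x y hx hy => simp only [map_add, hx, hy]
  | tmul x m =>
    rw [coHochT_tmul, coHochLeft_tmul, coHochLeft_tmul, hg.comul]
    generalize Δ m = z
    induction z using TensorProduct.induction_on with
    | zero => simp
    | add x y hx hy => simp only [map_add, hx, hy]
    | tmul a b =>
      simp [coHochT_tmul, cobarMap_mul, cobarMap_letter hg, cobarMap_parity hg hgP, hgs, hgP]

end Functoriality

variable [CharZero k]

local notation "W" => dualWeight R
local notation "N₁" => LinearMap.lTensor (Cobar R) (dualWeight R)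

lemma isDiagIn_coHochWeight : IsDiagIn (pow2 k : Set k) N₁ := isDiagIn_lTensor isDiagIn_dualWeight

lemma isDiagIn_coHochT_dualWeight : IsDiagIn (pow2 k : Set k) (coHochT W) :=
  isDiagIn_cobarWeight.tensor isDiagIn_dualWeight fun _ ha _ hb => (pow2 k).mul_mem ha hb

lemma coHochToKoszul_weight (z : CoHochChain R) :
    coHochToKoszul R (N₁ z) = LinearMap.lTensor A W (coHochToKoszul R z) := by
  induction z using TensorProduct.induction_on with
  | zero => simp
  | add x y hx hy => simp only [map_add, hx, hy]
  | tmul x m => simp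

omit [CharZero k] in
lemma coHochToKoszul_coHochT {σ : A ≃ₐ[k] A} (hσ : IsGradedAut σ) (z : CoHochChain R) :
    coHochToKoszul R (coHochT (dualAut σ hσ) z) =
      TensorProduct.map σ.toLinearMap (dualAut σ hσ) (coHochToKoszul R z) := by
  induction z using TensorProduct.induction_on with
  | zero => simp
  | add x y hx hy => simp only [map_add, hx, hy]
  | tmul x m => simp [coHochT_tmul, cobarToAlg_map]

lemma coHochInner_weight (z : CoHochChain R) : N₁ (coHochInner R z) = coHochInner R (N₁ z) := by
  induction z using TensorProduct.induction_on with
  | zero => simp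
  | add x y hx hy => simp only [map_add, hx, hy]
  | tmul x m => simp [coHochInner_tmul]

lemma map_toDualAug_weight {q : ℕ} {m : KoszulDual R} (hm : W m = (2 : k) ^ q • m) :
    TensorProduct.map (restrictAug W) W (LinearMap.rTensor _ (toDualAug R) (Δ m)) =
      (2 : k) ^ q • LinearMap.rTensor _ (toDualAug R) (Δ m) := by
  rw [← map_smul, ← map_smul, ← hm, isCoaugHom_dualWeight.comul]
  generalize Δ m = z
  induction z using TensorProduct.induction_on with
  | zero => simp
  | add x y hx hy => simp only [map_add, hx, hy]
  | tmul x y => simp [toDualAug_map isCoaugHom_dualWeight]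

lemma map_toDualAug_comm_weight {q : ℕ} {m : KoszulDual R} (hm : W m = (2 : k) ^ q • m) :
    TensorProduct.map (restrictAug W) W
        (LinearMap.rTensor _ (toDualAug R) (TensorProduct.comm k _ _ (Δ m))) =
      (2 : k) ^ q • LinearMap.rTensor _ (toDualAug R) (TensorProduct.comm k _ _ (Δ m)) := by
  rw [← map_smul, ← map_smul, ← map_smul, ← hm, isCoaugHom_dualWeight.comul]
  generalize Δ m = z
  induction z using TensorProduct.induction_on with
  | zero => simp
  | add x y hx hy => simp only [map_add, hx, hy]
  | tmul x y => simp [toDualAug_map isCoaugHom_dualWeight]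

lemma lowersWeight_coHochLeft {s : KoszulDual R →ₗ[k] KoszulDual R} (hs : IsCoaugHom s) :
    LowersWeight N₁ (coHochLeft s) := by
  refine lowersWeight_lTensor fun q x m hm => ?_
  have h := map_mem_degLT isDiagIn_restrictAug_dualWeight isDiagIn_dualWeight
    (map_toDualAug_weight hm) (LinearMap.mulLeft k (PΩ x) ∘ₗ TensorAlgebra.ι k ∘ₗ
      restrictAug s ∘ₗ restrictAug P) LinearMap.id fun _ => rfl
  have e : LinearMap.mulLeft k (PΩ x) ∘ₗ ℓ ∘ₗ s ∘ₗ P = (LinearMap.mulLeft k (PΩ x) ∘ₗ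
      TensorAlgebra.ι k ∘ₗ restrictAug s ∘ₗ restrictAug P) ∘ₗ toDualAug R :=
    LinearMap.ext fun c => by simp [letter, toDualAug_map hs, toDualAug_map isCoaugHom_parity]
  rw [← LinearMap.comp_apply, LinearMap.map_comp_rTensor, ← e] at h
  rwa [coHochLeft_tmul]

lemma lowersWeight_coHochRightOf (q : ℕ) : LowersWeight N₁ (coHochRightOf (R := R) q) := by
  have hq : ∀ c, toDualAug R ((P ^ q) c) = (restrictAug P ^ q) (toDualAug R c) := by
    induction q with
    | zero => intro c; rfl
    | succ q ih => intro c; rw [pow_succ, pow_succ, Module.End.mul_apply, Module.End.mul_apply,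
        ih,
        toDualAug_map isCoaugHom_parity]
  refine lowersWeight_lTensor fun p x m hm => ?_
  have h := map_mem_degLT isDiagIn_restrictAug_dualWeight isDiagIn_dualWeight
    (map_toDualAug_comm_weight hm) (LinearMap.mulRight k x ∘ₗ TensorAlgebra.ι k ∘ₗ
      restrictAug P ^ q) LinearMap.id fun _ => rfl
  have e : LinearMap.mulRight k x ∘ₗ ℓ ∘ₗ P ^ q = (LinearMap.mulRight k x ∘ₗ
      TensorAlgebra.ι k ∘ₗ restrictAug P ^ q) ∘ₗ toDualAug R :=
    LinearMap.ext fun c => by simp [letter, hq]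
  rw [← LinearMap.comp_apply, LinearMap.map_comp_rTensor, ← e] at h
  rw [coHochRightOf_tmul]
  exact Submodule.neg_mem _ h

lemma lowersWeight_coHochRight : LowersWeight N₁ (coHochRight R) := by
  intro q z hz
  have hp : N₁ (coHochParity R z) = (2 : k) ^ q • coHochParity R z := by
    rw [← map_smul, ← hz]
    clear hz
    induction z using TensorProduct.induction_on with
    | zero => simp
    | add x y hx hy => simp only [map_add, hx, hy]
    | tmul x m => simp [dualWeight_parity]
  rw [coHochRight_eq]
  refine Submodule.smul_mem _ _ (Submodule.add_mem _ (lowersWeight_coHochRightOf 0 q _ ?_)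
    (lowersWeight_coHochRightOf 1 q _ ?_))
  · rw [map_add, hz, hp, smul_add]
  · rw [map_sub, hz, hp, smul_sub]

omit [CharZero k] in
/-- If all coordinates in `Ω(C)` of a chain of `Ω(C) ⊗ C` are boundaries of elements of the kernel
of `Ω(C) → A`, then the chain is the boundary, for the differential of the first factor, of a chain
that maps to zero in `A ⊗ C`. -/
lemma exists_of_coHochInner_eq_zero {z : CoHochChain R}
    (H : ∀ φ : KoszulDual R →ₗ[k] k,
      TensorProduct.rid k (Cobar R) (LinearMap.lTensor (Cobar R) φ z) ∈
        (LinearMap.ker (κΩ).toLinearMap).map (cobarD R)) :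
    ∃ w, coHochToKoszul R w = 0 ∧ z = coHochInner R w := by
  obtain ⟨y, rfl⟩ := (mem_range_rTensor _ z).2 H
  clear H
  induction y using TensorProduct.induction_on with
  | zero => exact ⟨0, by simp, by simp⟩
  | add x y hx hy =>
    obtain ⟨u, hu, e⟩ := hx
    obtain ⟨v, hv, e'⟩ := hy
    exact ⟨u + v, by rw [map_add, hu, hv, add_zero], by rw [map_add, map_add, e, e']⟩
  | tmul x c =>
    obtain ⟨_, y, hy, rfl⟩ := x
    exact ⟨y ⊗ₜ c, by
      have hy' : κΩ y = 0 := hy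
      rw [coHochToKoszul_tmul, hy', TensorProduct.zero_tmul],
      rfl⟩

end FromCoHoch

/-! ### Acyclicity of the kernel -/

section Acyclic
variable {k : Type u} [Field k] [CharZero k] {V : Type v} [AddCommGroup V] [Module k V]
  {R : Submodule k (V ⊗[k] V)}

local notation "ℓ" => letter R
local notation "P" => dualParity R
local notation "PΩ" => cobarParity R
local notation "Δ" => Coalgebra.comul (R := k) (A := KoszulDual R)
local notation "ε" => Coalgebra.counit (R := k) (A := KoszulDual R)
local notation "κ" => kappa R
local notation "A" => QuadAlg R
local notation "κΩ" => cobarToAlg R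
local notation "W" => dualWeight R
local notation "N₁" => LinearMap.lTensor (Cobar R) (dualWeight R)
local notation "Nt" => coHochT (dualWeight R)
local notation "D" => coHochOneSided R

omit [CharZero k] in
lemma coHochToKoszul_oneSided (z : CoHochChain R) :
    coHochToKoszul R (D z) = -mulLeftFactor κ (coHochToKoszul R z) := by
  rw [coHochOneSided, LinearMap.add_apply, map_add, coHochToKoszul_coHochInner, zero_add,
    coHochToKoszul_coHochLeft (f := LinearMap.id) (fun _ => rfl), LinearMap.id_comp]

lemma oneSided_coHochT (z : CoHochChain R) : Nt (D z) = D (Nt z) := by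
  simp only [coHochOneSided, LinearMap.add_apply, map_add,
    coHochInner_coHochT isCoaugHom_dualWeight dualWeight_parity,
    coHochLeft_coHochT isCoaugHom_dualWeight dualWeight_parity (s := LinearMap.id) fun _ => rfl]

omit [CharZero k] in
lemma oneSided_tmul_one (x : Cobar R) : D (x ⊗ₜ dualOne R) = cobarD R x ⊗ₜ dualOne R := by
  simp [coHochOneSided, coHochInner_tmul, coHochLeft_tmul, comul_dualOne]

lemma coHochWeight_comm (z : CoHochChain R) : N₁ (Nt z) = Nt (N₁ z) := by
  induction z using TensorProduct.induction_on with
  | zero => simp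
  | add x y hx hy => simp only [map_add, hx, hy]
  | tmul x m => simp [coHochT_tmul]

lemma coHochT_dualWeight_eq (z : CoHochChain R) :
    Nt z = LinearMap.rTensor _ (cobarMap W) (N₁ z) := by
  induction z using TensorProduct.induction_on with
  | zero => simp
  | add x y hx hy => simp only [map_add, hx, hy]
  | tmul x m => simp [coHochT_tmul]

/-- A chain of weight `0` in the last factor is of the form `y ⊗ 1`. -/
lemma eq_tmul_one_of_weight_zero {z : CoHochChain R} (hz : N₁ z = z) :
    z = coHochCounit R z ⊗ₜ dualOne R := by
  refine tensor_eigen_induction (g := W) (μ := 1)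
    (Q := fun z => z = coHochCounit R z ⊗ₜ dualOne R) ?_ ?_ ?_ (by rw [hz, one_smul])
  · simp
  · intro x y hx hy; rw [map_add, TensorProduct.add_tmul, ← hx, ← hy]
  · intro x m hm
    rw [coHochCounit_tmul, TensorProduct.smul_tmul,
      ← eq_counit_smul_of_weight_zero (by rw [hm, one_smul])]

variable (R) in
/-- The chains of `Ω(C) ⊗ C` of total weight `w` that map to zero in `A ⊗ C`. -/
def kerWeight (w : ℕ) : Submodule k (CoHochChain R) :=
  LinearMap.ker (coHochToKoszul R) ⊓
    LinearMap.ker (coHochT (dualWeight R) - (2 : k) ^ w • LinearMap.id)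

lemma mem_kerWeight {w : ℕ} {z : CoHochChain R} :
    z ∈ kerWeight R w ↔ coHochToKoszul R z = 0 ∧ Nt z = (2 : k) ^ w • z := by
  simp [kerWeight, sub_eq_zero]

lemma coHochToKoszul_coHochT_dualWeight {z : CoHochChain R} (hz : coHochToKoszul R z = 0) :
    coHochToKoszul R (Nt z) = 0 := by
  rw [dualWeight, coHochToKoszul_coHochT, hz, map_zero]

lemma eproj_mem_kerWeight (w : ℕ) {z : CoHochChain R} (hz : coHochToKoszul R z = 0) :
    eproj Nt (2 ^ w) z ∈ kerWeight R w :=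
  mem_kerWeight.2 ⟨eproj_mem (K := LinearMap.ker (coHochToKoszul R)) isDiagIn_coHochT_dualWeight
    (fun _ h => coHochToKoszul_coHochT_dualWeight h) _ hz,
    map_eproj isDiagIn_coHochT_dualWeight _ _⟩

/-- Acyclicity of the kernel of `Ω(C) → A` in weights less than `w` makes the chains of total
weight `w` and positive weight in `C` acyclic for the differential of `Ω(C)`. -/
lemma exists_of_mem_kerWeight {w q : ℕ} (hq : 0 < q)
    (ih : ∀ m < w, ∀ x : Cobar R, cobarMap W x = (2 : k) ^ m • x → κΩ x = 0 → cobarD R x = 0 →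
      x ∈ (LinearMap.ker (κΩ).toLinearMap).map (cobarD R))
    {z : CoHochChain R} (hz : z ∈ kerWeight R w) (hzq : N₁ z = (2 : k) ^ q • z)
    (hdz : coHochInner R z = 0) : ∃ y ∈ kerWeight R w, z = coHochInner R y := by
  obtain ⟨hz0, hzw⟩ := mem_kerWeight.1 hz
  obtain ⟨y, hy, e⟩ := exists_of_coHochInner_eq_zero (z := z) (by
    intro φ
    set x := TensorProduct.rid k (Cobar R) (LinearMap.lTensor (Cobar R) φ z) with hx
    have h1 : κΩ x = 0 := by
      rw [← AlgHom.toLinearMap_apply, hx, ← rid_lTensor_rTensor]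
      have : LinearMap.rTensor (KoszulDual R) (κΩ).toLinearMap z = 0 := hz0
      rw [this, map_zero, map_zero]
    have h2 : cobarD R x = 0 := by
      rw [hx, ← rid_lTensor_rTensor]
      have : LinearMap.rTensor (KoszulDual R) (cobarD R) z = 0 := hdz
      rw [this, map_zero, map_zero]
    -- the coordinate has weight `w - q`, and so it vanishes unless `q ≤ w`
    have h3 : cobarMap W x = ((2 : k) ^ w / 2 ^ q) • x := by
      rw [coHochT_dualWeight_eq, hzq, map_smul] at hzw
      have h4 : LinearMap.rTensor _ (cobarMap W) z = ((2 : k) ^ w / 2 ^ q) • z := by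
        rw [div_eq_inv_mul, mul_smul, ← hzw, inv_smul_smul₀ (pow_ne_zero _ two_ne_zero)]
      rw [hx, ← rid_lTensor_rTensor, h4, map_smul, map_smul]
    by_cases hqw : q ≤ w
    · refine ih (w - q) (by omega) x ?_ h1 h2
      rw [h3, pow_sub₀ _ two_ne_zero hqw, div_eq_mul_inv]
    · have h4 : (2 : k) ^ w / 2 ^ q ∉ (pow2 k : Set k) := by
        intro h
        obtain ⟨n, hn⟩ := mem_pow2.1 h
        rw [div_eq_iff (pow_ne_zero _ two_ne_zero), ← pow_add, two_pow_inj] at hn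
        omega
      rw [eq_zero_of_not_mem isDiagIn_cobarWeight h4 h3]
      exact Submodule.zero_mem _)
  refine ⟨eproj Nt (2 ^ w) y, eproj_mem_kerWeight w hy, ?_⟩
  rw [eproj_comm isDiagIn_coHochT_dualWeight isDiagIn_coHochT_dualWeight (coHochInner R)
    (fun x => (coHochInner_coHochT isCoaugHom_dualWeight dualWeight_parity x).symm), ← e,
    eproj_same isDiagIn_coHochT_dualWeight hzw]

lemma oneSided_mem_kerWeight {w : ℕ} {z : CoHochChain R} (hz : z ∈ kerWeight R w) :
    D z ∈ kerWeight R w := by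
  obtain ⟨h1, h2⟩ := mem_kerWeight.1 hz
  refine mem_kerWeight.2 ⟨?_, ?_⟩
  · rw [coHochToKoszul_oneSided, h1, map_zero, neg_zero]
  · rw [oneSided_coHochT, h2, map_smul]

/-- The kernel of `Ω(C) → A` is acyclic in weight `w`. A cycle `x` of the kernel gives the cycle
`x ⊗ 1` of `Ω(C) ⊗ C`, which is a boundary within the kernel of the map to the Koszul complex
since both complexes are exact; filtering by the weight in `C`, the bounding chain can be moved
to one of the form `y ⊗ 1`. -/
lemma IsKoszul.mem_of_cobarD_eq_zero_weight (hR : IsKoszul R) (w : ℕ) : ∀ x : Cobar R,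
    cobarMap W x = (2 : k) ^ w • x → κΩ x = 0 → cobarD R x = 0 →
      x ∈ (LinearMap.ker (κΩ).toLinearMap).map (cobarD R) := by
  induction w using Nat.strong_induction_on with
  | _ w ih =>
  intro x hx hx0 hdx
  have hx1 : x ⊗ₜ dualOne R ∈ kerWeight R w := by
    refine mem_kerWeight.2 ⟨?_, ?_⟩
    · rw [coHochToKoszul_tmul, hx0, TensorProduct.zero_tmul]
    · rw [coHochT_tmul, hx, isCoaugHom_dualWeight.one, TensorProduct.smul_tmul']
  have hDx : D (x ⊗ₜ dualOne R) = 0 := by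
    rw [oneSided_tmul_one, hdx, TensorProduct.zero_tmul]
  have h := coHochOneSided_contraction (x ⊗ₜ dualOne R)
  rw [hDx, map_zero, add_zero, coHochCounit_tmul, map_smul, ← aug_cobarToAlg, hx0, map_zero,
    smul_zero, zero_smul, sub_zero] at h
  -- `x ⊗ 1` is the boundary of `coHochS (x ⊗ 1)`, whose image is a cycle, hence a boundary, of the
  -- Koszul complex; it is corrected by a lift of the chain bounding it
  obtain ⟨t, ht⟩ := hR.exists_eq (z := coHochToKoszul R (coHochS R (x ⊗ₜ dualOne R))) (by
    rw [← neg_eq_zero, ← coHochToKoszul_oneSided, h]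
    exact (mem_kerWeight.1 hx1).1) (koszulAug_coHochS _)
  obtain ⟨t, rfl⟩ := coHochToKoszul_surjective t
  have hs0 : coHochToKoszul R (coHochS R (x ⊗ₜ dualOne R) + D t) = 0 := by
    rw [map_add, coHochToKoszul_oneSided, ht, add_neg_cancel]
  have hs := eproj_mem_kerWeight w hs0
  have hDs : D (eproj Nt (2 ^ w) (coHochS R (x ⊗ₜ dualOne R) + D t)) = x ⊗ₜ dualOne R := by
    rw [eproj_comm isDiagIn_coHochT_dualWeight isDiagIn_coHochT_dualWeight D oneSided_coHochT,
      map_add D, h, coHochOneSided_coHochOneSided, add_zero,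
      eproj_same isDiagIn_coHochT_dualWeight (mem_kerWeight.1 hx1).2]
  generalize eproj Nt (2 ^ w) (coHochS R (x ⊗ₜ dualOne R) + D t) = s at hs hDs
  obtain ⟨p, hp⟩ := exists_mem_degLT isDiagIn_coHochWeight s
  have hN : ∀ z ∈ kerWeight R w, N₁ z ∈ kerWeight R w := by
    intro z hz
    obtain ⟨h1, h2⟩ := mem_kerWeight.1 hz
    refine mem_kerWeight.2 ⟨?_, ?_⟩
    · rw [coHochToKoszul_weight, h1, map_zero]
    · rw [← coHochWeight_comm, h2, map_smul]
  have hone : ∀ {z : CoHochChain R}, N₁ z = z → N₁ (D z) = D z := by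
    intro z hz
    rw [eq_tmul_one_of_weight_zero hz, oneSided_tmul_one, LinearMap.lTensor_tmul,
      isCoaugHom_dualWeight.one]
  -- `S` consists of the chains `y ⊗ 1` of the kernel
  let S : Submodule k (CoHochChain R) := kerWeight R w ⊓ LinearMap.ker (N₁ - LinearMap.id)
  have hS : ∀ {z}, z ∈ S ↔ z ∈ kerWeight R w ∧ N₁ z = z := by
    intro z
    simp [S, sub_eq_zero]
  obtain ⟨y, hy, v, -, -, e⟩ := exists_of_lowersWeight (S := S) (U := kerWeight R w)
    isDiagIn_coHochWeight coHochInner_weight (lowersWeight_coHochLeft isCoaugHom_id)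
    coHochOneSided_coHochOneSided inf_le_left
    (fun z hz => hS.2 ⟨hN z (hS.1 hz).1, by rw [(hS.1 hz).2, (hS.1 hz).2]⟩) hN
    (fun z hz => hS.2 ⟨oneSided_mem_kerWeight (hS.1 hz).1, hone (hS.1 hz).2⟩)
    (fun z hz => oneSided_mem_kerWeight hz) p
    (by
      intro q _ z hz hzq hdz
      rcases Nat.eq_zero_or_pos q with rfl | hq
      · exact ⟨z, hS.2 ⟨hz, by rw [hzq, pow_zero, one_smul]⟩, 0, Submodule.zero_mem _, by simp⟩
      · -- a boundary in `S` has weight `0` in `C`, but `coHochInner` preserves the weight `q`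
        have h1 : coHochInner R z = 0 := by
          have h2 := (hS.1 hdz).2
          rw [coHochInner_weight, hzq, map_smul] at h2
          have h3 : ((2 : k) ^ q - 1) • coHochInner R z = 0 := by
            linear_combination (norm := module) h2
          refine (smul_eq_zero.1 h3).resolve_left fun h4 => ?_
          rw [sub_eq_zero, ← pow_zero (2 : k), two_pow_inj] at h4
          omega
        obtain ⟨y, hy, e⟩ := exists_of_mem_kerWeight hq ih hz hzq h1
        exact ⟨0, Submodule.zero_mem _, y, hy, by rw [zero_add, e]⟩)
    hs hp (by
      rw [← coHochOneSided, hDs]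
      exact hS.2 ⟨hx1, by rw [LinearMap.lTensor_tmul, isCoaugHom_dualWeight.one]⟩)
  obtain ⟨hy1, hy2⟩ := hS.1 hy
  rw [← coHochOneSided] at e
  have hDy : x ⊗ₜ dualOne R = cobarD R (coHochCounit R y) ⊗ₜ[k] dualOne R := by
    rw [← hDs, e, map_add, coHochOneSided_coHochOneSided, add_zero, ← oneSided_tmul_one,
      ← eq_tmul_one_of_weight_zero hy2]
  refine ⟨coHochCounit R y, ?_, ?_⟩
  · have h1 := (mem_kerWeight.1 hy1).1
    rw [eq_tmul_one_of_weight_zero hy2, coHochToKoszul_tmul] at h1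
    have h2 := congrArg (fun z => TensorProduct.rid k A (LinearMap.lTensor A ε z)) h1
    simpa using h2
  · have h2 := congrArg (coHochCounit R) hDy
    simpa using h2.symm

lemma IsKoszul.mem_of_cobarD_eq_zero (hR : IsKoszul R) {x : Cobar R} (hx : κΩ x = 0)
    (hdx : cobarD R x = 0) : x ∈ (LinearMap.ker (κΩ).toLinearMap).map (cobarD R) := by
  obtain ⟨s, hs, e⟩ := isDiagIn_cobarWeight.exists_sum x
  rw [e]
  refine Submodule.sum_mem _ fun μ hμ => ?_
  obtain ⟨w, rfl⟩ := mem_pow2.1 (hs hμ)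
  refine hR.mem_of_cobarD_eq_zero_weight w _ (map_eproj isDiagIn_cobarWeight _ _) ?_ ?_
  · exact eproj_mem (K := LinearMap.ker (κΩ).toLinearMap) isDiagIn_cobarWeight
      (fun y (hy : κΩ y = 0) => by
        change κΩ (cobarMap W y) = 0
        rw [dualWeight, cobarToAlg_map, hy, map_zero]) _ hx
  · rw [eproj_comm isDiagIn_cobarWeight isDiagIn_cobarWeight (cobarD R)
      (cobarMap_cobarD isCoaugHom_dualWeight dualWeight_parity), hdx, map_zero]

/-- The kernel of the map from the Hochschild complex of the coalgebra to the twisted Koszul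
complex is acyclic. -/
lemma IsKoszul.exists_of_coHochB_eq_zero (hR : IsKoszul R) {σ : A ≃ₐ[k] A} (hσ : IsGradedAut σ)
    {z : CoHochChain R} (hz : coHochToKoszul R z = 0) (hdz : coHochB (dualAut σ hσ) z = 0) :
    ∃ y, coHochToKoszul R y = 0 ∧ z = coHochB (dualAut σ hσ) y := by
  have hs : IsCoaugHom (dualAut σ hσ) := isCoaugHom_dualMap _ _
  have hb : coHochInner R + (coHochLeft (dualAut σ hσ) + coHochRight R) =
      coHochB (dualAut σ hσ) := (add_assoc _ _ _).symm
  obtain ⟨p, hp⟩ := exists_mem_degLT isDiagIn_coHochWeight z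
  obtain ⟨y, hy, w, hw, -, e⟩ := exists_of_lowersWeight (S := ⊥)
    (U := LinearMap.ker (coHochToKoszul R)) isDiagIn_coHochWeight coHochInner_weight
    ((lowersWeight_coHochLeft hs).add lowersWeight_coHochRight)
    (fun z => by rw [hb]; exact coHochB_coHochB hs (dualAut_parity hσ) z) bot_le
    (by simp) (fun z (hz : coHochToKoszul R z = 0) => by
      change coHochToKoszul R _ = 0
      rw [coHochToKoszul_weight, hz, map_zero])
    (by simp) (fun z (hz : coHochToKoszul R z = 0) => by
      change coHochToKoszul R _ = 0
      rw [hb, coHochToKoszul_coHochB, hz, map_zero, neg_zero]) p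
    (by
      intro q _ z hz _ hdz
      have hz' : LinearMap.rTensor (KoszulDual R) (κΩ).toLinearMap z = 0 := hz
      have hdz' : LinearMap.rTensor (KoszulDual R) (cobarD R) z = 0 := hdz
      obtain ⟨w, hw, e⟩ := exists_of_coHochInner_eq_zero (z := z) fun φ =>
        hR.mem_of_cobarD_eq_zero
          (by rw [← AlgHom.toLinearMap_apply, ← rid_lTensor_rTensor, hz', map_zero, map_zero])
          (by rw [← rid_lTensor_rTensor, hdz', map_zero, map_zero])
      exact ⟨0, Submodule.zero_mem _, w, hw, by rw [zero_add, e]⟩)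
    (z := z) hz hp (by rw [hb]; exact hdz)
  rw [(Submodule.mem_bot k).1 hy, zero_add, hb] at e
  exact ⟨w, hw, e⟩

end Acyclic

/-! ### The homological gradings -/

section KoszulSign
variable {k : Type u} [Field k] {X : Type v} [AddCommGroup X] [Module k X]
  {Y : Type w} [AddCommGroup Y] [Module k Y]

lemma koszulSign_map {f a : X →ₗ[k] X} {g b : Y →ₗ[k] Y} (ha : ∀ x, f (a x) = a (f x))
    (hb : ∀ y, g (b y) = b (g y)) (z : X ⊗[k] Y) :
    koszulSign f g (TensorProduct.map a b z) = TensorProduct.map a b (koszulSign f g z) := by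
  induction z using TensorProduct.induction_on with
  | zero => simp
  | add x y hx hy => simp only [map_add, hx, hy]
  | tmul x y => simp [koszulSign, ha, hb]

/-- Since `T - 1` is null-homotopic, it is a map of complexes. -/
lemma comm_of_homotopy {d T B : X →ₗ[k] X} {c : k} (hc : c ≠ 0) (hdd : ∀ x, d (d x) = 0)
    (hB : ∀ x, d (B x) + B (d x) = c • (T x - x)) (x : X) : T (d x) = d (T x) := by
  have h1 := hB (d x)
  have h2 := congrArg d (hB x)
  rw [hdd, map_zero, add_zero] at h1
  rw [map_add, hdd, zero_add, map_smul, map_sub, h1] at h2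
  simpa using smul_right_injective X hc h2

end KoszulSign

section HochGrading
variable {k : Type u} [Field k] {A : Type w} [Ring A] [Algebra k A] (ε : A →ₐ[k] k)

local notation "T" => TensorAlgebra k (AugIdeal ε)
local notation "τ" => TensorAlgebra.ι k (M := AugIdeal ε)
local notation "par" => lengthParity k (AugIdeal ε)
local notation "θ" => tmap ((2 : k) • LinearMap.id : AugIdeal ε →ₗ[k] AugIdeal ε)
local notation "N" => LinearMap.lTensor A
  (AlgHom.toLinearMap (tmap ((2 : k) • LinearMap.id : AugIdeal ε →ₗ[k] AugIdeal ε)))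

lemma barD_tmap_two (x : T) : barD ε (θ x) = (2 : k) • θ (barD ε x) := by
  have h : ∀ (x : T) (a : AugIdeal ε), barD ε (θ (τ a * x)) = (2 : k) • θ (barD ε (τ a * x)) := by
    intro x
    induction x using words_induction with
    | h1 => intro a; simp
    | hsmul r x hx => intro a; simp only [mul_smul_comm, map_smul, hx, smul_comm r]
    | hadd x y hx hy => intro a; simp only [mul_add, map_add, hx, hy, smul_add]
    | hι b x hx =>
      intro a
      rw [map_mul, tmap_ι, LinearMap.smul_apply, LinearMap.id_apply, map_smul, smul_mul_assoc,
        map_smul, barD_ι_mul ε a, hx, barD_ι_mul ε a]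
      simp [smul_sub]
  induction x using words_induction with
  | h1 => simp
  | hsmul r x hx => simp only [map_smul, hx, smul_comm r]
  | hadd x y hx hy => simp only [map_add, hx, hy, smul_add]
  | hι a x _ => exact h x a

section
variable {W : Type v} [AddCommGroup W] [Module k W]

lemma isGradedBy_words [CharZero k] : IsGradedBy (X := TensorAlgebra k W)
    (tmap ((2 : k) • LinearMap.id : W →ₗ[k] W)).toLinearMap (wordsOfLength k W) :=
  isGradedBy_of_le (fun _ _ hx => tmap_smul_id_words 2 hx) fun x => by
    rw [(DirectSum.Decomposition.isInternal (wordsOfLength k W)).submodule_iSup_eq_top]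
    trivial
end

lemma isGradedBy_hochDeg [CharZero k] : IsGradedBy N (hochDeg ε) := isGradedBy_words.lTensor

lemma hochB_two (σ : A ≃ₐ[k] A) (z : HochChain ε) :
    hochB ε σ (N z) = (2 : k) • N (hochB ε σ z) := by
  induction z using TensorProduct.induction_on with
  | zero => simp
  | add x y hx hy => simp only [map_add, hx, hy, smul_add]
  | tmul a x =>
    have h1 : hochFirst ε σ (a ⊗ₜ θ x) = (2 : k) • N (hochFirst ε σ (a ⊗ₜ x)) := by
      rw [hochFirst_eq, hochFirst_eq, firstLetter_tmap]
      generalize firstLetter k _ x = t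
      induction t using TensorProduct.induction_on with
      | zero => simp
      | add x y hx hy => simp only [map_add, hx, hy, smul_add]
      | tmul b y => simp [TensorProduct.smul_tmul']
    have h2 : hochLast ε (a ⊗ₜ θ x) = (2 : k) • N (hochLast ε (a ⊗ₜ x)) := by
      rw [hochLast_eq, hochLast_eq, lastLetter_tmap]
      generalize lastLetter k _ x = t
      induction t using TensorProduct.induction_on with
      | zero => simp
      | add x y hx hy => simp only [map_add, hx, hy, smul_add, neg_add]
      | tmul b y => simp [parity_tmap]
    simp only [hochB, LinearMap.add_apply, map_add, smul_add, LinearMap.lTensor_tmul,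
      AlgHom.toLinearMap_apply, h1, h2, hochInner_tmul, barD_tmap_two, TensorProduct.tmul_smul]

lemma hochConnes_two (σ : A ≃ₐ[k] A) (z : HochChain ε) :
    N (hochConnes ε σ z) = (2 : k) • hochConnes ε σ (N z) := by
  induction z using TensorProduct.induction_on with
  | zero => simp
  | add x y hx hy => simp only [map_add, hx, hy, smul_add]
  | tmul a x =>
    have hs : ∀ x, tmap (augAut ε σ) (θ x) = θ (tmap (augAut ε σ) x) := by
      intro x
      rw [tmap_comp, tmap_comp]
      congr 2
      ext; simp
    rw [LinearMap.lTensor_tmul, AlgHom.toLinearMap_apply, hochConnes_tmul, hochConnes_tmul,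
      deconc_tmap, hochRot]
    simp only [LinearMap.comp_apply]
    rw [koszulSign_map (fun x => parity_tmap _ x) (fun x => parity_tmap _ x)]
    generalize koszulSign par par (deconc x) = t
    induction t using TensorProduct.induction_on with
    | zero => simp
    | add x y hx hy => simp only [map_add, hx, hy, smul_add]
    | tmul u v => simp [parity_tmap, hs]

lemma hochT_two (σ : A ≃ₐ[k] A) (z : HochChain ε) : N (hochT ε σ z) = hochT ε σ (N z) := by
  induction z using TensorProduct.induction_on with
  | zero => simp
  | add x y hx hy => simp only [map_add, hx, hy]
  | tmul a x =>
    simp only [hochT, TensorProduct.map_tmul, LinearMap.lTensor_tmul, AlgHom.toLinearMap_apply,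
      tmap_comp]
    congr 3
    ext; simp

lemma isDiagIn_hochT {σ : A ≃ₐ[k] A} (hε : ∀ a, ε (σ a) = ε a)
    (hσ : IsDiagIn Set.univ σ.toLinearMap) : IsDiagIn Set.univ (hochT ε σ) := by
  have h : IsDiagIn Set.univ (augAut ε σ) :=
    hσ.of_injective (AugIdeal ε).subtype (fun a => (coe_augAut ε hε a).symm)
      Subtype.val_injective
  exact hσ.tensor (h.tmap (S' := ⊤) le_rfl) fun _ _ _ _ => trivial

end HochGrading

section KoszulGrading
variable {k : Type u} [Field k] [CharZero k] {V : Type v} [AddCommGroup V] [Module k V]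
  {R : Submodule k (V ⊗[k] V)}

local notation "P" => dualParity R
local notation "κ" => kappa R
local notation "A" => QuadAlg R
local notation "W" => dualWeight R

lemma koszulB_weight (σ : A ≃ₐ[k] A) (z : KoszulChain R) :
    koszulB σ (LinearMap.lTensor A W z) = (2 : k) • LinearMap.lTensor A W (koszulB σ z) := by
  have h : ∀ z, LinearMap.lTensor A P (LinearMap.lTensor A W z) =
      LinearMap.lTensor A W (LinearMap.lTensor A P z) := by
    intro z
    induction z using TensorProduct.induction_on with
    | zero => simp
    | add x y hx hy => simp only [map_add, hx, hy]
    | tmul a c => simp [dualWeight_parity]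
  simp only [koszulB, LinearMap.add_apply, LinearMap.comp_apply, map_add, smul_add, h,
    mulRightFactor_weight kappa_dualWeight]
  rw [mulLeftFactor_weight (f := σ.toLinearMap ∘ₗ κ) fun c => by simp]

lemma koszulToHoch_two (z : KoszulChain R) :
    LinearMap.lTensor A (tmap ((2 : k) • LinearMap.id)).toLinearMap (koszulToHoch R z) =
      koszulToHoch R (LinearMap.lTensor A W z) := by
  induction z using TensorProduct.induction_on with
  | zero => simp
  | add x y hx hy => simp only [map_add, hx, hy]
  | tmul a c =>
    simp only [koszulToHoch_tmul, LinearMap.lTensor_tmul, dualToBar, LinearMap.comp_apply,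
      AlgHom.toLinearMap_apply, incl_dualWeight, tmap_comp]
    congr 3
    ext; simp

omit [CharZero k] in
lemma isDiagIn_dualAut {σ : A ≃ₐ[k] A} (hσ : IsGradedAut σ)
    (h : IsDiagIn Set.univ σ.toLinearMap) : IsDiagIn Set.univ (dualAut σ hσ) := by
  have h1 : IsDiagIn Set.univ (onGen σ) :=
    h.of_injective (QuadAlg.ι R) (fun v => (ι_onGen hσ v).symm) fun v w e => by
      rw [← QuadAlg.toGen_ι (R := R) v, e, QuadAlg.toGen_ι]
  exact (h1.tmap (S' := ⊤) le_rfl).of_injective (incl R) (fun c => (incl_dualMap _ _ c).symm)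
    incl_injective

omit [CharZero k] in
lemma isDiagIn_coHochT {s : KoszulDual R →ₗ[k] KoszulDual R} (hs : IsCoaugHom s)
    (h : IsDiagIn Set.univ s) : IsDiagIn Set.univ (coHochT s) := by
  have h1 : IsDiagIn Set.univ (restrictAug s) :=
    h.of_injective (DualAug R).subtype
      (fun a => (coe_restrictAug (fun c hc => by rw [hs.counit, hc]) a).symm)
      Subtype.val_injective
  exact (h1.tmap (S' := ⊤) le_rfl).tensor h fun _ _ _ _ => trivial

end KoszulGrading

/-! ### The grading of the Hochschild chains of the coalgebra -/

section CoHochGrading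
variable {k : Type u} [Field k] [CharZero k] {V : Type v} [AddCommGroup V] [Module k V]
  {R : Submodule k (V ⊗[k] V)}

local notation "ℓ" => letter R
local notation "P" => dualParity R
local notation "PΩ" => cobarParity R
local notation "Δ" => Coalgebra.comul (R := k) (A := KoszulDual R)
local notation "ε" => Coalgebra.counit (R := k) (A := KoszulDual R)
local notation "κ" => kappa R
local notation "A" => QuadAlg R
local notation "κΩ" => cobarToAlg R
local notation "W" => dualWeight R

variable (R) in
/-- Multiplication by `2^n` on the part of degree `n` of `Ω(C)`, where the letters from `Cₙ` have
degree `n - 1`. -/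
def cobarDegree : Cobar R →ₗ[k] Cobar R := cobarMap ((2 : k)⁻¹ • dualWeight R)

variable (R) in
/-- Multiplication by `2^n` on the chains of total degree `n`. -/
def coHochDegree : CoHochChain R →ₗ[k] CoHochChain R :=
  TensorProduct.map (cobarDegree R) (dualWeight R)

local notation "F" => cobarDegree R
local notation "N" => coHochDegree R

lemma coe_restrictAug_degree (a : DualAug R) :
    (restrictAug ((2 : k)⁻¹ • dualWeight R) a : KoszulDual R) = (2 : k)⁻¹ • W a :=
  coe_restrictAug (fun c hc => by
    rw [LinearMap.smul_apply, map_smul, isCoaugHom_dualWeight.counit, hc, smul_zero]) a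

lemma cobarDegree_ι (a : DualAug R) : F (TensorAlgebra.ι k a) =
    TensorAlgebra.ι k (restrictAug ((2 : k)⁻¹ • dualWeight R) a) := tmap_ι _ _

@[simp] lemma cobarDegree_one : F 1 = 1 := cobarMap_one _

lemma cobarDegree_mul (x y : Cobar R) : F (x * y) = F x * F y := cobarMap_mul _ x y

@[simp] lemma cobarDegree_letter (c : KoszulDual R) : F (ℓ c) = (2 : k)⁻¹ • ℓ (W c) := by
  rw [letter, LinearMap.comp_apply, cobarDegree_ι, LinearMap.comp_apply, ← map_smul]
  congr 1
  ext
  rw [coe_restrictAug_degree, toDualAug_map isCoaugHom_dualWeight, Submodule.coe_smul,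
    coe_restrictAug (fun c hc => by rw [isCoaugHom_dualWeight.counit, hc])]

lemma cobarDegree_parity (x : Cobar R) : F (PΩ x) = PΩ (F x) := by
  induction x using cobar_induction with
  | h1 => simp
  | hsmul r x hx => simp [hx]
  | hadd x y hx hy => simp [hx, hy]
  | hι c x hx => simp [cobarDegree_mul, cobarParity_mul, hx, dualWeight_parity]

lemma cobarDegree_cobarMap {s : KoszulDual R →ₗ[k] KoszulDual R} (hs : IsCoaugHom s)
    (hsW : ∀ c, s (W c) = W (s c)) (x : Cobar R) : F (cobarMap s x) = cobarMap s (F x) := by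
  induction x using cobar_induction with
  | h1 => simp
  | hsmul r x hx => simp [hx]
  | hadd x y hx hy => simp [hx, hy]
  | hι c x hx => simp [cobarDegree_mul, cobarMap_mul, hx, hs, hsW]

lemma cobarDegree_letterD (c : KoszulDual R) :
    F (letterD R c) = ((2 : k)⁻¹ * (2 : k)⁻¹) • letterD R (W c) := by
  simp only [letterD, LinearMap.comp_apply, isCoaugHom_dualWeight.comul]
  generalize Δ c = z
  induction z using TensorProduct.induction_on with
  | zero => simp
  | add x y hx hy => simp only [map_add, hx, hy, smul_add]
  | tmul x y => simp [cobarDegree_mul, dualWeight_parity, smul_smul]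

lemma cobarD_cobarDegree (x : Cobar R) : cobarD R (F x) = (2 : k) • F (cobarD R x) := by
  induction x using cobar_induction with
  | h1 => simp
  | hsmul r x hx => simp only [map_smul, hx, smul_comm r]
  | hadd x y hx hy => simp only [map_add, hx, hy, smul_add]
  | hι c x hx =>
    rw [cobarDegree_mul, cobarDegree_letter, smul_mul_assoc, map_smul, cobarD_letter_mul,
      cobarD_letter_mul, hx, map_add, cobarDegree_mul, cobarDegree_mul, cobarDegree_letterD,
      cobarDegree_parity, cobarDegree_letter]
    simp only [map_smul, smul_mul_assoc, mul_smul_comm, smul_add, smul_smul]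
    match_scalars <;> field_simp

lemma coHochDegree_tmul (x : Cobar R) (m : KoszulDual R) : N (x ⊗ₜ m) = F x ⊗ₜ W m := rfl

lemma coHochInner_degree (z : CoHochChain R) :
    coHochInner R (N z) = (2 : k) • N (coHochInner R z) := by
  induction z using TensorProduct.induction_on with
  | zero => simp
  | add x y hx hy => simp only [map_add, hx, hy, smul_add]
  | tmul x m =>
    simp only [coHochDegree_tmul, coHochInner_tmul, cobarD_cobarDegree, TensorProduct.smul_tmul']

lemma coHochLeft_degree {s : KoszulDual R →ₗ[k] KoszulDual R}
    (hsW : ∀ c, s (W c) = W (s c)) (z : CoHochChain R) :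
    coHochLeft s (N z) = (2 : k) • N (coHochLeft s z) := by
  induction z using TensorProduct.induction_on with
  | zero => simp
  | add x y hx hy => simp only [map_add, hx, hy, smul_add]
  | tmul x m =>
    rw [coHochDegree_tmul, coHochLeft_tmul, coHochLeft_tmul, isCoaugHom_dualWeight.comul]
    generalize Δ m = z
    induction z using TensorProduct.induction_on with
    | zero => simp
    | add x y hx hy => simp only [map_add, hx, hy, smul_add]
    | tmul a b =>
      simp [coHochDegree_tmul, cobarDegree_mul, cobarDegree_parity, ← dualWeight_parity, hsW,
        ← TensorProduct.smul_tmul']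

lemma coHochRightOf_degree (q : ℕ) (z : CoHochChain R) :
    coHochRightOf q (N z) = (2 : k) • N (coHochRightOf q z) := by
  have hq : ∀ c, W ((P ^ q) c) = (P ^ q) (W c) := by
    induction q with
    | zero => intro c; rfl
    | succ q ih =>
      intro c
      rw [pow_succ, Module.End.mul_apply, Module.End.mul_apply, ih, dualWeight_parity]
  induction z using TensorProduct.induction_on with
  | zero => simp
  | add x y hx hy => simp only [map_add, hx, hy, smul_add]
  | tmul x m =>
    rw [coHochDegree_tmul, coHochRightOf_tmul, coHochRightOf_tmul, isCoaugHom_dualWeight.comul]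
    generalize Δ m = z
    induction z using TensorProduct.induction_on with
    | zero => simp
    | add x y hx hy =>
      simp only [map_add, neg_add, smul_add] at hx hy ⊢
      rw [hx, hy]
    | tmul a b =>
      simp [coHochDegree_tmul, cobarDegree_mul, ← hq, ← TensorProduct.smul_tmul']

lemma coHochParity_degree (z : CoHochChain R) : coHochParity R (N z) = N (coHochParity R z) := by
  induction z using TensorProduct.induction_on with
  | zero => simp
  | add x y hx hy => simp only [map_add, hx, hy]
  | tmul x m => simp [coHochDegree_tmul, cobarDegree_parity, dualWeight_parity]

lemma coHochB_degree {s : KoszulDual R →ₗ[k] KoszulDual R}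
    (hsW : ∀ c, s (W c) = W (s c)) (z : CoHochChain R) :
    coHochB s (N z) = (2 : k) • N (coHochB s z) := by
  have h : coHochRight R (N z) = (2 : k) • N (coHochRight R z) := by
    rw [coHochRight_eq, coHochRight_eq, coHochParity_degree, ← map_add, ← map_sub,
      coHochRightOf_degree, coHochRightOf_degree, ← smul_add, ← map_add, smul_comm, map_smul]
  simp only [coHochB, LinearMap.add_apply, map_add, smul_add, coHochInner_degree,
    coHochLeft_degree hsW, h]

lemma coRotate_degree {s : KoszulDual R →ₗ[k] KoszulDual R} (hs : IsCoaugHom s)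
    (hsW : ∀ c, s (W c) = W (s c)) (x : Cobar R) :
    coRotate s (F x) = (2 : k)⁻¹ • N (coRotate s x) := by
  have hd : deconc (F x) = TensorProduct.map F F (deconc x) := deconc_tmap _ x
  have hl : ∀ U, lastLetter k (DualAug R) (F U) =
      TensorProduct.map F (restrictAug ((2 : k)⁻¹ • dualWeight R))
        (lastLetter k (DualAug R) U) := fun U => lastLetter_tmap _ U
  simp only [coRotate, LinearMap.comp_apply, hd]
  rw [koszulSign_map (fun x => (cobarDegree_parity x).symm) fun x => (cobarDegree_parity x).symm]
  generalize koszulSign PΩ PΩ (deconc x) = t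
  induction t using TensorProduct.induction_on with
  | zero => simp
  | add x y hx hy => simp only [map_add, hx, hy, smul_add]
  | tmul U v =>
    rw [TensorProduct.map_tmul, LinearMap.rTensor_tmul, LinearMap.rTensor_tmul, hl]
    generalize lastLetter k (DualAug R) U = y
    induction y using TensorProduct.induction_on with
    | zero => simp
    | add x y hx hy =>
      simp only [map_add, smul_add, TensorProduct.add_tmul] at hx hy ⊢
      rw [hx, hy]
    | tmul u a =>
      simp [coHochDegree_tmul, cobarDegree_mul, cobarDegree_cobarMap hs hsW,
        coe_restrictAug_degree]

lemma coHochConnes_degree {s : KoszulDual R →ₗ[k] KoszulDual R} (hs : IsCoaugHom s)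
    (hsW : ∀ c, s (W c) = W (s c)) (z : CoHochChain R) :
    N (coHochConnes s z) = (2 : k) • coHochConnes s (N z) := by
  have hc : ∀ z, coHochCounit R (N z) = F (coHochCounit R z) := by
    intro z
    induction z using TensorProduct.induction_on with
    | zero => simp
    | add x y hx hy => simp only [map_add, hx, hy]
    | tmul x m => simp [coHochDegree_tmul, isCoaugHom_dualWeight.counit]
  have he : ∀ z, coHochConnes s z = coRotate s (PΩ (coHochCounit R z)) := fun _ => rfl
  rw [he, he, hc, ← cobarDegree_parity, coRotate_degree hs hsW, smul_smul,
    mul_inv_cancel₀ two_ne_zero, one_smul]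

lemma coHochT_degree {s : KoszulDual R →ₗ[k] KoszulDual R} (hs : IsCoaugHom s)
    (hsW : ∀ c, s (W c) = W (s c)) (z : CoHochChain R) :
    N (coHochT s z) = coHochT s (N z) := by
  induction z using TensorProduct.induction_on with
  | zero => simp
  | add x y hx hy => simp only [map_add, hx, hy]
  | tmul x m =>
    rw [coHochT_tmul, coHochDegree_tmul, coHochDegree_tmul, coHochT_tmul,
      cobarDegree_cobarMap hs hsW, hsW]

lemma coHochToKoszul_degree (z : CoHochChain R) :
    LinearMap.lTensor A W (coHochToKoszul R z) = coHochToKoszul R (N z) := by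
  have h : ∀ x, κΩ (F x) = κΩ x := by
    intro x
    induction x using cobar_induction with
    | h1 => simp
    | hsmul r x hx => simp [hx]
    | hadd x y hx hy => simp [hx, hy]
    | hι c x hx => simp [cobarDegree_mul, hx]
  induction z using TensorProduct.induction_on with
  | zero => simp
  | add x y hx hy => simp only [map_add, hx, hy]
  | tmul x m => simp [coHochDegree_tmul, h]

end CoHochGrading

section CoHochGraded
variable {k : Type u} [Field k] [CharZero k] {V : Type v} [AddCommGroup V] [Module k V]
  {R : Submodule k (V ⊗[k] V)}

lemma isGradedBy_coHochDeg : IsGradedBy (coHochDegree R) (coHochDeg R) := by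
  refine isGradedBy_of_le ?_ ?_
  · intro n z hz
    induction hz using Submodule.span_induction with
    | zero => simp
    | add x y _ _ hx hy => rw [map_add, hx, hy, smul_add]
    | smul r x _ hx => rw [map_smul, hx, smul_comm]
    | mem z hz =>
      obtain ⟨l, p, m, hl, hm, rfl, rfl⟩ := hz
      have h : cobarDegree R (l.map fun x => TensorAlgebra.ι k x.2).prod =
          (2 : k) ^ (l.map Prod.fst).sum • (l.map fun x => TensorAlgebra.ι k x.2).prod := by
        induction l with
        | nil => simp
        | cons a l ih =>
          have ha : restrictAug ((2 : k)⁻¹ • dualWeight R) a.2 = (2 : k) ^ a.1 • a.2 := by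
            ext
            rw [coe_restrictAug_degree, (isGradedBy_dualWeight.mem_iff _ _).1
              (hl a (List.mem_cons_self ..)), smul_smul, pow_succ', inv_mul_cancel_left₀
              two_ne_zero, Submodule.coe_smul]
          rw [List.map_cons, List.prod_cons, List.map_cons, List.sum_cons, cobarDegree_mul,
            cobarDegree_ι, ha, ih fun x hx => hl x (List.mem_cons_of_mem _ hx), map_smul,
            smul_mul_smul_comm, pow_add]
      rw [coHochDegree_tmul, h, (isGradedBy_dualWeight.mem_iff _ _).1 hm,
        TensorProduct.smul_tmul_smul, pow_add]
  · have hmul : ∀ (n : ℕ) (a : DualAug R), (a : KoszulDual R) ∈ dualDeg R (n + 1) →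
        ∀ z ∈ ⨆ d, coHochDeg R d,
          LinearMap.rTensor (KoszulDual R) (LinearMap.mulLeft k (TensorAlgebra.ι k a)) z ∈
            ⨆ d, coHochDeg R d := by
      intro n a ha z hz
      have hle : ⨆ d, coHochDeg R d ≤ (⨆ d, coHochDeg R d).comap
          (LinearMap.rTensor (KoszulDual R) (LinearMap.mulLeft k (TensorAlgebra.ι k a))) := by
        refine iSup_le fun d => Submodule.span_le.2 ?_
        rintro _ ⟨l, p, m, hl, hm, rfl, rfl⟩
        refine Submodule.mem_iSup_of_mem (n + ((l.map Prod.fst).sum + p))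
          (Submodule.subset_span ⟨(n, a) :: l, p, m, ?_, hm, ?_, ?_⟩)
        · intro x hx
          rcases List.mem_cons.1 hx with rfl | hx
          · exact ha
          · exact hl x hx
        · simp [add_assoc]
        · simp
      exact hle hz
    intro z
    induction z using TensorProduct.induction_on with
    | zero => exact Submodule.zero_mem _
    | add x y hx hy => exact Submodule.add_mem _ hx hy
    | tmul x m =>
      induction x using words_induction with
      | h1 =>
        refine isDiagIn_dualWeight.induction (P := fun m => (1 : Cobar R) ⊗ₜ[k] m ∈
          ⨆ d, coHochDeg R d) ?_ ?_ ?_ m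
        · rw [TensorProduct.tmul_zero]; exact Submodule.zero_mem _
        · intro x y hx hy; rw [TensorProduct.tmul_add]; exact Submodule.add_mem _ hx hy
        · intro μ hμ m hm
          obtain ⟨p, rfl⟩ := mem_pow2.1 hμ
          exact Submodule.mem_iSup_of_mem p (Submodule.subset_span
            ⟨[], p, m, by simp, (isGradedBy_dualWeight.mem_iff _ _).2 hm, by simp, by simp⟩)
      | hsmul r x hx => rw [← TensorProduct.smul_tmul']; exact Submodule.smul_mem _ _ hx
      | hadd x y hx hy => rw [TensorProduct.add_tmul]; exact Submodule.add_mem _ hx hy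
      | hι a x hx =>
        refine isDiagIn_restrictAug_dualWeight.induction (P := fun a =>
          (TensorAlgebra.ι k a * x) ⊗ₜ[k] m ∈ ⨆ d, coHochDeg R d) ?_ ?_ ?_ a
        · rw [map_zero, zero_mul, TensorProduct.zero_tmul]; exact Submodule.zero_mem _
        · intro a b ha hb
          rw [map_add, add_mul, TensorProduct.add_tmul]; exact Submodule.add_mem _ ha hb
        · rintro _ ⟨n, rfl⟩ a ha
          refine hmul n a ((isGradedBy_dualWeight.mem_iff _ _).2 ?_) _ hx
          rw [← coe_restrictAug (fun c hc => by rw [isCoaugHom_dualWeight.counit, hc]) a, ha,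
            Submodule.coe_smul]

end CoHochGraded

/-! ### The isomorphisms and the Connes operators -/

section Abstract
variable {k : Type u} [Field k] {X : Type v} [AddCommGroup X] [Module k X]
  {Y : Type w} [AddCommGroup Y] [Module k Y] {Z : Type x} [AddCommGroup Z] [Module k Z]

lemma inv_two_smul_of_two_smul [CharZero k] {a b : X} (h : a = (2 : k) • b) :
    b = (2 : k)⁻¹ • a := by
  rw [h, inv_smul_smul₀ two_ne_zero]

/-- Maps of complexes that commute with the twists, and whose composite `f ∘ g` commutes with the
operators `B` up to boundaries on cycles, commute with the Connes operators. -/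
lemma connesOperator_comm [CharZero k] {d T B : X →ₗ[k] X} {G : ℕ → Submodule k X}
    {d' : Y →ₗ[k] Y} {G' : ℕ → Submodule k Y} {d'' T'' B'' N : Z →ₗ[k] Z}
    {G'' : ℕ → Submodule k Z} {β : ∀ n, Homology d G n →ₗ[k] Homology d G (n + 1)}
    {β'' : ∀ n, Homology d'' G'' n →ₗ[k] Homology d'' G'' (n + 1)}
    (hβ : IsConnesOperator d G T B β) (hβ'' : IsConnesOperator d'' G'' T'' B'' β'')
    {g : X →ₗ[k] Y} {f : Y →ₗ[k] Z} {Ψ : ∀ n, Homology d G n ≃ₗ[k] Homology d' G' n}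
    {Φ : ∀ n, Homology d' G' n ≃ₗ[k] Homology d'' G'' n}
    (hΨ : IsInducedBy g Ψ) (hΦ : IsInducedBy f Φ) (hN : IsGradedBy N G'')
    (hNd : ∀ x, N (d'' x) = (2 : k)⁻¹ • d'' (N x)) (hT : ∀ z, T'' (f (g z)) = f (g (T z)))
    (h : X → Z) (hh : ∀ z, d z = 0 → d'' (h z) = f (g (B z)) - B'' (f (g z)))
    (n : ℕ) (c : Homology d G n) :
    Φ (n + 1) (Ψ (n + 1) (β n c)) = β'' n (Φ n (Ψ n c)) := by
  obtain ⟨z, hz, hTz, rfl⟩ := hβ.1 n c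
  obtain ⟨hBz, e₁⟩ := hβ.2 n z hz hTz
  obtain ⟨h₁, e₂⟩ := hΨ (n + 1) _ hBz
  obtain ⟨h₂, e₃⟩ := hΦ (n + 1) _ h₁
  obtain ⟨h₃, e₄⟩ := hΨ n z hz
  obtain ⟨h₄, e₅⟩ := hΦ n _ h₃
  obtain ⟨h₅, e₆⟩ := hβ''.2 n _ h₄ (by rw [hT, hTz])
  rw [e₁, e₂, e₃, e₄, e₅, e₆]
  refine (Submodule.Quotient.eq _).2 ?_
  obtain ⟨w, hw, e⟩ := hN.exists_of_eq hNd (n := n + 1) (y := h z)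
    (by rw [hh z hz.2]; exact Submodule.sub_mem _ h₂.1 h₅.1)
  exact ⟨w, hw, e.trans (hh z hz.2)⟩

end Abstract

section Compatibility
variable {k : Type u} [Field k] [CharZero k] {V : Type v} [AddCommGroup V] [Module k V]
  {R : Submodule k (V ⊗[k] V)} {σ : QuadAlg R ≃ₐ[k] QuadAlg R}

local notation "A" => QuadAlg R
local notation "εA" => QuadAlg.aug R

/-- The map from the twisted Koszul complex to the Hochschild complex is an isomorphism in
homology. -/
theorem IsKoszul.exists_homology_equiv_hoch (hR : IsKoszul R) (σ : A ≃ₐ[k] A) :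
    ∃ Φ : ∀ n, HK σ n ≃ₗ[k] HH σ n, IsInducedBy (koszulToHoch R) Φ := by
  refine exists_homology_equiv isGradedBy_koszulDeg (isGradedBy_hochDeg εA)
    (fun z => inv_two_smul_of_two_smul (koszulB_weight σ z))
    (fun z => inv_two_smul_of_two_smul (hochB_two εA σ z)) (koszulToHoch R) koszulToHoch_two
    one_ne_zero (fun z => by rw [one_smul, koszulToHoch_koszulB]) ?_ ?_
  · intro x y _ hy
    obtain ⟨u, w, rfl⟩ := hR.exists_of_hochB_mem σ (z := y) ⟨x, hy.symm⟩
    rw [map_add, hochB_hochB, add_zero, ← koszulToHoch_koszulB] at hy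
    exact ⟨u, koszulToHoch_injective hy⟩
  · intro y hy
    obtain ⟨u, w, rfl⟩ := hR.exists_of_hochB_mem σ (z := y) (hy ▸ Submodule.zero_mem _)
    refine ⟨u, w, koszulToHoch_injective ?_, rfl⟩
    rwa [map_add, hochB_hochB, add_zero, ← koszulToHoch_koszulB, ← map_zero (koszulToHoch R)] at hy

/-- The map from the Hochschild complex of the coalgebra to the twisted Koszul complex is an
isomorphism in homology: it is onto, and its kernel is acyclic. It is a map of complexes up to the
sign `-1`, hence the scalar `c` in `exists_homology_equiv`. -/
theorem IsKoszul.exists_homology_equiv_coHoch (hR : IsKoszul R) (hσ : IsGradedAut σ) :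
    ∃ Ψ : ∀ n, coHH σ hσ n ≃ₗ[k] HK σ n, IsInducedBy (coHochToKoszul R) Ψ := by
  have hs : IsCoaugHom (dualAut σ hσ) := isCoaugHom_dualMap _ (onGen_relations hσ)
  have hdd := coHochB_coHochB hs (dualAut_parity hσ)
  refine exists_homology_equiv isGradedBy_coHochDeg isGradedBy_koszulDeg
    (fun z => inv_two_smul_of_two_smul (coHochB_degree (dualAut_dualWeight hσ) z))
    (fun z => inv_two_smul_of_two_smul (koszulB_weight σ z)) (coHochToKoszul R)
    coHochToKoszul_degree (c := -1) (by norm_num)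
    (fun z => by rw [coHochToKoszul_coHochB hσ, smul_neg, neg_smul, one_smul, neg_neg]) ?_ ?_
  · intro x y hx hy
    obtain ⟨y, rfl⟩ := coHochToKoszul_surjective y
    obtain ⟨w, -, hw⟩ := hR.exists_of_coHochB_eq_zero hσ (z := x + coHochB (dualAut σ hσ) y)
      (by rw [map_add, coHochToKoszul_coHochB hσ, hy, add_neg_cancel])
      (by rw [map_add, hx, hdd, add_zero])
    exact ⟨w - y, by rw [map_sub, ← hw, add_sub_cancel_right]⟩
  · intro y hy
    obtain ⟨x, rfl⟩ := coHochToKoszul_surjective y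
    obtain ⟨w, hw, e⟩ := hR.exists_of_coHochB_eq_zero hσ (z := coHochB (dualAut σ hσ) x)
      (by rw [coHochToKoszul_coHochB hσ, hy, neg_zero]) (hdd x)
    exact ⟨x - w, 0, by rw [map_sub, e, sub_self], by rw [map_sub, hw, map_zero]; abel⟩

/-- The Connes operator on `HH_•(A; A_σ)` exists. -/
theorem exists_connesOperator_hoch (hσ : IsGradedAut σ) (hss : IsSemisimpleAut σ) :
    ∃ β : ∀ n, HH σ n →ₗ[k] HH σ (n + 1),
      IsConnesOperator (hochB εA σ) (hochDeg εA) (hochT εA σ) (hochConnes εA σ) β := by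
  have hB : ∀ z, hochB εA σ (hochConnes εA σ z) + hochConnes εA σ (hochB εA σ z) =
      (1 : k) • (hochT εA σ z - z) := fun z => by
    rw [one_smul, hochB_hochConnes εA (aug_gradedAut hσ)]
  exact exists_connesOperator (isGradedBy_hochDeg εA)
    (isDiagIn_hochT εA (aug_gradedAut hσ) (isDiagIn_of_iSup hss)) (hochT_two εA σ)
    (comm_of_homotopy one_ne_zero (hochB_hochB εA σ) hB) (hochConnes_two εA σ) one_ne_zero hB

/-- The Connes operator on `HH_•(A^¡; _σ A^¡)` exists. -/
theorem exists_connesOperator_coHoch (hσ : IsGradedAut σ) (hss : IsSemisimpleAut σ) :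
    ∃ β : ∀ n, coHH σ hσ n →ₗ[k] coHH σ hσ (n + 1),
      IsConnesOperator (coHochB (dualAut σ hσ)) (coHochDeg R) (coHochT (dualAut σ hσ))
        (coHochConnes (dualAut σ hσ)) β := by
  have hs : IsCoaugHom (dualAut σ hσ) := isCoaugHom_dualMap _ (onGen_relations hσ)
  have hP := dualAut_parity hσ
  have hW := dualAut_dualWeight hσ
  have hB : ∀ z, coHochB (dualAut σ hσ) (coHochConnes (dualAut σ hσ) z) +
      coHochConnes (dualAut σ hσ) (coHochB (dualAut σ hσ) z) =
      (-1 : k) • (coHochT (dualAut σ hσ) z - z) := fun z => by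
    rw [coHochB_coHochConnes hs hP]; module
  exact exists_connesOperator isGradedBy_coHochDeg
    (isDiagIn_coHochT hs (isDiagIn_dualAut hσ (isDiagIn_of_iSup hss))) (coHochT_degree hs hW)
    (comm_of_homotopy (by norm_num) (coHochB_coHochB hs hP) hB) (coHochConnes_degree hs hW)
    (by norm_num) hB

omit [CharZero k] in
lemma hochT_koszulToHoch (hσ : IsGradedAut σ) (z : KoszulChain R) :
    hochT εA σ (koszulToHoch R z) =
      koszulToHoch R (TensorProduct.map σ.toLinearMap (dualAut σ hσ) z) := by
  induction z using TensorProduct.induction_on with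
  | zero => simp
  | add x y hx hy => simp only [map_add, hx, hy]
  | tmul a c =>
    rw [koszulToHoch_tmul, TensorProduct.map_tmul, koszulToHoch_tmul, ← tmap_augAut_dualToBar hσ]
    rfl

/-- On cycles, `f B` and `B f` differ by a boundary. -/
lemma connesHomotopy_boundary (hσ : IsGradedAut σ) {z : CoHochChain R}
    (hz : coHochB (dualAut σ hσ) z = 0) :
    hochB εA σ (-connesHomotopy R z) =
      koszulToHoch R (coHochToKoszul R (coHochConnes (dualAut σ hσ) z)) -
        hochConnes εA σ (koszulToHoch R (coHochToKoszul R z)) := by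
  have h := connesHomotopy_homotopy hσ z
  rw [hz, map_zero, add_zero] at h
  rw [map_neg]
  linear_combination (norm := module) -h

end Compatibility
end
end KoszulHH

theorem mainTheorem2 {k : Type*} [Field k] [CharZero k]
    {V : Type*} [AddCommGroup V] [Module k V] [FiniteDimensional k V]
    (R : Submodule k (V ⊗[k] V)) (hR : IsKoszul R)
    (n : ℕ) (σ : QuadAlg R ≃ₐ[k] QuadAlg R) (hσ : IsASRegular n σ) (hss : IsSemisimpleAut σ) :
    ∃ (Φ : ∀ i, HK σ i ≃ₗ[k] HH σ i) (Ψ : ∀ i, coHH σ hσ.graded i ≃ₗ[k] HK σ i)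
      (β : ∀ i, HH σ i →ₗ[k] HH σ (i + 1))
      (β' : ∀ i, coHH σ hσ.graded i →ₗ[k] coHH σ hσ.graded (i + 1)),
      IsInducedBy (koszulToHoch R) Φ ∧
      IsInducedBy (coHochToKoszul R) Ψ ∧
      IsConnesOperator (hochB (QuadAlg.aug R) σ) (hochDeg (QuadAlg.aug R))
        (hochT (QuadAlg.aug R) σ) (hochConnes (QuadAlg.aug R) σ) β ∧
      IsConnesOperator (coHochB (dualAut σ hσ.graded)) (coHochDeg R)
        (coHochT (dualAut σ hσ.graded)) (coHochConnes (dualAut σ hσ.graded)) β' ∧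
      ∀ (i : ℕ) (c : coHH σ hσ.graded i),
        Φ (i + 1) (Ψ (i + 1) (β' i c)) = β i (Φ i (Ψ i c)) := by
  obtain ⟨Φ, hΦ⟩ := hR.exists_homology_equiv_hoch σ
  obtain ⟨Ψ, hΨ⟩ := hR.exists_homology_equiv_coHoch hσ.graded
  obtain ⟨β, hβ⟩ := exists_connesOperator_hoch hσ.graded hss
  obtain ⟨β', hβ'⟩ := exists_connesOperator_coHoch hσ.graded hss
  refine ⟨Φ, Ψ, β, β', hΦ, hΨ, hβ, hβ', fun i c => ?_⟩
  refine connesOperator_comm hβ' hβ hΨ hΦ (isGradedBy_hochDeg (QuadAlg.aug R))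
    (fun z => inv_two_smul_of_two_smul (hochB_two (QuadAlg.aug R) σ z)) (fun z => ?_)
    (fun z => -connesHomotopy R z) (fun z hz => connesHomotopy_boundary hσ.graded hz) i c
  rw [hochT_koszulToHoch hσ.graded, ← coHochToKoszul_coHochT]
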